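/- **Setting.** Let $\mathbb T=\mathbb R/2\pi\mathbb Z$, $T>0$, $I^+=(0,1)$, $I^-=(-1,0)$, $\mathbb R^+=(0,\infty)$, $\mathbb R^-=(-\infty,0)$, $y'=(y_1,y_2)\in\mathbb T^2$, $y=(y',y_3)$. Repeated indices $j\in\{1,2\}$ are summed, and every statement with $\pm$ is made for both signs. Let $u_j^{0,\pm},H_j^{0,\pm},\tau\in\mathbb R$ $(j=1,2)$, $\xi'=(\xi_1,\xi_2)\in\mathbb R^2$, $u^{0,\pm}=(u_1^{0,\pm},u_2^{0,\pm},0)$, $H^{0,\pm}=(H_1^{0,\pm},H_2^{0,\pm},0)$, $[u^0]=u^{0,+}-u^{0,-}$, and $$a^\pm=\xi_ju_j^{0,\pm},\qquad b^\pm=\xi_jH_j^{0,\pm},\qquad c^\pm=\tau+a^\pm .$$ Assume $\tau\ne0$ and * (H1) $|H^{0,+}\times[u^0]|^2+|H^{0,-}\times[u^0]|^2<2\,|H^{0,+}\times H^{0,-}|^2$; * (H2) $\xi'=(p,q)/\sqrt{p^2+q^2}$ for some $(p,q)\in\mathbb Z^2\setminus\{0\}$; * (H3) $|a^+-a^-|\ne|b^+-b^-|$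 and $|a^+-a^-|\ne|b^++b^-|$; * (H4) $(c^+)^2+(c^-)^2=(b^+)^2+(b^-)^2$. **Spaces** (of real functions). $H^\infty$ denotes smooth functions up to the boundary. $\underline S^\pm=H^\infty([0,T]\times\mathbb T^2\times I^\pm\times\mathbb T)$ consists of functions of $(t,y,\theta)$. $S_\star^\pm$ consists of the functions of $(t,y,Y_3,\theta)$ in $H^\infty([0,T]\times\mathbb T^2\times I^\pm\times\mathbb R^\pm\times\mathbb T)$ for which there is $\delta>0$ such that for every multi-index $\alpha$ there is $C_\alpha$ with $|\partial^\alpha f|\le C_\alpha e^{\mp\delta Y_3}$ everywhere. $S^\pm=\underline S^\pm\oplus S_\star^\pm$, with the decomposition written $f=\underline f+f_\star$; $\hat f(k)$ is the $k$-th Fourier coefficient of $f$ in $\theta$. Membership of vectors is componentwise. **Fast problem.** For $U=(u_1,u_2,u_3,H_1,H_2,H_3,q)^T$, let $\mathcal L_f^\pm(\partial)U=A_3^\pm\partial_{Y_3}U+\mathcal A^\pm\partial_\theta U$, where $A_3^\pm,\mathcal A^\pm$ are the real $7\times7$ matrices for which, with $D_u=\partial_{Y_3}u_3+\xi_j\partial_\theta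 u_j$ and $D_H=\partial_{Y_3}H_3+\xi_j\partial_\theta H_j$ (and $l=1,2$), the components of $\mathcal L_f^\pm(\partial)U$ are $$\begin{aligned} &(l):&& c^\pm\partial_\theta u_l-b^\pm\partial_\theta H_l+\xi_l\partial_\theta q+u_l^{0,\pm}D_u-H_l^{0,\pm}D_H,\\ &(3):&& \partial_{Y_3}q+c^\pm\partial_\theta u_3-b^\pm\partial_\theta H_3,\\ &(3+l):&& -b^\pm\partial_\theta u_l+c^\pm\partial_\theta H_l+H_l^{0,\pm}D_u-u_l^{0,\pm}D_H,\\ &(6):&& -b^\pm\partial_\theta u_3+c^\pm\partial_\theta H_3,\\ &(7):&& D_u . \end{aligned}$$ Given $F^\pm=(F_1^\pm,\dots,F_7^\pm)\in S^\pm$, $F_8^\pm\in S^\pm$ and $G=(G_1,\dots,G_5)\in H^\infty([0,T]\times\mathbb T^2\times\mathbb T)$, the fast problem for $(U^\pm,\psi)$ is $$\mathcal L_f^\pm(\partial)U^\pm=F^\pm,\qquad \partial_{Y_3}H_3^\pm+\xi_j\partial_\theta H_j^\pm=F_8^\pm\qquad (y_3\in I^\pm,\ \pm Y_3>0),$$ together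 with the jump conditions at $y_3=Y_3=0$ $$u_3^+-c^+\partial_\theta\psi=G_1,\quad H_3^+-b^+\partial_\theta\psi=G_2,\quad u_3^--c^-\partial_\theta\psi=G_3,\quad H_3^--b^-\partial_\theta\psi=G_4,\quad q^+-q^-=G_5 .$$ **Vectors.** Let $$\mathbf R^\pm=\big(\xi_1c^\pm,\xi_2c^\pm,\pm ic^\pm,\xi_1b^\pm,\xi_2b^\pm,\pm ib^\pm,(b^\pm)^2-(c^\pm)^2\big)^T,$$ $$\mathbf L^\pm=\big(\xi_1\tau,\xi_2\tau,\pm i\tau,2\xi_1b^\pm,2\xi_2b^\pm,\pm2ib^\pm,-\tau(a^\pm+c^\pm)\big)^T.$$ Let $\mathcal R^\pm(k)=\mathbf R^\pm$, $\mathcal L^\pm(k)=\mathbf L^\pm$ for $k>0$, and their complex conjugates for $k<0$. Let $X\bullet Y=\sum_{i=1}^7\overline{X_i}Y_i$, $\ell_1^\pm=2(b^\pm)^2-\tau c^\pm$, $\ell_2^\pm=-(a^\pm+c^\pm)b^\pm$, $\Pi=\mathrm{diag}(1,1,0,1,1,0,0)$. **Theorem.** The fast problem has a solution $(U^\pm,\psi)\in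 S^\pm\times H^\infty([0,T]\times\mathbb T^2\times\mathbb T)$ if and only if the following five conditions hold. * (a) (boundary) $F_6^+|_{y_3=Y_3=0}=-b^+\partial_\theta G_1+c^+\partial_\theta G_2$ and $F_6^-|_{y_3=Y_3=0}=-b^-\partial_\theta G_3+c^-\partial_\theta G_4$. * (b) (slow means) $\hat{\underline F}^\pm(t,y,0)=0$ and $\hat{\underline F}{}_8^\pm(t,y,0)=0$. * (c) (fast means) for $l=1,2$: $\;u_l^{0,\pm}\hat F_{7,\star}^\pm(0)-H_l^{0,\pm}\hat F_{8,\star}^\pm(0)=\hat F_{l,\star}^\pm(0)$ and $H_l^{0,\pm}\hat F_{7,\star}^\pm(0)-u_l^{0,\pm}\hat F_{8,\star}^\pm(0)=\hat F_{3+l,\star}^\pm(0)$. * (d) (divergence of the magnetic field) $\partial_{Y_3}F_6^\pm+\xi_j\partial_\theta F_{3+j}^\pm-\tau\,\partial_\theta F_8^\pm=0$. * (e) (orthogonality) for every integer $k\ne0$ and all $(t,y')$: $$\int_0^{\infty}e^{-|k|Y_3}\,\mathcal L^+(k)\bullet\hat F^+(t,y',0,Y_3,k)\,dY_3-\int_{-\infty}^0e^{|k|Y_3}\,\mathcal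 L^-(k)\bullet\hat F^-(t,y',0,Y_3,k)\,dY_3$$ $$+\ell_1^+\hat G_1(t,y',k)+\ell_2^+\hat G_2(t,y',k)+\ell_1^-\hat G_3(t,y',k)+\ell_2^-\hat G_4(t,y',k)-i\tau\,\mathrm{sgn}(k)\,\hat G_5(t,y',k)=0 .$$ If they hold, there is $\mathbb U^\pm\in S^\pm$ such that $(\mathbb U^\pm,0)$ solves the fast problem, $\Pi\,\hat{\mathbb U}^\pm(0)=0$, $\hat{\underline{\mathbb U}}^\pm(0)|_{y_3=\pm1}=0$, and such that a pair $(U^\pm,\psi)\in S^\pm\times H^\infty([0,T]\times\mathbb T^2\times\mathbb T)$ solves the fast problem if and only if $$U^\pm=\mathbb U^\pm+\underline U_h^\pm(t,y)+\big(u_{1,\star}^\pm,u_{2,\star}^\pm,0,H_{1,\star}^\pm,H_{2,\star}^\pm,0,0\big)^T(t,y,Y_3)+\sum_{k\in\mathbb Z\setminus\{0\}}\gamma^\pm(t,y,k)\,e^{\mp|k|Y_3+ik\theta}\,\mathcal R^\pm(k),$$ where $\underline U_h^\pm=(\underline u_{h,1}^\pm,\underline u_{h,2}^\pm,\underline u_{h,3}^\pm,\underline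 H_{h,1}^\pm,\underline H_{h,2}^\pm,\underline H_{h,3}^\pm,\underline q_h^\pm)^T\in\underline S^\pm$ is independent of $\theta$; $u_{1,\star}^\pm,u_{2,\star}^\pm,H_{1,\star}^\pm,H_{2,\star}^\pm\in S_\star^\pm$ are independent of $\theta$; the series converges pointwise to an element of $S_\star^\pm$; $\gamma^\pm(t,y',0,k)=\pm|k|\,\hat\psi(t,y',k)$ and $\gamma^\pm(t,y,-k)=\overline{\gamma^\pm(t,y,k)}$ for all $k\ne0$; and $\underline u_{h,3}^\pm|_{y_3=0}=\underline H_{h,3}^\pm|_{y_3=0}=0$, $\underline q_h^+|_{y_3=0}=\underline q_h^-|_{y_3=0}$. -/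

import Mathlib

open Set Filter Topology MeasureTheory Matrix
open scoped ContDiff

namespace FastProblem

noncomputable section

/-- The two sides `+` and `-` of the sheet. -/
inductive Side where
  | plus : Side
  | minus : Side

/-- The sign `+1` or `-1` attached to a side. -/
def Side.sg : Side → ℝ
  | .plus => 1
  | .minus => -1

/-- The open interval `I^±` of the slow normal variable `y₃`: `(0,1)` or `(-1,0)`. -/
def Side.slowOpen : Side → Set ℝ
  | .plus => Ioo 0 1
  | .minus => Ioo (-1) 0

/-- The closure of `I^±`. -/
def Side.slowClosed : Side → Set ℝ
  | .plus => Icc 0 1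
  | .minus => Icc (-1) 0

/-- The open half-line `± Y₃ > 0` of the fast normal variable `Y₃`. -/
def Side.fastOpen : Side → Set ℝ
  | .plus => Ioi 0
  | .minus => Iio 0

/-- The closed half-line `± Y₃ ≥ 0`. -/
def Side.fastClosed : Side → Set ℝ
  | .plus => Ici 0
  | .minus => Iic 0

/-- The filter `Y₃ → ± ∞`. -/
def Side.infinity : Side → Filter ℝ
  | .plus => atTop
  | .minus => atBot

/-! ### Functions

A point `p = (t, y₁, y₂)` collects time and the tangential slow variables; functions on a torus
are functions on the line that are `2π`-periodic. -/

/-- Time and tangential slow variables `(t, y₁, y₂)`. -/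
abbrev Base := ℝ × ℝ × ℝ

/-- Functions of `(t, y₁, y₂), θ`. -/
abbrev BdryFun := Base → ℝ → ℝ

/-- Functions of `(t, y₁, y₂), y₃, θ`. -/
abbrev SlowFun := Base → ℝ → ℝ → ℝ

/-- Functions of `(t, y₁, y₂), y₃, Y₃, θ`. -/
abbrev FastFun := Base → ℝ → ℝ → ℝ → ℝ

/-- The set `[0,T] × ℝ²` of which `[0,T] × 𝕋²` is the quotient. -/
def baseDom (T : ℝ) : Set Base := Icc 0 T ×ˢ (univ ×ˢ univ)

/-- `f` belongs to `H^∞([0,T] × 𝕋² × 𝕋)`. By the Sobolev embedding theorem on a bounded Lipschitz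
domain, `H^∞` consists of the functions that are smooth up to the boundary. -/
structure IsHInfty (T : ℝ) (f : BdryFun) : Prop where
  smooth : ContDiffOn ℝ ∞ (fun z : Base × ℝ => f z.1 z.2) (baseDom T ×ˢ univ)
  periodic_y₁ : ∀ t ∈ Icc 0 T, ∀ y₁ y₂ θ, f (t, y₁ + 2 * Real.pi, y₂) θ = f (t, y₁, y₂) θ
  periodic_y₂ : ∀ t ∈ Icc 0 T, ∀ y₁ y₂ θ, f (t, y₁, y₂ + 2 * Real.pi) θ = f (t, y₁, y₂) θ
  periodic_θ : ∀ p ∈ baseDom T, ∀ θ, f p (θ + 2 * Real.pi) = f p θ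

/-- `f` belongs to `S̲^± = H^∞([0,T] × 𝕋² × I^± × 𝕋)`, i.e. it is smooth up to the boundary and
`2π`-periodic in `y₁`, `y₂`, `θ`. -/
structure IsResidual (T : ℝ) (σ : Side) (f : SlowFun) : Prop where
  smooth : ContDiffOn ℝ ∞ (fun z : Base × ℝ × ℝ => f z.1 z.2.1 z.2.2)
    (baseDom T ×ˢ (σ.slowClosed ×ˢ univ))
  periodic_y₁ : ∀ t ∈ Icc 0 T, ∀ y₁ y₂, ∀ y₃ ∈ σ.slowClosed, ∀ θ,
    f (t, y₁ + 2 * Real.pi, y₂) y₃ θ = f (t, y₁, y₂) y₃ θ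
  periodic_y₂ : ∀ t ∈ Icc 0 T, ∀ y₁ y₂, ∀ y₃ ∈ σ.slowClosed, ∀ θ,
    f (t, y₁, y₂ + 2 * Real.pi) y₃ θ = f (t, y₁, y₂) y₃ θ
  periodic_θ : ∀ p ∈ baseDom T, ∀ y₃ ∈ σ.slowClosed, ∀ θ,
    f p y₃ (θ + 2 * Real.pi) = f p y₃ θ

/-- The closed domain of the variables `((t, y₁, y₂), y₃, Y₃, θ)`. -/
def fastDom (T : ℝ) (σ : Side) : Set (Base × ℝ × ℝ × ℝ) :=
  baseDom T ×ˢ (σ.slowClosed ×ˢ (σ.fastClosed ×ˢ univ))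

/-- `f` belongs to `S_⋆^±`: it is smooth up to the boundary, `2π`-periodic in `y₁`, `y₂`, `θ`, and
decays exponentially as `Y₃ → ±∞`, with all its derivatives, uniformly in the other variables and
with a rate `δ` that does not depend on the order of differentiation. (Square integrability of all
derivatives follows, since all variables other than `Y₃` range in a compact set.) -/
structure IsSurface (T : ℝ) (σ : Side) (f : FastFun) : Prop where
  smooth : ContDiffOn ℝ ∞
    (fun z : Base × ℝ × ℝ × ℝ => f z.1 z.2.1 z.2.2.1 z.2.2.2) (fastDom T σ)
  periodic_y₁ : ∀ t ∈ Icc 0 T, ∀ y₁ y₂, ∀ y₃ ∈ σ.slowClosed, ∀ Y ∈ σ.fastClosed, ∀ θ,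
    f (t, y₁ + 2 * Real.pi, y₂) y₃ Y θ = f (t, y₁, y₂) y₃ Y θ
  periodic_y₂ : ∀ t ∈ Icc 0 T, ∀ y₁ y₂, ∀ y₃ ∈ σ.slowClosed, ∀ Y ∈ σ.fastClosed, ∀ θ,
    f (t, y₁, y₂ + 2 * Real.pi) y₃ Y θ = f (t, y₁, y₂) y₃ Y θ
  periodic_θ : ∀ p ∈ baseDom T, ∀ y₃ ∈ σ.slowClosed, ∀ Y ∈ σ.fastClosed, ∀ θ,
    f p y₃ Y (θ + 2 * Real.pi) = f p y₃ Y θ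
  decay : ∃ δ > 0, ∀ n : ℕ, ∃ C : ℝ, ∀ z ∈ fastDom T σ,
    ‖iteratedFDerivWithin ℝ n
        (fun z : Base × ℝ × ℝ × ℝ => f z.1 z.2.1 z.2.2.1 z.2.2.2) (fastDom T σ) z‖
      ≤ C * Real.exp (-δ * |z.2.2.1|)

/-- `f` belongs to `S^± = S̲^± ⊕ S_⋆^±`. -/
def IsProfile (T : ℝ) (σ : Side) (f : FastFun) : Prop :=
  ∃ (r : SlowFun) (s : FastFun), IsResidual T σ r ∧ IsSurface T σ s ∧
    ∀ p ∈ baseDom T, ∀ y₃ ∈ σ.slowClosed, ∀ Y ∈ σ.fastClosed, ∀ θ,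
      f p y₃ Y θ = r p y₃ θ + s p y₃ Y θ

/-- The component of a profile on `S̲^±`, which is its limit as `Y₃ → ± ∞`. -/
def resid (σ : Side) (f : FastFun) : SlowFun :=
  fun p y₃ θ => limUnder σ.infinity (fun Y => f p y₃ Y θ)

/-- The component of a profile on `S_⋆^±`. -/
def surf (σ : Side) (f : FastFun) : FastFun :=
  fun p y₃ Y θ => f p y₃ Y θ - resid σ f p y₃ θ

/-- The `k`-th Fourier coefficient `(2π)⁻¹ ∫_0^{2π} g(θ) e^{-ikθ} dθ`. -/
def fcoef (g : ℝ → ℝ) (k : ℤ) : ℂ :=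
  fourierCoeffOn Real.two_pi_pos (fun θ => (g θ : ℂ)) k

/-- The components of `f = r + s` are `r` and `s`. -/
theorem resid_eq {T : ℝ} {σ : Side} {f s : FastFun} {r : SlowFun} (hs : IsSurface T σ s)
    (h : ∀ p ∈ baseDom T, ∀ y₃ ∈ σ.slowClosed, ∀ Y ∈ σ.fastClosed, ∀ θ,
      f p y₃ Y θ = r p y₃ θ + s p y₃ Y θ)
    {p : Base} (hp : p ∈ baseDom T) {y₃ : ℝ} (hy : y₃ ∈ σ.slowClosed) (θ : ℝ) :
    resid σ f p y₃ θ = r p y₃ θ := by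
  obtain ⟨δ, hδ, hdec⟩ := hs.decay
  obtain ⟨C, hC⟩ := hdec 0
  have hne : σ.infinity.NeBot := by
    cases σ <;> simp only [Side.infinity] <;> infer_instance
  have hmem : ∀ᶠ Y in σ.infinity, Y ∈ σ.fastClosed := by
    cases σ
    · exact eventually_ge_atTop 0
    · exact eventually_le_atBot 0
  have habs : Tendsto (fun Y : ℝ => |Y|) σ.infinity atTop := by
    cases σ
    · exact tendsto_abs_atTop_atTop
    · exact tendsto_abs_atBot_atTop
  have hexp : Tendsto (fun Y : ℝ => C * Real.exp (-δ * |Y|)) σ.infinity (𝓝 0) := by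
    have h1 : Tendsto (fun Y : ℝ => -δ * |Y|) σ.infinity atBot :=
      habs.const_mul_atTop_of_neg (by linarith)
    simpa using (Real.tendsto_exp_atBot.comp h1).const_mul C
  have hs0 : Tendsto (fun Y => s p y₃ Y θ) σ.infinity (𝓝 0) := by
    refine squeeze_zero_norm' ?_ hexp
    filter_upwards [hmem] with Y hY
    have := hC (p, y₃, Y, θ) ⟨hp, hy, hY, mem_univ _⟩
    simpa [norm_iteratedFDerivWithin_zero] using this
  refine Tendsto.limUnder_eq ?_
  have h2 : Tendsto (fun Y => r p y₃ θ + s p y₃ Y θ) σ.infinity (𝓝 (r p y₃ θ)) := by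
    simpa using hs0.const_add (r p y₃ θ)
  refine h2.congr' ?_
  filter_upwards [hmem] with Y hY
  exact (h p hp y₃ hy Y hY θ).symm

/-! ### The reference current vortex sheet and the frequencies

Vectors of `ℝ⁷` are ordered as `(u₁, u₂, u₃, H₁, H₂, H₃, q)`, with indices `0, …, 6`. -/

/-- Tangential velocities `(u₁^{0,±}, u₂^{0,±})` and magnetic fields `(H₁^{0,±}, H₂^{0,±})` of the
reference sheet, tangential frequency `ξ'` and time frequency `τ`. -/
structure Params where
  u : Side → Fin 2 → ℝ
  H : Side → Fin 2 → ℝ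
  ξ : Fin 2 → ℝ
  τ : ℝ

namespace Params

variable (P : Params)

def a (σ : Side) : ℝ := P.ξ 0 * P.u σ 0 + P.ξ 1 * P.u σ 1

def b (σ : Side) : ℝ := P.ξ 0 * P.H σ 0 + P.ξ 1 * P.H σ 1

def c (σ : Side) : ℝ := P.τ + P.a σ

/-- The velocity `u^{0,±}` as a vector of `ℝ³`. -/
def uVec (σ : Side) : Fin 3 → ℝ := ![P.u σ 0, P.u σ 1, 0]

/-- The magnetic field `H^{0,±}` as a vector of `ℝ³`. -/
def HVec (σ : Side) : Fin 3 → ℝ := ![P.H σ 0, P.H σ 1, 0]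

/-- The square of the Euclidean norm of the cross product of two vectors. -/
def crossSq (v w : Fin 3 → ℝ) : ℝ := crossProduct v w ⬝ᵥ crossProduct v w

/-- Stability: `|H⁺ × [u]|² + |H⁻ × [u]|² < 2 |H⁺ × H⁻|²`. -/
def Stable : Prop :=
  crossSq (P.HVec .plus) (P.uVec .plus - P.uVec .minus)
    + crossSq (P.HVec .minus) (P.uVec .plus - P.uVec .minus)
    < 2 * crossSq (P.HVec .plus) (P.HVec .minus)

/-- `ξ'` is a unit vector with rational direction. -/
def RationalDirection : Prop :=
  ∃ m n : ℤ, (m, n) ≠ (0, 0) ∧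
    P.ξ 0 = m / Real.sqrt ((m : ℝ) ^ 2 + (n : ℝ) ^ 2) ∧
    P.ξ 1 = n / Real.sqrt ((m : ℝ) ^ 2 + (n : ℝ) ^ 2)

/-- Nondegeneracy: `|a⁺ - a⁻|` differs from `|b⁺ - b⁻|` and from `|b⁺ + b⁻|`. -/
def NonDegenerate : Prop :=
  |P.a .plus - P.a .minus| ≠ |P.b .plus - P.b .minus| ∧
  |P.a .plus - P.a .minus| ≠ |P.b .plus + P.b .minus|

/-- `τ` is a root of the Lopatinskii determinant. -/
def LopatinskiiRoot : Prop :=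
  (P.c .plus) ^ 2 + (P.c .minus) ^ 2 = (P.b .plus) ^ 2 + (P.b .minus) ^ 2

def A₀ : Matrix (Fin 7) (Fin 7) ℝ := Matrix.diagonal ![1, 1, 1, 1, 1, 1, 0]

def A₁ (σ : Side) : Matrix (Fin 7) (Fin 7) ℝ :=
  !![2 * P.u σ 0, 0, 0, -(2 * P.H σ 0), 0, 0, 1;
     P.u σ 1, P.u σ 0, 0, -P.H σ 1, -P.H σ 0, 0, 0;
     0, 0, P.u σ 0, 0, 0, -P.H σ 0, 0;
     0, 0, 0, 0, 0, 0, 0;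
     P.H σ 1, -P.H σ 0, 0, -P.u σ 1, P.u σ 0, 0, 0;
     0, 0, -P.H σ 0, 0, 0, P.u σ 0, 0;
     1, 0, 0, 0, 0, 0, 0]

def A₂ (σ : Side) : Matrix (Fin 7) (Fin 7) ℝ :=
  !![P.u σ 1, P.u σ 0, 0, -P.H σ 1, -P.H σ 0, 0, 0;
     0, 2 * P.u σ 1, 0, 0, -(2 * P.H σ 1), 0, 1;
     0, 0, P.u σ 1, 0, 0, -P.H σ 1, 0;
     -P.H σ 1, P.H σ 0, 0, P.u σ 1, -P.u σ 0, 0, 0;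
     0, 0, 0, 0, 0, 0, 0;
     0, 0, -P.H σ 1, 0, 0, P.u σ 1, 0;
     0, 1, 0, 0, 0, 0, 0]

def A₃ (σ : Side) : Matrix (Fin 7) (Fin 7) ℝ :=
  !![0, 0, P.u σ 0, 0, 0, -P.H σ 0, 0;
     0, 0, P.u σ 1, 0, 0, -P.H σ 1, 0;
     0, 0, 0, 0, 0, 0, 1;
     0, 0, P.H σ 0, 0, 0, -P.u σ 0, 0;
     0, 0, P.H σ 1, 0, 0, -P.u σ 1, 0;
     0, 0, 0, 0, 0, 0, 0;
     0, 0, 1, 0, 0, 0, 0]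

/-- `𝒜^± = τ A₀ + ξ₁ A₁^± + ξ₂ A₂^±`. -/
def calA (σ : Side) : Matrix (Fin 7) (Fin 7) ℝ :=
  P.τ • A₀ + P.ξ 0 • P.A₁ σ + P.ξ 1 • P.A₂ σ

/-- The boundary matrices `B^±`. -/
def B : Side → Matrix (Fin 5) (Fin 7) ℝ
  | .plus =>
    !![0, 0, 1, 0, 0, 0, 0;
       0, 0, 0, 0, 0, 1, 0;
       0, 0, 0, 0, 0, 0, 0;
       0, 0, 0, 0, 0, 0, 0;
       0, 0, 0, 0, 0, 0, 1]
  | .minus =>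
    !![0, 0, 0, 0, 0, 0, 0;
       0, 0, 0, 0, 0, 0, 0;
       0, 0, 1, 0, 0, 0, 0;
       0, 0, 0, 0, 0, 1, 0;
       0, 0, 0, 0, 0, 0, -1]

/-- `b̲ = -(c⁺, b⁺, c⁻, b⁻, 0)`. -/
def bvec : Fin 5 → ℝ :=
  ![-P.c .plus, -P.b .plus, -P.c .minus, -P.b .minus, 0]

/-- The vectors `𝐑^±`. -/
def boldR (σ : Side) : Fin 7 → ℂ :=
  ![P.ξ 0 * P.c σ, P.ξ 1 * P.c σ, σ.sg * Complex.I * P.c σ,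
    P.ξ 0 * P.b σ, P.ξ 1 * P.b σ, σ.sg * Complex.I * P.b σ,
    (P.b σ : ℂ) ^ 2 - (P.c σ : ℂ) ^ 2]

/-- The vectors `𝐋^±`. -/
def boldL (σ : Side) : Fin 7 → ℂ :=
  ![P.ξ 0 * P.τ, P.ξ 1 * P.τ, σ.sg * Complex.I * P.τ,
    2 * P.ξ 0 * P.b σ, 2 * P.ξ 1 * P.b σ, σ.sg * 2 * Complex.I * P.b σ,
    -(P.τ * (P.a σ + P.c σ))]

/-- `ℛ^±(k)`: the vector `𝐑^±` for `k > 0`, its complex conjugate for `k < 0`. -/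
def calR (σ : Side) (k : ℤ) : Fin 7 → ℂ := if 0 < k then P.boldR σ else star (P.boldR σ)

/-- `ℒ^±(k)`: the vector `𝐋^±` for `k > 0`, its complex conjugate for `k < 0`. -/
def calL (σ : Side) (k : ℤ) : Fin 7 → ℂ := if 0 < k then P.boldL σ else star (P.boldL σ)

def ell₁ (σ : Side) : ℝ := 2 * (P.b σ) ^ 2 - P.τ * P.c σ

def ell₂ (σ : Side) : ℝ := -((P.a σ + P.c σ) * P.b σ)

end Params

/-- The projector `Π = diag(1,1,0,1,1,0,0)`. -/
def projTan : Matrix (Fin 7) (Fin 7) ℂ := Matrix.diagonal ![1, 1, 0, 1, 1, 0, 0]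

/-- The vector of Fourier coefficients `Û(t,y,Y₃,k)`. -/
def fcoefVec (U : Fin 7 → FastFun) (p : Base) (y₃ Y : ℝ) (k : ℤ) : Fin 7 → ℂ :=
  fun j => fcoef (fun θ => U j p y₃ Y θ) k

/-! ### The fast problem -/

/-- `ℒ_f^±(∂) U = A₃^± ∂_{Y₃} U + 𝒜^± ∂_θ U`. -/
def fastOp (P : Params) (σ : Side) (U : Fin 7 → FastFun) (p : Base) (y₃ Y θ : ℝ) : Fin 7 → ℝ :=
  P.A₃ σ *ᵥ (fun j => deriv (fun Y' => U j p y₃ Y' θ) Y)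
    + P.calA σ *ᵥ (fun j => deriv (fun θ' => U j p y₃ Y θ') θ)

/-- `(U^±, ψ)` satisfies the equations of the fast problem with source terms `F^±, F₈^±, G`. -/
structure SolvesFast (T : ℝ) (P : Params) (F : Side → Fin 7 → FastFun) (F₈ : Side → FastFun)
    (G : Fin 5 → BdryFun) (U : Side → Fin 7 → FastFun) (ψ : BdryFun) : Prop where
  evolution : ∀ σ : Side, ∀ p ∈ baseDom T, ∀ y₃ ∈ σ.slowOpen, ∀ Y ∈ σ.fastOpen, ∀ θ : ℝ,
    fastOp P σ (U σ) p y₃ Y θ = fun i => F σ i p y₃ Y θ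
  divergence : ∀ σ : Side, ∀ p ∈ baseDom T, ∀ y₃ ∈ σ.slowOpen, ∀ Y ∈ σ.fastOpen, ∀ θ : ℝ,
    deriv (fun Y' => U σ 5 p y₃ Y' θ) Y
      + P.ξ 0 * deriv (fun θ' => U σ 3 p y₃ Y θ') θ
      + P.ξ 1 * deriv (fun θ' => U σ 4 p y₃ Y θ') θ = F₈ σ p y₃ Y θ
  jump : ∀ p ∈ baseDom T, ∀ θ : ℝ,
    Params.B .plus *ᵥ (fun j => U .plus j p 0 0 θ)
      + Params.B .minus *ᵥ (fun j => U .minus j p 0 0 θ)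
      + deriv (fun θ' => ψ p θ') θ • P.bvec = fun i => G i p θ

/-- The five compatibility conditions on the source terms (`F₁, …, F₇` have indices `0, …, 6`,
and `G₁, …, G₅` have indices `0, …, 4`). -/
structure Compatible (T : ℝ) (P : Params) (F : Side → Fin 7 → FastFun) (F₈ : Side → FastFun)
    (G : Fin 5 → BdryFun) : Prop where
  boundary_plus : ∀ p ∈ baseDom T, ∀ θ : ℝ,
    F .plus 5 p 0 0 θ
      = -P.b .plus * deriv (fun θ' => G 0 p θ') θ + P.c .plus * deriv (fun θ' => G 1 p θ') θ
  boundary_minus : ∀ p ∈ baseDom T, ∀ θ : ℝ,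
    F .minus 5 p 0 0 θ
      = -P.b .minus * deriv (fun θ' => G 2 p θ') θ + P.c .minus * deriv (fun θ' => G 3 p θ') θ
  slow_mean : ∀ σ : Side, ∀ p ∈ baseDom T, ∀ y₃ ∈ σ.slowClosed, ∀ i : Fin 7,
    fcoef (fun θ => resid σ (F σ i) p y₃ θ) 0 = 0
  slow_mean₈ : ∀ σ : Side, ∀ p ∈ baseDom T, ∀ y₃ ∈ σ.slowClosed,
    fcoef (fun θ => resid σ (F₈ σ) p y₃ θ) 0 = 0
  fast_mean_u : ∀ σ : Side, ∀ p ∈ baseDom T, ∀ y₃ ∈ σ.slowClosed, ∀ Y ∈ σ.fastClosed,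
    ∀ (j : Fin 2) (i : Fin 7), i.val = j.val →
      P.u σ j * fcoef (fun θ => surf σ (F σ 6) p y₃ Y θ) 0
        - P.H σ j * fcoef (fun θ => surf σ (F₈ σ) p y₃ Y θ) 0
        = fcoef (fun θ => surf σ (F σ i) p y₃ Y θ) 0
  fast_mean_H : ∀ σ : Side, ∀ p ∈ baseDom T, ∀ y₃ ∈ σ.slowClosed, ∀ Y ∈ σ.fastClosed,
    ∀ (j : Fin 2) (i : Fin 7), i.val = 3 + j.val →
      P.H σ j * fcoef (fun θ => surf σ (F σ 6) p y₃ Y θ) 0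
        - P.u σ j * fcoef (fun θ => surf σ (F₈ σ) p y₃ Y θ) 0
        = fcoef (fun θ => surf σ (F σ i) p y₃ Y θ) 0
  divergence : ∀ σ : Side, ∀ p ∈ baseDom T, ∀ y₃ ∈ σ.slowOpen, ∀ Y ∈ σ.fastOpen, ∀ θ : ℝ,
    deriv (fun Y' => F σ 5 p y₃ Y' θ) Y
      + P.ξ 0 * deriv (fun θ' => F σ 3 p y₃ Y θ') θ
      + P.ξ 1 * deriv (fun θ' => F σ 4 p y₃ Y θ') θ
      - P.τ * deriv (fun θ' => F₈ σ p y₃ Y θ') θ = 0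
  orthogonality : ∀ p ∈ baseDom T, ∀ k : ℤ, k ≠ 0 →
    (∫ Y in Ioi (0 : ℝ), (Real.exp (-|(k : ℝ)| * Y) : ℂ)
        * (star (P.calL .plus k) ⬝ᵥ fcoefVec (F .plus) p 0 Y k))
      - (∫ Y in Iio (0 : ℝ), (Real.exp (|(k : ℝ)| * Y) : ℂ)
        * (star (P.calL .minus k) ⬝ᵥ fcoefVec (F .minus) p 0 Y k))
      + P.ell₁ .plus * fcoef (fun θ => G 0 p θ) k
      + P.ell₂ .plus * fcoef (fun θ => G 1 p θ) k
      + P.ell₁ .minus * fcoef (fun θ => G 2 p θ) k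
      + P.ell₂ .minus * fcoef (fun θ => G 3 p θ) k
      - Complex.I * P.τ * (Int.sign k : ℂ) * fcoef (fun θ => G 4 p θ) k = 0

/-- The profiles `U^±` are obtained from `𝕌^±` by adding
* slow means `U̲_h^±(t,y)` in `S̲^±` that satisfy the homogeneous conditions at `y₃ = 0`,
* fast means `(u_{1,⋆}, u_{2,⋆}, 0, H_{1,⋆}, H_{2,⋆}, 0, 0)(t,y,Y₃)` with entries in `S_⋆^±`,
* surface waves `W^± = ∑_{k ≠ 0} γ^±(t,y,k) e^{∓|k| Y₃ + i k θ} ℛ^±(k)` in `S_⋆^±`, whose amplitudes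
  at `y₃ = 0` are given by the front `ψ`. -/
def HasGeneralForm (T : ℝ) (P : Params) (UU U : Side → Fin 7 → FastFun) (ψ : BdryFun) : Prop :=
  ∃ (Uh : Side → Fin 7 → Base → ℝ → ℝ) (v : Side → Fin 4 → Base → ℝ → ℝ → ℝ)
    (γ : Side → Base → ℝ → ℤ → ℂ) (W : Side → Fin 7 → FastFun),
    (∀ σ i, IsResidual T σ (fun p y₃ _ => Uh σ i p y₃)) ∧
    (∀ σ j, IsSurface T σ (fun p y₃ Y _ => v σ j p y₃ Y)) ∧
    (∀ σ i, IsSurface T σ (W σ i)) ∧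
    (∀ σ : Side, ∀ p ∈ baseDom T, ∀ y₃ ∈ σ.slowClosed, ∀ Y ∈ σ.fastClosed, ∀ θ : ℝ, ∀ i,
      HasSum (fun k : {k : ℤ // k ≠ 0} => γ σ p y₃ k
          * Complex.exp (-(σ.sg * |(k : ℝ)| * Y : ℝ) + Complex.I * (k : ℤ) * θ)
          * P.calR σ k i)
        (W σ i p y₃ Y θ : ℂ)) ∧
    (∀ σ : Side, ∀ p ∈ baseDom T, ∀ y₃ ∈ σ.slowClosed, ∀ Y ∈ σ.fastClosed, ∀ θ : ℝ, ∀ i,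
      U σ i p y₃ Y θ = UU σ i p y₃ Y θ + Uh σ i p y₃
        + (![v σ 0 p y₃ Y, v σ 1 p y₃ Y, 0, v σ 2 p y₃ Y, v σ 3 p y₃ Y, 0, 0] : Fin 7 → ℝ) i
        + W σ i p y₃ Y θ) ∧
    (∀ σ : Side, ∀ p ∈ baseDom T, ∀ k : ℤ, k ≠ 0 →
      γ σ p 0 k = σ.sg * |(k : ℝ)| * fcoef (fun θ => ψ p θ) k) ∧
    (∀ σ : Side, ∀ p ∈ baseDom T, ∀ y₃ ∈ σ.slowClosed, ∀ k : ℤ, k ≠ 0 →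
      γ σ p y₃ (-k) = star (γ σ p y₃ k)) ∧
    (∀ σ : Side, ∀ p ∈ baseDom T, Uh σ 2 p 0 = 0 ∧ Uh σ 5 p 0 = 0) ∧
    (∀ p ∈ baseDom T, Uh .plus 6 p 0 = Uh .minus 6 p 0)

end

end FastProblem

open FastProblem

open Set Filter Topology MeasureTheory Matrix
open scoped ContDiff

namespace FastProblem

/-! Algebra on one side. The seventh equation and the magnetic divergence equation give D_u = F₇ and
D_H = F₈. After substitution (`Reduced`), put f_l = F_l - u_l⁰ F₇ + H_l⁰ F₈ and g_l = F_{3+l} - H_l⁰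
F₇ + u_l⁰ F₈. The tangential unknowns then satisfy the two scalar relations c ∂_θ u_l - b ∂_θ H_l +
ξ_l ∂_θ q = f_l and -b ∂_θ u_l + c ∂_θ H_l = g_l. The combination Z = c H₃ - b u₃ satisfies ∂_θ Z =
F₆. The pair q, w = c u₃ - b H₃ solves the Cauchy–Riemann system ∂_Y q + ∂_θ w = F₃, ∂_Y w - ∂_θ q =
c F₇ - b F₈ - ξ·f. By (H3) and (H4) the determinant c² - b² is nonzero (`c_sq_ne`), so (w, Z)
returns (u₃, H₃), and u_l, H_l are recovered from q, f_l, g_l.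

Necessity. On θ-means all θ-derivatives disappear, which gives (b) and (c); cross differentiation of
u₃ and H₃ gives (d); the traces at the boundary give (a). For (e), ℒ(k) is a left null vector of
±|k| A₃ + i k 𝒜. Pairing the k-th mode with it leaves a scalar equation N' ∓ |k| N = ℒ(k) • F̂,
whose bounded solution is a tail integral; hence the integral in (e) is a boundary value of u₃, H₃,
q (`duality`). When the two sides are added the front drops out: ℓ₁ c + ℓ₂ b = -τ (c² - b²) on each
side, and (H4) makes the two values opposite (`ell_add`, `bform_jump`).

Sufficiency. With ψ = 0, each side is solved separately with u₃ and H₃ prescribed at the boundary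
(`SideCompatible.exists_solution`). Only the jump of q is left. For k ≠ 0, (e) and `duality` give it
after division by i τ sgn k; for k = 0 the mean of q is free (`exists_particular`).

General solution. The difference of two solutions is homogeneous. Its slow part has no θ-derivative,
its fast means of u₃, H₃, q are constant and decaying, hence zero, and each oscillating fast mode is
a multiple of ℛ(k) decaying like e^{-|k||Y₃|} (`Evol.eq_calR`). The jump conditions give the
amplitudes ±|k| ψ̂, and (H4) is again what makes q continuous (`modeJump_iff`).

Analysis. All functions are complexified and live on one closed domain (`Tame`). Smoothness up to
the boundary with uniform decay follows from a closure principle: if a family is stable under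
differentiation and each member is bounded by a weight, so are all derivatives
(`contDiffOn_and_bound_of_family`). Fourier modes f̂(k) e^{ikθ} are kept as functions on the same
domain, so this calculus applies to them too. For real data, φ = w ∓ i q turns the Cauchy–Riemann
system into ∂_Y φ ∓ i ∂_θ φ = h, that is φ_k' ± k φ_k = h_k. For k > 0 this is integrated from the
boundary, for k < 0 from infinity (`resOp`, `cauchyOp`). The estimates are uniform in k because the
decay rate is taken at most 1/2, below every |k|. The free positive modes serve to prescribe w at Y₃
= 0. -/

/-- Points `((t, y₁, y₂), y₃, Y₃, θ)`. -/
abbrev Pt := Base × ℝ × ℝ × ℝ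

variable {T : ℝ} {σ : Side} {δ : ℝ} {f g : Pt → ℂ} {P : Params}

/-! ### Coordinates and gradients relative to a set -/

/-- The six coordinates of a point. -/
noncomputable def crd : Fin 6 → Pt →L[ℝ] ℝ :=
  ![(ContinuousLinearMap.fst ℝ ℝ (ℝ × ℝ)).comp (ContinuousLinearMap.fst ℝ Base (ℝ × ℝ × ℝ)),
    ((ContinuousLinearMap.fst ℝ ℝ ℝ).comp (ContinuousLinearMap.snd ℝ ℝ (ℝ × ℝ))).comp
      (ContinuousLinearMap.fst ℝ Base (ℝ × ℝ × ℝ)),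
    ((ContinuousLinearMap.snd ℝ ℝ ℝ).comp (ContinuousLinearMap.snd ℝ ℝ (ℝ × ℝ))).comp
      (ContinuousLinearMap.fst ℝ Base (ℝ × ℝ × ℝ)),
    (ContinuousLinearMap.fst ℝ ℝ (ℝ × ℝ)).comp (ContinuousLinearMap.snd ℝ Base (ℝ × ℝ × ℝ)),
    ((ContinuousLinearMap.fst ℝ ℝ ℝ).comp (ContinuousLinearMap.snd ℝ ℝ (ℝ × ℝ))).comp
      (ContinuousLinearMap.snd ℝ Base (ℝ × ℝ × ℝ)),
    ((ContinuousLinearMap.snd ℝ ℝ ℝ).comp (ContinuousLinearMap.snd ℝ ℝ (ℝ × ℝ))).comp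
      (ContinuousLinearMap.snd ℝ Base (ℝ × ℝ × ℝ))]

/-- The basis dual to the coordinates. -/
def bas : Fin 6 → Pt :=
  ![((1, 0, 0), 0, 0, 0), ((0, 1, 0), 0, 0, 0), ((0, 0, 1), 0, 0, 0),
    ((0, 0, 0), 1, 0, 0), ((0, 0, 0), 0, 1, 0), ((0, 0, 0), 0, 0, 1)]

@[simp] theorem crd_zero (z : Pt) : crd 0 z = z.1.1 := rfl
@[simp] theorem crd_one (z : Pt) : crd 1 z = z.1.2.1 := rfl
@[simp] theorem crd_two (z : Pt) : crd 2 z = z.1.2.2 := rfl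
@[simp] theorem crd_three (z : Pt) : crd 3 z = z.2.1 := rfl
@[simp] theorem crd_four (z : Pt) : crd 4 z = z.2.2.1 := rfl
@[simp] theorem crd_five (z : Pt) : crd 5 z = z.2.2.2 := rfl

theorem crd_bas (i j : Fin 6) : crd i (bas j) = if i = j then 1 else 0 := by
  fin_cases i <;> fin_cases j <;> simp [bas]

theorem sum_crd_smul_bas (z : Pt) : ∑ i, crd i z • bas i = z := by
  obtain ⟨⟨t, y₁, y₂⟩, y₃, Y, θ⟩ := z
  simp [Fin.sum_univ_succ, crd, bas]

/-- The linear form with the given components. -/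
noncomputable def lin (g : Fin 6 → ℂ) : Pt →L[ℝ] ℂ := ∑ i, (crd i).smulRight (g i)

theorem lin_apply (g : Fin 6 → ℂ) (v : Pt) : lin g v = ∑ i, crd i v • g i := by
  simp [lin]

@[simp] theorem lin_bas (g : Fin 6 → ℂ) (i : Fin 6) : lin g (bas i) = g i := by
  simp [lin_apply, crd_bas]

theorem eq_lin (L : Pt →L[ℝ] ℂ) : L = lin (fun i => L (bas i)) := by
  refine ContinuousLinearMap.ext fun v => ?_
  conv_lhs => rw [← sum_crd_smul_bas v]
  simp [lin_apply]

theorem norm_lin_le (g : Fin 6 → ℂ) : ‖lin g‖ ≤ ∑ i, ‖crd i‖ * ‖g i‖ := by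
  refine (norm_sum_le _ _).trans (Finset.sum_le_sum fun i _ => ?_)
  rw [ContinuousLinearMap.norm_smulRight_apply]

/-- The function `f` has the partial derivatives `g` on `D`. -/
def HasGrad (D : Set Pt) (f : Pt → ℂ) (g : Fin 6 → Pt → ℂ) : Prop :=
  ∀ z ∈ D, HasFDerivWithinAt f (lin fun i => g i z) D z

theorem HasGrad.congr {D : Set Pt} {f f' : Pt → ℂ} {g : Fin 6 → Pt → ℂ}
    (h : HasGrad D f g) (hf : EqOn f' f D) : HasGrad D f' g :=
  fun z hz => (h z hz).congr hf (hf hz)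

theorem HasGrad.congr_grad {D : Set Pt} {f : Pt → ℂ} {g g' : Fin 6 → Pt → ℂ}
    (h : HasGrad D f g) (hg : ∀ i, EqOn (g' i) (g i) D) : HasGrad D f g' := by
  intro z hz
  have : (fun i => g' i z) = fun i => g i z := funext fun i => hg i hz
  rw [this]
  exact h z hz

theorem lin_add (g g' : Fin 6 → ℂ) : lin (fun i => g i + g' i) = lin g + lin g' := by
  refine ContinuousLinearMap.ext fun v => ?_; simp [lin_apply, Finset.sum_add_distrib]

theorem lin_mul (c : ℂ) (g : Fin 6 → ℂ) : lin (fun i => c * g i) = c • lin g := by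
  refine ContinuousLinearMap.ext fun v => ?_
  simp only [lin_apply, _root_.smul_apply, smul_eq_mul, Finset.mul_sum]
  exact Finset.sum_congr rfl fun i _ => mul_smul_comm _ _ _ |>.symm

theorem HasGrad.add {D : Set Pt} {f f' : Pt → ℂ} {g g' : Fin 6 → Pt → ℂ}
    (h : HasGrad D f g) (h' : HasGrad D f' g') :
    HasGrad D (fun z => f z + f' z) (fun i z => g i z + g' i z) := by
  intro z hz
  rw [lin_add]
  exact (h z hz).add (h' z hz)

theorem HasGrad.const_mul {D : Set Pt} {f : Pt → ℂ} {g : Fin 6 → Pt → ℂ} (c : ℂ)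
    (h : HasGrad D f g) : HasGrad D (fun z => c * f z) (fun i z => c * g i z) := by
  intro z hz
  rw [lin_mul]
  exact (h z hz).const_mul c

theorem hasGrad_const (D : Set Pt) (c : ℂ) : HasGrad D (fun _ => c) (fun _ _ => 0) := by
  intro z hz
  have : lin (fun _ => 0) = 0 := by refine ContinuousLinearMap.ext fun v => ?_; simp [lin_apply]
  rw [this]
  exact hasFDerivWithinAt_const c z D

theorem HasGrad.comp {D D' : Set Pt} {f : Pt → ℂ} {g : Fin 6 → Pt → ℂ} (h : HasGrad D f g)
    (L : Pt →L[ℝ] Pt) (v : Pt) (hL : ∀ z ∈ D', L z + v ∈ D) :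
    HasGrad D' (fun z => f (L z + v)) (fun i z => ∑ j, crd j (L (bas i)) • g j (L z + v)) := by
  intro z hz
  have h1 : HasFDerivWithinAt (fun z => L z + v) L D' z :=
    (L.hasFDerivWithinAt).add_const v
  have h2 := (h _ (hL z hz)).comp z h1 hL
  have e : (fun i => ((lin fun i => g i (L z + v)).comp L) (bas i))
      = fun i => ∑ j, crd j (L (bas i)) • g j (L z + v) := funext fun i => by simp [lin_apply]
  rw [eq_lin ((lin fun i => g i (L z + v)).comp L), e] at h2
  exact h2

theorem HasGrad.comp_add {D : Set Pt} {f : Pt → ℂ} {g : Fin 6 → Pt → ℂ} (h : HasGrad D f g)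
    (v : Pt) (hv : ∀ z ∈ D, z + v ∈ D) :
    HasGrad D (fun z => f (z + v)) (fun i z => g i (z + v)) := by
  have := h.comp (D' := D) (ContinuousLinearMap.id ℝ Pt) v hv
  simpa [crd_bas] using this

theorem HasGrad.continuousOn {D : Set Pt} {f : Pt → ℂ} {g : Fin 6 → Pt → ℂ}
    (h : HasGrad D f g) : ContinuousOn f D :=
  fun z hz => (h z hz).continuousWithinAt

/-! ### Differentiation of integrals and series; families closed under differentiation -/

/-- Differentiation under the integral sign on a convex set, up to its boundary. -/
theorem HasGrad.integral {α : Type*} [MeasurableSpace α] {μ : Measure α} {D : Set Pt}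
    (hD : Convex ℝ D) {f : α → Pt → ℂ} {g : α → Fin 6 → Pt → ℂ} {b : α → ℝ}
    (hf : ∀ᵐ a ∂μ, HasGrad D (f a) (g a)) (hb : Integrable b μ)
    (hfm : ∀ z ∈ D, AEStronglyMeasurable (fun a => f a z) μ)
    (hgm : ∀ z ∈ D, ∀ i, AEStronglyMeasurable (fun a => g a i z) μ)
    (hfb : ∀ᵐ a ∂μ, ∀ z ∈ D, ‖f a z‖ ≤ b a) (hgb : ∀ᵐ a ∂μ, ∀ i, ∀ z ∈ D, ‖g a i z‖ ≤ b a) :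
    HasGrad D (fun z => ∫ a, f a z ∂μ) (fun i z => ∫ a, g a i z ∂μ) := by
  intro x hx
  have hfi : ∀ z ∈ D, Integrable (fun a => f a z) μ := fun z hz =>
    hb.mono' (hfm z hz) (hfb.mono fun a ha => ha z hz)
  have hgi : ∀ z ∈ D, ∀ i, Integrable (fun a => g a i z) μ := fun z hz i =>
    hb.mono' (hgm z hz i) (hgb.mono fun a ha => ha i z hz)
  have hli : ∀ v, Integrable (fun a => lin (fun i => g a i x) v) μ := by
    intro v
    simp only [lin_apply]
    exact integrable_finsetSum _ fun i _ => (hgi x hx i).smul (crd i v)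
  have hlin : ∀ v, lin (fun i => ∫ a, g a i x ∂μ) v = ∫ a, lin (fun i => g a i x) v ∂μ := by
    intro v
    simp only [lin_apply]
    rw [integral_finsetSum (f := fun i a => crd i v • g a i x) _
      fun i _ => (hgi x hx i).smul (crd i v)]
    exact Finset.sum_congr rfl fun i _ => (integral_smul _ _).symm
  set C : ℝ := ∑ i, ‖crd i‖ with hC
  have hC0 : 0 ≤ C := Finset.sum_nonneg fun i _ => norm_nonneg _
  have hnl : ∀ᵐ a ∂μ, ∀ z ∈ D, ‖lin (fun i => g a i z)‖ ≤ C * b a := by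
    filter_upwards [hgb] with a ha z hz
    refine (norm_lin_le _).trans ?_
    rw [hC, Finset.sum_mul]
    exact Finset.sum_le_sum fun i _ => mul_le_mul_of_nonneg_left (ha i z hz) (norm_nonneg _)
  rw [hasFDerivWithinAt_iff_tendsto]
  -- The Taylor remainder of the integral is at most the integral of the remainders. Their quotients
  -- by ‖y - x‖ tend to 0 pointwise, and the mean value inequality on the convex set `D` dominates
  -- them by 2 C b(a), so no neighbourhood of `x` outside `D` is needed.
  have key : Tendsto (fun y => ∫ a, ‖y - x‖⁻¹ *
      ‖f a y - f a x - lin (fun i => g a i x) (y - x)‖ ∂μ) (𝓝[D] x) (𝓝 (∫ _, (0 : ℝ) ∂μ)) := by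
    refine tendsto_integral_filter_of_dominated_convergence (fun a => 2 * (C * b a)) ?_ ?_ ?_ ?_
    · filter_upwards [self_mem_nhdsWithin] with y hy
      exact ((((hfi y hy).sub (hfi x hx)).sub (hli _)).norm.const_mul _).aestronglyMeasurable
    · filter_upwards [self_mem_nhdsWithin] with y hy
      filter_upwards [hf, hnl] with a h1 h2
      have h3 := hD.norm_image_sub_le_of_norm_hasFDerivWithin_le h1 h2 hx hy
      have h4 : ‖lin (fun i => g a i x) (y - x)‖ ≤ C * b a * ‖y - x‖ :=
        ((lin (fun i => g a i x)).le_opNorm _).trans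
          (mul_le_mul_of_nonneg_right (h2 x hx) (norm_nonneg _))
      rw [norm_mul, norm_inv, norm_norm, norm_norm]
      have h5 : ‖f a y - f a x - lin (fun i => g a i x) (y - x)‖
          ≤ 2 * (C * b a) * ‖y - x‖ := (norm_sub_le _ _).trans (by linarith)
      have h6 : 0 ≤ C * b a := (norm_nonneg _).trans (h2 x hx)
      rcases eq_or_lt_of_le (norm_nonneg (y - x)) with h0 | h0
      · rw [← h0]; simp only [_root_.inv_zero, zero_mul]; linarith
      · rw [inv_mul_le_iff₀ h0]; linarith
    · exact (hb.const_mul C).const_mul 2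
    · filter_upwards [hf] with a ha
      exact (hasFDerivWithinAt_iff_tendsto.1 (ha x hx))
  rw [integral_zero] at key
  refine squeeze_zero' (Eventually.of_forall fun y => by positivity) ?_ key
  filter_upwards [self_mem_nhdsWithin] with y hy
  rw [integral_const_mul, hlin, ← integral_sub (hfi y hy) (hfi x hx),
    ← integral_sub (f := fun a => f a y - f a x) ((hfi y hy).sub (hfi x hx)) (hli _)]
  exact mul_le_mul_of_nonneg_left (norm_integral_le_integral_norm _) (by positivity)

/-- Termwise differentiation on a convex set, up to its boundary. -/
theorem HasGrad.tsum {D : Set Pt} (hD : Convex ℝ D) {f : ℤ → Pt → ℂ} {g : ℤ → Fin 6 → Pt → ℂ}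
    {b : ℤ → ℝ} (hf : ∀ k, HasGrad D (f k) (g k)) (hb : Summable b)
    (hfb : ∀ k, ∀ z ∈ D, ‖f k z‖ ≤ b k) (hgb : ∀ k i, ∀ z ∈ D, ‖g k i z‖ ≤ b k) :
    HasGrad D (fun z => ∑' k, f k z) (fun i z => ∑' k, g k i z) := by
  -- A series is an integral for the counting measure on ℤ, where every function is measurable.
  have hbi : Integrable b Measure.count := by
    rw [integrable_count_iff]
    exact hb.abs
  have h := HasGrad.integral (μ := Measure.count) hD (f := f) (g := g) (b := b)
    (Eventually.of_forall hf) hbi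
    (fun z _ => (measurable_from_top).aestronglyMeasurable)
    (fun z _ i => (measurable_from_top).aestronglyMeasurable)
    (Eventually.of_forall hfb) (Eventually.of_forall hgb)
  have hs : ∀ u : ℤ → ℂ, (∀ k, ‖u k‖ ≤ b k) → ∫ k, u k ∂Measure.count = ∑' k, u k := by
    intro u hu
    rw [integral_countable]
    · simp
    · rw [integrable_count_iff]
      exact Summable.of_nonneg_of_le (fun k => norm_nonneg _) hu hb
  refine (h.congr fun z hz => (hs _ fun k => hfb k z hz).symm).congr_grad
    fun i z hz => (hs _ fun k => hgb k i z hz).symm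

/-- A family of functions that is closed under differentiation consists of smooth functions, whose
derivatives of all orders are bounded by a weight if the functions themselves are. -/
theorem contDiffOn_and_bound_of_family {D : Set Pt} (hD : UniqueDiffOn ℝ D) {wt : Pt → ℝ}
    {𝒜 : Set (Pt → ℂ)} (hb : ∀ f ∈ 𝒜, ∃ C, ∀ z ∈ D, ‖f z‖ ≤ C * wt z)
    (hd : ∀ f ∈ 𝒜, ∃ g : Fin 6 → Pt → ℂ, (∀ i, g i ∈ 𝒜) ∧ HasGrad D f g) {f : Pt → ℂ}
    (hf : f ∈ 𝒜) : ContDiffOn ℝ ∞ f D ∧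
      ∀ n : ℕ, ∃ C, ∀ z ∈ D, ‖iteratedFDerivWithin ℝ n f D z‖ ≤ C * wt z := by
  have heq : ∀ f (g : Fin 6 → Pt → ℂ), HasGrad D f g → ∀ z ∈ D, fderivWithin ℝ f D z
      = ∑ i, (ContinuousLinearMap.smulRightL ℝ Pt ℂ (crd i)) (g i z) := by
    intro f g h z hz
    rw [(h z hz).fderivWithin (hD z hz)]
    rfl
  have hsm : ∀ n : ℕ, ∀ f ∈ 𝒜, ContDiffOn ℝ n f D := by
    intro n
    induction n with
    | zero =>
      intro f hf
      obtain ⟨g, -, hg⟩ := hd f hf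
      exact contDiffOn_zero.2 hg.continuousOn
    | succ n ih =>
      intro f hf
      obtain ⟨g, hgA, hg⟩ := hd f hf
      push_cast
      rw [contDiffOn_succ_iff_fderivWithin hD]
      refine ⟨fun z hz => (hg z hz).differentiableWithinAt, by simp, ?_⟩
      refine ContDiffOn.congr ?_ (heq f g hg)
      exact ContDiffOn.sum fun i _ =>
        (ContinuousLinearMap.contDiff _).comp_contDiffOn (ih _ (hgA i))
  have hbd : ∀ n : ℕ, ∀ f ∈ 𝒜, ∃ C, ∀ z ∈ D, ‖iteratedFDerivWithin ℝ n f D z‖ ≤ C * wt z := by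
    intro n
    induction n with
    | zero => intro f hf; simpa using hb f hf
    | succ n ih =>
      intro f hf
      obtain ⟨g, hgA, hg⟩ := hd f hf
      choose C hC using fun i => ih (g i) (hgA i)
      refine ⟨∑ i, ‖ContinuousLinearMap.smulRightL ℝ Pt ℂ (crd i)‖ * C i, fun z hz => ?_⟩
      rw [← norm_iteratedFDerivWithin_fderivWithin hD hz,
        iteratedFDerivWithin_congr (heq f g hg) hz, iteratedFDerivWithin_fun_sum_apply
        (f := fun i z => (ContinuousLinearMap.smulRightL ℝ Pt ℂ (crd i)) (g i z)) hD hz fun i _ =>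
        ((ContinuousLinearMap.contDiff _).comp_contDiffOn (hsm n _ (hgA i))) z hz, Finset.sum_mul]
      refine (norm_sum_le _ _).trans (Finset.sum_le_sum fun i _ => ?_)
      refine ((ContinuousLinearMap.norm_iteratedFDerivWithin_comp_left _
        (hsm n _ (hgA i) z hz) hD hz le_rfl)).trans ?_
      rw [mul_assoc]
      exact mul_le_mul_of_nonneg_left (hC i z hz) (norm_nonneg _)
  exact ⟨contDiffOn_infty.2 fun n => hsm n f hf, fun n => hbd n f hf⟩

/-! ### The two sides, the closed domain and its periods -/

theorem Side.sg_mul_sg (σ : Side) : σ.sg * σ.sg = 1 := by cases σ <;> simp [Side.sg]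

theorem Side.abs_sg (σ : Side) : |σ.sg| = 1 := by cases σ <;> simp [Side.sg]

theorem Side.mem_fastClosed {σ : Side} {Y : ℝ} : Y ∈ σ.fastClosed ↔ 0 ≤ σ.sg * Y := by
  cases σ <;> simp [Side.sg, Side.fastClosed]

theorem Side.mem_fastOpen {σ : Side} {Y : ℝ} : Y ∈ σ.fastOpen ↔ 0 < σ.sg * Y := by
  cases σ <;> simp [Side.sg, Side.fastOpen]

theorem Side.abs_eq {σ : Side} {Y : ℝ} (h : Y ∈ σ.fastClosed) : |Y| = σ.sg * Y := by
  rw [Side.mem_fastClosed] at h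
  rw [← abs_of_nonneg h, abs_mul, σ.abs_sg, one_mul]

theorem Side.zero_mem_slowClosed (σ : Side) : (0 : ℝ) ∈ σ.slowClosed := by
  cases σ <;> simp [Side.slowClosed]

theorem Side.zero_mem_fastClosed (σ : Side) : (0 : ℝ) ∈ σ.fastClosed := by
  cases σ <;> simp [Side.fastClosed]

theorem mem_fastDom {T : ℝ} {σ : Side} {z : Pt} : z ∈ fastDom T σ ↔
    z.1 ∈ baseDom T ∧ z.2.1 ∈ σ.slowClosed ∧ z.2.2.1 ∈ σ.fastClosed := by
  simp [fastDom, mem_prod]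

theorem mem_baseDom {T : ℝ} {p : Base} : p ∈ baseDom T ↔ p.1 ∈ Icc 0 T := by
  simp [baseDom, mem_prod]

theorem convex_fastDom (T : ℝ) (σ : Side) : Convex ℝ (fastDom T σ) := by
  refine ((convex_Icc _ _).prod (convex_univ.prod convex_univ)).prod
    (Convex.prod ?_ (Convex.prod ?_ convex_univ))
  · cases σ <;> exact convex_Icc _ _
  · cases σ
    · exact convex_Ici _
    · exact convex_Iic _

/-- The interior points of the variables `y₃` and `Y₃`. -/
def fastInt (T : ℝ) (σ : Side) : Set Pt :=
  baseDom T ×ˢ (σ.slowOpen ×ˢ (σ.fastOpen ×ˢ univ))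

theorem fastInt_subset (T : ℝ) (σ : Side) : fastInt T σ ⊆ fastDom T σ := by
  refine prod_mono le_rfl (prod_mono ?_ (prod_mono ?_ le_rfl))
  · cases σ <;> exact Ioo_subset_Icc_self
  · cases σ
    · exact Ioi_subset_Ici_self
    · exact Iio_subset_Iic_self

theorem fastDom_subset_closure (T : ℝ) (σ : Side) : fastDom T σ ⊆ closure (fastInt T σ) := by
  rw [fastInt, closure_prod_eq, closure_prod_eq, closure_prod_eq, closure_univ]
  refine prod_mono subset_closure (prod_mono ?_ (prod_mono ?_ le_rfl))
  · cases σ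
    · exact (closure_Ioo (by norm_num)).ge
    · exact (closure_Ioo (by norm_num)).ge
  · cases σ
    · exact (closure_Ioi _).ge
    · exact (closure_Iio _).ge

theorem interior_fastDom_nonempty {T : ℝ} (hT : 0 < T) (σ : Side) :
    (interior (fastDom T σ)).Nonempty := by
  simp only [fastDom, baseDom, interior_prod_eq, interior_univ]
  refine Set.Nonempty.prod (Set.Nonempty.prod (by simpa using hT) (by simp))
    (Set.Nonempty.prod ?_ (Set.Nonempty.prod ?_ univ_nonempty))
  · cases σ <;> simp [Side.slowClosed]
  · cases σ <;> simp [Side.fastClosed]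

/-- This is where T > 0 enters: it gives the domain interior points, so that derivatives within the
closed domain are determined at its boundary. -/
theorem uniqueDiffOn_fastDom {T : ℝ} (hT : 0 < T) (σ : Side) : UniqueDiffOn ℝ (fastDom T σ) :=
  uniqueDiffOn_convex (convex_fastDom T σ) (interior_fastDom_nonempty hT σ)

/-- The periods of the functions under consideration. -/
def periods : Set Pt := {(2 * Real.pi) • bas 1, (2 * Real.pi) • bas 2, (2 * Real.pi) • bas 5}

theorem add_smul_bas_one (z : Pt) (a : ℝ) :
    z + a • bas 1 = ((z.1.1, z.1.2.1 + a, z.1.2.2), z.2) := by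
  simp [bas, Prod.ext_iff]

theorem add_smul_bas_two (z : Pt) (a : ℝ) :
    z + a • bas 2 = ((z.1.1, z.1.2.1, z.1.2.2 + a), z.2) := by
  simp [bas, Prod.ext_iff]

theorem add_smul_bas_four (z : Pt) (a : ℝ) :
    z + a • bas 4 = (z.1, z.2.1, z.2.2.1 + a, z.2.2.2) := by
  simp [bas, Prod.ext_iff]

theorem add_smul_bas_five (z : Pt) (a : ℝ) :
    z + a • bas 5 = (z.1, z.2.1, z.2.2.1, z.2.2.2 + a) := by
  simp [bas, Prod.ext_iff]

theorem add_period_mem {T : ℝ} {σ : Side} {v : Pt} (hv : v ∈ periods) {z : Pt}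
    (hz : z ∈ fastDom T σ) : z + v ∈ fastDom T σ := by
  rcases hv with rfl | rfl | rfl
  · rw [add_smul_bas_one]; rw [mem_fastDom, mem_baseDom] at *; exact hz
  · rw [add_smul_bas_two]; rw [mem_fastDom, mem_baseDom] at *; exact hz
  · rw [add_smul_bas_five]; rw [mem_fastDom, mem_baseDom] at *; exact hz

theorem add_theta_mem {T : ℝ} {σ : Side} (a : ℝ) {z : Pt} (hz : z ∈ fastDom T σ) :
    z + a • bas 5 ∈ fastDom T σ := by
  rw [add_smul_bas_five]; rw [mem_fastDom] at *; exact hz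

theorem add_normal_mem {T : ℝ} {σ : Side} {a : ℝ} (ha : 0 ≤ a) {z : Pt} (hz : z ∈ fastDom T σ) :
    z + a • (σ.sg • bas 4) ∈ fastDom T σ := by
  rw [smul_smul, add_smul_bas_four]
  rw [mem_fastDom, Side.mem_fastClosed] at *
  refine ⟨hz.1, hz.2.1, ?_⟩
  have := σ.sg_mul_sg
  show 0 ≤ σ.sg * (z.2.2.1 + a * σ.sg)
  nlinarith [hz.2.2]

/-! ### Tame functions and their partial derivatives -/

/-- Smooth functions on the closed domain, `2π`-periodic in `y₁`, `y₂`, `θ`, all of whose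
derivatives are `O(e^{-δ|Y₃|})`. -/
structure Tame (T : ℝ) (σ : Side) (δ : ℝ) (f : Pt → ℂ) : Prop where
  smooth : ContDiffOn ℝ ∞ f (fastDom T σ)
  bound : ∀ n : ℕ, ∃ C : ℝ, ∀ z ∈ fastDom T σ,
    ‖iteratedFDerivWithin ℝ n f (fastDom T σ) z‖ ≤ C * Real.exp (-δ * |z.2.2.1|)
  per : ∀ v ∈ periods, ∀ z ∈ fastDom T σ, f (z + v) = f z

/-- Partial derivatives on the closed domain. -/
noncomputable def pd (T : ℝ) (σ : Side) (i : Fin 6) (f : Pt → ℂ) : Pt → ℂ :=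
  fun z => fderivWithin ℝ f (fastDom T σ) z (bas i)

theorem hasGrad_pd (hf : ContDiffOn ℝ ∞ f (fastDom T σ)) :
    HasGrad (fastDom T σ) f (fun i => pd T σ i f) := by
  intro z hz
  have h := (hf.differentiableOn (by simp) z hz).hasFDerivWithinAt
  rw [eq_lin (fderivWithin ℝ f (fastDom T σ) z)] at h
  exact h

theorem Tame.hasGrad (hf : Tame T σ δ f) : HasGrad (fastDom T σ) f (fun i => pd T σ i f) :=
  hasGrad_pd hf.smooth

theorem HasGrad.pd_eq (hT : 0 < T) {g : Fin 6 → Pt → ℂ} (h : HasGrad (fastDom T σ) f g)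
    (i : Fin 6) : EqOn (pd T σ i f) (g i) (fastDom T σ) := by
  intro z hz
  rw [pd, (h z hz).fderivWithin (uniqueDiffOn_fastDom hT σ z hz), lin_bas]

theorem pd_congr (i : Fin 6) (h : EqOn f g (fastDom T σ)) :
    EqOn (pd T σ i f) (pd T σ i g) (fastDom T σ) := by
  intro z hz
  rw [pd, pd, fderivWithin_congr h (h hz)]

/-- Partial derivatives inherit invariance under translations. -/
theorem pd_translate (hT : 0 < T) (hf : ContDiffOn ℝ ∞ f (fastDom T σ)) {v : Pt}
    (hv : ∀ z ∈ fastDom T σ, z + v ∈ fastDom T σ) (h : ∀ z ∈ fastDom T σ, f (z + v) = f z)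
    (i : Fin 6) : ∀ z ∈ fastDom T σ, pd T σ i f (z + v) = pd T σ i f z := by
  intro z hz
  exact ((((hasGrad_pd hf).comp_add v hv).congr fun z hz => (h z hz).symm).pd_eq hT i hz).symm

theorem contDiffOn_pd (hT : 0 < T) (hf : ContDiffOn ℝ ∞ f (fastDom T σ)) (i : Fin 6) :
    ContDiffOn ℝ ∞ (pd T σ i f) (fastDom T σ) := by
  have := (contDiffOn_infty_iff_fderivWithin (uniqueDiffOn_fastDom hT σ)).1 hf
  exact this.2.clm_apply contDiffOn_const

theorem Tame.pd (hT : 0 < T) (hf : Tame T σ δ f) (i : Fin 6) : Tame T σ δ (pd T σ i f) := by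
  have hD := uniqueDiffOn_fastDom hT σ
  refine ⟨contDiffOn_pd hT hf.smooth i, fun n => ?_, fun v hv =>
    pd_translate hT hf.smooth (fun z hz => add_period_mem hv hz) (hf.per v hv) i⟩
  obtain ⟨C, hC⟩ := hf.bound (n + 1)
  refine ⟨‖ContinuousLinearMap.apply ℝ ℂ (bas i)‖ * C, fun z hz => ?_⟩
  have h := ((contDiffOn_infty_iff_fderivWithin hD).1 hf.smooth).2
  refine (ContinuousLinearMap.norm_iteratedFDerivWithin_comp_left
    (ContinuousLinearMap.apply ℝ ℂ (bas i)) (h z hz) hD hz (by exact_mod_cast le_top)).trans ?_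
  rw [norm_iteratedFDerivWithin_fderivWithin hD hz, mul_assoc]
  exact mul_le_mul_of_nonneg_left (hC z hz) (norm_nonneg _)

theorem Tame.bound_zero (hf : Tame T σ δ f) :
    ∃ C : ℝ, 0 ≤ C ∧ ∀ z ∈ fastDom T σ, ‖f z‖ ≤ C * Real.exp (-δ * |z.2.2.1|) := by
  obtain ⟨C, hC⟩ := hf.bound 0
  refine ⟨|C|, abs_nonneg _, fun z hz => ?_⟩
  have := hC z hz
  rw [norm_iteratedFDerivWithin_zero] at this
  exact this.trans (mul_le_mul_of_nonneg_right (le_abs_self C) (Real.exp_pos _).le)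

theorem Tame.continuousOn (hf : Tame T σ δ f) : ContinuousOn f (fastDom T σ) :=
  hf.smooth.continuousOn

/-- A family of bounded periodic functions that is closed under differentiation is tame. -/
theorem Tame.of_family (hT : 0 < T) {𝒜 : Set (Pt → ℂ)}
    (hb : ∀ f ∈ 𝒜, ∃ C, ∀ z ∈ fastDom T σ, ‖f z‖ ≤ C * Real.exp (-δ * |z.2.2.1|))
    (hp : ∀ f ∈ 𝒜, ∀ v ∈ periods, ∀ z ∈ fastDom T σ, f (z + v) = f z)
    (hd : ∀ f ∈ 𝒜, ∃ g : Fin 6 → Pt → ℂ, (∀ i, g i ∈ 𝒜) ∧ HasGrad (fastDom T σ) f g)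
    (hf : f ∈ 𝒜) : Tame T σ δ f := by
  obtain ⟨h1, h2⟩ := contDiffOn_and_bound_of_family (uniqueDiffOn_fastDom hT σ)
    (wt := fun z => Real.exp (-δ * |z.2.2.1|)) hb hd hf
  exact ⟨h1, h2, hp f hf⟩

/-- An operator that commutes with differentiation, preserves periodicity and maps tame functions
to bounded functions preserves tame functions. -/
theorem Tame.of_op (hT : 0 < T) {δ' : ℝ} (Op : (Pt → ℂ) → Pt → ℂ)
    (hb : ∀ f, Tame T σ δ' f →
      ∃ C, ∀ z ∈ fastDom T σ, ‖Op f z‖ ≤ C * Real.exp (-δ * |z.2.2.1|))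
    (hp : ∀ f, Tame T σ δ' f → ∀ v ∈ periods, ∀ z ∈ fastDom T σ, Op f (z + v) = Op f z)
    (hd : ∀ f, Tame T σ δ' f → ∃ g : Fin 6 → Pt → ℂ, (∀ i, Tame T σ δ' (g i)) ∧
      HasGrad (fastDom T σ) (Op f) (fun i => Op (g i)))
    (hf : Tame T σ δ' f) : Tame T σ δ (Op f) := by
  refine Tame.of_family hT (𝒜 := {a | ∃ f, Tame T σ δ' f ∧ a = Op f}) ?_ ?_ ?_ ⟨f, hf, rfl⟩
  · rintro _ ⟨f, hf, rfl⟩; exact hb f hf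
  · rintro _ ⟨f, hf, rfl⟩; exact hp f hf
  · rintro _ ⟨f, hf, rfl⟩
    obtain ⟨g, hg, h⟩ := hd f hf
    exact ⟨_, fun i => ⟨g i, hg i, rfl⟩, h⟩

theorem Tame.congr (hf : Tame T σ δ f) (h : EqOn g f (fastDom T σ)) : Tame T σ δ g := by
  refine ⟨hf.smooth.congr h, fun n => ?_, fun v hv z hz => ?_⟩
  · obtain ⟨C, hC⟩ := hf.bound n
    refine ⟨C, fun z hz => ?_⟩
    rw [iteratedFDerivWithin_congr h hz]
    exact hC z hz
  · rw [h hz, h (add_period_mem hv hz), hf.per v hv z hz]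

theorem Tame.mono (hf : Tame T σ δ f) {δ' : ℝ} (h : δ' ≤ δ) : Tame T σ δ' f := by
  refine ⟨hf.smooth, fun n => ?_, hf.per⟩
  obtain ⟨C, hC⟩ := hf.bound n
  refine ⟨|C|, fun z hz => (hC z hz).trans ?_⟩
  refine mul_le_mul (le_abs_self C) (Real.exp_le_exp.2 ?_) (Real.exp_pos _).le (abs_nonneg _)
  nlinarith [abs_nonneg z.2.2.1]

theorem Tame.add (hT : 0 < T) (hf : Tame T σ δ f) (hg : Tame T σ δ g) :
    Tame T σ δ (fun z => f z + g z) := by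
  refine ⟨hf.smooth.add hg.smooth, fun n => ?_, fun v hv z hz => ?_⟩
  · obtain ⟨C, hC⟩ := hf.bound n
    obtain ⟨C', hC'⟩ := hg.bound n
    refine ⟨C + C', fun z hz => ?_⟩
    rw [fun_iteratedFDerivWithin_add_apply ((hf.smooth z hz).of_le (by exact_mod_cast le_top))
      ((hg.smooth z hz).of_le (by exact_mod_cast le_top)) (uniqueDiffOn_fastDom hT σ) hz, add_mul]
    exact (norm_add_le _ _).trans (add_le_add (hC z hz) (hC' z hz))
  · rw [hf.per v hv z hz, hg.per v hv z hz]

theorem Tame.clm (hT : 0 < T) (hf : Tame T σ δ f) (L : ℂ →L[ℝ] ℂ) :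
    Tame T σ δ (fun z => L (f z)) := by
  refine ⟨L.contDiff.comp_contDiffOn hf.smooth, fun n => ?_, fun v hv z hz => ?_⟩
  · obtain ⟨C, hC⟩ := hf.bound n
    refine ⟨‖L‖ * C, fun z hz => ?_⟩
    refine (L.norm_iteratedFDerivWithin_comp_left (hf.smooth z hz)
      (uniqueDiffOn_fastDom hT σ) hz (by exact_mod_cast le_top)).trans ?_
    rw [mul_assoc]
    exact mul_le_mul_of_nonneg_left (hC z hz) (norm_nonneg _)
  · rw [hf.per v hv z hz]

theorem Tame.const_mul (hT : 0 < T) (hf : Tame T σ δ f) (c : ℂ) :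
    Tame T σ δ (fun z => c * f z) :=
  hf.clm hT (ContinuousLinearMap.mul ℝ ℂ c)

theorem Tame.sub (hT : 0 < T) (hf : Tame T σ δ f) (hg : Tame T σ δ g) :
    Tame T σ δ (fun z => f z - g z) := by
  simpa [sub_eq_add_neg] using hf.add hT (hg.const_mul hT (-1))

theorem Tame.re (hT : 0 < T) (hf : Tame T σ δ f) : Tame T σ δ (fun z => ((f z).re : ℂ)) :=
  hf.clm hT (Complex.ofRealCLM.comp Complex.reCLM)

theorem Tame.zero : Tame T σ δ (fun _ => 0) := by
  refine ⟨contDiffOn_const, fun n => ⟨0, fun z hz => ?_⟩, fun _ _ _ _ => rfl⟩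
  rw [show (fun _ : Pt => (0 : ℂ)) = 0 from rfl, iteratedFDerivWithin_zero]
  simp

/-- Decay rates add under multiplication. In particular a bounded function (rate 0) times e^{-|Y₃|}
decays. -/
theorem Tame.mul (hT : 0 < T) {δ' : ℝ} (hf : Tame T σ δ f) (hg : Tame T σ δ' g) :
    Tame T σ (δ + δ') (fun z => f z * g z) := by
  refine ⟨hf.smooth.mul hg.smooth, fun n => ?_, fun v hv z hz => ?_⟩
  · choose C hC using hf.bound
    choose C' hC' using hg.bound
    refine ⟨∑ i ∈ Finset.range (n + 1), (n.choose i : ℝ) * |C i| * |C' (n - i)|, fun z hz => ?_⟩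
    refine (norm_iteratedFDerivWithin_mul_le hf.smooth hg.smooth (uniqueDiffOn_fastDom hT σ) hz
      (by exact_mod_cast le_top)).trans ?_
    rw [Finset.sum_mul]
    refine Finset.sum_le_sum fun i _ => ?_
    have e : Real.exp (-(δ + δ') * |z.2.2.1|)
        = Real.exp (-δ * |z.2.2.1|) * Real.exp (-δ' * |z.2.2.1|) := by
      rw [← Real.exp_add]; ring_nf
    have h1 : ‖iteratedFDerivWithin ℝ i f (fastDom T σ) z‖ ≤ |C i| * Real.exp (-δ * |z.2.2.1|) :=
      (hC i z hz).trans (mul_le_mul_of_nonneg_right (le_abs_self _) (Real.exp_pos _).le)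
    have h2 : ‖iteratedFDerivWithin ℝ (n - i) g (fastDom T σ) z‖
        ≤ |C' (n - i)| * Real.exp (-δ' * |z.2.2.1|) :=
      (hC' _ z hz).trans (mul_le_mul_of_nonneg_right (le_abs_self _) (Real.exp_pos _).le)
    calc _ ≤ (n.choose i : ℝ) * (|C i| * Real.exp (-δ * |z.2.2.1|)) *
          (|C' (n - i)| * Real.exp (-δ' * |z.2.2.1|)) := by gcongr
      _ = _ := by rw [e]; ring
  · rw [hf.per v hv z hz, hg.per v hv z hz]

/-! ### Derivatives of sums and multiples -/

theorem pd_add (hT : 0 < T) (hf : ContDiffOn ℝ ∞ f (fastDom T σ))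
    (hg : ContDiffOn ℝ ∞ g (fastDom T σ)) (i : Fin 6) :
    EqOn (pd T σ i fun z => f z + g z) (fun z => pd T σ i f z + pd T σ i g z) (fastDom T σ) :=
  ((hasGrad_pd hf).add (hasGrad_pd hg)).pd_eq hT i

theorem pd_const_mul (hT : 0 < T) (hf : ContDiffOn ℝ ∞ f (fastDom T σ)) (c : ℂ) (i : Fin 6) :
    EqOn (pd T σ i fun z => c * f z) (fun z => c * pd T σ i f z) (fastDom T σ) :=
  ((hasGrad_pd hf).const_mul c).pd_eq hT i

theorem HasGrad.clm {D : Set Pt} {g : Fin 6 → Pt → ℂ} (h : HasGrad D f g) (L : ℂ →L[ℝ] ℂ) :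
    HasGrad D (fun z => L (f z)) (fun i z => L (g i z)) := by
  intro z hz
  have h1 := L.hasFDerivAt.comp_hasFDerivWithinAt z (h z hz)
  have e : L.comp (lin fun i => g i z) = lin (fun i => L (g i z)) := by
    rw [eq_lin (L.comp _)]; congr 1; ext i; simp
  rw [e] at h1
  exact h1

/-- Second derivatives are symmetric up to the boundary because a convex set with interior points
lies in the closure of its interior. -/
theorem pd_comm (hT : 0 < T) (hf : ContDiffOn ℝ ∞ f (fastDom T σ)) (i j : Fin 6) :
    EqOn (pd T σ i (pd T σ j f)) (pd T σ j (pd T σ i f)) (fastDom T σ) := by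
  intro z hz
  have hD := uniqueDiffOn_fastDom hT σ
  have hsym : IsSymmSndFDerivWithinAt ℝ f (fastDom T σ) z := by
    refine (hf z hz).isSymmSndFDerivWithinAt ?_ hD ?_ hz
    · rw [minSmoothness_of_isRCLikeNormedField]
      exact WithTop.coe_le_coe.2 (le_top : (2 : ℕ∞) ≤ ⊤)
    · rw [(convex_fastDom T σ).closure_interior_eq_closure_of_nonempty_interior
        (interior_fastDom_nonempty hT σ)]
      exact subset_closure hz
  have hd : DifferentiableWithinAt ℝ (fderivWithin ℝ f (fastDom T σ)) (fastDom T σ) z :=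
    ((contDiffOn_infty_iff_fderivWithin hD).1 hf).2.differentiableOn (by simp) z hz
  have key : ∀ a b : Pt, fderivWithin ℝ (fun w => fderivWithin ℝ f (fastDom T σ) w b)
      (fastDom T σ) z a = fderivWithin ℝ (fderivWithin ℝ f (fastDom T σ)) (fastDom T σ) z a b := by
    intro a b
    rw [fderivWithin_clm_apply (hD z hz) hd (differentiableWithinAt_const b)]
    simp
  show fderivWithin ℝ (fun w => fderivWithin ℝ f (fastDom T σ) w (bas j)) (fastDom T σ) z (bas i)
    = fderivWithin ℝ (fun w => fderivWithin ℝ f (fastDom T σ) w (bas i)) (fastDom T σ) z (bas j)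
  rw [key, key]
  exact hsym _ _

/-! ### Derivatives along lines -/

theorem HasGrad.hasDerivWithinAt_line {D : Set Pt} {g : Fin 6 → Pt → ℂ} (h : HasGrad D f g)
    {z v : Pt} {s : Set ℝ} (hs : ∀ b ∈ s, z + b • v ∈ D) {b : ℝ} (hb : b ∈ s) :
    HasDerivWithinAt (fun b => f (z + b • v)) (lin (fun i => g i (z + b • v)) v) s b := by
  have h1 : HasDerivWithinAt (fun b : ℝ => z + b • v) v s b := by
    simpa using ((hasDerivAt_id b).smul_const v).const_add z |>.hasDerivWithinAt
  exact (h _ (hs b hb)).comp_hasDerivWithinAt b h1 hs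

theorem HasGrad.hasDerivAt_theta {g : Fin 6 → Pt → ℂ} (h : HasGrad (fastDom T σ) f g)
    {z : Pt} (hz : z ∈ fastDom T σ) (b : ℝ) :
    HasDerivAt (fun b : ℝ => f (z + b • bas 5)) (g 5 (z + b • bas 5)) b := by
  have := h.hasDerivWithinAt_line (z := z) (v := bas 5) (s := univ)
    (fun b _ => add_theta_mem b hz) (mem_univ b)
  rwa [lin_bas, hasDerivWithinAt_univ] at this

theorem HasGrad.hasDerivWithinAt_normal {g : Fin 6 → Pt → ℂ} (h : HasGrad (fastDom T σ) f g)
    {z : Pt} (hz : z ∈ fastDom T σ) {b : ℝ} (hb : 0 ≤ b) :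
    HasDerivWithinAt (fun b : ℝ => f (z + b • (σ.sg • bas 4)))
      (σ.sg * g 4 (z + b • (σ.sg • bas 4))) (Ici 0) b := by
  have := h.hasDerivWithinAt_line (z := z) (v := σ.sg • bas 4) (s := Ici 0)
    (fun b hb => add_normal_mem hb hz) hb
  rwa [map_smul, lin_bas, Complex.real_smul] at this

theorem continuousOn_normal (hf : ContinuousOn f (fastDom T σ)) {z : Pt}
    (hz : z ∈ fastDom T σ) : ContinuousOn (fun b : ℝ => f (z + b • (σ.sg • bas 4))) (Ici 0) :=
  hf.comp (by fun_prop) fun _ hb => add_normal_mem hb hz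

theorem continuous_theta (hf : ContinuousOn f (fastDom T σ)) {z : Pt}
    (hz : z ∈ fastDom T σ) : Continuous (fun b : ℝ => f (z + b • bas 5)) := by
  rw [← continuousOn_univ]
  exact hf.comp (by fun_prop) fun b _ => add_theta_mem b hz

/-! ### Averages of translates -/

/-- The average of the translates of `f` along `v` with the weight `κ`. -/
noncomputable def trOp (S : Set ℝ) (κ : ℝ → ℂ) (v : Pt) (f : Pt → ℂ) : Pt → ℂ :=
  fun z => ∫ a in S, κ a * f (z + a • v)

/-- Weights for which averages of translates preserve tame functions. -/
structure IsKernel (T : ℝ) (σ : Side) (δ : ℝ) (S : Set ℝ) (κ : ℝ → ℂ) (v : Pt) (ρ : ℝ → ℝ) :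
    Prop where
  meas : MeasurableSet S
  cont : Continuous κ
  mem : ∀ a ∈ S, ∀ z ∈ fastDom T σ, z + a • v ∈ fastDom T σ
  weight : ∀ a ∈ S, ∀ z ∈ fastDom T σ,
    Real.exp (-δ * |(z + a • v).2.2.1|) ≤ ρ a * Real.exp (-δ * |z.2.2.1|)
  integrable : IntegrableOn (fun a => ‖κ a‖ * ρ a) S

section trOp

variable {S : Set ℝ} {κ : ℝ → ℂ} {v : Pt} {ρ : ℝ → ℝ}

theorem IsKernel.norm_le (hK : IsKernel T σ δ S κ v ρ) {C : ℝ} (hC0 : 0 ≤ C)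
    (hC : ∀ z ∈ fastDom T σ, ‖f z‖ ≤ C * Real.exp (-δ * |z.2.2.1|)) {a : ℝ} (ha : a ∈ S)
    {z : Pt} (hz : z ∈ fastDom T σ) :
    ‖κ a * f (z + a • v)‖ ≤ ‖κ a‖ * ρ a * (C * Real.exp (-δ * |z.2.2.1|)) := by
  rw [norm_mul, mul_assoc]
  refine mul_le_mul_of_nonneg_left ?_ (norm_nonneg _)
  refine (hC _ (hK.mem a ha z hz)).trans ?_
  have := mul_le_mul_of_nonneg_left (hK.weight a ha z hz) hC0
  linarith

theorem IsKernel.aestronglyMeasurable (hK : IsKernel T σ δ S κ v ρ)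
    (hf : ContinuousOn f (fastDom T σ)) {z : Pt} (hz : z ∈ fastDom T σ) :
    AEStronglyMeasurable (fun a => κ a * f (z + a • v)) (volume.restrict S) := by
  refine ContinuousOn.aestronglyMeasurable (hK.cont.continuousOn.mul ?_) hK.meas
  exact hf.comp (by fun_prop) fun a ha => hK.mem a ha z hz

theorem IsKernel.integrableOn (hK : IsKernel T σ δ S κ v ρ) (hf : Tame T σ δ f) {z : Pt}
    (hz : z ∈ fastDom T σ) : IntegrableOn (fun a => κ a * f (z + a • v)) S := by
  obtain ⟨C, hC0, hC⟩ := hf.bound_zero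
  refine (hK.integrable.mul_const (C * Real.exp (-δ * |z.2.2.1|))).mono'
    (hK.aestronglyMeasurable hf.continuousOn hz) ?_
  filter_upwards [ae_restrict_mem hK.meas] with a ha
  exact hK.norm_le hC0 hC ha hz

theorem IsKernel.bound (hK : IsKernel T σ δ S κ v ρ) {C : ℝ} (hC0 : 0 ≤ C)
    (hC : ∀ z ∈ fastDom T σ, ‖f z‖ ≤ C * Real.exp (-δ * |z.2.2.1|)) {z : Pt}
    (hz : z ∈ fastDom T σ) : ‖trOp S κ v f z‖
      ≤ (∫ a in S, ‖κ a‖ * ρ a) * C * Real.exp (-δ * |z.2.2.1|) := by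
  rw [mul_assoc, ← integral_mul_const]
  refine norm_integral_le_of_norm_le (hK.integrable.mul_const _) ?_
  filter_upwards [ae_restrict_mem hK.meas] with a ha
  exact hK.norm_le hC0 hC ha hz

/-- Derivatives commute with translations, hence with averages of translates. One constant `M`
bounds the function and all its first derivatives, so the integrable weight ‖κ‖ ρ M dominates
everything. -/
theorem IsKernel.hasGrad (hδ : 0 ≤ δ) (hT : 0 < T) (hK : IsKernel T σ δ S κ v ρ)
    (hf : Tame T σ δ f) :
    HasGrad (fastDom T σ) (trOp S κ v f) (fun i => trOp S κ v (pd T σ i f)) := by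
  obtain ⟨C, hC0, hC⟩ := hf.bound_zero
  choose C' hC'0 hC' using fun i => (hf.pd hT i).bound_zero
  set M := C + ∑ i, C' i with hM
  have hsum : 0 ≤ ∑ i, C' i := Finset.sum_nonneg fun i _ => hC'0 i
  have hM0 : 0 ≤ M := by linarith
  have hle : ∀ z : Pt, Real.exp (-δ * |z.2.2.1|) ≤ 1 := fun z =>
    Real.exp_le_one_iff.2 (by nlinarith [abs_nonneg z.2.2.1])
  have hbd : ∀ f' : Pt → ℂ, ∀ C'', 0 ≤ C'' → C'' ≤ M →
      (∀ z ∈ fastDom T σ, ‖f' z‖ ≤ C'' * Real.exp (-δ * |z.2.2.1|)) →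
      ∀ a ∈ S, ∀ z ∈ fastDom T σ, ‖κ a * f' (z + a • v)‖ ≤ ‖κ a‖ * ρ a * M := by
    intro f' C'' h0 h1 h2 a ha z hz
    refine (hK.norm_le h0 h2 ha hz).trans ?_
    have hρ : 0 ≤ ρ a := by
      have h4 := (Real.exp_pos _).trans_le (hK.weight a ha z hz)
      nlinarith [Real.exp_pos (-δ * |z.2.2.1|)]
    refine mul_le_mul_of_nonneg_left ?_ (mul_nonneg (norm_nonneg _) hρ)
    nlinarith [hle z]
  refine HasGrad.integral (convex_fastDom T σ) (b := fun a => ‖κ a‖ * ρ a * M)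
    (g := fun a i z => κ a * pd T σ i f (z + a • v)) ?_
    (hK.integrable.mul_const M) (fun z hz => hK.aestronglyMeasurable hf.continuousOn hz)
    (fun z hz i => hK.aestronglyMeasurable (hf.pd hT i).continuousOn hz) ?_ ?_
  · filter_upwards [ae_restrict_mem hK.meas] with a ha
    exact (hf.hasGrad.comp_add (a • v) (hK.mem a ha)).const_mul _
  · filter_upwards [ae_restrict_mem hK.meas] with a ha
    exact hbd f C hC0 (by linarith) hC a ha
  · filter_upwards [ae_restrict_mem hK.meas] with a ha i
    refine hbd _ (C' i) (hC'0 i) ?_ (hC' i) a ha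
    have := Finset.single_le_sum (fun j _ => hC'0 j) (Finset.mem_univ i)
    linarith

theorem trOp_translate (hK : IsKernel T σ δ S κ v ρ) {w : Pt}
    (h : ∀ z ∈ fastDom T σ, f (z + w) = f z) {z : Pt} (hz : z ∈ fastDom T σ) :
    trOp S κ v f (z + w) = trOp S κ v f z := by
  refine setIntegral_congr_fun hK.meas fun a ha => ?_
  show κ a * f (z + w + a • v) = κ a * f (z + a • v)
  rw [show z + w + a • v = z + a • v + w by abel, h _ (hK.mem a ha z hz)]

theorem Tame.trOp (hδ : 0 ≤ δ) (hT : 0 < T) (hK : IsKernel T σ δ S κ v ρ) (hf : Tame T σ δ f) :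
    Tame T σ δ (trOp S κ v f) := by
  refine Tame.of_op hT (FastProblem.trOp S κ v) ?_ ?_ ?_ hf
  · intro f hf
    obtain ⟨C, hC0, hC⟩ := hf.bound_zero
    exact ⟨_, fun z hz => hK.bound hC0 hC hz⟩
  · exact fun f hf w hw z hz => trOp_translate hK (hf.per w hw) hz
  · exact fun f hf => ⟨_, fun i => hf.pd hT i, hK.hasGrad hδ hT hf⟩

theorem pd_trOp (hδ : 0 ≤ δ) (hT : 0 < T) (hK : IsKernel T σ δ S κ v ρ) (hf : Tame T σ δ f)
    (i : Fin 6) : EqOn (pd T σ i (FastProblem.trOp S κ v f))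
      (FastProblem.trOp S κ v (pd T σ i f)) (fastDom T σ) :=
  (hK.hasGrad hδ hT hf).pd_eq hT i

theorem trOp_congr (hK : IsKernel T σ δ S κ v ρ) (h : EqOn f g (fastDom T σ)) :
    EqOn (FastProblem.trOp S κ v f) (FastProblem.trOp S κ v g) (fastDom T σ) := by
  intro z hz
  refine setIntegral_congr_fun hK.meas fun a ha => ?_
  show κ a * f (z + a • v) = κ a * g (z + a • v)
  rw [h (hK.mem a ha z hz)]

theorem trOp_const_mul (S : Set ℝ) (κ : ℝ → ℂ) (v : Pt) (f : Pt → ℂ) (c : ℂ) (z : Pt) :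
    FastProblem.trOp S κ v (fun z => c * f z) z = c * FastProblem.trOp S κ v f z := by
  unfold FastProblem.trOp
  rw [← integral_const_mul]
  congr 1; ext a; ring

theorem trOp_add (hK : IsKernel T σ δ S κ v ρ) (hf : Tame T σ δ f) (hg : Tame T σ δ g) :
    EqOn (FastProblem.trOp S κ v fun z => f z + g z)
      (fun z => FastProblem.trOp S κ v f z + FastProblem.trOp S κ v g z) (fastDom T σ) := by
  intro z hz
  simp only [FastProblem.trOp, mul_add]
  exact integral_add (hK.integrableOn hf hz) (hK.integrableOn hg hz)

end trOp

/-! ### Fourier modes -/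

theorem isKernel_theta (T : ℝ) (σ : Side) (δ : ℝ) {κ : ℝ → ℂ} (hκ : Continuous κ) :
    IsKernel T σ δ (Ioc 0 (2 * Real.pi)) κ (bas 5) (fun _ => 1) := by
  refine ⟨measurableSet_Ioc, hκ, fun a _ z hz => add_theta_mem a hz, fun a _ z _ => ?_, ?_⟩
  · rw [add_smul_bas_five, one_mul]
  · simp only [mul_one]
    exact (hκ.norm.integrableOn_Icc).mono_set Ioc_subset_Icc_self

/-- The weight whose averages are the Fourier modes. -/
noncomputable def modeKer (k : ℤ) (a : ℝ) : ℂ :=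
  (2 * Real.pi : ℂ)⁻¹ * Complex.exp (-(Complex.I * k * a))

theorem continuous_modeKer (k : ℤ) : Continuous (modeKer k) := by
  unfold modeKer; fun_prop

/-- The `k`-th Fourier mode `f̂(k) e^{ikθ}` of `f`. -/
noncomputable def mode (k : ℤ) (f : Pt → ℂ) : Pt → ℂ :=
  trOp (Ioc 0 (2 * Real.pi)) (modeKer k) (bas 5) f

theorem isKernel_mode (T : ℝ) (σ : Side) (δ : ℝ) (k : ℤ) :
    IsKernel T σ δ (Ioc 0 (2 * Real.pi)) (modeKer k) (bas 5) (fun _ => 1) :=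
  isKernel_theta T σ δ (continuous_modeKer k)

theorem Tame.mode (hδ : 0 ≤ δ) (hT : 0 < T) (hf : Tame T σ δ f) (k : ℤ) :
    Tame T σ δ (mode k f) := hf.trOp hδ hT (isKernel_mode T σ δ k)

theorem pd_mode (hδ : 0 ≤ δ) (hT : 0 < T) (hf : Tame T σ δ f) (k : ℤ) (i : Fin 6) :
    EqOn (pd T σ i (FastProblem.mode k f)) (FastProblem.mode k (pd T σ i f)) (fastDom T σ) :=
  pd_trOp hδ hT (isKernel_mode T σ δ k) hf i

theorem mode_congr (k : ℤ) (h : EqOn f g (fastDom T σ)) :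
    EqOn (FastProblem.mode k f) (FastProblem.mode k g) (fastDom T σ) :=
  trOp_congr (isKernel_mode T σ 0 k) h

theorem mode_const_mul (k : ℤ) (f : Pt → ℂ) (c : ℂ) (z : Pt) :
    FastProblem.mode k (fun z => c * f z) z = c * FastProblem.mode k f z :=
  trOp_const_mul _ _ _ f c z

theorem mode_add (k : ℤ) (hf : Tame T σ δ f) (hg : Tame T σ δ g) :
    EqOn (FastProblem.mode k fun z => f z + g z)
      (fun z => FastProblem.mode k f z + FastProblem.mode k g z) (fastDom T σ) :=
  trOp_add (isKernel_mode T σ δ k) hf hg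

theorem norm_modeKer (k : ℤ) (a : ℝ) : ‖modeKer k a‖ = (2 * Real.pi)⁻¹ := by
  rw [modeKer, norm_mul, show -(Complex.I * k * a) = ((-(k * a) : ℝ) : ℂ) * Complex.I by
    push_cast; ring, Complex.norm_exp_ofReal_mul_I, mul_one, norm_inv]
  congr 1
  rw [norm_mul, Complex.norm_ofNat, Complex.norm_real, Real.norm_of_nonneg Real.pi_pos.le]

theorem norm_mode_le {C : ℝ} (hC0 : 0 ≤ C)
    (hC : ∀ z ∈ fastDom T σ, ‖f z‖ ≤ C * Real.exp (-δ * |z.2.2.1|)) (k : ℤ) {z : Pt}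
    (hz : z ∈ fastDom T σ) : ‖FastProblem.mode k f z‖ ≤ C * Real.exp (-δ * |z.2.2.1|) := by
  refine ((isKernel_mode T σ δ k).bound hC0 hC hz).trans (le_of_eq ?_)
  simp only [norm_modeKer, mul_one]
  have := Real.pi_pos
  rw [setIntegral_const, measureReal_def, Real.volume_Ioc, sub_zero,
    ENNReal.toReal_ofReal (by positivity), smul_eq_mul]
  field_simp

theorem exp_two_pi_int (k : ℤ) : Complex.exp (-(Complex.I * k * (2 * Real.pi : ℝ))) = 1 := by
  rw [show -(Complex.I * k * ((2 * Real.pi : ℝ) : ℂ)) = ((-k : ℤ) : ℂ) * (2 * Real.pi * Complex.I) by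
    push_cast; ring]
  exact Complex.exp_int_mul_two_pi_mul_I _

theorem theta_periodic (hp : ∀ v ∈ periods, ∀ z ∈ fastDom T σ, f (z + v) = f z) {z : Pt}
    (hz : z ∈ fastDom T σ) :
    Function.Periodic (fun b : ℝ => f (z + b • bas 5)) (2 * Real.pi) := by
  intro b
  simp only
  rw [add_smul, ← add_assoc]
  exact hp _ (by simp [periods]) _ (add_theta_mem b hz)

/-- A shift of θ becomes a shift of the variable of integration. The integrand is 2π-periodic, so
the interval may be moved back. -/
theorem mode_add_theta (hp : ∀ v ∈ periods, ∀ z ∈ fastDom T σ, f (z + v) = f z) (k : ℤ) {z : Pt}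
    (hz : z ∈ fastDom T σ) (a : ℝ) : FastProblem.mode k f (z + a • bas 5)
      = Complex.exp (Complex.I * k * a) * FastProblem.mode k f z := by
  have hper : Function.Periodic (fun b : ℝ => modeKer k b * f (z + b • bas 5)) (2 * Real.pi) := by
    intro b
    have h1 := theta_periodic hp hz b
    simp only at h1 ⊢
    rw [h1, modeKer, modeKer, show -(Complex.I * k * ((b + 2 * Real.pi : ℝ) : ℂ))
      = -(Complex.I * k * b) + -(Complex.I * k * (2 * Real.pi : ℝ)) by push_cast; ring,
      Complex.exp_add, exp_two_pi_int, mul_one]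
  have h0 : (0 : ℝ) ≤ 2 * Real.pi := by positivity
  have e1 : FastProblem.mode k f (z + a • bas 5) = ∫ b in (0 : ℝ)..(2 * Real.pi),
      Complex.exp (Complex.I * k * a) *
        (fun b : ℝ => modeKer k b * f (z + b • bas 5)) (b + a) := by
    rw [intervalIntegral.integral_of_le h0]
    refine integral_congr_ae (Eventually.of_forall fun b => ?_)
    simp only [modeKer]
    rw [show z + a • bas 5 + b • bas 5 = z + (b + a) • bas 5 by rw [add_smul]; abel,
      show -(Complex.I * k * ((b + a : ℝ) : ℂ)) = -(Complex.I * k * b) + -(Complex.I * k * a) by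
        push_cast; ring, Complex.exp_add, Complex.exp_neg (Complex.I * k * a)]
    field_simp [Complex.exp_ne_zero]
  rw [e1, intervalIntegral.integral_const_mul, intervalIntegral.integral_comp_add_right
    (fun b : ℝ => modeKer k b * f (z + b • bas 5)), zero_add,
    add_comm (2 * Real.pi) a, hper.intervalIntegral_add_eq a 0, zero_add,
    intervalIntegral.integral_of_le h0]
  rfl

/-- The mode depends on θ through the factor e^{ikθ} only. Differentiating `mode_add_theta` at shift
0, together with `pd_mode`, replaces an integration by parts. -/
theorem mode_pd_theta (hδ : 0 ≤ δ) (hT : 0 < T) (hf : Tame T σ δ f) (k : ℤ) :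
    EqOn (FastProblem.mode k (pd T σ 5 f)) (fun z => Complex.I * k * FastProblem.mode k f z)
      (fastDom T σ) := by
  intro z hz
  have h1 := ((hf.mode hδ hT k).hasGrad).hasDerivAt_theta hz 0
  rw [pd_mode hδ hT hf k 5 (add_theta_mem 0 hz), zero_smul, add_zero] at h1
  have h2 : HasDerivAt (fun b : ℝ => FastProblem.mode k f (z + b • bas 5))
      (Complex.I * k * FastProblem.mode k f z) 0 := by
    have e : (fun b : ℝ => FastProblem.mode k f (z + b • bas 5))
        = fun b : ℝ => Complex.exp (Complex.I * k * b) * FastProblem.mode k f z :=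
      funext fun b => mode_add_theta hf.per k hz b
    rw [e]
    have h3 : HasDerivAt (fun b : ℝ => Complex.I * k * (b : ℂ)) (Complex.I * k) 0 := by
      simpa using (Complex.ofRealCLM.hasDerivAt (x := (0 : ℝ))).const_mul (Complex.I * k)
    simpa using h3.cexp.mul_const (FastProblem.mode k f z)
  exact h1.unique h2

theorem mode_zero_of_const {z : Pt} (h : ∀ a : ℝ, f (z + a • bas 5) = f z) :
    FastProblem.mode 0 f z = f z := by
  have : ∀ a : ℝ, modeKer 0 a * f (z + a • bas 5) = (2 * Real.pi : ℂ)⁻¹ * f z := by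
    intro a; rw [h a]; simp [modeKer]
  have hpi := Real.pi_pos
  unfold FastProblem.mode trOp
  simp only [this]
  rw [setIntegral_const, measureReal_def, Real.volume_Ioc, sub_zero,
    ENNReal.toReal_ofReal (by positivity), Complex.real_smul]
  have : (Real.pi : ℂ) ≠ 0 := by exact_mod_cast hpi.ne'
  push_cast
  field_simp

theorem mode_zero_theta (hp : ∀ v ∈ periods, ∀ z ∈ fastDom T σ, f (z + v) = f z) {z : Pt}
    (hz : z ∈ fastDom T σ) (a : ℝ) :
    FastProblem.mode 0 f (z + a • bas 5) = FastProblem.mode 0 f z := by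
  rw [mode_add_theta hp 0 hz]; simp

theorem mode_zero_mode_zero (hp : ∀ v ∈ periods, ∀ z ∈ fastDom T σ, f (z + v) = f z) :
    EqOn (FastProblem.mode 0 (FastProblem.mode 0 f)) (FastProblem.mode 0 f) (fastDom T σ) :=
  fun _ hz => mode_zero_of_const (mode_zero_theta hp hz)

theorem mode_sub (k : ℤ) (hT : 0 < T) (hf : Tame T σ δ f) (hg : Tame T σ δ g) :
    EqOn (FastProblem.mode k fun z => f z - g z)
      (fun z => FastProblem.mode k f z - FastProblem.mode k g z) (fastDom T σ) := by
  intro z hz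
  have h := mode_add k hf (hg.const_mul hT (-1)) hz
  simp only [mode_const_mul] at h
  simpa [sub_eq_add_neg] using h

/-! ### Antiderivatives in `θ` -/

/-- An antiderivative in `θ` of the oscillating part of `f`. -/
noncomputable def antiTheta₀ (f : Pt → ℂ) : Pt → ℂ :=
  trOp (Ioc 0 (2 * Real.pi)) (fun a => (2 * Real.pi : ℂ)⁻¹ * (a - Real.pi)) (bas 5) f

/-- The antiderivative in `θ`, of mean zero, of the oscillating part of `f`. -/
noncomputable def antiTheta (f : Pt → ℂ) : Pt → ℂ :=
  fun z => antiTheta₀ f z - mode 0 (antiTheta₀ f) z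

theorem isKernel_antiTheta₀ (T : ℝ) (σ : Side) (δ : ℝ) :
    IsKernel T σ δ (Ioc 0 (2 * Real.pi)) (fun a => (2 * Real.pi : ℂ)⁻¹ * (a - Real.pi)) (bas 5)
      (fun _ => 1) :=
  isKernel_theta T σ δ (by fun_prop)

theorem Tame.antiTheta₀ (hδ : 0 ≤ δ) (hT : 0 < T) (hf : Tame T σ δ f) :
    Tame T σ δ (antiTheta₀ f) := hf.trOp hδ hT (isKernel_antiTheta₀ T σ δ)

theorem Tame.antiTheta (hδ : 0 ≤ δ) (hT : 0 < T) (hf : Tame T σ δ f) :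
    Tame T σ δ (antiTheta f) :=
  (hf.antiTheta₀ hδ hT).sub hT ((hf.antiTheta₀ hδ hT).mode hδ hT 0)

theorem mode_zero_antiTheta (hδ : 0 ≤ δ) (hT : 0 < T) (hf : Tame T σ δ f) {z : Pt}
    (hz : z ∈ fastDom T σ) : FastProblem.mode 0 (FastProblem.antiTheta f) z = 0 := by
  have h := hf.antiTheta₀ hδ hT
  unfold FastProblem.antiTheta
  rw [mode_sub 0 hT h (h.mode hδ hT 0) hz]
  simp only
  rw [mode_zero_mode_zero h.per hz, sub_self]

/-- Integration by parts against the sawtooth (a - π)/2π: its end values over a period are ±1/2,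
which yields `f z` by periodicity, and its slope 1/2π yields the mean. -/
theorem antiTheta₀_pd_theta (hT : 0 < T) (hf : Tame T σ δ f) {z : Pt}
    (hz : z ∈ fastDom T σ) :
    FastProblem.antiTheta₀ (pd T σ 5 f) z = f z - FastProblem.mode 0 f z := by
  have h0 : (0 : ℝ) ≤ 2 * Real.pi := by positivity
  have hu : ∀ a ∈ uIcc (0 : ℝ) (2 * Real.pi), HasDerivAt
      (fun a : ℝ => (2 * Real.pi : ℂ)⁻¹ * ((a : ℂ) - Real.pi)) ((2 * Real.pi : ℂ)⁻¹) a := by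
    intro a _
    simpa using ((Complex.ofRealCLM.hasDerivAt (x := a)).sub_const (Real.pi : ℂ)).const_mul
      ((2 * Real.pi : ℂ)⁻¹)
  have hv : ∀ a ∈ uIcc (0 : ℝ) (2 * Real.pi), HasDerivAt
      (fun a : ℝ => f (z + a • bas 5)) (pd T σ 5 f (z + a • bas 5)) a :=
    fun a _ => hf.hasGrad.hasDerivAt_theta hz a
  have h := intervalIntegral.integral_mul_deriv_eq_deriv_mul hu hv (by simp)
    ((continuous_theta (hf.pd hT 5).continuousOn hz).intervalIntegrable _ _)
  have hper := theta_periodic hf.per hz 0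
  simp only [zero_add, zero_smul, add_zero] at hper
  unfold FastProblem.antiTheta₀ FastProblem.mode trOp
  rw [← intervalIntegral.integral_of_le h0, ← intervalIntegral.integral_of_le h0, h, hper]
  have hpi : (Real.pi : ℂ) ≠ 0 := by exact_mod_cast Real.pi_ne_zero
  congr 1
  · push_cast; simp; field_simp; ring
  · simp [modeKer]

theorem pd_antiTheta₀ (hδ : 0 ≤ δ) (hT : 0 < T) (hf : Tame T σ δ f) (i : Fin 6) :
    EqOn (pd T σ i (FastProblem.antiTheta₀ f)) (FastProblem.antiTheta₀ (pd T σ i f))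
      (fastDom T σ) :=
  pd_trOp hδ hT (isKernel_antiTheta₀ T σ δ) hf i

theorem pd_theta_antiTheta (hδ : 0 ≤ δ) (hT : 0 < T) (hf : Tame T σ δ f) {z : Pt}
    (hz : z ∈ fastDom T σ) :
    pd T σ 5 (FastProblem.antiTheta f) z = f z - FastProblem.mode 0 f z := by
  have h := hf.antiTheta₀ hδ hT
  have h1 := (h.hasGrad.add ((h.mode hδ hT 0).hasGrad.const_mul (-1))).pd_eq hT 5 hz
  have e : FastProblem.antiTheta f = fun z => FastProblem.antiTheta₀ f z
      + -1 * FastProblem.mode 0 (FastProblem.antiTheta₀ f) z := by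
    ext z; simp [FastProblem.antiTheta, sub_eq_add_neg]
  rw [e, h1]
  simp only
  rw [pd_mode hδ hT h 0 5 hz, mode_pd_theta hδ hT h 0 hz,
    pd_antiTheta₀ hδ hT hf 5 hz]
  simpa using antiTheta₀_pd_theta hT hf hz

theorem pd_antiTheta (hδ : 0 ≤ δ) (hT : 0 < T) (hf : Tame T σ δ f) (i : Fin 6) {z : Pt}
    (hz : z ∈ fastDom T σ) :
    pd T σ i (FastProblem.antiTheta f) z = FastProblem.antiTheta (pd T σ i f) z := by
  have h := hf.antiTheta₀ hδ hT
  have h1 := (h.hasGrad.add ((h.mode hδ hT 0).hasGrad.const_mul (-1))).pd_eq hT i hz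
  have e : FastProblem.antiTheta f = fun z => FastProblem.antiTheta₀ f z
      + -1 * FastProblem.mode 0 (FastProblem.antiTheta₀ f) z := by
    ext z; simp [FastProblem.antiTheta, sub_eq_add_neg]
  have h2 := pd_antiTheta₀ hδ hT hf i
  rw [e, h1]
  simp only
  rw [pd_mode hδ hT h 0 i hz]
  rw [h2 hz, mode_congr 0 h2 hz, FastProblem.antiTheta]
  ring

/-! ### Exponential averages in the normal direction -/

/-- `∫₀^∞ e^{-l v} f(…, Y₃ ± v, θ) dv`. -/
noncomputable def tailOp (σ : Side) (l : ℝ) (f : Pt → ℂ) : Pt → ℂ :=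
  trOp (Ioi 0) (fun a => Complex.exp (-(l * a : ℝ))) (σ.sg • bas 4) f

/-- Moving away from the sheet by `a` multiplies the weight e^{-δ|Y₃|} by exactly e^{-δa}. Hence
only l + δ > 0 is needed: l = 0 is allowed for decaying functions, and δ = 0 for l > 0. -/
theorem isKernel_tail (T : ℝ) (σ : Side) {l : ℝ} (h : 0 < l + δ) :
    IsKernel T σ δ (Ioi 0) (fun a => Complex.exp (-(l * a : ℝ))) (σ.sg • bas 4)
      (fun a => Real.exp (-δ * a)) := by
  refine ⟨measurableSet_Ioi, by fun_prop, fun a ha z hz => add_normal_mem (le_of_lt ha) hz,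
    fun a ha z hz => ?_, ?_⟩
  · have h1 := (mem_fastDom.1 (add_normal_mem (le_of_lt ha) hz)).2.2
    rw [Side.abs_eq h1, Side.abs_eq (mem_fastDom.1 hz).2.2, ← Real.exp_add]
    refine Real.exp_le_exp.2 (le_of_eq ?_)
    rw [smul_smul, add_smul_bas_four]
    linear_combination (-δ * a) * σ.sg_mul_sg
  · have : (fun a : ℝ => ‖Complex.exp (-(l * a : ℝ))‖ * Real.exp (-δ * a))
        = fun a => Real.exp (-(l + δ) * a) := by
      ext a
      rw [← Complex.ofReal_neg, Complex.norm_exp_ofReal, ← Real.exp_add]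
      ring_nf
    rw [this]
    exact integrableOn_exp_mul_Ioi (by linarith) 0

theorem Tame.tailOp (hδ : 0 ≤ δ) (hT : 0 < T) (hf : Tame T σ δ f) {l : ℝ} (h : 0 < l + δ) :
    Tame T σ δ (tailOp σ l f) := hf.trOp hδ hT (isKernel_tail T σ h)

theorem pd_tailOp (hδ : 0 ≤ δ) (hT : 0 < T) (hf : Tame T σ δ f) {l : ℝ} (h : 0 < l + δ)
    (i : Fin 6) : EqOn (pd T σ i (FastProblem.tailOp σ l f))
      (FastProblem.tailOp σ l (pd T σ i f)) (fastDom T σ) :=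
  pd_trOp hδ hT (isKernel_tail T σ h) hf i

/-- The kernel has mass 1/(l + δ) ≤ 1, so the constant does not depend on l. This uniformity makes
the sum over all Fourier modes converge. -/
theorem norm_tailOp_le {l : ℝ} (hl : 1 ≤ l) (hδ : 0 ≤ δ) {C : ℝ} (hC0 : 0 ≤ C)
    (hC : ∀ z ∈ fastDom T σ, ‖f z‖ ≤ C * Real.exp (-δ * |z.2.2.1|)) {z : Pt}
    (hz : z ∈ fastDom T σ) : ‖FastProblem.tailOp σ l f z‖ ≤ C * Real.exp (-δ * |z.2.2.1|) := by
  refine ((isKernel_tail T σ (show 0 < l + δ by linarith)).bound hC0 hC hz).trans ?_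
  have : (fun a : ℝ => ‖Complex.exp (-(l * a : ℝ))‖ * Real.exp (-δ * a))
      = fun a => Real.exp (-(l + δ) * a) := by
    ext a
    rw [← Complex.ofReal_neg, Complex.norm_exp_ofReal, ← Real.exp_add]
    ring_nf
  rw [this, integral_exp_mul_Ioi (by linarith)]
  refine mul_le_mul_of_nonneg_right ?_ (Real.exp_pos _).le
  simp only [mul_zero, Real.exp_zero]
  rw [neg_div_neg_eq, one_div]
  exact mul_le_of_le_one_left hC0 (inv_le_one_of_one_le₀ (by linarith))

/-- Integration by parts on the half-line; the term at infinity vanishes since l + δ > 0. With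
commutation of derivatives, this says that the tail average solves g' = ±(l g - f). -/
theorem tailOp_pd_normal (hδ : 0 ≤ δ) (hT : 0 < T) (hf : Tame T σ δ f) {l : ℝ}
    (hl : 0 < l + δ) {z : Pt} (hz : z ∈ fastDom T σ) :
    FastProblem.tailOp σ l (pd T σ 4 f) z
      = σ.sg * (l * FastProblem.tailOp σ l f z - f z) := by
  set u : ℝ → ℂ := fun a => f (z + a • (σ.sg • bas 4)) with hu
  set E : ℝ → ℂ := fun a => Complex.exp (-(l * a : ℝ)) with hE
  have hK := isKernel_tail T σ hl
  have hE' : ∀ a, HasDerivAt E (-(l : ℂ) * E a) a := by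
    intro a
    have h3 : HasDerivAt (fun a : ℝ => -((l * a : ℝ) : ℂ)) (-(l : ℂ)) a := by
      have := ((Complex.ofRealCLM.hasDerivAt (x := a)).const_mul (l : ℂ)).fun_neg
      simpa using this
    simpa [hE, mul_comm] using h3.cexp
  have hu' : ∀ a ∈ Ioi (0 : ℝ), HasDerivAt u
      (σ.sg * pd T σ 4 f (z + a • (σ.sg • bas 4))) a := fun a ha =>
    (hf.hasGrad.hasDerivWithinAt_normal hz (le_of_lt ha)).hasDerivAt (Ici_mem_nhds ha)
  have i1 : IntegrableOn (fun a => -(l : ℂ) * (E a * u a)) (Ioi 0) :=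
    (hK.integrableOn hf hz).const_mul _
  have i2 : IntegrableOn (fun a => (σ.sg : ℂ) * (E a * pd T σ 4 f (z + a • (σ.sg • bas 4))))
      (Ioi 0) := (hK.integrableOn (hf.pd hT 4) hz).const_mul _
  obtain ⟨C, hC0, hC⟩ := hf.bound_zero
  have hlim : Tendsto (fun a => E a * u a) atTop (𝓝 0) := by
    have h1 : Tendsto (fun a : ℝ => C * Real.exp (-(l + δ) * a)) atTop (𝓝 0) := by
      have : Tendsto (fun a : ℝ => -(l + δ) * a) atTop atBot :=
        tendsto_id.const_mul_atTop_of_neg (by linarith)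
      simpa using (Real.tendsto_exp_atBot.comp this).const_mul C
    refine squeeze_zero_norm' ?_ h1
    filter_upwards [eventually_gt_atTop 0] with a ha
    refine (hK.norm_le hC0 hC ha hz).trans ?_
    rw [← Complex.ofReal_neg, Complex.norm_exp_ofReal, ← Real.exp_add]
    have h2 : Real.exp (-δ * |z.2.2.1|) ≤ 1 :=
      Real.exp_le_one_iff.2 (by nlinarith [abs_nonneg z.2.2.1])
    rw [show -(l * a) + -δ * a = -(l + δ) * a by ring, mul_comm]
    exact mul_le_mul_of_nonneg_right (mul_le_of_le_one_right hC0 h2) (Real.exp_pos _).le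
  have hcont : ContinuousWithinAt (fun a => E a * u a) (Ici 0) 0 := by
    refine ContinuousWithinAt.mul (by fun_prop) ?_
    exact continuousOn_normal hf.continuousOn hz 0 self_mem_Ici
  have h := integral_Ioi_of_hasDerivAt_of_tendsto (f' := fun a => -(l : ℂ) * (E a * u a)
    + (σ.sg : ℂ) * (E a * pd T σ 4 f (z + a • (σ.sg • bas 4)))) hcont
    (fun a ha => ((hE' a).mul (hu' a ha)).congr_deriv (by ring)) (i1.add i2) hlim
  rw [integral_add i1 i2, integral_const_mul, integral_const_mul] at h
  have e0 : E 0 * u 0 = f z := by simp [hE, hu]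
  rw [e0] at h
  have hs : (σ.sg : ℂ) * σ.sg = 1 := by exact_mod_cast σ.sg_mul_sg
  have hA : ∫ a in Ioi 0, E a * u a = FastProblem.tailOp σ l f z := rfl
  have hB : ∫ a in Ioi 0, E a * pd T σ 4 f (z + a • (σ.sg • bas 4))
    = FastProblem.tailOp σ l (pd T σ 4 f) z := rfl
  rw [hA, hB] at h
  linear_combination (σ.sg : ℂ) * h - FastProblem.tailOp σ l (pd T σ 4 f) z * hs

/-! ### Exponential averages between the sheet and the point -/

theorem hasDerivAt_of_eq {u v : ℝ → ℂ} {a b : ℂ} {x : ℝ} (h : HasDerivAt u a x)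
    (huv : ∀ y, v y = u y) (hab : b = a) : HasDerivAt v b x := by
  rw [funext huv, hab]; exact h

theorem HasGrad.mul {D : Set Pt} {f f' : Pt → ℂ} {g g' : Fin 6 → Pt → ℂ}
    (h : HasGrad D f g) (h' : HasGrad D f' g') :
    HasGrad D (fun z => f z * f' z) (fun i z => f z * g' i z + f' z * g i z) := by
  intro z hz
  rw [lin_add, lin_mul, lin_mul]
  exact (h z hz).mul (h' z hz)

theorem HasGrad.mono {D D' : Set Pt} {g : Fin 6 → Pt → ℂ} (h : HasGrad D f g) (hD : D' ⊆ D) :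
    HasGrad D' f g := fun z hz => (h z (hD hz)).mono hD

theorem hasGrad_normal (D : Set Pt) {h h' : ℝ → ℂ} (hh : ∀ Y, HasDerivAt h (h' Y) Y) :
    HasGrad D (fun z => h z.2.2.1) (fun i z => if i = 4 then h' z.2.2.1 else 0) := by
  intro z hz
  have h1 := (hh (crd 4 z)).hasFDerivAt.comp_hasFDerivWithinAt z
    ((crd 4).hasFDerivAt.hasFDerivWithinAt (s := D))
  rw [eq_lin (ContinuousLinearMap.comp _ (crd 4))] at h1
  have e : (fun i => ((ContinuousLinearMap.toSpanSingleton ℝ (h' (crd 4 z))).comp (crd 4)) (bas i))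
      = fun i => if i = 4 then h' z.2.2.1 else 0 := by
    funext i
    by_cases hi : i = 4
    · subst hi; simp [crd_bas]
    · simp [crd_bas, hi, Ne.symm hi]
  rw [← e]
  exact h1

/-- Multiplication of the variable `Y₃` by `r`. -/
noncomputable def scaleY (r : ℝ) : Pt →L[ℝ] Pt :=
  ContinuousLinearMap.id ℝ Pt + (crd 4).smulRight ((r - 1) • bas 4)

theorem scaleY_apply (r : ℝ) (z : Pt) : scaleY r z = (z.1, z.2.1, r * z.2.2.1, z.2.2.2) := by
  have : scaleY r z = z + (z.2.2.1 * (r - 1)) • bas 4 := by simp [scaleY, smul_smul]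
  rw [this, add_smul_bas_four]
  simp; ring

/-- As r varies, the scaled point runs along a straight line, so that the lemmas on derivatives
along lines apply. -/
theorem scaleY_eq_line (r : ℝ) (z : Pt) :
    scaleY r z = scaleY 0 z + r • (z.2.2.1 • bas 4) := by
  rw [smul_smul, add_smul_bas_four, scaleY_apply, scaleY_apply]
  simp

theorem scaleY_one (z : Pt) : scaleY 1 z = z := by rw [scaleY_apply]; simp

theorem crd_scaleY_bas (r : ℝ) (i j : Fin 6) :
    crd j (scaleY r (bas i)) = if j = i then (if i = 4 then r else 1) else 0 := by
  simp only [scaleY, _root_.add_apply, ContinuousLinearMap.id_apply, map_add,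
    ContinuousLinearMap.smulRight_apply, map_smul, crd_bas]
  by_cases h : j = i
  · subst h
    by_cases h4 : j = 4
    · subst h4; simp
    · simp [h4]
  · by_cases h4 : i = 4
    · subst h4; simp [h]
    · simp [h, Ne.symm h4]

theorem scaleY_mem {r : ℝ} (hr : 0 ≤ r) {z : Pt} (hz : z ∈ fastDom T σ) :
    scaleY r z ∈ fastDom T σ := by
  rw [scaleY_apply]
  rw [mem_fastDom, Side.mem_fastClosed] at *
  refine ⟨hz.1, hz.2.1, ?_⟩
  show 0 ≤ σ.sg * (r * z.2.2.1)
  nlinarith [hz.2.2, mul_nonneg hr hz.2.2]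

theorem HasGrad.comp_scaleY {g : Fin 6 → Pt → ℂ} (h : HasGrad (fastDom T σ) f g) {r : ℝ}
    (hr : 0 ≤ r) : HasGrad (fastDom T σ) (fun z => f (scaleY r z))
      (fun i z => (if i = 4 then (r : ℂ) else 1) * g i (scaleY r z)) := by
  have h1 := h.comp (D' := fastDom T σ) (scaleY r) 0 (fun z hz => by
    rw [add_zero]; exact scaleY_mem hr hz)
  simp only [add_zero] at h1
  refine h1.congr_grad fun i z _ => ?_
  simp only [crd_scaleY_bas]
  rw [Finset.sum_eq_single i (by intro j _ hj; simp [hj]) (by simp)]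
  by_cases hi : i = 4 <;> simp [hi]

/-- `∫_0^{Y₃} e^{-l |Y₃ - Y|} f(…, Y, θ) dY`, written as an integral over `(0, 1]`. -/
noncomputable def fwdOp (σ : Side) (l : ℝ) (f : Pt → ℂ) : Pt → ℂ := fun z =>
  ∫ r in Ioc (0 : ℝ) 1, (z.2.2.1 : ℂ) * Complex.exp (-(l * (σ.sg * z.2.2.1) * (1 - r) : ℝ))
    * f (scaleY r z)

theorem fwdOp_of_normal_eq_zero {l : ℝ} {z : Pt} (hz : z.2.2.1 = 0) : fwdOp σ l f z = 0 := by
  simp [fwdOp, hz]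

theorem fwdOp_congr (l : ℝ) (h : EqOn f g (fastDom T σ)) :
    EqOn (fwdOp σ l f) (fwdOp σ l g) (fastDom T σ) := by
  intro z hz
  refine setIntegral_congr_fun measurableSet_Ioc fun r hr => ?_
  rw [show f (scaleY r z) = g (scaleY r z) from h (scaleY_mem hr.1.le hz)]

theorem fwdOp_const_mul (l : ℝ) (f : Pt → ℂ) (c : ℂ) (z : Pt) :
    fwdOp σ l (fun z => c * f z) z = c * fwdOp σ l f z := by
  unfold fwdOp
  rw [← integral_const_mul]
  congr 1; ext a; ring

theorem fwdOp_translate (l : ℝ) {w : Pt} (hw : w.2.2.1 = 0) {c : ℂ}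
    (h : ∀ z ∈ fastDom T σ, f (z + w) = c * f z) {z : Pt} (hz : z ∈ fastDom T σ) :
    fwdOp σ l f (z + w) = c * fwdOp σ l f z := by
  unfold fwdOp
  rw [← integral_const_mul]
  refine setIntegral_congr_fun measurableSet_Ioc fun r hr => ?_
  have e : scaleY r (z + w) = scaleY r z + w := by
    rw [map_add]; congr 1
    rw [scaleY_apply, hw]; simp [Prod.ext_iff, hw]
  have e' : (z + w).2.2.1 = z.2.2.1 := by simp [hw]
  simp only [e, e', h _ (scaleY_mem hr.1.le hz)]
  ring

/-- The exponents compare because (l - δ - 1/2) |Y₃| (1 - r) ≥ 0: half of the kernel's decay remains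
for integrability in r, and the rest transports the weight from rY₃ to Y₃. This is the reason for δ
≤ 1/2. -/
theorem norm_fwd_integrand_le {l : ℝ} (hl : 1 ≤ l) (hδ2 : δ ≤ 1 / 2) {C : ℝ}
    (hC0 : 0 ≤ C) (hC : ∀ z ∈ fastDom T σ, ‖f z‖ ≤ C * Real.exp (-δ * |z.2.2.1|)) {z : Pt}
    (hz : z ∈ fastDom T σ) {r : ℝ} (hr : r ∈ Ioc (0 : ℝ) 1) :
    ‖(z.2.2.1 : ℂ) * Complex.exp (-(l * (σ.sg * z.2.2.1) * (1 - r) : ℝ)) * f (scaleY r z)‖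
      ≤ |z.2.2.1| * Real.exp (-(|z.2.2.1| / 2 * (1 - r))) * (C * Real.exp (-δ * |z.2.2.1|)) := by
  have hY := (Side.abs_eq (mem_fastDom.1 hz).2.2)
  rw [norm_mul, norm_mul, Complex.norm_real, Real.norm_eq_abs, ← Complex.ofReal_neg,
    Complex.norm_exp_ofReal, mul_assoc |z.2.2.1|, mul_assoc |z.2.2.1|]
  refine mul_le_mul_of_nonneg_left ?_ (abs_nonneg _)
  have h1 := hC _ (scaleY_mem hr.1.le hz)
  rw [scaleY_apply] at h1
  simp only [abs_mul, abs_of_pos hr.1] at h1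
  rw [← hY]
  calc _ ≤ Real.exp (-(l * |z.2.2.1| * (1 - r))) * (C * Real.exp (-δ * (r * |z.2.2.1|))) :=
        by
          refine mul_le_mul_of_nonneg_left ?_ (Real.exp_pos _).le
          rw [scaleY_apply]; exact h1
    _ = C * Real.exp (-(l * |z.2.2.1| * (1 - r)) + -δ * (r * |z.2.2.1|)) := by
        rw [Real.exp_add]; ring
    _ ≤ C * Real.exp (-(|z.2.2.1| / 2 * (1 - r)) + -δ * |z.2.2.1|) := by
        refine mul_le_mul_of_nonneg_left (Real.exp_le_exp.2 ?_) hC0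
        have := mul_nonneg (mul_nonneg (show 0 ≤ l - δ - 1 / 2 by linarith)
          (abs_nonneg z.2.2.1)) (show 0 ≤ 1 - r by linarith [hr.2])
        nlinarith
    _ = _ := by rw [Real.exp_add]; ring

/-- The integral equals 2 (1 - e^{-a/2}). The factor |Y₃| from scaling to the unit interval
therefore costs nothing. -/
theorem integral_fwd_weight_le {a : ℝ} :
    IntegrableOn (fun r : ℝ => a * Real.exp (-(a / 2 * (1 - r)))) (Ioc 0 1) ∧
    ∫ r in Ioc (0 : ℝ) 1, a * Real.exp (-(a / 2 * (1 - r))) ≤ 2 := by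
  have hc : Continuous fun r : ℝ => a * Real.exp (-(a / 2 * (1 - r))) := by fun_prop
  refine ⟨hc.integrableOn_Icc.mono_set Ioc_subset_Icc_self, ?_⟩
  rw [← intervalIntegral.integral_of_le zero_le_one]
  have hd : ∀ r ∈ uIcc (0 : ℝ) 1, HasDerivAt (fun r : ℝ => 2 * Real.exp (-(a / 2 * (1 - r))))
      (a * Real.exp (-(a / 2 * (1 - r)))) r := by
    intro r _
    have h1 : HasDerivAt (fun r : ℝ => -(a / 2 * (1 - r))) (a / 2) r := by
      have := (((hasDerivAt_id r).const_sub 1).const_mul (a / 2)).fun_neg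
      simpa using this
    exact (h1.exp.const_mul 2).congr_deriv (by ring)
  rw [intervalIntegral.integral_eq_sub_of_hasDerivAt hd (hc.intervalIntegrable _ _)]
  simp
  positivity

theorem norm_fwdOp_le {l : ℝ} (hl : 1 ≤ l) (hδ2 : δ ≤ 1 / 2) {C : ℝ}
    (hC0 : 0 ≤ C) (hC : ∀ z ∈ fastDom T σ, ‖f z‖ ≤ C * Real.exp (-δ * |z.2.2.1|)) {z : Pt}
    (hz : z ∈ fastDom T σ) : ‖fwdOp σ l f z‖ ≤ 2 * C * Real.exp (-δ * |z.2.2.1|) := by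
  obtain ⟨hi, h2⟩ := integral_fwd_weight_le (a := |z.2.2.1|)
  refine (norm_integral_le_of_norm_le (hi.mul_const (C * Real.exp (-δ * |z.2.2.1|))) ?_).trans ?_
  · filter_upwards [ae_restrict_mem measurableSet_Ioc] with r hr
    exact norm_fwd_integrand_le hl hδ2 hC0 hC hz hr
  · rw [integral_mul_const, mul_assoc]
    exact mul_le_mul_of_nonneg_right h2 (by positivity)

theorem hasGrad_fwd_integrand (hf : Tame T σ δ f) (l : ℝ) {r : ℝ} (hr : 0 ≤ r) :
    HasGrad (fastDom T σ) (fun z => (z.2.2.1 : ℂ) *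
        Complex.exp (-(l * (σ.sg * z.2.2.1) * (1 - r) : ℝ)) * f (scaleY r z))
      (fun i z => (z.2.2.1 : ℂ) * Complex.exp (-(l * (σ.sg * z.2.2.1) * (1 - r) : ℝ)) *
          ((if i = 4 then (r : ℂ) else 1) * pd T σ i f (scaleY r z))
        + f (scaleY r z) * (if i = 4 then (1 - l * σ.sg * (1 - r) * z.2.2.1) *
          Complex.exp (-(l * (σ.sg * z.2.2.1) * (1 - r) : ℝ)) else 0)) := by
  refine HasGrad.mul (f := fun z => (z.2.2.1 : ℂ) *
        Complex.exp (-(l * (σ.sg * z.2.2.1) * (1 - r) : ℝ))) ?_ (hf.hasGrad.comp_scaleY hr)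
  refine hasGrad_normal (fastDom T σ)
    (h := fun Y => (Y : ℂ) * Complex.exp (-(l * (σ.sg * Y) * (1 - r) : ℝ)))
    (h' := fun Y => (1 - l * σ.sg * (1 - r) * Y) *
          Complex.exp (-(l * (σ.sg * Y) * (1 - r) : ℝ))) fun Y => ?_
  have h0 : HasDerivAt (fun Y : ℝ => (Y : ℂ)) 1 Y := Complex.ofRealCLM.hasDerivAt
  have h1 : HasDerivAt (fun Y : ℝ => -((l * (σ.sg * Y) * (1 - r) : ℝ) : ℂ))
      (-(l * σ.sg * (1 - r) : ℂ)) Y := by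
    have h2 := (h0.const_mul (l * σ.sg * (1 - r) : ℂ)).fun_neg
    exact hasDerivAt_of_eq h2 (fun Y => by push_cast; ring) (by ring)
  exact (h0.mul h1.cexp).congr_deriv (by ring)

theorem norm_fwd_grad_le {l : ℝ} (hl : 0 ≤ l) {M : ℝ} (hM : 0 ≤ M)
    (hf : ∀ z ∈ fastDom T σ, ‖f z‖ ≤ M) (hg : ∀ z ∈ fastDom T σ, ‖g z‖ ≤ M) (i : Fin 6)
    {R : ℝ} {z : Pt} (hz : z ∈ fastDom T σ) (hR : |z.2.2.1| ≤ R) {r : ℝ}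
    (hr : r ∈ Ioc (0 : ℝ) 1) :
    ‖(z.2.2.1 : ℂ) * Complex.exp (-(l * (σ.sg * z.2.2.1) * (1 - r) : ℝ)) *
          ((if i = 4 then (r : ℂ) else 1) * g (scaleY r z))
        + f (scaleY r z) * (if i = 4 then (1 - l * σ.sg * (1 - r) * z.2.2.1) *
          Complex.exp (-(l * (σ.sg * z.2.2.1) * (1 - r) : ℝ)) else 0)‖ ≤ (R + (1 + l * R)) * M := by
  have hY := Side.mem_fastClosed.1 (mem_fastDom.1 hz).2.2
  have hR0 := (abs_nonneg _).trans hR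
  have he : ‖Complex.exp (-(l * (σ.sg * z.2.2.1) * (1 - r) : ℝ))‖ ≤ 1 := by
    rw [← Complex.ofReal_neg, Complex.norm_exp_ofReal]
    refine Real.exp_le_one_iff.2 ?_
    have := mul_nonneg (mul_nonneg hl hY) (show 0 ≤ 1 - r by linarith [hr.2])
    linarith
  have h1 := hf _ (scaleY_mem hr.1.le hz)
  have h2 := hg _ (scaleY_mem hr.1.le hz)
  have h3 : ‖(if i = 4 then (r : ℂ) else 1)‖ ≤ 1 := by
    split_ifs
    · rw [Complex.norm_real, Real.norm_of_nonneg hr.1.le]; exact hr.2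
    · simp
  have h4 : ‖(1 - l * σ.sg * (1 - r) * z.2.2.1 : ℂ)‖ ≤ 1 + l * R := by
    refine (norm_sub_le _ _).trans ?_
    have e : (l * σ.sg * (1 - r) * z.2.2.1 : ℂ) = ((l * σ.sg * (1 - r) * z.2.2.1 : ℝ) : ℂ) := by
      push_cast; ring
    rw [norm_one, e, Complex.norm_real, Real.norm_eq_abs, abs_mul, abs_mul, abs_mul, σ.abs_sg,
      abs_of_nonneg hl, abs_of_nonneg (show 0 ≤ 1 - r by linarith [hr.2]), mul_one]
    have : l * (1 - r) * |z.2.2.1| ≤ l * R := by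
      rw [mul_assoc]
      refine mul_le_mul_of_nonneg_left ?_ hl
      nlinarith [abs_nonneg z.2.2.1, hr.1]
    linarith
  have h5 : ‖(if i = 4 then (1 - l * σ.sg * (1 - r) * z.2.2.1) *
          Complex.exp (-(l * (σ.sg * z.2.2.1) * (1 - r) : ℝ)) else 0 : ℂ)‖ ≤ (1 + l * R) := by
    split_ifs
    · rw [norm_mul]
      exact (mul_le_mul h4 he (norm_nonneg _) (by positivity)).trans (by rw [mul_one])
    · rw [norm_zero]; positivity
  refine (norm_add_le _ _).trans ?_
  rw [norm_mul, norm_mul, norm_mul, norm_mul, Complex.norm_real, Real.norm_eq_abs, add_mul]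
  refine add_le_add ?_ ?_
  · calc _ ≤ R * 1 * (1 * M) := by gcongr
      _ = R * M := by ring
  · calc _ ≤ M * (1 + l * R) := by gcongr
      _ = _ := by ring

theorem convex_slab (T : ℝ) (σ : Side) (R : ℝ) :
    Convex ℝ (fastDom T σ ∩ {z : Pt | |z.2.2.1| ≤ R}) := by
  refine (convex_fastDom T σ).inter ?_
  have : {z : Pt | |z.2.2.1| ≤ R} = crd 4 ⁻¹' (Icc (-R) R) := by ext z; simp [abs_le]
  rw [this]
  exact (convex_Icc _ _).linear_preimage (crd 4).toLinearMap

theorem continuousOn_scale (hf : ContinuousOn f (fastDom T σ)) {z : Pt}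
    (hz : z ∈ fastDom T σ) : ContinuousOn (fun r : ℝ => f (scaleY r z)) (Icc 0 1) := by
  have e : (fun r : ℝ => f (scaleY r z))
      = fun r : ℝ => f (scaleY 0 z + r • (z.2.2.1 • bas 4)) :=
    funext fun r => by rw [scaleY_eq_line r z]
  rw [e]
  refine hf.comp (by fun_prop) fun r hr => ?_
  rw [← scaleY_eq_line]
  exact scaleY_mem hr.1 hz

/-- The integration interval does not depend on the point, so differentiation under the integral
applies. The bounds used for the differentiated integrand grow with |Y₃|, so one works on a convex
slab |Y₃| ≤ R around the point, which does not change derivatives there. -/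
theorem hasGrad_fwdOp_aux (hδ : 0 ≤ δ) (hT : 0 < T) (hf : Tame T σ δ f) {l : ℝ} (hl : 0 ≤ l) :
    HasGrad (fastDom T σ) (fwdOp σ l f) (fun i z => ∫ r in Ioc (0 : ℝ) 1,
      ((z.2.2.1 : ℂ) * Complex.exp (-(l * (σ.sg * z.2.2.1) * (1 - r) : ℝ)) *
          ((if i = 4 then (r : ℂ) else 1) * pd T σ i f (scaleY r z))
        + f (scaleY r z) * (if i = 4 then (1 - l * σ.sg * (1 - r) * z.2.2.1) *
          Complex.exp (-(l * (σ.sg * z.2.2.1) * (1 - r) : ℝ)) else 0))) := by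
  obtain ⟨C, hC0, hC₀⟩ := (hf.mono hδ).bound_zero
  choose C' hC'0 hC'₀ using fun i => ((hf.mono hδ).pd hT i).bound_zero
  have hC : ∀ z ∈ fastDom T σ, ‖f z‖ ≤ C := fun z hz => by simpa using hC₀ z hz
  have hC' : ∀ i, ∀ z ∈ fastDom T σ, ‖pd T σ i f z‖ ≤ C' i := fun i z hz => by
    simpa using hC'₀ i z hz
  set M := C + ∑ i, C' i with hM
  have hsum : 0 ≤ ∑ i, C' i := Finset.sum_nonneg fun i _ => hC'0 i
  have hM0 : 0 ≤ M := by linarith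
  have hCM : ∀ z ∈ fastDom T σ, ‖f z‖ ≤ M := fun z hz => (hC z hz).trans (by linarith)
  have hC'M : ∀ i, ∀ z ∈ fastDom T σ, ‖pd T σ i f z‖ ≤ M := fun i z hz => by
    have := Finset.single_le_sum (fun j _ => hC'0 j) (Finset.mem_univ i)
    linarith [hC' i z hz]
  intro z₀ hz₀
  set R := |z₀.2.2.1| + 1 with hR
  have hR0 : 0 ≤ R := by positivity
  have hmeas : ∀ {h : ℝ → ℂ}, ContinuousOn h (Icc 0 1) →
      AEStronglyMeasurable h (volume.restrict (Ioc 0 1)) := fun hh =>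
    (hh.mono Ioc_subset_Icc_self).aestronglyMeasurable measurableSet_Ioc
  have key := HasGrad.integral (μ := volume.restrict (Ioc (0 : ℝ) 1)) (convex_slab T σ R)
    (b := fun _ => (R + (1 + l * R)) * M)
    (f := fun r z => (z.2.2.1 : ℂ) *
        Complex.exp (-(l * (σ.sg * z.2.2.1) * (1 - r) : ℝ)) * f (scaleY r z))
    (g := fun r i z => (z.2.2.1 : ℂ) * Complex.exp (-(l * (σ.sg * z.2.2.1) * (1 - r) : ℝ)) *
          ((if i = 4 then (r : ℂ) else 1) * pd T σ i f (scaleY r z))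
        + f (scaleY r z) * (if i = 4 then (1 - l * σ.sg * (1 - r) * z.2.2.1) *
          Complex.exp (-(l * (σ.sg * z.2.2.1) * (1 - r) : ℝ)) else 0)) ?_
    (integrable_const _) ?_ ?_ ?_ ?_
  · have h1 := key z₀ ⟨hz₀, by simp [hR]⟩
    have hn : {z : Pt | |z.2.2.1| ≤ R} ∈ 𝓝 z₀ := by
      have hc : Continuous fun z : Pt => |z.2.2.1| := by fun_prop
      filter_upwards [hc.continuousAt.eventually_lt continuousAt_const
        (show |z₀.2.2.1| < R by simp [hR])] with z hz
      exact le_of_lt hz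
    exact (hasFDerivWithinAt_inter hn).1 h1
  · filter_upwards [ae_restrict_mem measurableSet_Ioc] with r hr
    exact (hasGrad_fwd_integrand hf l hr.1.le).mono inter_subset_left
  · intro z hz
    refine hmeas (ContinuousOn.mul (by fun_prop) (continuousOn_scale hf.continuousOn hz.1))
  · intro z hz i
    refine hmeas (ContinuousOn.add (ContinuousOn.mul (by fun_prop) (ContinuousOn.mul ?_
      (continuousOn_scale (hf.pd hT i).continuousOn hz.1)))
      (ContinuousOn.mul (continuousOn_scale hf.continuousOn hz.1) ?_))
    · split_ifs <;> fun_prop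
    · split_ifs <;> fun_prop
  · filter_upwards [ae_restrict_mem measurableSet_Ioc] with r hr z hz
    have hY := Side.mem_fastClosed.1 (mem_fastDom.1 hz.1).2.2
    rw [norm_mul, norm_mul, Complex.norm_real, Real.norm_eq_abs, ← Complex.ofReal_neg,
      Complex.norm_exp_ofReal]
    have he : Real.exp (-(l * (σ.sg * z.2.2.1) * (1 - r))) ≤ 1 := by
      refine Real.exp_le_one_iff.2 ?_
      have := mul_nonneg (mul_nonneg hl hY) (show 0 ≤ 1 - r by linarith [hr.2])
      linarith
    have h1 := hCM _ (scaleY_mem hr.1.le hz.1)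
    have h2 : |z.2.2.1| ≤ R := hz.2
    calc _ ≤ R * 1 * M := by gcongr
      _ ≤ _ := by
        have := mul_nonneg hl hR0
        nlinarith
  · filter_upwards [ae_restrict_mem measurableSet_Ioc] with r hr i z hz
    exact norm_fwd_grad_le hl hM0 hCM (hC'M i) i hz.1 hz.2 hr

/-- The forward average solves g' ± l g = f and commutes with the other derivatives. The normal
derivative found under the integral is brought to this form by integrating a total derivative in r.
-/
theorem hasGrad_fwdOp (hδ : 0 ≤ δ) (hT : 0 < T) (hf : Tame T σ δ f) {l : ℝ} (hl : 0 ≤ l) :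
    HasGrad (fastDom T σ) (fwdOp σ l f) (fun i z =>
      if i = 4 then f z - l * σ.sg * fwdOp σ l f z else fwdOp σ l (pd T σ i f) z) := by
  refine (hasGrad_fwdOp_aux hδ hT hf hl).congr_grad fun i z hz => ?_
  by_cases hi : i = 4
  · subst hi
    simp only [if_true]
    set E : ℝ → ℂ := fun r => Complex.exp (-(l * (σ.sg * z.2.2.1) * (1 - r) : ℝ)) with hE
    set u : ℝ → ℂ := fun r => f (scaleY r z) with hu
    set u' : ℝ → ℂ := fun r => pd T σ 4 f (scaleY r z) with hu'
    have cE : ContinuousOn E (Icc 0 1) := by fun_prop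
    have cu : ContinuousOn u (Icc 0 1) := continuousOn_scale hf.continuousOn hz
    have cu' : ContinuousOn u' (Icc 0 1) := continuousOn_scale (hf.pd hT 4).continuousOn hz
    have cr : ContinuousOn (fun r : ℝ => (r : ℂ)) (Icc 0 1) := by fun_prop
    have dE : ∀ r, HasDerivAt E (l * σ.sg * z.2.2.1 * E r) r := by
      intro r
      have h1 : HasDerivAt (fun r : ℝ => -((l * (σ.sg * z.2.2.1) * (1 - r) : ℝ) : ℂ))
          (l * σ.sg * z.2.2.1 : ℂ) r := by
        have h0 : HasDerivAt (fun r : ℝ => (r : ℂ)) 1 r := Complex.ofRealCLM.hasDerivAt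
        have h2 := ((h0.const_sub 1).const_mul (l * σ.sg * z.2.2.1 : ℂ)).fun_neg
        exact hasDerivAt_of_eq h2 (fun Y => by push_cast; ring) (by ring)
      exact h1.cexp.congr_deriv (by simp only [hE]; ring)
    have du : ∀ r ∈ Ioo (0 : ℝ) 1, HasDerivAt u (z.2.2.1 * u' r) r := by
      intro r hr
      have h1 := hf.hasGrad.hasDerivWithinAt_line (z := scaleY 0 z) (v := z.2.2.1 • bas 4)
        (s := Icc 0 1) (fun b hb => by rw [← scaleY_eq_line]; exact scaleY_mem hb.1 hz)
        (Ioo_subset_Icc_self hr)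
      simp only [← scaleY_eq_line] at h1
      rw [map_smul, lin_bas, Complex.real_smul] at h1
      exact h1.hasDerivAt (Icc_mem_nhds hr.1 hr.2)
    have dr : ∀ r : ℝ, HasDerivAt (fun r : ℝ => (r : ℂ)) 1 r := fun r =>
      Complex.ofRealCLM.hasDerivAt
    have i1 : IntervalIntegrable (fun r : ℝ => (z.2.2.1 : ℂ) * E r * ((r : ℂ) * u' r)
        + u r * ((1 - l * σ.sg * (1 - r) * z.2.2.1) * E r)) volume 0 1 := by
      refine ContinuousOn.intervalIntegrable ?_
      rw [uIcc_of_le zero_le_one]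
      refine ((continuousOn_const.mul cE).mul (cr.mul cu')).add (cu.mul (ContinuousOn.mul ?_ cE))
      fun_prop
    have i2 : IntervalIntegrable (fun r : ℝ => (z.2.2.1 : ℂ) * E r * u r) volume 0 1 := by
      refine ContinuousOn.intervalIntegrable ?_
      rw [uIcc_of_le zero_le_one]
      exact (continuousOn_const.mul cE).mul cu
    -- The r-derivative of r E(r) u(r) is the differentiated integrand plus ±l times the integrand.
    -- Its integral over (0, 1) is E(1) u(1) = f z, since the factor r kills the end point 0.
    have h := intervalIntegral.integral_eq_sub_of_hasDerivAt_of_le zero_le_one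
      ((cr.mul cE).mul cu) (fun r hr => (((dr r).mul (dE r)).mul (du r hr)).congr_deriv (by
        show _ = ((z.2.2.1 : ℂ) * E r * ((r : ℂ) * u' r)
          + u r * ((1 - l * σ.sg * (1 - r) * z.2.2.1) * E r))
          + (l * σ.sg) * ((z.2.2.1 : ℂ) * E r * u r)
        simp only [Pi.mul_apply]
        ring)) (i1.add (i2.const_mul _))
    rw [intervalIntegral.integral_add i1 (i2.const_mul _),
      intervalIntegral.integral_const_mul, intervalIntegral.integral_of_le zero_le_one,
      intervalIntegral.integral_of_le zero_le_one] at h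
    have hA : ∫ r in Ioc (0 : ℝ) 1, (z.2.2.1 : ℂ) * E r * u r = fwdOp σ l f z := rfl
    rw [hA] at h
    have e1 : E 1 = 1 := by simp [hE]
    have e2 : u 1 = f z := by simp only [hu, scaleY_one]
    simp only [Pi.mul_apply, e1, e2, Complex.ofReal_zero, Complex.ofReal_one, one_mul, zero_mul,
      sub_zero] at h
    linear_combination -h
  · simp only [hi, if_false, mul_zero, add_zero, one_mul]
    rfl

/-! ### Fourier series -/

theorem integral_exp_int (n : ℤ) : ∫ a in Ioc 0 (2 * Real.pi),
    Complex.exp (Complex.I * n * (a : ℝ)) = if n = 0 then (2 * Real.pi : ℂ) else 0 := by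
  have h0 : (0 : ℝ) ≤ 2 * Real.pi := by positivity
  rw [← intervalIntegral.integral_of_le h0]
  split_ifs with h
  · subst h; simp
  · have hn : Complex.I * (n : ℂ) ≠ 0 := mul_ne_zero Complex.I_ne_zero (by exact_mod_cast h)
    rw [integral_exp_mul_complex hn]
    have := exp_two_pi_int (-n)
    push_cast at this
    rw [show -(Complex.I * -(n : ℂ) * (2 * Real.pi)) = Complex.I * n * (2 * Real.pi) by ring] at this
    simp [this]

/-- The Fourier coefficients of an absolutely convergent trigonometric series. -/
theorem integral_modeKer_mul_of_hasSum {a : ℤ → ℂ} {u : ℝ → ℂ}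
    (h : ∀ θ : ℝ, HasSum (fun k : ℤ => a k * Complex.exp (Complex.I * k * θ)) (u θ)) (m : ℤ) :
    ∫ θ in Ioc 0 (2 * Real.pi), modeKer m θ * u θ = a m := by
  have hs : Summable fun k => ‖a k‖ := by
    have := (h 0).summable.norm
    simpa using this
  have hF : ∀ k : ℤ, ∀ θ : ℝ, ‖modeKer m θ * (a k * Complex.exp (Complex.I * k * θ))‖
      = (2 * Real.pi)⁻¹ * ‖a k‖ := by
    intro k θ
    rw [norm_mul, norm_modeKer, norm_mul, show Complex.I * k * θ = ((k * θ : ℝ) : ℂ) * Complex.I by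
      push_cast; ring, Complex.norm_exp_ofReal_mul_I, mul_one]
  have h1 := hasSum_integral_of_dominated_convergence (μ := volume.restrict (Ioc 0 (2 * Real.pi)))
    (F := fun (k : ℤ) (θ : ℝ) => modeKer m θ * (a k * Complex.exp (Complex.I * k * θ)))
    (f := fun θ => modeKer m θ * u θ) (fun k _ => (2 * Real.pi)⁻¹ * ‖a k‖)
    (fun k => Continuous.aestronglyMeasurable
      ((continuous_modeKer m).mul (by fun_prop)))
    (fun k => Eventually.of_forall fun θ => (hF k θ).le)
    (Eventually.of_forall fun θ => hs.mul_left _) (integrable_const _)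
    (Eventually.of_forall fun θ => (h θ).mul_left _)
  refine h1.unique ?_
  have h2 : ∀ k : ℤ, ∫ θ in Ioc 0 (2 * Real.pi),
      modeKer m θ * (a k * Complex.exp (Complex.I * k * θ)) = if k = m then a m else 0 := by
    intro k
    have : ∀ θ : ℝ, modeKer m θ * (a k * Complex.exp (Complex.I * k * θ))
        = ((2 * Real.pi : ℂ)⁻¹ * a k) * Complex.exp (Complex.I * (k - m : ℤ) * θ) := by
      intro θ
      rw [show Complex.I * (k - m : ℤ) * (θ : ℂ) = -(Complex.I * m * θ) + Complex.I * k * θ by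
        push_cast; ring, Complex.exp_add, modeKer]
      ring
    simp only [this]
    rw [integral_const_mul, integral_exp_int]
    have hpi : (Real.pi : ℂ) ≠ 0 := by exact_mod_cast Real.pi_ne_zero
    by_cases hk : k = m
    · subst hk; simp; field_simp
    · simp [hk, sub_ne_zero.2 hk]
  simp only [h2]
  exact hasSum_ite_eq m (a m)

theorem mode_of_hasSum {a : ℤ → ℂ} {z : Pt}
    (h : ∀ θ : ℝ, HasSum (fun k : ℤ => a k * Complex.exp (Complex.I * k * θ))
      (f (z + θ • bas 5))) (m : ℤ) : mode m f z = a m :=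
  integral_modeKer_mul_of_hasSum h m

/-- The modes of ∂_θ² f are -k² times those of f, and modes are bounded by the function. Two
θ-derivatives thus make the series of modes absolutely summable, with the weight in Y₃ retained. -/
theorem norm_mode_le_inv_sq (hδ : 0 ≤ δ) (hT : 0 < T) (hf : Tame T σ δ f) :
    ∃ C, 0 ≤ C ∧ ∀ k : ℤ, ∀ z ∈ fastDom T σ,
      ‖mode k f z‖ ≤ C * (1 + (k : ℝ) ^ 2)⁻¹ * Real.exp (-δ * |z.2.2.1|) := by
  obtain ⟨C, hC0, hC⟩ := hf.bound_zero
  obtain ⟨C', hC'0, hC'⟩ := ((hf.pd hT 5).pd hT 5).bound_zero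
  refine ⟨C + C', by positivity, fun k z hz => ?_⟩
  have h1 := norm_mode_le hC0 hC k hz
  have h2 := norm_mode_le hC'0 hC' k hz
  rw [mode_pd_theta hδ hT (hf.pd hT 5) k hz] at h2
  simp only at h2
  rw [mode_pd_theta hδ hT hf k hz] at h2
  simp only [norm_mul, Complex.norm_I, one_mul, Complex.norm_intCast] at h2
  have h3 : (1 + (k : ℝ) ^ 2) * ‖mode k f z‖ ≤ (C + C') * Real.exp (-δ * |z.2.2.1|) := by
    rw [← sq_abs]; linarith
  have h4 : 0 < 1 + (k : ℝ) ^ 2 := by positivity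
  rw [mul_right_comm, ← div_eq_mul_inv, le_div_iff₀ h4, mul_comm]
  exact h3

theorem summable_inv_one_add_sq : Summable fun k : ℤ => (1 + (k : ℝ) ^ 2)⁻¹ := by
  have h : Summable fun n : ℕ => (1 + (n : ℝ) ^ 2)⁻¹ := by
    refine (summable_nat_add_iff 1).1 ?_
    have h1 := (summable_nat_add_iff 1).2 (Real.summable_nat_pow_inv.2 (one_lt_two))
    refine Summable.of_nonneg_of_le (fun n => by positivity) (fun n => ?_) h1
    exact inv_anti₀ (by positivity) (by linarith)
  refine Summable.of_nat_of_neg (by simpa using h) (by simpa using h)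

/-- On the θ-line through `z` the function descends to the circle. Its Fourier coefficients are the
modes at `z`; they are summable, so the Fourier series converges at θ-shift 0. -/
theorem hasSum_mode (hδ : 0 ≤ δ) (hT : 0 < T) (hf : Tame T σ δ f) {z : Pt}
    (hz : z ∈ fastDom T σ) : HasSum (fun k => mode k f z) (f z) := by
  have : Fact (0 < 2 * Real.pi) := ⟨by positivity⟩
  set u : ℝ → ℂ := fun b => f (z + b • bas 5) with hu
  have hper : Function.Periodic u (2 * Real.pi) := theta_periodic hf.per hz
  have hcont : Continuous u := continuous_theta hf.continuousOn hz
  let F : C(AddCircle (2 * Real.pi), ℂ) := ⟨hper.lift, by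
    rw [continuous_coinduced_dom]; exact hcont⟩
  have hF : ∀ b : ℝ, F (b : AddCircle (2 * Real.pi)) = u b := fun b => rfl
  have hcoef : ∀ k, fourierCoeff F k = mode k f z := by
    intro k
    rw [fourierCoeff_eq_intervalIntegral _ k 0, zero_add,
      intervalIntegral.integral_of_le (by positivity), mode, trOp, ← integral_smul]
    refine setIntegral_congr_fun measurableSet_Ioc fun a _ => ?_
    simp only [hF, fourier_coe_apply, smul_eq_mul, modeKer, Complex.real_smul]
    have hpi : (Real.pi : ℂ) ≠ 0 := by exact_mod_cast Real.pi_ne_zero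
    rw [show 2 * (Real.pi : ℂ) * Complex.I * ((-k : ℤ) : ℂ) * a / ((2 * Real.pi : ℝ) : ℂ)
      = -(Complex.I * k * a) by push_cast; field_simp]
    push_cast
    simp only [hu]
    ring
  obtain ⟨C, hC0, hC⟩ := norm_mode_le_inv_sq hδ hT hf
  have hsum : Summable (fourierCoeff F) := by
    simp only [funext hcoef]
    refine Summable.of_norm_bounded ((summable_inv_one_add_sq.mul_left C).mul_right
      (Real.exp (-δ * |z.2.2.1|))) fun k => hC k z hz
  have h := has_pointwise_sum_fourier_series_of_summable hsum ((0 : ℝ) : AddCircle (2 * Real.pi))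
  rw [hF] at h
  simpa [hcoef, hu] using h

theorem eq_zero_of_mode_eq_zero (hδ : 0 ≤ δ) (hT : 0 < T) (hf : Tame T σ δ f) {z : Pt}
    (hz : z ∈ fastDom T σ) (h : ∀ k, mode k f z = 0) : f z = 0 := by
  have := hasSum_mode hδ hT hf hz
  simp only [h] at this
  exact this.unique hasSum_zero

/-! ### The decaying solutions of `∂_{Y₃} φ - (± i) ∂_θ φ = h` -/

/-- The decaying solution of `φ' ± k φ = f`, which vanishes at `Y₃ = 0` if `k > 0`. -/
noncomputable def resOp (σ : Side) (k : ℤ) (f : Pt → ℂ) : Pt → ℂ := fun z =>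
  if 0 < k then fwdOp σ k f z else -σ.sg * tailOp σ (-k) f z

theorem resOp_congr (k : ℤ) (h : EqOn f g (fastDom T σ)) :
    EqOn (resOp σ k f) (resOp σ k g) (fastDom T σ) := by
  intro z hz
  unfold resOp
  split_ifs with hk
  · exact fwdOp_congr _ h hz
  · have e : tailOp σ (-k) f z = tailOp σ (-k) g z := by
      refine setIntegral_congr_fun measurableSet_Ioi fun a ha => ?_
      rw [show f (z + a • σ.sg • bas 4) = g (z + a • σ.sg • bas 4) from
        h (add_normal_mem (le_of_lt ha) hz)]
    rw [e]

theorem resOp_const_mul (k : ℤ) (f : Pt → ℂ) (c : ℂ) (z : Pt) :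
    resOp σ k (fun z => c * f z) z = c * resOp σ k f z := by
  unfold resOp
  split_ifs
  · exact fwdOp_const_mul _ f c z
  · rw [tailOp, trOp_const_mul, tailOp]; ring

theorem resOp_translate (k : ℤ) {w : Pt} (hw : w.2.2.1 = 0) {c : ℂ}
    (h : ∀ z ∈ fastDom T σ, f (z + w) = c * f z) {z : Pt} (hz : z ∈ fastDom T σ) :
    resOp σ k f (z + w) = c * resOp σ k f z := by
  unfold resOp
  split_ifs
  · exact fwdOp_translate _ hw h hz
  · rw [tailOp, trOp, trOp, mul_left_comm, ← integral_const_mul c]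
    congr 1
    refine setIntegral_congr_fun measurableSet_Ioi fun a ha => ?_
    have e : f (z + w + a • σ.sg • bas 4) = c * f (z + a • σ.sg • bas 4) := by
      rw [show z + w + a • σ.sg • bas 4 = z + a • σ.sg • bas 4 + w by abel,
        h _ (add_normal_mem (le_of_lt ha) hz)]
    rw [e]
    ring

/-- The direction of integration is chosen according to the sign of k so that the kernel always
decays with exponent |k| ≥ 1; the constant 2 serves all modes at once. -/
theorem norm_resOp_le {k : ℤ} (hk : k ≠ 0) (hδ : 0 ≤ δ) (hδ2 : δ ≤ 1 / 2) {C : ℝ}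
    (hC0 : 0 ≤ C) (hC : ∀ z ∈ fastDom T σ, ‖f z‖ ≤ C * Real.exp (-δ * |z.2.2.1|)) {z : Pt}
    (hz : z ∈ fastDom T σ) : ‖resOp σ k f z‖ ≤ 2 * C * Real.exp (-δ * |z.2.2.1|) := by
  unfold resOp
  split_ifs with h
  · exact norm_fwdOp_le (by exact_mod_cast h) hδ2 hC0 hC hz
  · rw [norm_mul, norm_neg, Complex.norm_real, Real.norm_eq_abs, σ.abs_sg, one_mul]
    have hk1 : (1 : ℝ) ≤ -(k : ℝ) := by
      have : (1 : ℤ) ≤ -k := by omega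
      exact_mod_cast this
    have := norm_tailOp_le hk1 hδ hC0 hC hz
    refine this.trans (mul_le_mul_of_nonneg_right (by linarith) (Real.exp_pos _).le)

theorem hasGrad_resOp (hδ : 0 ≤ δ) (hT : 0 < T) (hf : Tame T σ δ f) {k : ℤ} (hk : k ≠ 0) :
    HasGrad (fastDom T σ) (resOp σ k f) (fun i z =>
      if i = 4 then f z - σ.sg * k * resOp σ k f z else resOp σ k (pd T σ i f) z) := by
  by_cases h : 0 < k
  · have e : ∀ f, resOp σ k f = fwdOp σ k f := fun f => by ext z; simp [resOp, h]
    simp only [e]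
    refine (hasGrad_fwdOp hδ hT hf (by exact_mod_cast h.le)).congr_grad fun i z hz => ?_
    split_ifs
    · push_cast; ring
    · rfl
  · have e : ∀ f, resOp σ k f = fun z => -σ.sg * tailOp σ (-k) f z := fun f => by
      ext z; simp [resOp, h]
    have hk1 : (0 : ℝ) < -k + δ := by
      have : (0 : ℤ) < -k := by omega
      have : (0 : ℝ) < -k := by exact_mod_cast this
      linarith
    simp only [e]
    refine (((isKernel_tail T σ hk1).hasGrad hδ hT hf).const_mul (-σ.sg : ℂ)).congr_grad
      fun i z hz => ?_
    split_ifs with hi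
    · subst hi
      have h1 := tailOp_pd_normal hδ hT hf hk1 hz
      have hs : (σ.sg : ℂ) * σ.sg = 1 := by exact_mod_cast σ.sg_mul_sg
      simp only [tailOp] at h1 ⊢
      rw [h1]
      push_cast
      linear_combination (-f z) * hs
    · rfl

/-- The sum of the decaying solutions of the equations for the Fourier modes. -/
noncomputable def cauchyOp (σ : Side) (f : Pt → ℂ) : Pt → ℂ := fun z =>
  ∑' k : ℤ, if k = 0 then 0 else resOp σ k (mode k f) z

theorem cauchyOp_const_mul (f : Pt → ℂ) (c : ℂ) (z : Pt) :
    cauchyOp σ (fun z => c * f z) z = c * cauchyOp σ f z := by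
  have h : ∀ k, mode k (fun z => c * f z) = fun z => c * mode k f z := fun k =>
    funext fun z => mode_const_mul k f c z
  unfold cauchyOp
  rw [← tsum_mul_left]
  congr 1
  ext k
  split_ifs
  · rw [mul_zero]
  · rw [h, resOp_const_mul]

theorem norm_cauchyOp_term_le (hδ : 0 ≤ δ) (hδ2 : δ ≤ 1 / 2) (hT : 0 < T) (hf : Tame T σ δ f) :
    ∃ C, 0 ≤ C ∧ ∀ k : ℤ, ∀ z ∈ fastDom T σ,
      ‖(if k = 0 then 0 else resOp σ k (mode k f) z)‖
        ≤ C * (1 + (k : ℝ) ^ 2)⁻¹ * Real.exp (-δ * |z.2.2.1|) := by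
  obtain ⟨C, hC0, hC⟩ := norm_mode_le_inv_sq hδ hT hf
  refine ⟨2 * C, by positivity, fun k z hz => ?_⟩
  split_ifs with hk
  · rw [norm_zero]; positivity
  · rw [mul_assoc 2 C]
    exact norm_resOp_le hk hδ hδ2 (by positivity) (hC k) hz

theorem hasGrad_cauchyOp (hδ : 0 ≤ δ) (hδ2 : δ ≤ 1 / 2) (hT : 0 < T) (hf : Tame T σ δ f) :
    HasGrad (fastDom T σ) (cauchyOp σ f) (fun i z =>
      if i = 4 then f z - mode 0 f z + Complex.I * σ.sg * cauchyOp σ (pd T σ 5 f) z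
      else cauchyOp σ (pd T σ i f) z) := by
  obtain ⟨C, hC0, hC⟩ := norm_cauchyOp_term_le hδ hδ2 hT hf
  choose C' hC'0 hC' using fun i => norm_cauchyOp_term_le hδ hδ2 hT (hf.pd hT i)
  obtain ⟨C₂, hC₂0, hC₂⟩ := norm_mode_le_inv_sq hδ hT hf
  set M := C + (∑ i, C' i) + C₂ with hM
  have hsum : 0 ≤ ∑ i, C' i := Finset.sum_nonneg fun i _ => hC'0 i
  have hle : ∀ z : Pt, Real.exp (-δ * |z.2.2.1|) ≤ 1 := fun z =>
    Real.exp_le_one_iff.2 (by nlinarith [abs_nonneg z.2.2.1])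
  have hle' : ∀ (A B x : ℝ) (z : Pt), 0 ≤ x → 0 ≤ A → A ≤ B →
      A * x * Real.exp (-δ * |z.2.2.1|) ≤ B * x := by
    intro A B x z hx hA hAB
    calc _ ≤ A * x * 1 := mul_le_mul_of_nonneg_left (hle z) (by positivity)
      _ ≤ _ := by rw [mul_one]; exact mul_le_mul_of_nonneg_right hAB hx
  have hpos : ∀ k : ℤ, 0 ≤ (1 + (k : ℝ) ^ 2)⁻¹ := fun k => by positivity
  have hs : (σ.sg : ℂ) * σ.sg = 1 := by exact_mod_cast σ.sg_mul_sg
  -- The normal derivative of the k-th term contains the factor k. It is absorbed by writing -k φ_k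
  -- = i (i k φ_k) and moving i k onto the source, where it becomes the mode of ∂_θ f; no power of k
  -- is then lost in the series.
  have hgrad : ∀ k : ℤ, HasGrad (fastDom T σ)
      (fun z => if k = 0 then 0 else resOp σ k (mode k f) z)
      (fun i z => if i = 4 then (if k = 0 then 0 else mode k f z)
        + Complex.I * σ.sg * (if k = 0 then 0 else resOp σ k (mode k (pd T σ 5 f)) z)
        else (if k = 0 then 0 else resOp σ k (mode k (pd T σ i f)) z)) := by
    intro k
    by_cases hk : k = 0
    · simp only [hk, if_true, mul_zero, add_zero, ite_self]
      exact hasGrad_const _ 0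
    · simp only [hk, if_false]
      refine (hasGrad_resOp hδ hT (hf.mode hδ hT k) hk).congr_grad fun i z hz => ?_
      split_ifs with hi
      · rw [resOp_congr k (mode_pd_theta hδ hT hf k) hz, resOp_const_mul]
        linear_combination (k * σ.sg * resOp σ k (mode k f) z) * Complex.I_mul_I
      · exact resOp_congr k (fun w hw => (pd_mode hδ hT hf k i hw).symm) hz
  -- The bound is doubled because the normal derivative has two terms, the mode of `f` and the
  -- solution with source ∂_θ f.
  have key := HasGrad.tsum (convex_fastDom T σ) hgrad
    (b := fun k => M * (1 + (k : ℝ) ^ 2)⁻¹ + M * (1 + (k : ℝ) ^ 2)⁻¹)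
    ((summable_inv_one_add_sq.mul_left M).add (summable_inv_one_add_sq.mul_left M)) ?_ ?_
  · refine key.congr_grad fun i z hz => ?_
    simp only
    split_ifs with hi
    · have s1 : HasSum (fun k : ℤ => if k = 0 then 0 else mode k f z) (f z - mode 0 f z) := by
        have h1 := (hasSum_mode hδ hT hf hz).update 0 0
        have e : (fun k : ℤ => if k = 0 then 0 else mode k f z)
            = Function.update (fun k => mode k f z) 0 0 := by
          ext k; rw [Function.update_apply]
        rw [e, show f z - mode 0 f z = 0 - mode 0 f z + f z by ring]
        exact h1
      have s2 : Summable fun k : ℤ => if k = 0 then 0 else resOp σ k (mode k (pd T σ 5 f)) z :=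
        Summable.of_norm_bounded ((summable_inv_one_add_sq.mul_left (C' 5)).mul_right
          (Real.exp (-δ * |z.2.2.1|))) fun k => hC' 5 k z hz
      rw [s1.summable.tsum_add (s2.mul_left _), s1.tsum_eq, tsum_mul_left]
      rfl
    · rfl
  · intro k z hz
    have h1 := (hC k z hz).trans (hle' C M _ z (hpos k) hC0 (by linarith))
    have : 0 ≤ M * (1 + (k : ℝ) ^ 2)⁻¹ := mul_nonneg (by linarith) (hpos k)
    linarith
  · intro k i z hz
    have h1 : ∀ i, C' i ≤ M := fun i => by
      have := Finset.single_le_sum (fun j _ => hC'0 j) (Finset.mem_univ i)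
      linarith
    have h2 := fun i => (hC' i k z hz).trans (hle' (C' i) M _ z (hpos k) (hC'0 i) (h1 i))
    have h3 := (hC₂ k z hz).trans (hle' C₂ M _ z (hpos k) hC₂0 (by linarith))
    have h4 : 0 ≤ M * (1 + (k : ℝ) ^ 2)⁻¹ := mul_nonneg (by linarith) (hpos k)
    split_ifs with hi hk hk
    · simp only [mul_zero, add_zero, norm_zero]; linarith
    · have h5 := h2 5
      rw [if_neg hk] at h5
      refine (norm_add_le _ _).trans (add_le_add h3 ?_)
      rw [norm_mul, norm_mul, Complex.norm_I, one_mul, Complex.norm_real, Real.norm_eq_abs,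
        σ.abs_sg, one_mul]
      exact h5
    · rw [norm_zero]; linarith
    · have h5 := h2 i
      rw [if_neg hk] at h5
      linarith

theorem norm_cauchyOp_le (hδ : 0 ≤ δ) (hδ2 : δ ≤ 1 / 2) (hT : 0 < T) (hf : Tame T σ δ f) :
    ∃ C, ∀ z ∈ fastDom T σ, ‖cauchyOp σ f z‖ ≤ C * Real.exp (-δ * |z.2.2.1|) := by
  obtain ⟨C, hC0, hC⟩ := norm_cauchyOp_term_le hδ hδ2 hT hf
  refine ⟨∑' k : ℤ, C * (1 + (k : ℝ) ^ 2)⁻¹, fun z hz => ?_⟩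
  rw [← tsum_mul_right]
  exact tsum_of_norm_bounded ((summable_inv_one_add_sq.mul_left C).mul_right _).hasSum
    fun k => hC k z hz

theorem cauchyOp_periodic (hf : Tame T σ δ f) {v : Pt} (hv : v ∈ periods) {z : Pt}
    (hz : z ∈ fastDom T σ) : cauchyOp σ f (z + v) = cauchyOp σ f z := by
  unfold cauchyOp
  congr 1
  ext k
  split_ifs
  · rfl
  · have hv0 : v.2.2.1 = 0 := by rcases hv with rfl | rfl | rfl <;> simp [bas]
    have := resOp_translate (σ := σ) (T := T) k hv0 (f := mode k f) (c := 1) (fun w hw => by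
      rw [one_mul]; exact trOp_translate (isKernel_mode T σ δ k) (hf.per v hv) hw) hz
    rw [this, one_mul]

theorem Tame.cauchyOp (hδ : 0 ≤ δ) (hδ2 : δ ≤ 1 / 2) (hT : 0 < T) (hf : Tame T σ δ f) :
    Tame T σ δ (cauchyOp σ f) := by
  -- The normal derivative of `cauchyOp σ f` produces the local term `f` minus its mean, so the
  -- family closed under differentiation must contain the sums `cauchyOp σ f + g`.
  refine Tame.of_family hT (𝒜 := {a | ∃ f g, Tame T σ δ f ∧ Tame T σ δ g ∧
    a = fun z => FastProblem.cauchyOp σ f z + g z}) ?_ ?_ ?_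
    ⟨f, fun _ => 0, hf, Tame.zero, by simp⟩
  · rintro _ ⟨f, g, hf, hg, rfl⟩
    obtain ⟨C, hC⟩ := norm_cauchyOp_le hδ hδ2 hT hf
    obtain ⟨C', -, hC'⟩ := hg.bound_zero
    refine ⟨C + C', fun z hz => (norm_add_le _ _).trans ?_⟩
    rw [add_mul]
    exact add_le_add (hC z hz) (hC' z hz)
  · rintro _ ⟨f, g, hf, hg, rfl⟩ v hv z hz
    simp only
    rw [cauchyOp_periodic hf hv hz, hg.per v hv z hz]
  · rintro _ ⟨f, g, hf, hg, rfl⟩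
    refine ⟨_, fun i => ?_, (hasGrad_cauchyOp hδ hδ2 hT hf).add hg.hasGrad⟩
    by_cases hi : i = 4
    · refine ⟨fun z => Complex.I * σ.sg * FastProblem.pd T σ 5 f z,
        fun z => f z - FastProblem.mode 0 f z + FastProblem.pd T σ i g z,
        (hf.pd hT 5).const_mul hT _, (hf.sub hT (hf.mode hδ hT 0)).add hT (hg.pd hT i), ?_⟩
      ext z
      simp only [hi, if_true]
      rw [cauchyOp_const_mul]
      ring
    · exact ⟨_, _, hf.pd hT i, hg.pd hT i, by ext z; simp only [hi, if_false]⟩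

theorem cauchyOp_eq (hδ : 0 ≤ δ) (hδ2 : δ ≤ 1 / 2) (hT : 0 < T) (hf : Tame T σ δ f) {z : Pt}
    (hz : z ∈ fastDom T σ) : pd T σ 4 (FastProblem.cauchyOp σ f) z
      - Complex.I * σ.sg * pd T σ 5 (FastProblem.cauchyOp σ f) z = f z - mode 0 f z := by
  have h := hasGrad_cauchyOp hδ hδ2 hT hf
  rw [h.pd_eq hT 4 hz, h.pd_eq hT 5 hz]
  simp

/-- Along a θ-line the k-th summand varies like e^{ikθ}, because `resOp` commutes with θ-shifts. The
defining series is therefore a trigonometric series, and its coefficients can be read off. -/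
theorem mode_cauchyOp (hδ : 0 ≤ δ) (hδ2 : δ ≤ 1 / 2) (hT : 0 < T) (hf : Tame T σ δ f)
    (k : ℤ) {z : Pt} (hz : z ∈ fastDom T σ) : mode k (FastProblem.cauchyOp σ f) z
      = if k = 0 then 0 else resOp σ k (mode k f) z := by
  obtain ⟨C, hC0, hC⟩ := norm_cauchyOp_term_le hδ hδ2 hT hf
  refine mode_of_hasSum (a := fun k => if k = 0 then 0 else resOp σ k (mode k f) z) ?_ k
  intro θ
  have hz' := add_theta_mem θ hz
  have s2 : Summable fun k : ℤ => if k = 0 then 0 else resOp σ k (mode k f) (z + θ • bas 5) :=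
    Summable.of_norm_bounded ((summable_inv_one_add_sq.mul_left C).mul_right
      (Real.exp (-δ * |(z + θ • bas 5).2.2.1|))) fun k => hC k _ hz'
  have e : (fun k : ℤ => (if k = 0 then 0 else resOp σ k (mode k f) z)
      * Complex.exp (Complex.I * k * θ))
      = fun k : ℤ => if k = 0 then 0 else resOp σ k (mode k f) (z + θ • bas 5) := ?_
  · rw [e]; exact s2.hasSum
  ext k
  split_ifs
  · simp
  · rw [resOp_translate (σ := σ) (T := T) k (c := Complex.exp (Complex.I * k * θ))
      (by simp [bas]) (fun w hw => mode_add_theta hf.per k hw θ) hz, mul_comm]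

/-! ### Restriction to `Y₃ = 0` and functions independent of `Y₃` -/

theorem scaleY_zero_normal (z : Pt) : (scaleY 0 z).2.2.1 = 0 := by rw [scaleY_apply]; simp

theorem scaleY_zero_of_normal {z : Pt} (h : z.2.2.1 = 0) : scaleY 0 z = z := by
  rw [scaleY_apply, zero_mul, ← h]

theorem scaleY_zero_add_theta (z : Pt) (a : ℝ) : scaleY 0 (z + a • bas 5)
    = scaleY 0 z + a • bas 5 := by
  rw [add_smul_bas_five, add_smul_bas_five, scaleY_apply, scaleY_apply]

theorem scaleY_zero_add_period (z : Pt) {v : Pt} (hv : v ∈ periods) : scaleY 0 (z + v)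
    = scaleY 0 z + v := by
  rw [map_add]
  congr 1
  rcases hv with rfl | rfl | rfl <;> rw [scaleY_apply] <;> simp [bas]

theorem Tame.restrict (hδ : 0 ≤ δ) (hT : 0 < T) (hf : Tame T σ δ f) :
    Tame T σ 0 (fun z => f (scaleY 0 z)) := by
  refine Tame.of_op hT (δ' := δ) (fun f z => f (scaleY 0 z)) ?_ ?_ ?_ hf
  · intro f hf
    obtain ⟨C, -, hC⟩ := (hf.mono hδ).bound_zero
    refine ⟨C, fun z hz => ?_⟩
    simpa using hC _ (scaleY_mem le_rfl hz)
  · intro f hf v hv z hz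
    rw [scaleY_zero_add_period z hv, hf.per v hv _ (scaleY_mem le_rfl hz)]
  · intro f hf
    refine ⟨fun i z => (if i = 4 then 0 else 1) * FastProblem.pd T σ i f z, fun i => ?_, ?_⟩
    · exact (hf.pd hT i).const_mul hT _
    · refine (hf.hasGrad.comp_scaleY le_rfl).congr_grad fun i z hz => ?_
      simp

/-- The function does not depend on `Y₃`. -/
def NormalIndep (T : ℝ) (σ : Side) (f : Pt → ℂ) : Prop :=
  ∀ z ∈ fastDom T σ, f z = f (scaleY 0 z)

theorem eq_scaleY_zero_add {z : Pt} (hz : z ∈ fastDom T σ) :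
    z = scaleY 0 z + |z.2.2.1| • (σ.sg • bas 4) := by
  rw [Side.abs_eq (mem_fastDom.1 hz).2.2, smul_smul, add_smul_bas_four, scaleY_apply,
    show σ.sg * z.2.2.1 * σ.sg = z.2.2.1 by linear_combination z.2.2.1 * σ.sg_mul_sg]
  simp

theorem NormalIndep.add_normal (h : NormalIndep T σ f) {a : ℝ} (ha : 0 ≤ a) {z : Pt}
    (hz : z ∈ fastDom T σ) : f (z + a • (σ.sg • bas 4)) = f z := by
  rw [h _ (add_normal_mem ha hz), h z hz]
  congr 1
  rw [smul_smul, add_smul_bas_four, scaleY_apply, scaleY_apply]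
  simp

/-- Independence of Y₃ is invariance under translations away from the sheet, and partial derivatives
inherit such invariance even at the boundary. -/
theorem NormalIndep.pd (hT : 0 < T) (h : NormalIndep T σ f)
    (hf : ContDiffOn ℝ ∞ f (fastDom T σ)) (i : Fin 6) : NormalIndep T σ (pd T σ i f) := by
  intro z hz
  conv_lhs => rw [eq_scaleY_zero_add hz]
  exact pd_translate hT hf (fun w hw => add_normal_mem (abs_nonneg _) hw)
    (fun w hw => h.add_normal (abs_nonneg _) hw) i _ (scaleY_mem le_rfl hz)

theorem NormalIndep.pd_normal (hT : 0 < T) (h : NormalIndep T σ f)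
    (hf : ContDiffOn ℝ ∞ f (fastDom T σ)) {z : Pt} (hz : z ∈ fastDom T σ) :
    FastProblem.pd T σ 4 f z = 0 := by
  have h1 := ((hasGrad_pd hf).comp_scaleY (σ := σ) (T := T) le_rfl).congr
    (f' := f) (fun w hw => h w hw)
  rw [h1.pd_eq hT 4 hz]
  simp

theorem exists_period_reduction (z : Pt) : ∃ m n l : ℤ,
    (z.1.2.1 - m * (2 * Real.pi) ∈ Icc 0 (2 * Real.pi)) ∧
    (z.1.2.2 - n * (2 * Real.pi) ∈ Icc 0 (2 * Real.pi)) ∧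
    (z.2.2.2 - l * (2 * Real.pi) ∈ Icc 0 (2 * Real.pi)) := by
  have hp : (0 : ℝ) < 2 * Real.pi := by positivity
  have key : ∀ x : ℝ, ∃ m : ℤ, x - m * (2 * Real.pi) ∈ Icc 0 (2 * Real.pi) := by
    intro x
    refine ⟨⌊x / (2 * Real.pi)⌋, ?_, ?_⟩
    · have := (le_div_iff₀ hp).1 (Int.floor_le (x / (2 * Real.pi)))
      linarith
    · have := (div_lt_iff₀ hp).1 (Int.lt_floor_add_one (x / (2 * Real.pi)))
      linarith
  obtain ⟨m, hm⟩ := key z.1.2.1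
  obtain ⟨n, hn⟩ := key z.1.2.2
  obtain ⟨l, hl⟩ := key z.2.2.2
  exact ⟨m, n, l, hm, hn, hl⟩

theorem add_int_smul_period {v : Pt} (hv : v ∈ periods)
    (hp : ∀ v ∈ periods, ∀ z ∈ fastDom T σ, f (z + v) = f z) (m : ℤ) {z : Pt}
    (hz : z ∈ fastDom T σ) : z + m • v ∈ fastDom T σ ∧ f (z + m • v) = f z := by
  have hmem : ∀ m : ℤ, z + m • v ∈ fastDom T σ := by
    intro m
    rcases hv with rfl | rfl | rfl <;> rw [← Int.cast_smul_eq_zsmul ℝ, smul_smul]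
    · rw [add_smul_bas_one]; rw [mem_fastDom, mem_baseDom] at *; exact hz
    · rw [add_smul_bas_two]; rw [mem_fastDom, mem_baseDom] at *; exact hz
    · exact add_theta_mem _ hz
  refine ⟨hmem m, ?_⟩
  induction m using Int.induction_on with
  | zero => simp
  | succ m ih =>
    rw [add_smul, one_smul, ← add_assoc, hp v hv _ (hmem _), ih]
  | pred m ih =>
    rw [← ih]
    have := hp v hv _ (hmem (-m - 1))
    rw [← this]
    congr 1
    rw [sub_smul, one_smul]; abel

/-- Projection to Y₃ = 0 and subtraction of integer multiples of the periods move every point into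
one compact box without changing the value of the function. -/
theorem bounded_of_periodic (hc : ContinuousOn f (fastDom T σ))
    (hp : ∀ v ∈ periods, ∀ z ∈ fastDom T σ, f (z + v) = f z) (hi : NormalIndep T σ f) :
    ∃ C, ∀ z ∈ fastDom T σ, ‖f z‖ ≤ C := by
  set K : Set Pt := (Icc 0 T ×ˢ (Icc 0 (2 * Real.pi) ×ˢ Icc 0 (2 * Real.pi))) ×ˢ
    (σ.slowClosed ×ˢ ({0} ×ˢ Icc 0 (2 * Real.pi))) with hK
  have hKc : IsCompact K := by
    refine (isCompact_Icc.prod (isCompact_Icc.prod isCompact_Icc)).prod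
      (IsCompact.prod ?_ (isCompact_singleton.prod isCompact_Icc))
    cases σ <;> exact isCompact_Icc
  have hKD : K ⊆ fastDom T σ := by
    rintro z ⟨⟨h1, h2⟩, h3, h4, h5⟩
    rw [mem_fastDom, mem_baseDom]
    refine ⟨h1, h3, ?_⟩
    rw [mem_singleton_iff.1 h4]
    exact σ.zero_mem_fastClosed
  obtain ⟨C, hC⟩ := hKc.exists_bound_of_continuousOn (hc.mono hKD)
  refine ⟨C, fun z hz => ?_⟩
  obtain ⟨m, n, l, hm, hn, hl⟩ := exists_period_reduction z
  have h0 := scaleY_mem le_rfl hz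
  obtain ⟨k1, e1⟩ := add_int_smul_period (v := (2 * Real.pi) • bas 1) (by simp [periods]) hp (-m) h0
  obtain ⟨k2, e2⟩ := add_int_smul_period (v := (2 * Real.pi) • bas 2) (by simp [periods]) hp (-n) k1
  obtain ⟨k3, e3⟩ := add_int_smul_period (v := (2 * Real.pi) • bas 5) (by simp [periods]) hp (-l) k2
  rw [hi z hz, ← e1, ← e2, ← e3]
  refine hC _ ?_
  simp only [← Int.cast_smul_eq_zsmul ℝ, smul_smul, add_smul_bas_one, add_smul_bas_two,
    add_smul_bas_five, scaleY_apply]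
  have hz' := mem_fastDom.1 hz
  rw [mem_baseDom] at hz'
  refine ⟨⟨hz'.1, ?_, ?_⟩, hz'.2.1, by simp, ?_⟩
  · show z.1.2.1 + ((-m : ℤ) : ℝ) * (2 * Real.pi) ∈ _
    push_cast; convert hm using 1; ring
  · show z.1.2.2 + ((-n : ℤ) : ℝ) * (2 * Real.pi) ∈ _
    push_cast; convert hn using 1; ring
  · show z.2.2.2 + ((-l : ℤ) : ℝ) * (2 * Real.pi) ∈ _
    push_cast; convert hl using 1; ring

/-- Smooth periodic functions independent of Y₃ form a class closed under differentiation, and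
compactness bounds each member. Hence slow profiles and boundary data need no estimate as a
hypothesis. -/
theorem Tame.of_normalIndep (hT : 0 < T) (hf : ContDiffOn ℝ ∞ f (fastDom T σ))
    (hp : ∀ v ∈ periods, ∀ z ∈ fastDom T σ, f (z + v) = f z) (hi : NormalIndep T σ f) :
    Tame T σ 0 f := by
  refine Tame.of_family hT (𝒜 := {f | ContDiffOn ℝ ∞ f (fastDom T σ) ∧
    (∀ v ∈ periods, ∀ z ∈ fastDom T σ, f (z + v) = f z) ∧ NormalIndep T σ f}) ?_ ?_ ?_ ⟨hf, hp, hi⟩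
  · rintro f ⟨hf, hp, hi⟩
    obtain ⟨C, hC⟩ := bounded_of_periodic hf.continuousOn hp hi
    exact ⟨C, fun z hz => by simpa using hC z hz⟩
  · exact fun f h => h.2.1
  · rintro f ⟨hf, hp, hi⟩
    exact ⟨_, fun i => ⟨contDiffOn_pd hT hf i, fun v hv => pd_translate hT hf
      (fun z hz => add_period_mem hv hz) (hp v hv) i, hi.pd hT hf i⟩, hasGrad_pd hf⟩

/-- The function `e^{-|Y₃|}`. -/
noncomputable def expY (σ : Side) : Pt → ℂ := fun z => Complex.exp (-(σ.sg * z.2.2.1))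

theorem tame_expY (hT : 0 < T) : Tame T σ 1 (expY σ) := by
  refine Tame.of_family hT (𝒜 := {a | ∃ c : ℂ, a = fun z => c * expY σ z}) ?_ ?_ ?_
    ⟨1, by simp⟩
  · rintro _ ⟨c, rfl⟩
    refine ⟨‖c‖, fun z hz => ?_⟩
    rw [norm_mul, expY, show -((σ.sg : ℂ) * z.2.2.1) = ((-(σ.sg * z.2.2.1) : ℝ) : ℂ) by
      push_cast; ring, Complex.norm_exp_ofReal, Side.abs_eq (mem_fastDom.1 hz).2.2, neg_one_mul]
  · rintro _ ⟨c, rfl⟩ v hv z hz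
    have hv0 : v.2.2.1 = 0 := by rcases hv with rfl | rfl | rfl <;> simp [bas]
    simp [expY, hv0]
  · rintro _ ⟨c, rfl⟩
    refine ⟨fun i z => (if i = 4 then -c * σ.sg else 0) * expY σ z, fun i => ⟨_, rfl⟩, ?_⟩
    have h1 := hasGrad_normal (fastDom T σ) (h := fun Y : ℝ => Complex.exp (-(σ.sg * Y)))
      (h' := fun Y => -σ.sg * Complex.exp (-(σ.sg * Y))) (fun Y => by
        have h0 : HasDerivAt (fun Y : ℝ => (Y : ℂ)) 1 Y := Complex.ofRealCLM.hasDerivAt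
        exact ((h0.const_mul (σ.sg : ℂ)).fun_neg.cexp).congr_deriv (by ring))
    refine (h1.const_mul c).congr_grad fun i z _ => ?_
    simp only [expY]
    split_ifs <;> ring

/-! ### More on Fourier modes -/

theorem mode_mul_left (k : ℤ) {z : Pt} (h : ∀ a : ℝ, g (z + a • bas 5) = g z) :
    mode k (fun z => g z * f z) z = g z * mode k f z := by
  unfold mode trOp
  rw [← integral_const_mul]
  congr 1
  ext a
  show modeKer k a * (g (z + a • bas 5) * f (z + a • bas 5)) = _
  rw [h a]
  ring

theorem mode_comp_scaleY (k : ℤ) (z : Pt) :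
    mode k (fun z => f (scaleY 0 z)) z = mode k f (scaleY 0 z) := by
  unfold mode trOp
  simp only [scaleY_zero_add_theta]

/-- Conjugation exchanges the frequencies k and -k. Reality of functions is always expressed through
this relation. -/
theorem mode_star (k : ℤ) (z : Pt) :
    mode k (fun z => starRingEnd ℂ (f z)) z = starRingEnd ℂ (mode (-k) f z) := by
  unfold mode trOp
  rw [← integral_conj]
  congr 1
  ext a
  rw [map_mul]
  congr 1
  simp only [modeKer, map_mul, ← Complex.exp_conj, map_neg, Complex.conj_I, Complex.conj_ofReal,
    map_inv₀, map_ofNat, map_intCast]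
  push_cast
  ring_nf

theorem Tame.star (hT : 0 < T) (hf : Tame T σ δ f) :
    Tame T σ δ (fun z => starRingEnd ℂ (f z)) :=
  hf.clm hT (Complex.conjCLE : ℂ →L[ℝ] ℂ)

theorem mode_re (hT : 0 < T) (hf : Tame T σ δ f) (k : ℤ) {z : Pt} (hz : z ∈ fastDom T σ) :
    mode k (fun z => ((f z).re : ℂ)) z
      = (mode k f z + starRingEnd ℂ (mode (-k) f z)) / 2 := by
  have e : (fun z => ((f z).re : ℂ))
      = fun z => (1 / 2 : ℂ) * (f z + starRingEnd ℂ (f z)) := by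
    ext z; rw [Complex.add_conj]; push_cast; ring
  rw [e, mode_const_mul, mode_add k hf (hf.star hT) hz]
  simp only
  rw [mode_star]
  ring

/-! ### Linear equations in the normal variable -/

/-- Multiplied by the integrating factor e^{-cb}, the function has zero right derivative along the
ray away from the sheet, hence is constant there. -/
theorem eq_exp_mul_of_pd_normal (hf : Tame T σ δ f) {c : ℝ}
    (h : ∀ z ∈ fastDom T σ, pd T σ 4 f z = σ.sg * c * f z) {z : Pt} (hz : z ∈ fastDom T σ)
    {b : ℝ} (hb : 0 ≤ b) : f (z + b • (σ.sg • bas 4)) = Complex.exp (c * b) * f z := by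
  set u : ℝ → ℂ := fun b => Complex.exp (-(c * b)) * f (z + b • (σ.sg • bas 4)) with hu
  have hs : (σ.sg : ℂ) * σ.sg = 1 := by exact_mod_cast σ.sg_mul_sg
  have hE : ∀ x : ℝ, HasDerivAt (fun b : ℝ => Complex.exp (-(c * b)))
      (-c * Complex.exp (-(c * x))) x := by
    intro x
    have h0 : HasDerivAt (fun Y : ℝ => (Y : ℂ)) 1 x := Complex.ofRealCLM.hasDerivAt
    exact ((h0.const_mul (c : ℂ)).fun_neg.cexp).congr_deriv (by ring)
  have hd : ∀ x ∈ Ico 0 b, HasDerivWithinAt u 0 (Ici x) x := by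
    intro x hx
    have h1 := (hf.hasGrad.hasDerivWithinAt_normal hz hx.1).mono (Ici_subset_Ici.2 hx.1)
    refine ((hE x).hasDerivWithinAt.mul h1).congr_deriv ?_
    rw [h _ (add_normal_mem hx.1 hz)]
    linear_combination (c * Complex.exp (-(c * x)) * f (z + x • (σ.sg • bas 4))) * hs
  have hc : ContinuousOn u (Icc 0 b) := by
    refine ContinuousOn.mul (by fun_prop) ?_
    exact (continuousOn_normal hf.continuousOn hz).mono Icc_subset_Ici_self
  have h2 := constant_of_has_deriv_right_zero hc hd b (right_mem_Icc.2 hb)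
  simp only [hu, Complex.ofReal_zero, mul_zero, neg_zero, Complex.exp_zero, one_mul, zero_smul,
    add_zero] at h2
  rw [← h2, ← mul_assoc, ← Complex.exp_add]
  simp

/-- A nonzero value would grow like e^{cb} away from the sheet, against boundedness. This excludes
the growing exponentials, both in the extension below and in the homogeneous problem. -/
theorem eq_zero_of_pd_normal (hδ : 0 ≤ δ) (hf : Tame T σ δ f) {c : ℝ} (hc : 0 < c)
    (h : ∀ z ∈ fastDom T σ, pd T σ 4 f z = σ.sg * c * f z) {z : Pt} (hz : z ∈ fastDom T σ) :
    f z = 0 := by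
  obtain ⟨C, -, hC⟩ := (hf.mono hδ).bound_zero
  have h1 : ∀ b : ℝ, 0 ≤ b → Real.exp (c * b) * ‖f z‖ ≤ C := by
    intro b hb
    have h2 := hC _ (add_normal_mem hb hz)
    rw [eq_exp_mul_of_pd_normal hf h hz hb, norm_mul, ← Complex.ofReal_mul,
      Complex.norm_exp_ofReal] at h2
    simpa using h2
  by_contra hne
  have hpos : 0 < ‖f z‖ := norm_pos_iff.2 hne
  have h3 : Tendsto (fun b : ℝ => Real.exp (c * b) * ‖f z‖) atTop atTop :=
    (Real.tendsto_exp_atTop.comp (tendsto_id.const_mul_atTop hc)).atTop_mul_const hpos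
  obtain ⟨b, hb, hb'⟩ := ((eventually_ge_atTop 0).and (h3.eventually_gt_atTop C)).exists
  exact absurd (h1 b hb) (not_le.2 hb')

/-! ### The Cauchy–Riemann system on the half-line -/

theorem pd_re (hT : 0 < T) (hf : Tame T σ δ f) (c : ℂ) (i : Fin 6) {z : Pt}
    (hz : z ∈ fastDom T σ) :
    pd T σ i (fun z => ((c * f z).re : ℂ)) z = ((c * pd T σ i f z).re : ℂ) :=
  ((hf.hasGrad.const_mul c).clm (Complex.ofRealCLM.comp Complex.reCLM)).pd_eq hT i hz

theorem pd_sub (hT : 0 < T) (hf : ContDiffOn ℝ ∞ f (fastDom T σ))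
    (hg : ContDiffOn ℝ ∞ g (fastDom T σ)) (i : Fin 6) :
    EqOn (pd T σ i fun z => f z - g z) (fun z => pd T σ i f z - pd T σ i g z) (fastDom T σ) := by
  intro z hz
  have := ((hasGrad_pd hf).add ((hasGrad_pd hg).const_mul (-1))).pd_eq hT i hz
  simpa [sub_eq_add_neg] using this

/-- Decaying solutions of the homogeneous equation with prescribed real part at `Y₃ = 0`. -/
theorem exists_holomorphic_extension (hδ : 0 ≤ δ) (hδ2 : δ ≤ 1 / 2) (hT : 0 < T)
    (hg : Tame T σ 0 g) (hg0 : ∀ z ∈ fastDom T σ, mode 0 g z = 0) :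
    ∃ A, Tame T σ δ A ∧ (∀ z ∈ fastDom T σ, pd T σ 4 A z = Complex.I * σ.sg * pd T σ 5 A z) ∧
      (∀ z ∈ fastDom T σ, mode 0 A z = 0) ∧
      ∀ z ∈ fastDom T σ, z.2.2.1 = 0 → (A z).re = (g z).re := by
  set e : Pt → ℂ := fun z => ((g z).re : ℂ) with he
  have hte : Tame T σ 0 e := hg.re hT
  have he0 : ∀ z ∈ fastDom T σ, mode 0 e z = 0 := fun z hz => by
    rw [he, mode_re hT hg 0 hz, neg_zero, hg0 z hz]; simp
  have hestar : ∀ k, ∀ z ∈ fastDom T σ, starRingEnd ℂ (mode (-k) e z) = mode k e z := by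
    intro k z hz
    rw [he, mode_re hT hg k hz, mode_re hT hg (-k) hz]
    simp only [map_div₀, map_add, neg_neg, Complex.conj_conj, map_ofNat]
    ring
  have hEθ : ∀ (z : Pt) (a : ℝ), expY σ (z + a • bas 5) = expY σ z := fun z a => by
    rw [add_smul_bas_five]; rfl
  -- `Φ` is any decaying function with the right trace. The solution is obtained by subtracting
  -- `cauchyOp` of its defect `h`; the correction has no positive modes at Y₃ = 0.
  set Φ : Pt → ℂ := fun z => expY σ z * e z with hΦ
  have htΦ : Tame T σ δ Φ := ((tame_expY hT).mul hT hte).mono (by linarith)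
  have hmΦ : ∀ k z, mode k Φ z = expY σ z * mode k e z := fun k z =>
    mode_mul_left k (hEθ z)
  set h : Pt → ℂ := fun z => pd T σ 4 Φ z - Complex.I * σ.sg * pd T σ 5 Φ z with hh
  have hth : Tame T σ δ h := (htΦ.pd hT 4).sub hT ((htΦ.pd hT 5).const_mul hT _)
  have hh0 : ∀ z ∈ fastDom T σ, mode 0 h z = 0 := by
    intro z hz
    rw [hh, mode_sub 0 hT (htΦ.pd hT 4) ((htΦ.pd hT 5).const_mul hT _) hz]
    simp only
    rw [mode_const_mul, mode_pd_theta hδ hT htΦ 0 hz, ← pd_mode hδ hT htΦ 0 4 hz]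
    have : EqOn (mode 0 Φ) (fun _ => 0) (fastDom T σ) := fun w hw => by
      rw [hmΦ, he0 w hw, mul_zero]
    rw [pd_congr 4 this hz, (hasGrad_const _ 0).pd_eq hT 4 hz]
    simp
  set A : Pt → ℂ := fun z => Φ z - cauchyOp σ h z with hA
  have htC := hth.cauchyOp hδ hδ2 hT
  have htA : Tame T σ δ A := htΦ.sub hT htC
  have hAeq : ∀ z ∈ fastDom T σ, pd T σ 4 A z = Complex.I * σ.sg * pd T σ 5 A z := by
    intro z hz
    have h1 := cauchyOp_eq hδ hδ2 hT hth hz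
    rw [hA, pd_sub hT htΦ.smooth htC.smooth 4 hz, pd_sub hT htΦ.smooth htC.smooth 5 hz]
    rw [hh0 z hz] at h1
    simp only [hh] at h1 ⊢
    linear_combination -h1
  have hmA : ∀ k, ∀ z ∈ fastDom T σ, mode k A z
      = mode k Φ z - (if k = 0 then 0 else resOp σ k (mode k h) z) := by
    intro k z hz
    rw [hA, mode_sub k hT htΦ htC hz, ← mode_cauchyOp hδ hδ2 hT hth k hz]
  have hmA0 : ∀ z ∈ fastDom T σ, mode 0 A z = 0 := by
    intro z hz
    rw [hmA 0 z hz, hmΦ, he0 z hz]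
    simp
  -- A homogeneous solution with k < 0 would be a growing exponential, so these modes vanish.
  have hmAneg : ∀ k : ℤ, k < 0 → ∀ z ∈ fastDom T σ, mode k A z = 0 := by
    intro k hk z hz
    refine eq_zero_of_pd_normal hδ (htA.mode hδ hT k) (c := -k) (by
      have : (0 : ℤ) < -k := by omega
      exact_mod_cast this) (fun w hw => ?_) hz
    rw [pd_mode hδ hT htA k 4 hw, mode_congr k (fun z hz => hAeq z hz) hw, mode_const_mul,
      mode_pd_theta hδ hT htA k hw]
    push_cast
    linear_combination (σ.sg * k * mode k A w) * Complex.I_mul_I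
  have hmApos : ∀ k : ℤ, 0 < k → ∀ z ∈ fastDom T σ, z.2.2.1 = 0 → mode k A z = mode k e z := by
    intro k hk z hz h0
    rw [hmA k z hz, hmΦ, if_neg hk.ne', resOp, if_pos hk, fwdOp_of_normal_eq_zero h0]
    simp [expY, h0]
  have h2A := htA.const_mul hT 2
  -- Twice, because `A` carries only the positive half of the spectrum of the real function `e`: the
  -- real part of 2 ∑_{k>0} e_k restores both halves when the mean is 0.
  refine ⟨fun z => 2 * A z, h2A, ?_, ?_, ?_⟩
  · intro z hz
    rw [pd_const_mul hT htA.smooth 2 4 hz, pd_const_mul hT htA.smooth 2 5 hz]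
    simp only
    rw [hAeq z hz]; ring
  · intro z hz
    rw [mode_const_mul, hmA0 z hz, mul_zero]
  · intro z hz h0
    have hr := (h2A.re hT).restrict hδ hT
    have key : (fun z => (((2 * A (scaleY 0 z)).re : ℂ)) - e z) z = 0 := by
      refine eq_zero_of_mode_eq_zero le_rfl hT (hr.sub hT hte) hz fun k => ?_
      rw [mode_sub k hT hr hte hz]
      simp only
      rw [mode_comp_scaleY (f := fun z => ((2 * A z).re : ℂ)), scaleY_zero_of_normal h0,
        mode_re hT h2A k hz, mode_const_mul, mode_const_mul, map_mul, map_ofNat]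
      rcases lt_trichotomy k 0 with hk | hk | hk
      · rw [hmAneg k hk z hz, hmApos (-k) (by omega) z hz h0, hestar k z hz]; ring
      · subst hk
        rw [neg_zero, hmA0 z hz, he0 z hz]; simp
      · rw [hmApos k hk z hz h0, hmAneg (-k) (by omega) z hz]; simp
    simp only [scaleY_zero_of_normal h0, he] at key
    have := sub_eq_zero.1 key
    exact_mod_cast this

/-- For real data the two equations are the real and imaginary parts of ∂_Y φ - (±i) ∂_θ φ = S -
(±i) F with φ = w ∓ i q. A particular solution is `cauchyOp`; a homogeneous one corrects the real
part at Y₃ = 0. -/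
theorem exists_cauchyRiemann_re (hδ : 0 ≤ δ) (hδ2 : δ ≤ 1 / 2) (hT : 0 < T) {F S d : Pt → ℂ}
    (hF : Tame T σ δ F) (hS : Tame T σ δ S) (hd : Tame T σ 0 d)
    (hF0 : ∀ z ∈ fastDom T σ, mode 0 F z = 0) (hS0 : ∀ z ∈ fastDom T σ, mode 0 S z = 0)
    (hd0 : ∀ z ∈ fastDom T σ, mode 0 d z = 0) :
    ∃ q w, Tame T σ δ q ∧ Tame T σ δ w ∧
      (∀ z ∈ fastDom T σ, pd T σ 4 q z + pd T σ 5 w z = (F z).re) ∧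
      (∀ z ∈ fastDom T σ, pd T σ 4 w z - pd T σ 5 q z = (S z).re) ∧
      (∀ z ∈ fastDom T σ, z.2.2.1 = 0 → w z = (d z).re) ∧
      (∀ z ∈ fastDom T σ, mode 0 q z = 0) ∧ (∀ z ∈ fastDom T σ, mode 0 w z = 0) := by
  have hre0 : ∀ {f : Pt → ℂ} {δ : ℝ}, Tame T σ δ f → (∀ z ∈ fastDom T σ, mode 0 f z = 0) →
      ∀ z ∈ fastDom T σ, mode 0 (fun z => ((f z).re : ℂ)) z = 0 := by
    intro f δ hf h z hz
    rw [mode_re hT hf 0 hz, neg_zero, h z hz]; simp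
  set h : Pt → ℂ := fun z => ((S z).re : ℂ) - Complex.I * σ.sg * ((F z).re : ℂ) with hh
  have hth : Tame T σ δ h := (hS.re hT).sub hT ((hF.re hT).const_mul hT _)
  have hh0 : ∀ z ∈ fastDom T σ, mode 0 h z = 0 := by
    intro z hz
    rw [hh, mode_sub 0 hT (hS.re hT) ((hF.re hT).const_mul hT _) hz]
    simp only
    rw [mode_const_mul, hre0 hF hF0 z hz, hre0 hS hS0 z hz]; simp
  set K := cauchyOp σ h with hK
  have htK : Tame T σ δ K := hth.cauchyOp hδ hδ2 hT
  have hK0 : ∀ z ∈ fastDom T σ, mode 0 K z = 0 := fun z hz => by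
    rw [hK, mode_cauchyOp hδ hδ2 hT hth 0 hz, if_pos rfl]
  have hdr := hd.restrict le_rfl hT
  have hKr := htK.restrict hδ hT
  obtain ⟨A, htA, hA1, hA0, hA2⟩ := exists_holomorphic_extension (σ := σ) hδ hδ2 hT
    (hdr.sub hT hKr) (fun z hz => by
      rw [mode_sub 0 hT hdr hKr hz]
      simp only
      rw [mode_comp_scaleY, mode_comp_scaleY, hd0 _ (scaleY_mem le_rfl hz),
        hK0 _ (scaleY_mem le_rfl hz), sub_zero])
  have htφ := htK.add hT htA
  set φ : Pt → ℂ := fun z => K z + A z with hφ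
  have hφ0 : ∀ z ∈ fastDom T σ, mode 0 φ z = 0 := fun z hz => by
    rw [hφ, mode_add 0 htK htA hz]
    simp only
    rw [hK0 z hz, hA0 z hz, add_zero]
  have hφeq : ∀ z ∈ fastDom T σ, pd T σ 4 φ z = Complex.I * σ.sg * pd T σ 5 φ z + h z := by
    intro z hz
    have h1 := cauchyOp_eq hδ hδ2 hT hth hz
    rw [hφ, pd_add hT htK.smooth htA.smooth 4 hz, pd_add hT htK.smooth htA.smooth 5 hz]
    rw [hh0 z hz] at h1
    simp only
    rw [hA1 z hz]
    linear_combination h1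
  have hq := htφ.const_mul hT (σ.sg * Complex.I)
  have hw := htφ.const_mul hT 1
  have hs : (σ.sg : ℂ) * σ.sg = 1 := by exact_mod_cast σ.sg_mul_sg
  have hs' := σ.sg_mul_sg
  refine ⟨fun z => ((σ.sg * Complex.I * φ z).re : ℂ), fun z => ((1 * φ z).re : ℂ), hq.re hT,
    hw.re hT, ?_, ?_, ?_, ?_, ?_⟩
  · intro z hz
    rw [pd_re hT htφ _ 4 hz, pd_re hT htφ _ 5 hz, hφeq z hz, ← Complex.ofReal_add]
    congr 1
    simp only [hh, Complex.mul_re, Complex.mul_im, Complex.add_re, Complex.add_im, Complex.sub_re,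
      Complex.sub_im, Complex.I_re, Complex.I_im, Complex.ofReal_re, Complex.ofReal_im,
      Complex.one_re, Complex.one_im]
    linear_combination (-(pd T σ 5 φ z).re + (F z).re) * hs'
  · intro z hz
    rw [pd_re hT htφ _ 4 hz, pd_re hT htφ _ 5 hz, hφeq z hz, ← Complex.ofReal_sub]
    congr 1
    simp only [hh, Complex.mul_re, Complex.mul_im, Complex.add_re, Complex.add_im, Complex.sub_re,
      Complex.sub_im, Complex.I_re, Complex.I_im, Complex.ofReal_re, Complex.ofReal_im,
      Complex.one_re, Complex.one_im]
    ring
  · intro z hz h0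
    have := hA2 z hz h0
    simp only [scaleY_zero_of_normal h0, Complex.sub_re] at this
    simp only [hφ, one_mul, Complex.add_re]
    rw [this]
    congr 1
    ring
  · refine hre0 hq fun z hz => ?_
    rw [mode_const_mul, hφ0 z hz, mul_zero]
  · refine hre0 hw fun z hz => ?_
    rw [mode_const_mul, hφ0 z hz, mul_zero]

/-- The Cauchy–Riemann system with prescribed values of `w` at `Y₃ = 0`. -/
theorem exists_cauchyRiemann (hδ : 0 ≤ δ) (hδ2 : δ ≤ 1 / 2) (hT : 0 < T) {F S d : Pt → ℂ}
    (hF : Tame T σ δ F) (hS : Tame T σ δ S) (hd : Tame T σ 0 d)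
    (hF0 : ∀ z ∈ fastDom T σ, mode 0 F z = 0) (hS0 : ∀ z ∈ fastDom T σ, mode 0 S z = 0)
    (hd0 : ∀ z ∈ fastDom T σ, mode 0 d z = 0) :
    ∃ q w, Tame T σ δ q ∧ Tame T σ δ w ∧
      (∀ z ∈ fastDom T σ, pd T σ 4 q z + pd T σ 5 w z = F z) ∧
      (∀ z ∈ fastDom T σ, pd T σ 4 w z - pd T σ 5 q z = S z) ∧
      (∀ z ∈ fastDom T σ, z.2.2.1 = 0 → w z = d z) ∧
      (∀ z ∈ fastDom T σ, mode 0 q z = 0) ∧ (∀ z ∈ fastDom T σ, mode 0 w z = 0) := by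
  obtain ⟨q, w, hq, hw, h1, h2, h3, h4, h5⟩ := exists_cauchyRiemann_re hδ hδ2 hT hF hS hd hF0 hS0 hd0
  have hm : ∀ {f : Pt → ℂ}, (∀ z ∈ fastDom T σ, mode 0 f z = 0) →
      ∀ z ∈ fastDom T σ, mode 0 (fun z => -Complex.I * f z) z = 0 := fun h z hz => by
    rw [mode_const_mul, h z hz, mul_zero]
  -- The real and imaginary parts of complex data are treated separately: Im x = Re(-i x), and the
  -- system is linear with real coefficients.
  obtain ⟨q', w', hq', hw', h1', h2', h3', h4', h5'⟩ := exists_cauchyRiemann_re hδ hδ2 hT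
    (hF.const_mul hT (-Complex.I)) (hS.const_mul hT (-Complex.I)) (hd.const_mul hT (-Complex.I))
    (hm hF0) (hm hS0) (hm hd0)
  have hsplit : ∀ x : ℂ, (x.re : ℂ) + Complex.I * ((-Complex.I * x).re : ℂ) = x := by
    intro x
    apply Complex.ext <;> simp
  have hqI := hq'.const_mul hT Complex.I
  have hwI := hw'.const_mul hT Complex.I
  refine ⟨fun z => q z + Complex.I * q' z, fun z => w z + Complex.I * w' z,
    hq.add hT hqI, hw.add hT hwI, ?_, ?_, ?_, ?_, ?_⟩
  · intro z hz
    rw [pd_add hT hq.smooth hqI.smooth 4 hz, pd_add hT hw.smooth hwI.smooth 5 hz]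
    simp only
    rw [pd_const_mul hT hq'.smooth _ 4 hz, pd_const_mul hT hw'.smooth _ 5 hz, ← hsplit (F z),
      ← h1 z hz, ← h1' z hz]
    ring
  · intro z hz
    rw [pd_add hT hw.smooth hwI.smooth 4 hz, pd_add hT hq.smooth hqI.smooth 5 hz]
    simp only
    rw [pd_const_mul hT hw'.smooth _ 4 hz, pd_const_mul hT hq'.smooth _ 5 hz, ← hsplit (S z),
      ← h2 z hz, ← h2' z hz]
    ring
  · intro z hz h0
    simp only
    rw [h3 z hz h0, h3' z hz h0, hsplit]
  · intro z hz
    rw [mode_add 0 hq hqI hz]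
    simp only
    rw [mode_const_mul, h4 z hz, h4' z hz]; simp
  · intro z hz
    rw [mode_add 0 hw hwI hz]
    simp only
    rw [mode_const_mul, h5 z hz, h5' z hz]; simp

/-! ### Real functions of the variables `(t, y), y₃, Y₃, θ` -/

/-- A real function seen as a complex function on the space of points. -/
def lft (f : FastFun) : Pt → ℂ := fun z => (f z.1 z.2.1 z.2.2.1 z.2.2.2 : ℂ)

/-- Functions that do not depend on `Y₃`. -/
def ofSlow (r : SlowFun) : FastFun := fun p y₃ _ θ => r p y₃ θ

/-- Functions that do not depend on `y₃` and `Y₃`. -/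
def ofBdry (r : BdryFun) : FastFun := fun p _ _ θ => r p θ

theorem IsSurface.tame (hT : 0 < T) {f : FastFun} (hf : IsSurface T σ f) :
    ∃ δ > 0, Tame T σ δ (lft f) := by
  obtain ⟨δ, hδ, hb⟩ := hf.decay
  refine ⟨δ, hδ, Complex.ofRealCLM.contDiff.comp_contDiffOn hf.smooth, fun n => ?_, ?_⟩
  · obtain ⟨C, hC⟩ := hb n
    refine ⟨‖Complex.ofRealCLM‖ * C, fun z hz => ?_⟩
    refine (Complex.ofRealCLM.norm_iteratedFDerivWithin_comp_left (hf.smooth z hz)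
      (uniqueDiffOn_fastDom hT σ) hz (by exact_mod_cast le_top)).trans ?_
    rw [mul_assoc]
    exact mul_le_mul_of_nonneg_left (hC z hz) (norm_nonneg _)
  · rintro v hv ⟨⟨t, y₁, y₂⟩, y₃, Y, θ⟩ hz
    obtain ⟨h1, h2, h3⟩ := mem_fastDom.1 hz
    rcases hv with rfl | rfl | rfl
    · rw [add_smul_bas_one]
      exact congrArg Complex.ofReal (hf.periodic_y₁ t (mem_baseDom.1 h1) y₁ y₂ y₃ h2 Y h3 θ)
    · rw [add_smul_bas_two]
      exact congrArg Complex.ofReal (hf.periodic_y₂ t (mem_baseDom.1 h1) y₁ y₂ y₃ h2 Y h3 θ)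
    · rw [add_smul_bas_five]
      exact congrArg Complex.ofReal (hf.periodic_θ _ h1 y₃ h2 Y h3 θ)

/-- The real part of a complex function. -/
def reFun (g : Pt → ℂ) : FastFun := fun p y₃ Y θ => (g (p, y₃, Y, θ)).re

theorem Tame.isSurface (hT : 0 < T) (hδ : 0 < δ) (hg : Tame T σ δ g) :
    IsSurface T σ (reFun g) := by
  refine ⟨Complex.reCLM.contDiff.comp_contDiffOn hg.smooth, ?_, ?_, ?_, δ, hδ, fun n => ?_⟩
  · intro t ht y₁ y₂ y₃ h2 Y h3 θ
    have := hg.per _ (Or.inl rfl) ((t, y₁, y₂), y₃, Y, θ) (mem_fastDom.2 ⟨mem_baseDom.2 ht, h2, h3⟩)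
    rw [add_smul_bas_one] at this
    exact congrArg Complex.re this
  · intro t ht y₁ y₂ y₃ h2 Y h3 θ
    have := hg.per _ (Or.inr (Or.inl rfl)) ((t, y₁, y₂), y₃, Y, θ)
      (mem_fastDom.2 ⟨mem_baseDom.2 ht, h2, h3⟩)
    rw [add_smul_bas_two] at this
    exact congrArg Complex.re this
  · intro p hp y₃ h2 Y h3 θ
    have := hg.per _ (Or.inr (Or.inr rfl)) (p, y₃, Y, θ) (mem_fastDom.2 ⟨hp, h2, h3⟩)
    rw [add_smul_bas_five] at this
    exact congrArg Complex.re this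
  · obtain ⟨C, hC⟩ := hg.bound n
    refine ⟨‖Complex.reCLM‖ * C, fun z hz => ?_⟩
    refine (Complex.reCLM.norm_iteratedFDerivWithin_comp_left (hg.smooth z hz)
      (uniqueDiffOn_fastDom hT σ) hz (by exact_mod_cast le_top)).trans ?_
    rw [mul_assoc]
    exact mul_le_mul_of_nonneg_left (hC z hz) (norm_nonneg _)

theorem normalIndep_ofSlow (r : SlowFun) : NormalIndep T σ (lft (ofSlow r)) := fun z _ => by
  rw [scaleY_apply]; rfl

theorem normalIndep_ofBdry (r : BdryFun) : NormalIndep T σ (lft (ofBdry r)) := fun z _ => by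
  rw [scaleY_apply]; rfl

theorem IsResidual.tame (hT : 0 < T) {r : SlowFun} (hr : IsResidual T σ r) :
    Tame T σ 0 (lft (ofSlow r)) := by
  refine Tame.of_normalIndep hT ?_ ?_ (normalIndep_ofSlow r)
  · refine Complex.ofRealCLM.contDiff.comp_contDiffOn (hr.smooth.comp
      (f := fun z : Pt => (z.1, z.2.1, z.2.2.2)) (by fun_prop) fun z hz => ?_)
    obtain ⟨h1, h2, h3⟩ := mem_fastDom.1 hz
    exact ⟨h1, h2, mem_univ _⟩
  · rintro v hv ⟨⟨t, y₁, y₂⟩, y₃, Y, θ⟩ hz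
    obtain ⟨h1, h2, h3⟩ := mem_fastDom.1 hz
    rcases hv with rfl | rfl | rfl
    · rw [add_smul_bas_one]
      exact congrArg Complex.ofReal (hr.periodic_y₁ t (mem_baseDom.1 h1) y₁ y₂ y₃ h2 θ)
    · rw [add_smul_bas_two]
      exact congrArg Complex.ofReal (hr.periodic_y₂ t (mem_baseDom.1 h1) y₁ y₂ y₃ h2 θ)
    · rw [add_smul_bas_five]
      exact congrArg Complex.ofReal (hr.periodic_θ _ h1 y₃ h2 θ)

theorem IsHInfty.tame (hT : 0 < T) (σ : Side) {r : BdryFun} (hr : IsHInfty T r) :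
    Tame T σ 0 (lft (ofBdry r)) := by
  refine Tame.of_normalIndep hT ?_ ?_ (normalIndep_ofBdry r)
  · refine Complex.ofRealCLM.contDiff.comp_contDiffOn (hr.smooth.comp
      (f := fun z : Pt => (z.1, z.2.2.2)) (by fun_prop) fun z hz => ?_)
    exact ⟨(mem_fastDom.1 hz).1, mem_univ _⟩
  · rintro v hv ⟨⟨t, y₁, y₂⟩, y₃, Y, θ⟩ hz
    obtain ⟨h1, h2, h3⟩ := mem_fastDom.1 hz
    rcases hv with rfl | rfl | rfl
    · rw [add_smul_bas_one]
      exact congrArg Complex.ofReal (hr.periodic_y₁ t (mem_baseDom.1 h1) y₁ y₂ θ)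
    · rw [add_smul_bas_two]
      exact congrArg Complex.ofReal (hr.periodic_y₂ t (mem_baseDom.1 h1) y₁ y₂ θ)
    · rw [add_smul_bas_five]
      exact congrArg Complex.ofReal (hr.periodic_θ _ h1 θ)

theorem Tame.isResidual (hg : Tame T σ δ g) :
    IsResidual T σ (fun p y₃ θ => (g (p, y₃, 0, θ)).re) := by
  refine ⟨Complex.reCLM.contDiff.comp_contDiffOn (hg.smooth.comp
      (f := fun z : Base × ℝ × ℝ => ((z.1, z.2.1, 0, z.2.2) : Pt)) (by fun_prop) ?_), ?_, ?_, ?_⟩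
  · rintro z ⟨h1, h2, -⟩
    exact mem_fastDom.2 ⟨h1, h2, σ.zero_mem_fastClosed⟩
  · intro t ht y₁ y₂ y₃ h2 θ
    have := hg.per _ (Or.inl rfl) ((t, y₁, y₂), y₃, 0, θ)
      (mem_fastDom.2 ⟨mem_baseDom.2 ht, h2, σ.zero_mem_fastClosed⟩)
    rw [add_smul_bas_one] at this
    exact congrArg Complex.re this
  · intro t ht y₁ y₂ y₃ h2 θ
    have := hg.per _ (Or.inr (Or.inl rfl)) ((t, y₁, y₂), y₃, 0, θ)
      (mem_fastDom.2 ⟨mem_baseDom.2 ht, h2, σ.zero_mem_fastClosed⟩)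
    rw [add_smul_bas_two] at this
    exact congrArg Complex.re this
  · intro p hp y₃ h2 θ
    have := hg.per _ (Or.inr (Or.inr rfl)) (p, y₃, 0, θ)
      (mem_fastDom.2 ⟨hp, h2, σ.zero_mem_fastClosed⟩)
    rw [add_smul_bas_five] at this
    exact congrArg Complex.re this

/-! ### Decomposition of complex profiles -/

/-- `f = r + s`, where `r` does not depend on `Y₃` and `s` decays exponentially. -/
structure Dec (T : ℝ) (σ : Side) (f r s : Pt → ℂ) : Prop where
  tame_r : Tame T σ 0 r
  indep : NormalIndep T σ r
  tame_s : ∃ δ > 0, Tame T σ δ s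
  eq : ∀ z ∈ fastDom T σ, f z = r z + s z

variable {r s r' s' : Pt → ℂ}

theorem exists_common_rate {ι : Type*} [Finite ι] {h : ι → Pt → ℂ}
    (hh : ∀ i, ∃ δ > 0, Tame T σ δ (h i)) :
    ∃ δ > 0, δ ≤ 1 / 2 ∧ ∀ i, Tame T σ δ (h i) := by
  choose d hd hd' using hh
  rcases isEmpty_or_nonempty ι with hι | hι
  · exact ⟨1 / 2, by norm_num, le_rfl, fun i => hι.elim i⟩
  · obtain ⟨i₀, hi₀⟩ := Finite.exists_min d
    exact ⟨min (d i₀) (1 / 2), lt_min (hd i₀) (by norm_num), min_le_right _ _, fun i =>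
      (hd' i).mono ((min_le_left _ _).trans (hi₀ i))⟩

theorem Dec.tame (hT : 0 < T) (h : Dec T σ f r s) : Tame T σ 0 f := by
  obtain ⟨δ, hδ, hs⟩ := h.tame_s
  exact (h.tame_r.add hT (hs.mono hδ.le)).congr h.eq

theorem NormalIndep.add (hf : NormalIndep T σ f) (hg : NormalIndep T σ g) :
    NormalIndep T σ (fun z => f z + g z) := fun z hz => by
  show f z + g z = _
  rw [hf z hz, hg z hz]

theorem NormalIndep.const_mul (hf : NormalIndep T σ f) (c : ℂ) :
    NormalIndep T σ (fun z => c * f z) := fun z hz => by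
  show c * f z = _
  rw [hf z hz]

theorem NormalIndep.mode (hf : NormalIndep T σ f) (k : ℤ) : NormalIndep T σ (mode k f) :=
  fun z hz => by
    rw [← mode_comp_scaleY]
    exact mode_congr k hf hz

theorem Dec.add (hT : 0 < T) (h : Dec T σ f r s) (h' : Dec T σ g r' s') :
    Dec T σ (fun z => f z + g z) (fun z => r z + r' z) (fun z => s z + s' z) := by
  obtain ⟨δ, hδ, hs⟩ := h.tame_s
  obtain ⟨δ', hδ', hs'⟩ := h'.tame_s
  refine ⟨h.tame_r.add hT h'.tame_r, h.indep.add h'.indep, ⟨min δ δ', lt_min hδ hδ',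
    (hs.mono (min_le_left _ _)).add hT (hs'.mono (min_le_right _ _))⟩, fun z hz => ?_⟩
  rw [h.eq z hz, h'.eq z hz]
  ring

theorem Dec.const_mul (hT : 0 < T) (h : Dec T σ f r s) (c : ℂ) :
    Dec T σ (fun z => c * f z) (fun z => c * r z) (fun z => c * s z) := by
  obtain ⟨δ, hδ, hs⟩ := h.tame_s
  refine ⟨h.tame_r.const_mul hT c, h.indep.const_mul c, ⟨δ, hδ, hs.const_mul hT c⟩, fun z hz => ?_⟩
  rw [h.eq z hz]
  ring

theorem Dec.sub (hT : 0 < T) (h : Dec T σ f r s) (h' : Dec T σ g r' s') :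
    Dec T σ (fun z => f z - g z) (fun z => r z - r' z) (fun z => s z - s' z) := by
  simpa [sub_eq_add_neg] using h.add hT (h'.const_mul hT (-1))

theorem Dec.zero : Dec T σ (fun _ => 0) (fun _ => 0) (fun _ => 0) :=
  ⟨Tame.zero, fun _ _ => rfl, ⟨1, one_pos, Tame.zero⟩, fun _ _ => by simp⟩

theorem Dec.pd (hT : 0 < T) (h : Dec T σ f r s) (i : Fin 6) :
    Dec T σ (pd T σ i f) (pd T σ i r) (pd T σ i s) := by
  obtain ⟨δ, hδ, hs⟩ := h.tame_s
  refine ⟨h.tame_r.pd hT i, h.indep.pd hT h.tame_r.smooth i, ⟨δ, hδ, hs.pd hT i⟩, fun z hz => ?_⟩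
  rw [pd_congr i h.eq hz, pd_add hT h.tame_r.smooth hs.smooth i hz]

theorem Dec.mode (hT : 0 < T) (h : Dec T σ f r s) (k : ℤ) :
    Dec T σ (mode k f) (mode k r) (mode k s) := by
  obtain ⟨δ, hδ, hs⟩ := h.tame_s
  refine ⟨h.tame_r.mode le_rfl hT k, h.indep.mode k, ⟨δ, hδ, hs.mode hδ.le hT k⟩, fun z hz => ?_⟩
  rw [mode_congr k h.eq hz, mode_add k h.tame_r (hs.mono hδ.le) hz]

theorem Dec.congr (h : Dec T σ f r s) (hf : EqOn g f (fastDom T σ)) (hr : EqOn r' r (fastDom T σ))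
    (hs : EqOn s' s (fastDom T σ)) : Dec T σ g r' s' := by
  obtain ⟨δ, hδ, hs0⟩ := h.tame_s
  refine ⟨h.tame_r.congr hr, fun z hz => ?_, ⟨δ, hδ, hs0.congr hs⟩, fun z hz => ?_⟩
  · rw [hr hz, h.indep z hz, hr (scaleY_mem le_rfl hz)]
  · rw [hf hz, h.eq z hz, hr hz, hs hz]

theorem Dec.sum (hT : 0 < T) {ι : Type*} (t : Finset ι) {f r s : ι → Pt → ℂ}
    (h : ∀ i, Dec T σ (f i) (r i) (s i)) :
    Dec T σ (fun z => ∑ i ∈ t, f i z) (fun z => ∑ i ∈ t, r i z) (fun z => ∑ i ∈ t, s i z) := by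
  classical
  induction t using Finset.induction_on with
  | empty => simpa using Dec.zero
  | insert a t ha ih => simpa [Finset.sum_insert ha] using (h a).add hT ih

theorem Tame.tendsto_zero (hδ : 0 < δ) (hf : Tame T σ δ f) {z : Pt} (hz : z ∈ fastDom T σ) :
    Tendsto (fun a : ℝ => f (z + a • (σ.sg • bas 4))) atTop (𝓝 0) := by
  obtain ⟨C, hC0, hC⟩ := hf.bound_zero
  refine squeeze_zero_norm' (a := fun a : ℝ => C * Real.exp (-δ * a)) ?_ ?_
  · filter_upwards [eventually_ge_atTop 0] with a ha
    refine (hC _ (add_normal_mem ha hz)).trans (mul_le_mul_of_nonneg_left ?_ hC0)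
    rw [Real.exp_le_exp]
    have h1 := mem_fastDom.1 (add_normal_mem ha hz)
    have h2 := Side.mem_fastClosed.1 (mem_fastDom.1 hz).2.2
    rw [Side.abs_eq h1.2.2, smul_smul, add_smul_bas_four]
    have : σ.sg * (z.2.2.1 + a * σ.sg) = σ.sg * z.2.2.1 + a := by
      linear_combination a * σ.sg_mul_sg
    simp only [this]
    nlinarith
  · have h1 : Tendsto (fun a : ℝ => -δ * a) atTop atBot :=
      tendsto_id.const_mul_atTop_of_neg (by linarith)
    simpa using (Real.tendsto_exp_atBot.comp h1).const_mul C

/-- Along the normal ray r is constant and s tends to 0, so r is its own limit 0. This gives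
uniqueness of the decomposition, by which every linear identity splits into a slow and a decaying
one. -/
theorem Dec.eq_zero (h : Dec T σ f r s) (hf : ∀ z ∈ fastDom T σ, f z = 0) :
    (∀ z ∈ fastDom T σ, r z = 0) ∧ ∀ z ∈ fastDom T σ, s z = 0 := by
  obtain ⟨δ, hδ, hs⟩ := h.tame_s
  have hr : ∀ z ∈ fastDom T σ, r z = 0 := by
    intro z hz
    have h1 := (hs.tendsto_zero hδ hz).neg
    rw [neg_zero] at h1
    refine tendsto_nhds_unique (tendsto_const_nhds.congr' ?_) h1
    filter_upwards [eventually_ge_atTop 0] with a ha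
    have h2 := h.eq _ (add_normal_mem ha hz)
    rw [hf _ (add_normal_mem ha hz), h.indep.add_normal ha hz] at h2
    linear_combination -h2
  refine ⟨hr, fun z hz => ?_⟩
  have := h.eq z hz
  rw [hf z hz, hr z hz] at this
  linear_combination -this

theorem Dec.unique (hT : 0 < T) (h : Dec T σ f r s) (h' : Dec T σ f r' s') :
    EqOn r r' (fastDom T σ) ∧ EqOn s s' (fastDom T σ) := by
  have := (h.sub hT h').eq_zero fun z _ => sub_self _
  exact ⟨fun z hz => sub_eq_zero.1 (this.1 z hz), fun z hz => sub_eq_zero.1 (this.2 z hz)⟩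

/-- The canonical components, defined by a limit at infinity, agree with those of any decomposition
witnessing that `f` is a profile. -/
theorem IsProfile.dec (hT : 0 < T) {f : FastFun} (hf : IsProfile T σ f) :
    Dec T σ (lft f) (lft (ofSlow (resid σ f))) (lft (surf σ f)) := by
  obtain ⟨r, s, hr, hs, h⟩ := hf
  have hres : ∀ z ∈ fastDom T σ, resid σ f z.1 z.2.1 z.2.2.2 = r z.1 z.2.1 z.2.2.2 :=
    fun z hz => resid_eq hs h (mem_fastDom.1 hz).1 (mem_fastDom.1 hz).2.1 _
  have hfz : ∀ z ∈ fastDom T σ, f z.1 z.2.1 z.2.2.1 z.2.2.2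
      = r z.1 z.2.1 z.2.2.2 + s z.1 z.2.1 z.2.2.1 z.2.2.2 := fun z hz =>
    h _ (mem_fastDom.1 hz).1 _ (mem_fastDom.1 hz).2.1 _ (mem_fastDom.1 hz).2.2 _
  have hd : Dec T σ (lft f) (lft (ofSlow r)) (lft s) :=
    ⟨hr.tame hT, normalIndep_ofSlow r, hs.tame hT, fun z hz => by
      simp only [lft, ofSlow, hfz z hz]; push_cast; ring⟩
  refine hd.congr (fun _ _ => rfl) (fun z hz => ?_) fun z hz => ?_
  · simp only [lft, ofSlow, hres z hz]
  · simp only [lft, surf, hres z hz, hfz z hz]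
    push_cast; ring

theorem IsProfile.tame (hT : 0 < T) {f : FastFun} (hf : IsProfile T σ f) : Tame T σ 0 (lft f) :=
  (hf.dec hT).tame hT

theorem Dec.isProfile (hT : 0 < T) (h : Dec T σ f r s) : IsProfile T σ (reFun f) := by
  obtain ⟨δ, hδ, hs⟩ := h.tame_s
  refine ⟨_, _, h.tame_r.isResidual, hs.isSurface hT hδ, fun p hp y₃ hy Y hY θ => ?_⟩
  have hz : (p, y₃, Y, θ) ∈ fastDom T σ := mem_fastDom.2 ⟨hp, hy, hY⟩
  show (f (p, y₃, Y, θ)).re = _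
  rw [h.eq _ hz, Complex.add_re, h.indep _ hz, scaleY_apply]
  simp [reFun]

theorem Dec.re (hT : 0 < T) (h : Dec T σ f r s) :
    Dec T σ (lft (reFun f)) (lft (reFun r)) (lft (reFun s)) := by
  obtain ⟨δ, hδ, hs⟩ := h.tame_s
  refine ⟨h.tame_r.re hT, fun z hz => ?_, ⟨δ, hδ, hs.re hT⟩, fun z hz => ?_⟩
  · show ((r z).re : ℂ) = (r _).re
    rw [h.indep z hz]
  · show ((f z).re : ℂ) = (r z).re + (s z).re
    rw [h.eq z hz]
    simp

/-! ### Derivatives and Fourier coefficients of real functions -/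

theorem deriv_ofReal {u : ℝ → ℝ} {c : ℂ} {x : ℝ} (h : HasDerivAt (fun x => (u x : ℂ)) c x) :
    HasDerivAt u c.re x ∧ ((deriv u x : ℝ) : ℂ) = c := by
  have h1 : HasDerivAt u c.re x := by
    have := Complex.reCLM.hasFDerivAt.comp_hasDerivAt x h
    simpa [Function.comp_def] using this
  exact ⟨h1, h1.differentiableAt.hasDerivAt.ofReal_comp.unique h⟩

theorem hasDerivAt_theta_lft {f : FastFun} (hf : Tame T σ δ (lft f)) {p : Base} {y₃ Y θ : ℝ}
    (hz : (p, y₃, Y, θ) ∈ fastDom T σ) :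
    HasDerivAt (fun θ => (f p y₃ Y θ : ℂ)) (pd T σ 5 (lft f) (p, y₃, Y, θ)) θ := by
  have h := hf.hasGrad.hasDerivAt_theta hz 0
  have h2 := HasDerivAt.comp_sub_const (x := θ) θ (by simpa using h)
  refine hasDerivAt_of_eq h2 (fun y => ?_) (by simp)
  rw [add_smul_bas_five]
  simp [lft]

theorem hasDerivAt_normal_lft {f : FastFun} (hf : Tame T σ δ (lft f)) {p : Base} {y₃ Y θ : ℝ}
    (hp : p ∈ baseDom T) (hy : y₃ ∈ σ.slowClosed) (hY : Y ∈ σ.fastOpen) :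
    HasDerivAt (fun Y => (f p y₃ Y θ : ℂ)) (pd T σ 4 (lft f) (p, y₃, Y, θ)) Y := by
  have hc : ∀ b ∈ {b : ℝ | 0 < σ.sg * b},
      ((p, y₃, 0, θ) : Pt) + b • bas 4 ∈ fastDom T σ := by
    intro b hb
    rw [add_smul_bas_four]
    exact mem_fastDom.2 ⟨hp, hy, Side.mem_fastClosed.2 (by simpa using le_of_lt hb)⟩
  have h := (hf.hasGrad.hasDerivWithinAt_line hc (b := Y) (Side.mem_fastOpen.1 hY)).hasDerivAt
    ((isOpen_lt continuous_const (by fun_prop)).mem_nhds (Side.mem_fastOpen.1 hY))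
  refine hasDerivAt_of_eq h (fun y => ?_) ?_
  · rw [add_smul_bas_four]
    simp [lft]
  · rw [lin_bas, add_smul_bas_four]
    simp

theorem deriv_theta {f : FastFun} (hf : Tame T σ δ (lft f)) {p : Base} {y₃ Y : ℝ}
    (hp : p ∈ baseDom T) (hy : y₃ ∈ σ.slowClosed) (hY : Y ∈ σ.fastClosed) (θ : ℝ) :
    ((deriv (fun θ => f p y₃ Y θ) θ : ℝ) : ℂ) = pd T σ 5 (lft f) (p, y₃, Y, θ) :=
  (deriv_ofReal (hasDerivAt_theta_lft hf (mem_fastDom.2 ⟨hp, hy, hY⟩))).2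

theorem deriv_normal {f : FastFun} (hf : Tame T σ δ (lft f)) {p : Base} {y₃ Y : ℝ}
    (hp : p ∈ baseDom T) (hy : y₃ ∈ σ.slowClosed) (hY : Y ∈ σ.fastOpen) (θ : ℝ) :
    ((deriv (fun Y => f p y₃ Y θ) Y : ℝ) : ℂ) = pd T σ 4 (lft f) (p, y₃, Y, θ) :=
  (deriv_ofReal (hasDerivAt_normal_lft hf hp hy hY)).2

theorem deriv_theta_bdry {g : BdryFun} (hT : 0 < T) (hg : IsHInfty T g) (σ : Side) {p : Base}
    (hp : p ∈ baseDom T) (θ : ℝ) :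
    ((deriv (fun θ => g p θ) θ : ℝ) : ℂ) = pd T σ 5 (lft (ofBdry g)) (p, 0, 0, θ) :=
  deriv_theta (f := ofBdry g) (hg.tame hT σ) hp σ.zero_mem_slowClosed σ.zero_mem_fastClosed θ

/-- Derivatives in `θ` depend on the values on a line only. -/
theorem pd_theta_congr {σ' : Side} {δ' : ℝ} (hf : Tame T σ δ f) (hg : Tame T σ' δ' g) {z : Pt}
    (hz : z ∈ fastDom T σ) (hz' : z ∈ fastDom T σ')
    (h : ∀ a : ℝ, f (z + a • bas 5) = g (z + a • bas 5)) : pd T σ 5 f z = pd T σ' 5 g z := by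
  have h1 := hf.hasGrad.hasDerivAt_theta hz 0
  have h2 := hg.hasGrad.hasDerivAt_theta hz' 0
  simp only [h] at h1
  simpa using h1.unique h2

theorem mode_line_congr (k : ℤ) {z : Pt} (h : ∀ a : ℝ, f (z + a • bas 5) = g (z + a • bas 5)) :
    mode k f z = mode k g z := by
  unfold mode trOp
  simp only [h]

/-- At θ = 0 the factor e^{ikθ} is 1, so the mode there is the Fourier coefficient itself. -/
theorem fcoef_eq_mode {u : ℝ → ℝ} {z : Pt} (h : ∀ θ : ℝ, (u θ : ℂ) = f (z + θ • bas 5)) (k : ℤ) :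
    fcoef u k = mode k f z := by
  rw [fcoef, fourierCoeffOn_eq_integral, sub_zero,
    intervalIntegral.integral_of_le Real.two_pi_pos.le, ← integral_smul]
  unfold mode trOp
  refine setIntegral_congr_fun measurableSet_Ioc fun a _ => ?_
  rw [fourier_coe_apply, ← h, modeKer, Complex.real_smul]
  simp only [smul_eq_mul]
  rw [← mul_assoc]
  congr 2
  · push_cast; simp
  · congr 1
    have := Complex.ofReal_ne_zero.2 Real.pi_pos.ne'
    push_cast
    field_simp

theorem fcoef_lft (f : FastFun) (p : Base) (y₃ Y : ℝ) (k : ℤ) :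
    fcoef (fun θ => f p y₃ Y θ) k = mode k (lft f) (p, y₃, Y, 0) :=
  fcoef_eq_mode (fun θ => by rw [add_smul_bas_five]; simp [lft]) k

/-- Equality of functions follows from equality on the interior. -/
theorem eqOn_of_eqOn_interior (hf : ContinuousOn f (fastDom T σ)) (hg : ContinuousOn g (fastDom T σ))
    (h : EqOn f g (fastInt T σ)) : EqOn f g (fastDom T σ) :=
  h.of_subset_closure hf hg (fastInt_subset T σ) (fastDom_subset_closure T σ)

/-! ### Linear algebra of the fast operator -/

/-- The symbol of the fast operator, applied to normal and angular derivatives. -/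
noncomputable def symb (P : Params) (σ : Side) (y x : Fin 7 → ℂ) (i : Fin 7) : ℂ :=
  ∑ j, ((P.A₃ σ i j : ℂ) * y j + (P.calA σ i j : ℂ) * x j)

theorem A₀_eq : Params.A₀ = !![1, 0, 0, 0, 0, 0, 0; 0, 1, 0, 0, 0, 0, 0; 0, 0, 1, 0, 0, 0, 0;
    0, 0, 0, 1, 0, 0, 0; 0, 0, 0, 0, 1, 0, 0; 0, 0, 0, 0, 0, 1, 0; 0, 0, 0, 0, 0, 0, 0] := by
  ext i j
  fin_cases i <;> fin_cases j <;> simp [Params.A₀, Matrix.diagonal]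

theorem symb_eq (P : Params) (σ : Side) (y x : Fin 7 → ℂ) : symb P σ y x =
    ![P.c σ * x 0 - P.b σ * x 3 + P.ξ 0 * x 6 + P.u σ 0 * (y 2 + P.ξ 0 * x 0 + P.ξ 1 * x 1)
        - P.H σ 0 * (y 5 + P.ξ 0 * x 3 + P.ξ 1 * x 4),
      P.c σ * x 1 - P.b σ * x 4 + P.ξ 1 * x 6 + P.u σ 1 * (y 2 + P.ξ 0 * x 0 + P.ξ 1 * x 1)
        - P.H σ 1 * (y 5 + P.ξ 0 * x 3 + P.ξ 1 * x 4),
      y 6 + P.c σ * x 2 - P.b σ * x 5,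
      -P.b σ * x 0 + P.c σ * x 3 + P.H σ 0 * (y 2 + P.ξ 0 * x 0 + P.ξ 1 * x 1)
        - P.u σ 0 * (y 5 + P.ξ 0 * x 3 + P.ξ 1 * x 4),
      -P.b σ * x 1 + P.c σ * x 4 + P.H σ 1 * (y 2 + P.ξ 0 * x 0 + P.ξ 1 * x 1)
        - P.u σ 1 * (y 5 + P.ξ 0 * x 3 + P.ξ 1 * x 4),
      -P.b σ * x 2 + P.c σ * x 5,
      y 2 + P.ξ 0 * x 0 + P.ξ 1 * x 1] := by
  funext i
  fin_cases i <;>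
    simp [symb, Fin.sum_univ_succ, Params.A₃, Params.calA, A₀_eq, Params.A₁, Params.A₂,
      Params.c, Params.a, Params.b] <;>
    ring

/-- The equations of the fast problem, solved for the divergences of `u` and `H`. -/
structure Reduced (P : Params) (σ : Side) (y x F : Fin 7 → ℂ) (F₈ : ℂ) : Prop where
  div_u : y 2 + P.ξ 0 * x 0 + P.ξ 1 * x 1 = F 6
  div_H : y 5 + P.ξ 0 * x 3 + P.ξ 1 * x 4 = F₈
  u₁ : P.c σ * x 0 - P.b σ * x 3 + P.ξ 0 * x 6 = F 0 - P.u σ 0 * F 6 + P.H σ 0 * F₈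
  u₂ : P.c σ * x 1 - P.b σ * x 4 + P.ξ 1 * x 6 = F 1 - P.u σ 1 * F 6 + P.H σ 1 * F₈
  H₁ : -P.b σ * x 0 + P.c σ * x 3 = F 3 - P.H σ 0 * F 6 + P.u σ 0 * F₈
  H₂ : -P.b σ * x 1 + P.c σ * x 4 = F 4 - P.H σ 1 * F 6 + P.u σ 1 * F₈
  u₃ : y 6 + P.c σ * x 2 - P.b σ * x 5 = F 2
  H₃ : -P.b σ * x 2 + P.c σ * x 5 = F 5

theorem reduced_iff {y x F : Fin 7 → ℂ} {F₈ : ℂ} : Reduced P σ y x F F₈ ↔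
    (∀ i, symb P σ y x i = F i) ∧ y 5 + P.ξ 0 * x 3 + P.ξ 1 * x 4 = F₈ := by
  constructor
  · intro h
    refine ⟨fun i => ?_, h.div_H⟩
    rw [symb_eq, h.div_u, h.div_H]
    have h1 := h.u₁
    have h2 := h.u₂
    have h3 := h.H₁
    have h4 := h.H₂
    have h5 := h.u₃
    have h6 := h.H₃
    fin_cases i <;> simp
    · linear_combination h1
    · linear_combination h2
    · linear_combination h5
    · linear_combination h3
    · linear_combination h4
    · linear_combination h6
  · rintro ⟨h, h8⟩
    rw [symb_eq] at h
    have h0 := h 0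
    have h1 := h 1
    have h2 := h 2
    have h3 := h 3
    have h4 := h 4
    have h5 := h 5
    have h6 := h 6
    simp at h0 h1 h2 h3 h4 h5 h6
    exact ⟨h6, h8, by linear_combination h0 - P.u σ 0 * h6 + P.H σ 0 * h8,
      by linear_combination h1 - P.u σ 1 * h6 + P.H σ 1 * h8,
      by linear_combination h3 - P.H σ 0 * h6 + P.u σ 0 * h8,
      by linear_combination h4 - P.H σ 1 * h6 + P.u σ 1 * h8, by linear_combination h2,
      by linear_combination h5⟩

/-! ### The parameters -/

theorem norm_xi (h : P.RationalDirection) : P.ξ 0 ^ 2 + P.ξ 1 ^ 2 = 1 := by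
  obtain ⟨m, n, hmn, h0, h1⟩ := h
  have hpos : 0 < (m : ℝ) ^ 2 + (n : ℝ) ^ 2 := by
    rcases eq_or_ne m 0 with rfl | hm
    · have hn : n ≠ 0 := fun h => hmn (by rw [h])
      have : (n : ℝ) ≠ 0 := by exact_mod_cast hn
      positivity
    · have : (m : ℝ) ≠ 0 := by exact_mod_cast hm
      positivity
  rw [h0, h1, div_pow, div_pow, Real.sq_sqrt hpos.le]
  field_simp

/-- If c² = b² held on one side, (H4) would give it on the other, so c⁺ = ±b⁺ and c⁻ = ±b⁻. Then |a⁺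
- a⁻| = |c⁺ - c⁻| would be |b⁺ - b⁻| or |b⁺ + b⁻|, which (H3) excludes. -/
theorem c_sq_ne (h₃ : P.NonDegenerate) (h₄ : P.LopatinskiiRoot) (σ : Side) :
    P.c σ ^ 2 - P.b σ ^ 2 ≠ 0 := by
  have key : P.c .plus ^ 2 ≠ P.b .plus ^ 2 := by
    intro h
    have h' : P.c .minus ^ 2 = P.b .minus ^ 2 := by
      unfold Params.LopatinskiiRoot at h₄; linarith
    have hd : P.a .plus - P.a .minus = P.c .plus - P.c .minus := by
      simp only [Params.c]; ring
    rcases sq_eq_sq_iff_eq_or_eq_neg.1 h with h1 | h1 <;>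
      rcases sq_eq_sq_iff_eq_or_eq_neg.1 h' with h2 | h2
    · exact h₃.1 (by rw [hd, h1, h2])
    · exact h₃.2 (by rw [hd, h1, h2, sub_neg_eq_add])
    · exact h₃.2 (by rw [hd, h1, h2, ← abs_neg]; congr 1; ring)
    · exact h₃.1 (by rw [hd, h1, h2, ← abs_neg]; congr 1; ring)
  unfold Params.LopatinskiiRoot at h₄
  cases σ
  · exact sub_ne_zero.2 key
  · intro h
    exact key (by linarith)

theorem mu_ne_zero (h₃ : P.NonDegenerate) (h₄ : P.LopatinskiiRoot) (σ : Side) :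
    (P.c σ : ℂ) ^ 2 - (P.b σ : ℂ) ^ 2 ≠ 0 := by
  exact_mod_cast c_sq_ne h₃ h₄ σ

theorem mu_add (h₄ : P.LopatinskiiRoot) : (P.c .plus : ℂ) ^ 2 - (P.b .plus : ℂ) ^ 2
    + ((P.c .minus : ℂ) ^ 2 - (P.b .minus : ℂ) ^ 2) = 0 := by
  unfold Params.LopatinskiiRoot at h₄
  have : (P.c .plus) ^ 2 - (P.b .plus) ^ 2 + ((P.c .minus) ^ 2 - (P.b .minus) ^ 2) = 0 := by
    linarith
  exact_mod_cast this

/-! ### The fast problem for complex functions -/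

/-- The equations of the fast problem on the closed domain. -/
def Evol (T : ℝ) (σ : Side) (P : Params) (U F : Fin 7 → Pt → ℂ) (F₈ : Pt → ℂ) : Prop :=
  ∀ z ∈ fastDom T σ, Reduced P σ (fun j => pd T σ 4 (U j) z) (fun j => pd T σ 5 (U j) z)
    (fun j => F j z) (F₈ z)

theorem fastOp_eq {U : Fin 7 → FastFun} (hU : ∀ j, Tame T σ 0 (lft (U j))) {p : Base}
    (hp : p ∈ baseDom T) {y₃ Y : ℝ} (hy : y₃ ∈ σ.slowClosed) (hY : Y ∈ σ.fastOpen) (θ : ℝ)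
    (i : Fin 7) : (fastOp P σ U p y₃ Y θ i : ℂ)
      = symb P σ (fun j => pd T σ 4 (lft (U j)) (p, y₃, Y, θ))
        (fun j => pd T σ 5 (lft (U j)) (p, y₃, Y, θ)) i := by
  have hY' : Y ∈ σ.fastClosed := Side.mem_fastClosed.2 (Side.mem_fastOpen.1 hY).le
  simp only [fastOp, Pi.add_apply, Matrix.mulVec, dotProduct, symb, Finset.sum_add_distrib,
    Complex.ofReal_add, Complex.ofReal_sum, Complex.ofReal_mul, deriv_normal (hU _) hp hy hY,
    deriv_theta (hU _) hp hy hY']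

theorem slowOpen_subset : σ.slowOpen ⊆ σ.slowClosed := by
  cases σ
  · exact Ioo_subset_Icc_self
  · exact Ioo_subset_Icc_self

/-- The equations are required at interior values of y₃ and Y₃ only; continuity of all first
derivatives extends them to the closed domain, where traces can be taken. -/
theorem evol_iff (hT : 0 < T) {U F : Fin 7 → FastFun} {F₈ : FastFun}
    (hU : ∀ j, Tame T σ 0 (lft (U j))) (hF : ∀ j, Tame T σ 0 (lft (F j)))
    (hF₈ : Tame T σ 0 (lft F₈)) :
    Evol T σ P (fun j => lft (U j)) (fun j => lft (F j)) (lft F₈) ↔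
      ∀ p ∈ baseDom T, ∀ y₃ ∈ σ.slowOpen, ∀ Y ∈ σ.fastOpen, ∀ θ : ℝ,
        fastOp P σ U p y₃ Y θ = (fun i => F i p y₃ Y θ) ∧
        deriv (fun Y' => U 5 p y₃ Y' θ) Y + P.ξ 0 * deriv (fun θ' => U 3 p y₃ Y θ') θ
          + P.ξ 1 * deriv (fun θ' => U 4 p y₃ Y θ') θ = F₈ p y₃ Y θ := by
  have hc : ∀ i j, ContinuousOn (pd T σ i (lft (U j))) (fastDom T σ) := fun i j =>
    ((hU j).pd hT i).continuousOn
  constructor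
  · intro h p hp y₃ hy Y hY θ
    have hy' := slowOpen_subset hy
    have hY' : Y ∈ σ.fastClosed := Side.mem_fastClosed.2 (Side.mem_fastOpen.1 hY).le
    have hr := reduced_iff.1 (h (p, y₃, Y, θ) (mem_fastDom.2 ⟨hp, hy', hY'⟩))
    refine ⟨funext fun i => ?_, ?_⟩
    · have := hr.1 i
      rw [← fastOp_eq hU hp hy' hY] at this
      exact Complex.ofReal_injective this
    · have := hr.2
      rw [← deriv_normal (hU 5) hp hy' hY, ← deriv_theta (hU 3) hp hy' hY',
        ← deriv_theta (hU 4) hp hy' hY'] at this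
      simp only [lft] at this
      exact_mod_cast this
  · intro h
    have h1 : ∀ i, EqOn (fun z => symb P σ (fun j => pd T σ 4 (lft (U j)) z)
        (fun j => pd T σ 5 (lft (U j)) z) i) (lft (F i)) (fastDom T σ) := by
      intro i
      refine eqOn_of_eqOn_interior ?_ (hF i).continuousOn ?_
      · unfold symb
        exact continuousOn_finsetSum _ fun j _ =>
          ((hc 4 j).const_mul _).add ((hc 5 j).const_mul _)
      · rintro ⟨p, y₃, Y, θ⟩ ⟨hp, hy, hY, -⟩
        simp only
        rw [← fastOp_eq hU hp (slowOpen_subset hy) hY, (h p hp y₃ hy Y hY θ).1]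
        rfl
    have h2 : EqOn (fun z => pd T σ 4 (lft (U 5)) z + P.ξ 0 * pd T σ 5 (lft (U 3)) z
        + P.ξ 1 * pd T σ 5 (lft (U 4)) z) (lft F₈) (fastDom T σ) := by
      refine eqOn_of_eqOn_interior (((hc 4 5).add ((hc 5 3).const_mul _)).add
        ((hc 5 4).const_mul _)) hF₈.continuousOn ?_
      rintro ⟨p, y₃, Y, θ⟩ ⟨hp, hy, hY, -⟩
      have hY' : Y ∈ σ.fastClosed := Side.mem_fastClosed.2 (Side.mem_fastOpen.1 hY).le
      simp only
      rw [← deriv_normal (hU 5) hp (slowOpen_subset hy) hY,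
        ← deriv_theta (hU 3) hp (slowOpen_subset hy) hY',
        ← deriv_theta (hU 4) hp (slowOpen_subset hy) hY']
      simp only [lft]
      exact_mod_cast (h p hp y₃ hy Y hY θ).2
    exact fun z hz => reduced_iff.2 ⟨fun i => h1 i hz, h2 hz⟩

/-- The jump conditions. -/
structure Jump (P : Params) (G : Fin 5 → ℝ) (U V : Fin 7 → ℝ) (d : ℝ) : Prop where
  u_plus : U 2 = G 0 + P.c .plus * d
  H_plus : U 5 = G 1 + P.b .plus * d
  u_minus : V 2 = G 2 + P.c .minus * d
  H_minus : V 5 = G 3 + P.b .minus * d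
  q : U 6 - V 6 = G 4

theorem jump_iff {G : Fin 5 → ℝ} {U V : Fin 7 → ℝ} {d : ℝ} :
    Params.B .plus *ᵥ U + Params.B .minus *ᵥ V + d • P.bvec = G ↔ Jump P G U V d := by
  constructor
  · intro h
    have h0 := congrFun h 0
    have h1 := congrFun h 1
    have h2 := congrFun h 2
    have h3 := congrFun h 3
    have h4 := congrFun h 4
    simp [Params.B, Params.bvec, dotProduct, Fin.sum_univ_succ] at h0 h1 h2 h3 h4
    exact ⟨by linarith, by linarith, by linarith, by linarith, by linarith⟩
  · rintro ⟨h0, h1, h2, h3, h4⟩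
    funext i
    fin_cases i <;>
      simp [Params.B, Params.bvec, dotProduct, Fin.sum_univ_succ] <;> linarith

theorem solvesFast_iff (hT : 0 < T) {F : Side → Fin 7 → FastFun} {F₈ : Side → FastFun}
    {G : Fin 5 → BdryFun} {U : Side → Fin 7 → FastFun} {ψ : BdryFun}
    (hF : ∀ σ i, IsProfile T σ (F σ i)) (hF₈ : ∀ σ, IsProfile T σ (F₈ σ))
    (hU : ∀ σ i, IsProfile T σ (U σ i)) :
    SolvesFast T P F F₈ G U ψ ↔
      (∀ σ, Evol T σ P (fun j => lft (U σ j)) (fun j => lft (F σ j)) (lft (F₈ σ))) ∧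
      ∀ p ∈ baseDom T, ∀ θ : ℝ, Jump P (fun i => G i p θ) (fun j => U .plus j p 0 0 θ)
        (fun j => U .minus j p 0 0 θ) (deriv (fun θ' => ψ p θ') θ) := by
  have he := fun σ => evol_iff (P := P) hT (fun j => (hU σ j).tame hT)
    (fun j => (hF σ j).tame hT) ((hF₈ σ).tame hT)
  constructor
  · intro h
    exact ⟨fun σ => (he σ).2 fun p hp y₃ hy Y hY θ =>
      ⟨h.evolution σ p hp y₃ hy Y hY θ, h.divergence σ p hp y₃ hy Y hY θ⟩,
      fun p hp θ => jump_iff.1 (h.jump p hp θ)⟩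
  · rintro ⟨h1, h2⟩
    exact ⟨fun σ p hp y₃ hy Y hY θ => ((he σ).1 (h1 σ) p hp y₃ hy Y hY θ).1,
      fun σ p hp y₃ hy Y hY θ => ((he σ).1 (h1 σ) p hp y₃ hy Y hY θ).2,
      fun p hp θ => jump_iff.2 (h2 p hp θ)⟩

/-! ### Linear combinations of normal and angular derivatives -/

/-- A linear combination of the derivatives of the functions `U j` in `Y₃` and `θ`. -/
noncomputable def lcomb (T : ℝ) (σ : Side) (α β : Fin 7 → ℂ) (U : Fin 7 → Pt → ℂ) (z : Pt) : ℂ :=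
  ∑ j, (α j * pd T σ 4 (U j) z + β j * pd T σ 5 (U j) z)

section lcomb

variable {α β : Fin 7 → ℂ} {U r s : Fin 7 → Pt → ℂ}

theorem tame_lcomb (hT : 0 < T) (hU : ∀ j, Tame T σ δ (U j)) :
    Tame T σ δ (lcomb T σ α β U) := by
  have : ∀ t : Finset (Fin 7), Tame T σ δ
      (fun z => ∑ j ∈ t, (α j * pd T σ 4 (U j) z + β j * pd T σ 5 (U j) z)) := by
    intro t
    induction t using Finset.induction_on with
    | empty => simpa using Tame.zero
    | insert a t ha ih =>
      simp only [Finset.sum_insert ha]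
      exact ((((hU a).pd hT 4).const_mul hT _).add hT (((hU a).pd hT 5).const_mul hT _)).add hT ih
  exact this _

theorem dec_lcomb (hT : 0 < T) (hU : ∀ j, Dec T σ (U j) (r j) (s j)) :
    Dec T σ (lcomb T σ α β U) (lcomb T σ α β r) (lcomb T σ α β s) :=
  Dec.sum hT _ fun j => (((hU j).pd hT 4).const_mul hT _).add hT (((hU j).pd hT 5).const_mul hT _)

theorem mode_sum {ι : Type*} (t : Finset ι) {h : ι → Pt → ℂ} (hT : 0 < T)
    (hh : ∀ i, Tame T σ δ (h i)) (k : ℤ) :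
    EqOn (mode k fun z => ∑ i ∈ t, h i z) (fun z => ∑ i ∈ t, mode k (h i) z) (fastDom T σ) := by
  classical
  have : Tame T σ δ (fun z => ∑ i ∈ t, h i z) ∧
    EqOn (mode k fun z => ∑ i ∈ t, h i z) (fun z => ∑ i ∈ t, mode k (h i) z) (fastDom T σ) := by
    induction t using Finset.induction_on with
    | empty =>
      refine ⟨by simpa using Tame.zero, fun z _ => ?_⟩
      simp [mode, trOp]
    | insert a t ha ih =>
      simp only [Finset.sum_insert ha]
      refine ⟨(hh a).add hT ih.1, fun z hz => ?_⟩
      rw [mode_add k (hh a) ih.1 hz]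
      simp only
      rw [ih.2 hz]
  exact this.2

theorem mode_lcomb (hδ : 0 ≤ δ) (hT : 0 < T) (hU : ∀ j, Tame T σ δ (U j)) (k : ℤ) :
    EqOn (mode k (lcomb T σ α β U)) (lcomb T σ α β fun j => mode k (U j)) (fastDom T σ) := by
  intro z hz
  unfold lcomb
  rw [mode_sum Finset.univ hT (fun j => (((hU j).pd hT 4).const_mul hT (α j)).add hT
    (((hU j).pd hT 5).const_mul hT (β j))) k hz]
  refine Finset.sum_congr rfl fun j _ => ?_
  rw [mode_add k (((hU j).pd hT 4).const_mul hT (α j)) (((hU j).pd hT 5).const_mul hT (β j)) hz]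
  simp only
  rw [mode_const_mul, mode_const_mul, pd_mode hδ hT (hU j) k 4 hz, pd_mode hδ hT (hU j) k 5 hz]

end lcomb

/-- The coefficients of the equation for the divergence of the magnetic field. -/
noncomputable def divCoef (P : Params) : Fin 7 → ℂ := ![0, 0, 0, P.ξ 0, P.ξ 1, 0, 0]

/-- All eight equations are constant-coefficient combinations of normal and angular derivatives. In
this shape, splitting into slow and fast parts and passing to Fourier modes are proved once for all
of them. -/
theorem evol_iff_lcomb {U F : Fin 7 → Pt → ℂ} {F₈ : Pt → ℂ} : Evol T σ P U F F₈ ↔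
    (∀ i, ∀ z ∈ fastDom T σ,
      lcomb T σ (fun j => (P.A₃ σ i j : ℂ)) (fun j => (P.calA σ i j : ℂ)) U z = F i z) ∧
    ∀ z ∈ fastDom T σ, lcomb T σ ![0, 0, 0, 0, 0, 1, 0] (divCoef P) U z = F₈ z := by
  have h8 : ∀ z, lcomb T σ ![0, 0, 0, 0, 0, 1, 0] (divCoef P) U z
      = pd T σ 4 (U 5) z + P.ξ 0 * pd T σ 5 (U 3) z + P.ξ 1 * pd T σ 5 (U 4) z := by
    intro z
    simp [lcomb, divCoef, Fin.sum_univ_succ]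
    ring
  constructor
  · intro h
    exact ⟨fun i z hz => (reduced_iff.1 (h z hz)).1 i, fun z hz => by
      rw [h8]; exact (reduced_iff.1 (h z hz)).2⟩
  · rintro ⟨h1, h2⟩ z hz
    exact reduced_iff.2 ⟨fun i => h1 i z hz, by rw [← h8]; exact h2 z hz⟩

theorem Evol.dec (hT : 0 < T) {U F Ur Fr Us Fs : Fin 7 → Pt → ℂ} {F₈ F₈r F₈s : Pt → ℂ}
    (h : Evol T σ P U F F₈) (hU : ∀ j, Dec T σ (U j) (Ur j) (Us j))
    (hF : ∀ j, Dec T σ (F j) (Fr j) (Fs j)) (hF₈ : Dec T σ F₈ F₈r F₈s) :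
    Evol T σ P Ur Fr F₈r ∧ Evol T σ P Us Fs F₈s := by
  obtain ⟨h1, h2⟩ := evol_iff_lcomb.1 h
  have h1' := fun i => ((dec_lcomb hT hU).congr (fun z hz => (h1 i z hz).symm) (fun _ _ => rfl)
    (fun _ _ => rfl)).unique hT (hF i)
  have h2' := ((dec_lcomb hT hU).congr (fun z hz => (h2 z hz).symm) (fun _ _ => rfl)
    (fun _ _ => rfl)).unique hT hF₈
  exact ⟨evol_iff_lcomb.2 ⟨fun i z hz => (h1' i).1 hz, fun z hz => h2'.1 hz⟩,
    evol_iff_lcomb.2 ⟨fun i z hz => (h1' i).2 hz, fun z hz => h2'.2 hz⟩⟩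

theorem Evol.mode (hδ : 0 ≤ δ) (hT : 0 < T) {U F : Fin 7 → Pt → ℂ} {F₈ : Pt → ℂ}
    (h : Evol T σ P U F F₈) (hU : ∀ j, Tame T σ δ (U j)) (k : ℤ) :
    Evol T σ P (fun j => mode k (U j)) (fun j => mode k (F j)) (mode k F₈) := by
  obtain ⟨h1, h2⟩ := evol_iff_lcomb.1 h
  refine evol_iff_lcomb.2 ⟨fun i z hz => ?_, fun z hz => ?_⟩
  · rw [← mode_lcomb hδ hT hU k hz]
    exact mode_congr k (fun z hz => h1 i z hz) hz
  · rw [← mode_lcomb hδ hT hU k hz]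
    exact mode_congr k (fun z hz => h2 z hz) hz

theorem pd_theta_mode (hδ : 0 ≤ δ) (hT : 0 < T) (hf : Tame T σ δ f) (k : ℤ) {z : Pt}
    (hz : z ∈ fastDom T σ) : pd T σ 5 (mode k f) z = Complex.I * k * mode k f z := by
  rw [pd_mode hδ hT hf k 5 hz, mode_pd_theta hδ hT hf k hz]

/-! ### The duality formula -/

/-- The boundary form in the duality formula. -/
noncomputable def bform (P : Params) (σ : Side) (k : ℤ) (v : Fin 7 → ℂ) : ℂ :=
  P.ell₁ σ * v 2 + P.ell₂ σ * v 5 - σ.sg * Complex.I * P.τ * (Int.sign k : ℂ) * v 6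

/-- ℒ(k) is a left null vector of ±|k| A₃ + i k 𝒜, and its pairing with A₃ is the covector `bform`.
The verification uses |ξ'| = 1 for the pressure entry and i² = -1 for the normal ones. -/
theorem sum_calL_symb (h₂ : P.RationalDirection) {k : ℤ} (hk : k ≠ 0) (y x : Fin 7 → ℂ) :
    ∑ i, star (P.calL σ k i) * symb P σ y (fun j => Complex.I * k * x j) i
      = bform P σ k y - σ.sg * |(k : ℝ)| * bform P σ k x := by
  have hξ : (P.ξ 0 : ℂ) ^ 2 + (P.ξ 1 : ℂ) ^ 2 = 1 := by exact_mod_cast norm_xi h₂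
  have hI := Complex.I_sq
  rw [symb_eq]
  rcases lt_or_gt_of_ne hk with hk' | hk'
  · have h1 : ¬ 0 < k := by omega
    have h2 : |(k : ℝ)| = -k := abs_of_neg (by exact_mod_cast hk')
    have h3 : Int.sign k = -1 := Int.sign_eq_neg_one_of_neg hk'
    simp only [Params.calL, h1, if_false, bform, h2, h3]
    cases σ <;>
      simp [Fin.sum_univ_succ, Params.boldL, Params.ell₁, Params.ell₂, Side.sg] <;>
      simp only [Params.c, Params.a, Params.b, Complex.ofReal_add, Complex.ofReal_mul]
    · linear_combination (P.τ * Complex.I * k * x 6) * hξ + (k * (P.τ * (P.τ + (P.ξ 0 * P.u .plus 0 + P.ξ 1 * P.u .plus 1 : ℂ))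
          - 2 * (P.ξ 0 * P.H .plus 0 + P.ξ 1 * P.H .plus 1 : ℂ) ^ 2) * x 2
          + k * ((P.τ + 2 * (P.ξ 0 * P.u .plus 0 + P.ξ 1 * P.u .plus 1 : ℂ))
          * (P.ξ 0 * P.H .plus 0 + P.ξ 1 * P.H .plus 1 : ℂ)) * x 5) * hI
    · linear_combination (P.τ * Complex.I * k * x 6) * hξ - (k * (P.τ * (P.τ + (P.ξ 0 * P.u .minus 0 + P.ξ 1 * P.u .minus 1 : ℂ))
          - 2 * (P.ξ 0 * P.H .minus 0 + P.ξ 1 * P.H .minus 1 : ℂ) ^ 2) * x 2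
          + k * ((P.τ + 2 * (P.ξ 0 * P.u .minus 0 + P.ξ 1 * P.u .minus 1 : ℂ))
          * (P.ξ 0 * P.H .minus 0 + P.ξ 1 * P.H .minus 1 : ℂ)) * x 5) * hI
  · have h2 : |(k : ℝ)| = k := abs_of_pos (by exact_mod_cast hk')
    have h3 : Int.sign k = 1 := Int.sign_eq_one_of_pos hk'
    simp only [Params.calL, hk', if_true, bform, h2, h3]
    cases σ <;>
      simp [Fin.sum_univ_succ, Params.boldL, Params.ell₁, Params.ell₂, Side.sg, Complex.conj_ofNat] <;>
      simp only [Params.c, Params.a, Params.b, Complex.ofReal_add, Complex.ofReal_mul]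
    · linear_combination (P.τ * Complex.I * k * x 6) * hξ - (k * (P.τ * (P.τ + (P.ξ 0 * P.u .plus 0 + P.ξ 1 * P.u .plus 1 : ℂ))
          - 2 * (P.ξ 0 * P.H .plus 0 + P.ξ 1 * P.H .plus 1 : ℂ) ^ 2) * x 2
          + k * ((P.τ + 2 * (P.ξ 0 * P.u .plus 0 + P.ξ 1 * P.u .plus 1 : ℂ))
          * (P.ξ 0 * P.H .plus 0 + P.ξ 1 * P.H .plus 1 : ℂ)) * x 5) * hI
    · linear_combination (P.τ * Complex.I * k * x 6) * hξ + (k * (P.τ * (P.τ + (P.ξ 0 * P.u .minus 0 + P.ξ 1 * P.u .minus 1 : ℂ))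
          - 2 * (P.ξ 0 * P.H .minus 0 + P.ξ 1 * P.H .minus 1 : ℂ) ^ 2) * x 2
          + k * ((P.τ + 2 * (P.ξ 0 * P.u .minus 0 + P.ξ 1 * P.u .minus 1 : ℂ))
          * (P.ξ 0 * P.H .minus 0 + P.ξ 1 * P.H .minus 1 : ℂ)) * x 5) * hI

theorem tailOp_sum {ι : Type*} (t : Finset ι) {h : ι → Pt → ℂ} (hT : 0 < T)
    (hh : ∀ i, Tame T σ δ (h i)) {l : ℝ} (hl : 0 < l + δ) :
    EqOn (tailOp σ l fun z => ∑ i ∈ t, h i z) (fun z => ∑ i ∈ t, tailOp σ l (h i) z)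
      (fastDom T σ) := by
  classical
  have : Tame T σ δ (fun z => ∑ i ∈ t, h i z) ∧
    EqOn (tailOp σ l fun z => ∑ i ∈ t, h i z) (fun z => ∑ i ∈ t, tailOp σ l (h i) z)
      (fastDom T σ) := by
    induction t using Finset.induction_on with
    | empty =>
      refine ⟨by simpa using Tame.zero, fun z _ => ?_⟩
      simp [tailOp, trOp]
    | insert a t ha ih =>
      simp only [Finset.sum_insert ha]
      refine ⟨(hh a).add hT ih.1, fun z hz => ?_⟩
      show trOp _ _ _ _ z = _
      rw [trOp_add (isKernel_tail T σ hl) (hh a) ih.1 hz]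
      simp only
      congr 1
      exact ih.2 hz
  exact this.2

theorem tame_bform (hT : 0 < T) {V : Fin 7 → Pt → ℂ} (hV : ∀ j, Tame T σ δ (V j)) (k : ℤ) :
    Tame T σ δ (fun z => bform P σ k fun j => V j z) :=
  (((hV 2).const_mul hT _).add hT ((hV 5).const_mul hT _)).sub hT ((hV 6).const_mul hT _)

theorem pd_bform (hT : 0 < T) {V : Fin 7 → Pt → ℂ} (hV : ∀ j, Tame T σ δ (V j)) (k : ℤ) (i : Fin 6)
    {z : Pt} (hz : z ∈ fastDom T σ) : pd T σ i (fun z => bform P σ k fun j => V j z) z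
      = bform P σ k fun j => pd T σ i (V j) z := by
  have := ((((hV 2).hasGrad.const_mul (P.ell₁ σ : ℂ)).add
    ((hV 5).hasGrad.const_mul (P.ell₂ σ : ℂ))).add
    ((hV 6).hasGrad.const_mul (-(σ.sg * Complex.I * P.τ * (Int.sign k : ℂ))))).pd_eq hT i hz
  simp only at this
  rw [show (fun z => bform P σ k fun j => V j z) = (fun z => (P.ell₁ σ : ℂ) * V 2 z
    + (P.ell₂ σ : ℂ) * V 5 z + (-(σ.sg * Complex.I * P.τ * (Int.sign k : ℂ))) * V 6 z) from
    funext fun z => by simp only [bform]; ring, this, bform]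
  ring

/-- Paired with ℒ(k), the k-th mode of the equations becomes N' - (±|k|) N = ℒ(k) • F̂ for the
scalar N = `bform`. Tail averaging with rate |k| inverts this operator and leaves ∓N. -/
theorem duality (hT : 0 < T) (h₂ : P.RationalDirection) {U F : Fin 7 → Pt → ℂ} {F₈ : Pt → ℂ}
    (hE : Evol T σ P U F F₈) (hU : ∀ j, Tame T σ 0 (U j)) (hF : ∀ j, Tame T σ 0 (F j)) {k : ℤ}
    (hk : k ≠ 0) {z : Pt} (hz : z ∈ fastDom T σ) :
    ∑ i, star (P.calL σ k i) * tailOp σ |(k : ℝ)| (mode k (F i)) z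
      = -σ.sg * bform P σ k (fun j => mode k (U j) z) := by
  have hk' : 0 < |(k : ℝ)| + 0 := by
    rw [add_zero]
    exact abs_pos.2 (by exact_mod_cast hk)
  have hUk := fun j => (hU j).mode le_rfl hT k
  have hFk := fun j => (hF j).mode le_rfl hT k
  set N : Pt → ℂ := fun z => bform P σ k fun j => mode k (U j) z with hN
  have htN : Tame T σ 0 N := tame_bform hT hUk k
  have h1 : EqOn (fun z => ∑ i, star (P.calL σ k i) * mode k (F i) z)
      (fun z => pd T σ 4 N z + (-(σ.sg * |(k : ℝ)| : ℂ)) * N z) (fastDom T σ) := by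
    intro w hw
    have h2 := reduced_iff.1 (hE.mode le_rfl hT hU k w hw)
    have h3 := sum_calL_symb (σ := σ) h₂ hk (fun j => pd T σ 4 (mode k (U j)) w)
      (fun j => mode k (U j) w)
    have h4 : (fun j => pd T σ 5 (mode k (U j)) w) = fun j => Complex.I * k * mode k (U j) w :=
      funext fun j => pd_theta_mode le_rfl hT (hU j) k hw
    simp only [h4] at h2
    simp only [h2.1] at h3
    simp only
    rw [h3, hN, pd_bform hT hUk k 4 hw]
    ring
  have h5 := trOp_congr (isKernel_tail T σ hk') h1 hz
  rw [trOp_add (isKernel_tail T σ hk') (htN.pd hT 4) (htN.const_mul hT _) hz] at h5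
  simp only [trOp_const_mul] at h5
  have h6 := tailOp_sum Finset.univ hT (fun i => (hFk i).const_mul hT (star (P.calL σ k i))) hk' hz
  simp only at h6
  have h7 := tailOp_pd_normal le_rfl hT htN hk' hz
  unfold tailOp at h6 h7 ⊢
  simp only [trOp_const_mul] at h6
  rw [← h6, h5, h7]
  ring

/-- The integrals of the orthogonality condition. -/
theorem integral_duality (hT : 0 < T) {F : Fin 7 → FastFun} (hF : ∀ j, Tame T σ 0 (lft (F j))) {k : ℤ}
    (hk : k ≠ 0) {p : Base} (hp : p ∈ baseDom T) :
    ∫ a in Ioi (0 : ℝ), (Real.exp (-|(k : ℝ)| * a) : ℂ)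
        * (star (P.calL σ k) ⬝ᵥ fcoefVec F p 0 (σ.sg * a) k)
      = ∑ i, star (P.calL σ k i) * tailOp σ |(k : ℝ)| (mode k (lft (F i))) (p, 0, 0, 0) := by
  have hk' : 0 < |(k : ℝ)| + 0 := by
    rw [add_zero]
    exact abs_pos.2 (by exact_mod_cast hk)
  have hz : ((p, 0, 0, 0) : Pt) ∈ fastDom T σ :=
    mem_fastDom.2 ⟨hp, σ.zero_mem_slowClosed, σ.zero_mem_fastClosed⟩
  have h := tailOp_sum Finset.univ hT
    (fun i => ((hF i).mode le_rfl hT k).const_mul hT (star (P.calL σ k i))) hk' hz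
  simp only at h
  unfold tailOp at h ⊢
  simp only [trOp_const_mul] at h
  rw [← h, trOp]
  refine setIntegral_congr_fun measurableSet_Ioi fun a _ => ?_
  simp only [dotProduct, Pi.star_apply]
  congr 1
  · push_cast
    ring_nf
  · refine Finset.sum_congr rfl fun i _ => ?_
    rw [fcoefVec, fcoef_lft, smul_smul, add_smul_bas_four]
    simp [mul_comm]

theorem integral_duality_plus (hT : 0 < T) {F : Fin 7 → FastFun}
    (hF : ∀ j, Tame T .plus 0 (lft (F j))) {k : ℤ} (hk : k ≠ 0) {p : Base} (hp : p ∈ baseDom T) :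
    ∫ a in Ioi (0 : ℝ), (Real.exp (-|(k : ℝ)| * a) : ℂ)
        * (star (P.calL .plus k) ⬝ᵥ fcoefVec F p 0 a k)
      = ∑ i, star (P.calL .plus k i)
        * tailOp .plus |(k : ℝ)| (mode k (lft (F i))) (p, 0, 0, 0) := by
  rw [← integral_duality hT hF hk hp]
  simp only [Side.sg, one_mul]

theorem integral_duality_minus (hT : 0 < T) {F : Fin 7 → FastFun}
    (hF : ∀ j, Tame T .minus 0 (lft (F j))) {k : ℤ} (hk : k ≠ 0) {p : Base} (hp : p ∈ baseDom T) :
    ∫ a in Iio (0 : ℝ), (Real.exp (|(k : ℝ)| * a) : ℂ)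
        * (star (P.calL .minus k) ⬝ᵥ fcoefVec F p 0 a k)
      = ∑ i, star (P.calL .minus k i)
        * tailOp .minus |(k : ℝ)| (mode k (lft (F i))) (p, 0, 0, 0) := by
  rw [← integral_duality hT hF hk hp, ← integral_Iic_eq_integral_Iio]
  have := integral_comp_neg_Ioi 0 fun a => (Real.exp (|(k : ℝ)| * a) : ℂ)
        * (star (P.calL .minus k) ⬝ᵥ fcoefVec F p 0 a k)
  rw [neg_zero] at this
  rw [← this]
  simp only [Side.sg, neg_mul, one_mul, mul_neg]

/-! ### Jump conditions for Fourier modes -/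

/-- The index of the jump condition for the normal velocity. -/
def Side.iu : Side → Fin 5
  | .plus => 0
  | .minus => 2

/-- The index of the jump condition for the normal magnetic field. -/
def Side.iH : Side → Fin 5
  | .plus => 1
  | .minus => 3

theorem bdry_mem {p : Base} (hp : p ∈ baseDom T) (σ : Side) (θ : ℝ) :
    ((p, 0, 0, θ) : Pt) ∈ fastDom T σ :=
  mem_fastDom.2 ⟨hp, σ.zero_mem_slowClosed, σ.zero_mem_fastClosed⟩

theorem bdry_add (p : Base) (a : ℝ) : ((p, 0, 0, 0) : Pt) + a • bas 5 = (p, 0, 0, a) := by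
  rw [add_smul_bas_five]
  simp

/-- The jump conditions for the `k`-th Fourier modes at `(p, 0, 0, 0)`. -/
structure ModeJump (P : Params) (G : Fin 5 → Pt → ℂ) (U : Side → Fin 7 → Pt → ℂ) (ψ : Pt → ℂ)
    (p : Base) (k : ℤ) : Prop where
  u : ∀ σ : Side, mode k (U σ 2) (p, 0, 0, 0)
    = mode k (G σ.iu) (p, 0, 0, 0) + P.c σ * (Complex.I * k * mode k ψ (p, 0, 0, 0))
  H : ∀ σ : Side, mode k (U σ 5) (p, 0, 0, 0)
    = mode k (G σ.iH) (p, 0, 0, 0) + P.b σ * (Complex.I * k * mode k ψ (p, 0, 0, 0))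
  q : mode k (U .plus 6) (p, 0, 0, 0) - mode k (U .minus 6) (p, 0, 0, 0)
    = mode k (G 4) (p, 0, 0, 0)

/-- The two functions may live on opposite sides of the sheet. They are compared along a θ-line
common to both domains, where each is the sum of its modes. -/
theorem line_eq_of_mode_eq (hT : 0 < T) {σ' : Side} (hf : Tame T σ 0 f) (hg : Tame T σ' 0 g)
    {z : Pt} (hz : z ∈ fastDom T σ) (hz' : z ∈ fastDom T σ') (h : ∀ k, mode k f z = mode k g z)
    (a : ℝ) : f (z + a • bas 5) = g (z + a • bas 5) := by
  have h1 := hasSum_mode le_rfl hT hf (add_theta_mem a hz)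
  have h2 := hasSum_mode le_rfl hT hg (add_theta_mem a hz')
  simp only [mode_add_theta hf.per _ hz, h, ← mode_add_theta hg.per _ hz'] at h1
  exact h1.unique h2

theorem mode_add_const_mul_pd (hT : 0 < T) (hf : Tame T σ 0 f) (hg : Tame T σ 0 g) (c : ℂ) (k : ℤ)
    {z : Pt} (hz : z ∈ fastDom T σ) : mode k (fun z => f z + c * pd T σ 5 g z) z
      = mode k f z + c * (Complex.I * k * mode k g z) := by
  rw [mode_add k hf ((hg.pd hT 5).const_mul hT c) hz]
  simp only
  rw [mode_const_mul, mode_pd_theta le_rfl hT hg k hz]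

theorem jump_iff_mode (hT : 0 < T) {G : Fin 5 → BdryFun} {U : Side → Fin 7 → FastFun} {ψ : BdryFun}
    (hG : ∀ i, IsHInfty T (G i)) (hU : ∀ σ i, Tame T σ 0 (lft (U σ i))) (hψ : IsHInfty T ψ)
    {p : Base} (hp : p ∈ baseDom T) :
    (∀ θ : ℝ, Jump P (fun i => G i p θ) (fun j => U .plus j p 0 0 θ)
      (fun j => U .minus j p 0 0 θ) (deriv (fun θ' => ψ p θ') θ)) ↔
    ∀ k, ModeJump P (fun i => lft (ofBdry (G i))) (fun σ j => lft (U σ j)) (lft (ofBdry ψ)) p k := by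
  have hz := fun σ => bdry_mem hp σ 0
  have hg := fun σ i => (hG i).tame hT σ
  have hs := fun σ => hψ.tame hT σ
  have hd := fun σ θ => deriv_theta_bdry hT hψ σ hp θ
  constructor
  · intro h k
    refine ⟨fun σ => ?_, fun σ => ?_, ?_⟩
    · rw [← mode_add_const_mul_pd hT (hg σ _) (hs σ) _ k (hz σ)]
      refine mode_line_congr k fun a => ?_
      simp only [bdry_add, ← hd]
      cases σ
      · have := congrArg Complex.ofReal (h a).u_plus
        rw [Complex.ofReal_add, Complex.ofReal_mul] at this
        exact this
      · have := congrArg Complex.ofReal (h a).u_minus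
        rw [Complex.ofReal_add, Complex.ofReal_mul] at this
        exact this
    · rw [← mode_add_const_mul_pd hT (hg σ _) (hs σ) _ k (hz σ)]
      refine mode_line_congr k fun a => ?_
      simp only [bdry_add, ← hd]
      cases σ
      · have := congrArg Complex.ofReal (h a).H_plus
        rw [Complex.ofReal_add, Complex.ofReal_mul] at this
        exact this
      · have := congrArg Complex.ofReal (h a).H_minus
        rw [Complex.ofReal_add, Complex.ofReal_mul] at this
        exact this
    · have h1 : mode k (lft (U .plus 6)) (p, 0, 0, 0)
          = mode k (fun z => lft (U .minus 6) z + lft (ofBdry (G 4)) z) (p, 0, 0, 0) := by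
        refine mode_line_congr k fun a => ?_
        simp only [bdry_add, lft, ofBdry]
        exact_mod_cast by linarith [(h a).q]
      rw [h1, mode_add k (hU .minus 6) (hg .minus 4) (hz .minus)]
      ring
  · intro h θ
    have hu : ∀ σ, U σ 2 p 0 0 θ = G σ.iu p θ + P.c σ * deriv (fun θ' => ψ p θ') θ := by
      intro σ
      have := line_eq_of_mode_eq hT (hU σ 2)
        ((hg σ σ.iu).add hT (((hs σ).pd hT 5).const_mul hT (P.c σ))) (hz σ) (hz σ)
        (fun k => by rw [mode_add_const_mul_pd hT (hg σ _) (hs σ) _ k (hz σ), (h k).u σ]) θ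
      simp only [bdry_add, ← hd] at this
      exact Complex.ofReal_injective (by rw [Complex.ofReal_add, Complex.ofReal_mul]; exact this)
    have hH : ∀ σ, U σ 5 p 0 0 θ = G σ.iH p θ + P.b σ * deriv (fun θ' => ψ p θ') θ := by
      intro σ
      have := line_eq_of_mode_eq hT (hU σ 5)
        ((hg σ σ.iH).add hT (((hs σ).pd hT 5).const_mul hT (P.b σ))) (hz σ) (hz σ)
        (fun k => by rw [mode_add_const_mul_pd hT (hg σ _) (hs σ) _ k (hz σ), (h k).H σ]) θ
      simp only [bdry_add, ← hd] at this
      exact Complex.ofReal_injective (by rw [Complex.ofReal_add, Complex.ofReal_mul]; exact this)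
    refine ⟨hu .plus, hH .plus, hu .minus, hH .minus, ?_⟩
    have := line_eq_of_mode_eq hT (hU .plus 6) ((hU .minus 6).add hT (hg .minus 4)) (hz .plus)
      (hz .minus) (fun k => by
        rw [mode_add k (hU .minus 6) (hg .minus 4) (hz .minus)]
        have := (h k).q
        simp only at this ⊢
        linear_combination this) θ
    simp only [bdry_add, lft, ofBdry] at this
    have h2 : U .plus 6 p 0 0 θ = U .minus 6 p 0 0 θ + G 4 p θ := by exact_mod_cast this
    linarith

/-! ### Necessity of the compatibility conditions -/

/-- On each side ℓ₁ c + ℓ₂ b = -τ (c² - b²), and (H4) makes c² - b² opposite on the two sides. -/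
theorem ell_add (h₄ : P.LopatinskiiRoot) :
    (P.ell₁ .plus : ℂ) * P.c .plus + P.ell₂ .plus * P.b .plus
      + (P.ell₁ .minus * P.c .minus + P.ell₂ .minus * P.b .minus) = 0 := by
  have h : ∀ σ, (P.ell₁ σ : ℂ) * P.c σ + P.ell₂ σ * P.b σ
      = -P.τ * ((P.c σ : ℂ) ^ 2 - (P.b σ : ℂ) ^ 2) := by
    intro σ
    simp only [Params.ell₁, Params.ell₂, Params.c]
    push_cast
    ring
  rw [h, h]
  linear_combination -P.τ * mu_add h₄

/-- The orthogonality condition in terms of Fourier modes. -/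
theorem orthogonality_iff (hT : 0 < T) {F : Side → Fin 7 → FastFun} {G : Fin 5 → BdryFun}
    (hF : ∀ σ i, Tame T σ 0 (lft (F σ i))) {k : ℤ} (hk : k ≠ 0) {p : Base} (hp : p ∈ baseDom T) :
    ((∫ Y in Ioi (0 : ℝ), (Real.exp (-|(k : ℝ)| * Y) : ℂ)
        * (star (P.calL .plus k) ⬝ᵥ fcoefVec (F .plus) p 0 Y k))
      - (∫ Y in Iio (0 : ℝ), (Real.exp (|(k : ℝ)| * Y) : ℂ)
        * (star (P.calL .minus k) ⬝ᵥ fcoefVec (F .minus) p 0 Y k))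
      + P.ell₁ .plus * fcoef (fun θ => G 0 p θ) k
      + P.ell₂ .plus * fcoef (fun θ => G 1 p θ) k
      + P.ell₁ .minus * fcoef (fun θ => G 2 p θ) k
      + P.ell₂ .minus * fcoef (fun θ => G 3 p θ) k
      - Complex.I * P.τ * (Int.sign k : ℂ) * fcoef (fun θ => G 4 p θ) k = 0) ↔
    (∑ i, star (P.calL .plus k i)
        * tailOp .plus |(k : ℝ)| (mode k (lft (F .plus i))) (p, 0, 0, 0))
      - (∑ i, star (P.calL .minus k i)
        * tailOp .minus |(k : ℝ)| (mode k (lft (F .minus i))) (p, 0, 0, 0))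
      + P.ell₁ .plus * mode k (lft (ofBdry (G 0))) (p, 0, 0, 0)
      + P.ell₂ .plus * mode k (lft (ofBdry (G 1))) (p, 0, 0, 0)
      + P.ell₁ .minus * mode k (lft (ofBdry (G 2))) (p, 0, 0, 0)
      + P.ell₂ .minus * mode k (lft (ofBdry (G 3))) (p, 0, 0, 0)
      - Complex.I * P.τ * (Int.sign k : ℂ) * mode k (lft (ofBdry (G 4))) (p, 0, 0, 0) = 0 := by
  have hg : ∀ i, fcoef (fun θ => G i p θ) k = mode k (lft (ofBdry (G i))) (p, 0, 0, 0) :=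
    fun i => fcoef_lft (ofBdry (G i)) p 0 0 k
  rw [integral_duality_plus hT (hF .plus) hk hp, integral_duality_minus hT (hF .minus) hk hp,
    hg, hg, hg, hg, hg]

/-- The front enters with the coefficient of `ell_add` and drops out. The jump of q is left
unevaluated: necessity inserts it, while the construction of a solution solves for it. -/
theorem bform_jump {G : Fin 5 → Pt → ℂ} {U : Side → Fin 7 → Pt → ℂ} {ψ : Pt → ℂ} {p : Base} {k : ℤ}
    (h₄ : P.LopatinskiiRoot)
    (hu : ∀ σ : Side, mode k (U σ 2) (p, 0, 0, 0)
      = mode k (G σ.iu) (p, 0, 0, 0) + P.c σ * (Complex.I * k * mode k ψ (p, 0, 0, 0)))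
    (hH : ∀ σ : Side, mode k (U σ 5) (p, 0, 0, 0)
      = mode k (G σ.iH) (p, 0, 0, 0) + P.b σ * (Complex.I * k * mode k ψ (p, 0, 0, 0))) :
    bform P .plus k (fun j => mode k (U .plus j) (p, 0, 0, 0))
      + bform P .minus k (fun j => mode k (U .minus j) (p, 0, 0, 0))
      = P.ell₁ .plus * mode k (G 0) (p, 0, 0, 0) + P.ell₂ .plus * mode k (G 1) (p, 0, 0, 0)
        + P.ell₁ .minus * mode k (G 2) (p, 0, 0, 0) + P.ell₂ .minus * mode k (G 3) (p, 0, 0, 0)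
        - Complex.I * P.τ * (Int.sign k : ℂ)
          * (mode k (U .plus 6) (p, 0, 0, 0) - mode k (U .minus 6) (p, 0, 0, 0)) := by
  simp only [bform, hu, hH, Side.sg, Side.iu, Side.iH]
  push_cast
  linear_combination (Complex.I * k * mode k ψ (p, 0, 0, 0)) * ell_add h₄

/-- F₆ = ∂_θ(c H₃ - b u₃), while ξ_j F_{3+j} - τ F₈ = -∂_Y(c H₃ - b u₃). Equality of mixed
derivatives gives the condition. -/
theorem Evol.divergence (hT : 0 < T) {U F : Fin 7 → Pt → ℂ} {F₈ : Pt → ℂ}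
    (h : Evol T σ P U F F₈) (hU : ∀ j, Tame T σ 0 (U j)) (hF : ∀ j, Tame T σ 0 (F j))
    (hF₈ : Tame T σ 0 F₈) {z : Pt} (hz : z ∈ fastDom T σ) :
    pd T σ 4 (F 5) z + P.ξ 0 * pd T σ 5 (F 3) z + P.ξ 1 * pd T σ 5 (F 4) z
      - P.τ * pd T σ 5 F₈ z = 0 := by
  have h1 : EqOn (F 5) (fun z => -P.b σ * pd T σ 5 (U 2) z + P.c σ * pd T σ 5 (U 5) z)
      (fastDom T σ) := fun w hw => (h w hw).H₃.symm
  have h2 : EqOn (fun z => P.ξ 0 * F 3 z + P.ξ 1 * F 4 z + -P.τ * F₈ z)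
      (fun z => P.b σ * pd T σ 4 (U 2) z + -P.c σ * pd T σ 4 (U 5) z) (fastDom T σ) := by
    intro w hw
    have h3 := h w hw
    have hb : (P.b σ : ℂ) = P.ξ 0 * P.H σ 0 + P.ξ 1 * P.H σ 1 := by simp [Params.b]
    have hc : (P.c σ : ℂ) = P.τ + (P.ξ 0 * P.u σ 0 + P.ξ 1 * P.u σ 1) := by
      simp [Params.c, Params.a]
    simp only
    linear_combination (-P.ξ 0) * h3.H₁ - P.ξ 1 * h3.H₂ - P.b σ * h3.div_u + P.c σ * h3.div_H
      - F 6 w * hb + F₈ w * hc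
  have h3 := pd_congr (T := T) 4 h1 hz
  have h4 := pd_congr (T := T) 5 h2 hz
  rw [(((hU 2).pd hT 5).hasGrad.const_mul _ |>.add (((hU 5).pd hT 5).hasGrad.const_mul _)).pd_eq
    hT 4 hz] at h3
  rw [((((hF 3).hasGrad.const_mul _).add ((hF 4).hasGrad.const_mul _)).add
    (hF₈.hasGrad.const_mul _)).pd_eq hT 5 hz,
    ((((hU 2).pd hT 4).hasGrad.const_mul _).add (((hU 5).pd hT 4).hasGrad.const_mul _)).pd_eq
    hT 5 hz] at h4
  simp only at h3 h4
  rw [pd_comm hT (hU 2).smooth 5 4 hz, pd_comm hT (hU 5).smooth 5 4 hz] at h4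
  linear_combination h3 + h4

theorem slow_mean_eq_zero (hT : 0 < T) {U F : Fin 7 → Pt → ℂ} {F₈ : Pt → ℂ}
    (h : Evol T σ P U F F₈) (hU : ∀ j, Tame T σ 0 (U j)) (hi : ∀ j, NormalIndep T σ (U j)) :
    ∀ z ∈ fastDom T σ, (∀ i, mode 0 (F i) z = 0) ∧ mode 0 F₈ z = 0 := by
  intro z hz
  have hr := reduced_iff.1 (h.mode le_rfl hT hU 0 z hz)
  have h4 : ∀ j, pd T σ 4 (mode 0 (U j)) z = 0 := fun j =>
    ((hi j).mode 0).pd_normal hT ((hU j).mode le_rfl hT 0).smooth hz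
  have h5 : ∀ j, pd T σ 5 (mode 0 (U j)) z = 0 := fun j => by
    rw [pd_theta_mode le_rfl hT (hU j) 0 hz]
    simp
  simp only [h4, h5] at hr
  refine ⟨fun i => ?_, by rw [← hr.2]; simp⟩
  rw [← hr.1 i]
  simp [symb]

/-- On means every θ-derivative vanishes; the left-hand sides of the four tangential equations of
`Reduced` are then 0, which forces their right-hand sides to be 0. -/
theorem fast_mean_eq (hδ : 0 ≤ δ) (hT : 0 < T) {U F : Fin 7 → Pt → ℂ} {F₈ : Pt → ℂ}
    (h : Evol T σ P U F F₈) (hU : ∀ j, Tame T σ δ (U j)) {z : Pt} (hz : z ∈ fastDom T σ) :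
    (P.u σ 0 * mode 0 (F 6) z - P.H σ 0 * mode 0 F₈ z = mode 0 (F 0) z ∧
      P.u σ 1 * mode 0 (F 6) z - P.H σ 1 * mode 0 F₈ z = mode 0 (F 1) z) ∧
    P.H σ 0 * mode 0 (F 6) z - P.u σ 0 * mode 0 F₈ z = mode 0 (F 3) z ∧
      P.H σ 1 * mode 0 (F 6) z - P.u σ 1 * mode 0 F₈ z = mode 0 (F 4) z := by
  have hr := h.mode hδ hT hU 0 z hz
  have h5 : ∀ j, pd T σ 5 (mode 0 (U j)) z = 0 := fun j => by
    rw [pd_theta_mode hδ hT (hU j) 0 hz]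
    simp
  simp only [h5] at hr
  exact ⟨⟨by linear_combination hr.u₁, by linear_combination hr.u₂⟩,
    by linear_combination hr.H₁, by linear_combination hr.H₂⟩

/-- In -b ∂_θ u₃ + c ∂_θ H₃ at the boundary the front contributes (-bc + cb) ∂_θ² ψ = 0. The jump
conditions are taken mode by mode and reassembled along the θ-line. -/
theorem boundary_eq (hT : 0 < T) {U F : Fin 7 → Pt → ℂ} {F₈ gu gH ψ : Pt → ℂ}
    (h : Evol T σ P U F F₈) (hU : ∀ j, Tame T σ 0 (U j)) (hgu : Tame T σ 0 gu)
    (hgH : Tame T σ 0 gH) (hψ : Tame T σ 0 ψ) {p : Base} (hp : p ∈ baseDom T)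
    (hu : ∀ k : ℤ, mode k (U 2) (p, 0, 0, 0)
      = mode k gu (p, 0, 0, 0) + P.c σ * (Complex.I * k * mode k ψ (p, 0, 0, 0)))
    (hH : ∀ k : ℤ, mode k (U 5) (p, 0, 0, 0)
      = mode k gH (p, 0, 0, 0) + P.b σ * (Complex.I * k * mode k ψ (p, 0, 0, 0))) (θ : ℝ) :
    F 5 (p, 0, 0, θ) = -P.b σ * pd T σ 5 gu (p, 0, 0, θ) + P.c σ * pd T σ 5 gH (p, 0, 0, θ) := by
  have hz := bdry_mem hp σ 0
  have key : ∀ (v g : Pt → ℂ) (c : ℂ), Tame T σ 0 v → Tame T σ 0 g → (∀ k : ℤ, mode k v (p, 0, 0, 0)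
      = mode k g (p, 0, 0, 0) + c * (Complex.I * k * mode k ψ (p, 0, 0, 0))) →
      pd T σ 5 v (p, 0, 0, θ) = pd T σ 5 g (p, 0, 0, θ)
        + c * pd T σ 5 (pd T σ 5 ψ) (p, 0, 0, θ) := by
    intro v g c hv hg hm
    have hr := hg.add hT ((hψ.pd hT 5).const_mul hT c)
    rw [pd_theta_congr hv hr (bdry_mem hp σ θ) (bdry_mem hp σ θ) fun a => ?_,
      (hg.hasGrad.add ((hψ.pd hT 5).hasGrad.const_mul c)).pd_eq hT 5 (bdry_mem hp σ θ)]
    have := line_eq_of_mode_eq hT hv hr hz hz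
      (fun k => by rw [mode_add_const_mul_pd hT hg hψ c k hz, hm k]) (θ + a)
    rw [bdry_add] at this
    rw [add_smul_bas_five]
    exact this
  rw [← (h _ (bdry_mem hp σ θ)).H₃, key _ _ _ (hU 2) hgu hu, key _ _ _ (hU 5) hgH hH]
  ring

theorem mode_ofReal (f : FastFun) (z : Pt) : mode 0 (lft f) z = ((mode 0 (lft f) z).re : ℂ) := by
  have := mode_star (f := lft f) 0 z
  rw [neg_zero] at this
  have h2 : (fun z => starRingEnd ℂ (lft f z)) = lft f := funext fun z => Complex.conj_ofReal _
  rw [h2] at this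
  exact (Complex.conj_eq_iff_re.1 this.symm).symm

theorem compatible_of_solvesFast (hT : 0 < T) (h₂ : P.RationalDirection) (h₄ : P.LopatinskiiRoot)
    {F : Side → Fin 7 → FastFun} {F₈ : Side → FastFun} {G : Fin 5 → BdryFun}
    (hF : ∀ σ i, IsProfile T σ (F σ i)) (hF₈ : ∀ σ, IsProfile T σ (F₈ σ))
    (hG : ∀ i, IsHInfty T (G i)) {U : Side → Fin 7 → FastFun} {ψ : BdryFun}
    (hU : ∀ σ i, IsProfile T σ (U σ i)) (hψ : IsHInfty T ψ) (h : SolvesFast T P F F₈ G U ψ) :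
    Compatible T P F F₈ G := by
  obtain ⟨hE, hJ⟩ := (solvesFast_iff hT hF hF₈ hU).1 h
  have htU := fun σ i => (hU σ i).tame hT
  have htF := fun σ i => (hF σ i).tame hT
  have hM := fun p hp => (jump_iff_mode hT hG htU hψ hp).1 (hJ p hp)
  have hbd : ∀ σ, ∀ p ∈ baseDom T, ∀ θ, F σ 5 p 0 0 θ
      = -P.b σ * deriv (fun θ' => G σ.iu p θ') θ + P.c σ * deriv (fun θ' => G σ.iH p θ') θ := by
    intro σ p hp θ
    have := boundary_eq hT (hE σ) (htU σ) ((hG σ.iu).tame hT σ) ((hG σ.iH).tame hT σ)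
      (hψ.tame hT σ) hp (fun k => (hM p hp k).u σ) (fun k => (hM p hp k).H σ) θ
    rw [← deriv_theta_bdry hT (hG _) σ hp, ← deriv_theta_bdry hT (hG _) σ hp] at this
    simp only [lft] at this
    exact_mod_cast this
  have hdec := fun σ => (hE σ).dec hT (fun j => (hU σ j).dec hT) (fun j => (hF σ j).dec hT)
    ((hF₈ σ).dec hT)
  have hslow := fun σ => slow_mean_eq_zero hT (hdec σ).1 (fun j => ((hU σ j).dec hT).tame_r)
    (fun j => ((hU σ j).dec hT).indep)
  choose δ hδ _ hs using fun σ => exists_common_rate fun j => ((hU σ j).dec hT).tame_s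
  have hfast := fun σ (z : Pt) (hz : z ∈ fastDom T σ) =>
    fast_mean_eq (hδ σ).le hT (hdec σ).2 (hs σ) hz
  refine ⟨hbd .plus, hbd .minus, fun σ p hp y₃ hy i => ?_, fun σ p hp y₃ hy => ?_,
    fun σ p hp y₃ hy Y hY j i hij => ?_, fun σ p hp y₃ hy Y hY j i hij => ?_,
    fun σ p hp y₃ hy Y hY θ => ?_, fun p hp k hk => ?_⟩
  · exact (fcoef_lft (ofSlow (resid σ (F σ i))) p y₃ 0 0).trans
      ((hslow σ _ (mem_fastDom.2 ⟨hp, hy, σ.zero_mem_fastClosed⟩)).1 i)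
  · exact (fcoef_lft (ofSlow (resid σ (F₈ σ))) p y₃ 0 0).trans
      (hslow σ _ (mem_fastDom.2 ⟨hp, hy, σ.zero_mem_fastClosed⟩)).2
  · obtain ⟨⟨h0, h1⟩, -⟩ := hfast σ (p, y₃, Y, 0) (mem_fastDom.2 ⟨hp, hy, hY⟩)
    simp only [fcoef_lft]
    fin_cases j
    · obtain rfl : i = 0 := Fin.ext hij
      exact h0
    · obtain rfl : i = 1 := Fin.ext hij
      exact h1
  · obtain ⟨-, h0, h1⟩ := hfast σ (p, y₃, Y, 0) (mem_fastDom.2 ⟨hp, hy, hY⟩)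
    simp only [fcoef_lft]
    fin_cases j
    · obtain rfl : i = 3 := Fin.ext hij
      exact h0
    · obtain rfl : i = 4 := Fin.ext hij
      exact h1
  · have hy' := slowOpen_subset hy
    have hY' : Y ∈ σ.fastClosed := Side.mem_fastClosed.2 (Side.mem_fastOpen.1 hY).le
    have := (hE σ).divergence hT (htU σ) (htF σ) ((hF₈ σ).tame hT)
      (mem_fastDom.2 ⟨hp, hy', hY'⟩ : ((p, y₃, Y, θ) : Pt) ∈ fastDom T σ)
    rw [← deriv_normal (htF σ 5) hp hy' hY, ← deriv_theta (htF σ 3) hp hy' hY',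
      ← deriv_theta (htF σ 4) hp hy' hY', ← deriv_theta ((hF₈ σ).tame hT) hp hy' hY'] at this
    exact_mod_cast this
  -- By duality the difference of the two integrals is minus the sum of the boundary forms of the
  -- two sides, from which the front is eliminated by `bform_jump`.
  · rw [orthogonality_iff hT htF hk hp, duality hT h₂ (hE .plus) (htU .plus) (htF .plus) hk
      (bdry_mem hp .plus 0), duality hT h₂ (hE .minus) (htU .minus) (htF .minus) hk
      (bdry_mem hp .minus 0)]
    have h1 := bform_jump (G := fun i => lft (ofBdry (G i)))
      (U := fun σ j => lft (U σ j)) (ψ := lft (ofBdry ψ)) h₄ (fun σ => (hM p hp k).u σ) (fun σ => (hM p hp k).H σ)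
    have h2 := (hM p hp k).q
    simp only [Side.sg] at h1 h2 ⊢
    push_cast
    rw [h2] at h1
    linear_combination -h1

/-! ### Linear combinations of three functions -/

section lin

variable {h r₁ r₂ r₃ s₁ s₂ s₃ : Pt → ℂ}

theorem Tame.lin (hT : 0 < T) (hf : Tame T σ δ f) (hg : Tame T σ δ g) (hh : Tame T σ δ h)
    (a b c : ℂ) : Tame T σ δ (fun z => a * f z + b * g z + c * h z) :=
  ((hf.const_mul hT a).add hT (hg.const_mul hT b)).add hT (hh.const_mul hT c)

theorem Dec.lin (hT : 0 < T) (hf : Dec T σ f r₁ s₁) (hg : Dec T σ g r₂ s₂) (hh : Dec T σ h r₃ s₃)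
    (a b c : ℂ) : Dec T σ (fun z => a * f z + b * g z + c * h z)
      (fun z => a * r₁ z + b * r₂ z + c * r₃ z) (fun z => a * s₁ z + b * s₂ z + c * s₃ z) :=
  ((hf.const_mul hT a).add hT (hg.const_mul hT b)).add hT (hh.const_mul hT c)

theorem mode_lin (hT : 0 < T) (hf : Tame T σ δ f) (hg : Tame T σ δ g) (hh : Tame T σ δ h)
    (a b c : ℂ) (k : ℤ) {z : Pt} (hz : z ∈ fastDom T σ) :
    mode k (fun z => a * f z + b * g z + c * h z) z
      = a * mode k f z + b * mode k g z + c * mode k h z := by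
  rw [mode_add k ((hf.const_mul hT a).add hT (hg.const_mul hT b)) (hh.const_mul hT c) hz]
  simp only
  rw [mode_add k (hf.const_mul hT a) (hg.const_mul hT b) hz]
  simp only [mode_const_mul]

theorem pd_lin (hT : 0 < T) (hf : Tame T σ δ f) (hg : Tame T σ δ g) (hh : Tame T σ δ h)
    (a b c : ℂ) (i : Fin 6) {z : Pt} (hz : z ∈ fastDom T σ) :
    pd T σ i (fun z => a * f z + b * g z + c * h z) z
      = a * pd T σ i f z + b * pd T σ i g z + c * pd T σ i h z :=
  (((hf.hasGrad.const_mul a).add (hg.hasGrad.const_mul b)).add (hh.hasGrad.const_mul c)).pd_eq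
    hT i hz

end lin

/-! ### Antiderivatives of profiles -/

variable {r s : Pt → ℂ}

theorem antiTheta_line_congr {z : Pt} (h : ∀ a : ℝ, f (z + a • bas 5) = g (z + a • bas 5)) :
    antiTheta f z = antiTheta g z := by
  have h0 : ∀ b : ℝ, antiTheta₀ f (z + b • bas 5) = antiTheta₀ g (z + b • bas 5) := by
    intro b
    unfold antiTheta₀ trOp
    simp only [add_assoc, ← add_smul, h]
  have h1 := h0 0
  rw [zero_smul, add_zero] at h1
  unfold antiTheta
  rw [h1, mode_line_congr 0 h0]

theorem antiTheta_pd_theta (hδ : 0 ≤ δ) (hT : 0 < T) (hf : Tame T σ δ f) {z : Pt}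
    (hz : z ∈ fastDom T σ) : antiTheta (pd T σ 5 f) z = f z - mode 0 f z := by
  have h0 := fun w (hw : w ∈ fastDom T σ) => antiTheta₀_pd_theta hT hf hw
  have hm := hf.mode hδ hT 0
  unfold antiTheta
  rw [h0 z hz, mode_congr 0 (g := fun w => f w - mode 0 f w) h0 hz, mode_sub 0 hT hf hm hz]
  simp only
  rw [mode_zero_mode_zero hf.per hz]
  ring

theorem antiTheta_add (hδ : 0 ≤ δ) (hT : 0 < T) (hf : Tame T σ δ f) (hg : Tame T σ δ g) {z : Pt}
    (hz : z ∈ fastDom T σ) :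
    antiTheta (fun z => f z + g z) z = antiTheta f z + antiTheta g z := by
  have h0 : EqOn (antiTheta₀ fun z => f z + g z) (fun z => antiTheta₀ f z + antiTheta₀ g z)
    (fastDom T σ) := trOp_add (isKernel_antiTheta₀ T σ δ) hf hg
  unfold antiTheta
  rw [h0 hz, mode_congr 0 h0 hz, mode_add 0 (hf.antiTheta₀ hδ hT) (hg.antiTheta₀ hδ hT) hz]
  ring

/-- Antidifferentiation in θ acts along θ-lines only, so it preserves both independence of Y₃ and
decay in Y₃. -/
theorem Dec.antiTheta (hT : 0 < T) (h : Dec T σ f r s) :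
    Dec T σ (antiTheta f) (antiTheta r) (antiTheta s) := by
  obtain ⟨δ, hδ, hs⟩ := h.tame_s
  refine ⟨h.tame_r.antiTheta le_rfl hT, fun z hz => ?_, ⟨δ, hδ, hs.antiTheta hδ.le hT⟩,
    fun z hz => ?_⟩
  · have h1 : ∀ a : ℝ, r (z + a • bas 5) = r (scaleY 0 (z + a • bas 5)) :=
      fun a => h.indep _ (add_theta_mem a hz)
    have h2 : ∀ a : ℝ, FastProblem.antiTheta₀ r (z + a • bas 5)
        = FastProblem.antiTheta₀ r (scaleY 0 z + a • bas 5) := by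
      intro a
      unfold FastProblem.antiTheta₀ FastProblem.trOp
      simp only [add_assoc, ← add_smul, h1, scaleY_zero_add_theta]
    have h3 := h2 0
    rw [zero_smul, add_zero, add_zero] at h3
    unfold FastProblem.antiTheta
    rw [h3]
    congr 1
    unfold FastProblem.mode FastProblem.trOp
    simp only [h2]
  · rw [← antiTheta_add le_rfl hT h.tame_r (hs.mono hδ.le) hz]
    exact antiTheta_line_congr fun a => h.eq _ (add_theta_mem a hz)

theorem NormalIndep.antiTheta (hT : 0 < T) (hf : Tame T σ 0 f) (h : NormalIndep T σ f) :
    NormalIndep T σ (antiTheta f) :=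
  (Dec.antiTheta (s := fun _ => 0) hT
    ⟨hf, h, ⟨1, one_pos, Tame.zero⟩, fun _ _ => (add_zero _).symm⟩).indep

theorem pd_theta_eq_zero (hf : Tame T σ δ f) {z : Pt} (hz : z ∈ fastDom T σ)
    (h : ∀ a : ℝ, f (z + a • bas 5) = f z) : pd T σ 5 f z = 0 := by
  have h1 := hf.hasGrad.hasDerivAt_theta hz 0
  simp only [h] at h1
  simpa using h1.unique (hasDerivAt_const 0 (f z))

/-! ### Construction of means -/

/-- The factor 1 - |y₃| equals 1 on the sheet and 0 at y₃ = ±1. It normalizes the slow means there.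
-/
theorem tame_affine (hT : 0 < T) (σ : Side) :
    Tame T σ 0 (fun z => ((1 - σ.sg * z.2.1 : ℝ) : ℂ)) := by
  refine Tame.of_normalIndep hT ?_ ?_ fun z _ => by rw [scaleY_apply]
  · exact Complex.ofRealCLM.contDiff.comp_contDiffOn
      (contDiff_const.sub (contDiff_const.mul contDiff_snd.fst)).contDiffOn
  · intro v hv z _
    rcases hv with rfl | rfl | rfl
    · rw [add_smul_bas_one]
    · rw [add_smul_bas_two]
    · rw [add_smul_bas_five]

/-- The decaying part is minus the integral of the mean of `s` from Y₃ to infinity. The slow part, 1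
- |y₃| times the resulting discrepancy at Y₃ = 0, corrects the value on the sheet and vanishes at y₃
= ±1. -/
theorem exists_mean (hT : 0 < T) (hδ : 0 < δ) (hs : Tame T σ δ s) (hg : Tame T σ 0 g) :
    ∃ m r t, Dec T σ m r t ∧ (∀ z ∈ fastDom T σ, pd T σ 4 m z = mode 0 s z) ∧
      (∀ z ∈ fastDom T σ, pd T σ 5 m z = 0) ∧ (∀ z ∈ fastDom T σ, mode 0 m z = m z) ∧
      (∀ z ∈ fastDom T σ, z.2.1 = 0 → z.2.2.1 = 0 → m z = mode 0 g z) ∧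
      ∀ z ∈ fastDom T σ, z.2.1 = σ.sg → r z = 0 := by
  -- The tail average with l = 0 is the plain integral to infinity; it converges because δ > 0.
  have hl : 0 < (0 : ℝ) + δ := by linarith
  have hn := hs.mode hδ.le hT 0
  have ht := hn.tailOp hδ.le hT hl
  have hnθ : ∀ a : ℝ, ∀ z ∈ fastDom T σ, mode 0 s (z + a • bas 5) = mode 0 s z :=
    fun a z hz => mode_zero_theta hs.per hz a
  have htθ : ∀ a : ℝ, ∀ z ∈ fastDom T σ,
      tailOp σ 0 (mode 0 s) (z + a • bas 5) = tailOp σ 0 (mode 0 s) z :=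
    fun a z hz => trOp_translate (isKernel_tail T σ hl) (hnθ a) hz
  set h : Pt → ℂ := fun z => mode 0 g z + σ.sg * tailOp σ 0 (mode 0 s) z with hh
  have hth : Tame T σ 0 h :=
    (hg.mode le_rfl hT 0).add hT ((ht.mono hδ.le).const_mul hT _)
  have hhθ : ∀ a : ℝ, ∀ z ∈ fastDom T σ, h (z + a • bas 5) = h z := fun a z hz => by
    simp only [hh]
    rw [mode_zero_theta hg.per hz a, htθ a z hz]
  set r : Pt → ℂ := fun z => ((1 - σ.sg * z.2.1 : ℝ) : ℂ) * h (scaleY 0 z) with hr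
  have htr : Tame T σ 0 r := by
    have := (tame_affine hT σ).mul hT (hth.restrict le_rfl hT)
    rwa [add_zero] at this
  have hri : NormalIndep T σ r := fun z _ => by
    simp only [hr, scaleY_zero_of_normal (scaleY_zero_normal z)]
    rw [scaleY_apply]
  have hrθ : ∀ a : ℝ, ∀ z ∈ fastDom T σ, r (z + a • bas 5) = r z := fun a z hz => by
    simp only [hr]
    rw [scaleY_zero_add_theta, hhθ a _ (scaleY_mem le_rfl hz), add_smul_bas_five]
  set t : Pt → ℂ := fun z => -σ.sg * tailOp σ 0 (mode 0 s) z with htdef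
  have htt : Tame T σ δ t := ht.const_mul hT _
  have htm : Tame T σ 0 (fun z => r z + t z) := htr.add hT (htt.mono hδ.le)
  have hmθ : ∀ a : ℝ, ∀ z ∈ fastDom T σ, r (z + a • bas 5) + t (z + a • bas 5) = r z + t z :=
    fun a z hz => by
      simp only [htdef]
      rw [hrθ a z hz, htθ a z hz]
  refine ⟨fun z => r z + t z, r, t, ⟨htr, hri, ⟨δ, hδ, htt⟩, fun _ _ => rfl⟩, fun z hz => ?_,
    fun z hz => pd_theta_eq_zero htm hz fun a => hmθ a z hz,
    fun z hz => mode_zero_of_const fun a => hmθ a z hz, fun z _ h3 h4 => ?_, fun z _ h3 => ?_⟩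
  · rw [pd_add hT htr.smooth htt.smooth 4 hz]
    simp only
    rw [hri.pd_normal hT htr.smooth hz, htdef, pd_const_mul hT ht.smooth _ 4 hz]
    simp only
    rw [pd_tailOp hδ.le hT hn hl 4 hz, tailOp_pd_normal hδ.le hT hn hl hz]
    have : (σ.sg : ℂ) * σ.sg = 1 := by exact_mod_cast σ.sg_mul_sg
    push_cast
    linear_combination mode 0 s z * this
  · simp only [hr, htdef, hh, scaleY_zero_of_normal h4, h3]
    push_cast
    ring
  · simp only [hr, h3, σ.sg_mul_sg]
    simp

/-! ### Construction of oscillating profiles -/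

/-- For sources independent of Y₃ the system is solved without normal derivatives: w is the
θ-antiderivative of the first source and q minus that of the second. The decaying system then takes
over the remaining sources and the boundary value diminished by the slow w. -/
theorem exists_wave (hT : 0 < T) {F S rF rS sF sS e : Pt → ℂ} (hF : Dec T σ F rF sF)
    (hS : Dec T σ S rS sS) (he : Tame T σ 0 e) (he0 : ∀ z ∈ fastDom T σ, mode 0 e z = 0) :
    ∃ q w rq sq rw sw, Dec T σ q rq sq ∧ Dec T σ w rw sw ∧
      (∀ z ∈ fastDom T σ, pd T σ 4 q z + pd T σ 5 w z = F z - mode 0 F z) ∧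
      (∀ z ∈ fastDom T σ, pd T σ 4 w z - pd T σ 5 q z = S z - mode 0 S z) ∧
      (∀ z ∈ fastDom T σ, z.2.2.1 = 0 → w z = e z) ∧
      (∀ z ∈ fastDom T σ, mode 0 q z = 0) ∧ (∀ z ∈ fastDom T σ, mode 0 w z = 0) := by
  obtain ⟨δ, hδ, hδ2, hs⟩ := exists_common_rate (ι := Bool)
    (h := fun i => if i then sF else sS) (T := T) (σ := σ) (by
      rintro (_ | _)
      · exact hS.tame_s
      · exact hF.tame_s)
  have hsF : Tame T σ δ sF := hs true
  have hsS : Tame T σ δ sS := hs false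
  have hmF := hsF.mode hδ.le hT 0
  have hmS := hsS.mode hδ.le hT 0
  have hAF := hF.tame_r.antiTheta le_rfl hT
  have hAS := hS.tame_r.antiTheta le_rfl hT
  have osc : ∀ {v : Pt → ℂ}, Tame T σ δ v → ∀ z ∈ fastDom T σ,
      mode 0 (fun z => v z - mode 0 v z) z = 0 := by
    intro v hv z hz
    rw [mode_sub 0 hT hv (hv.mode hδ.le hT 0) hz]
    simp only
    rw [mode_zero_mode_zero hv.per hz, sub_self]
  obtain ⟨q, w, hq, hw, h1, h2, h3, hq0, hw0⟩ := exists_cauchyRiemann hδ.le hδ2 hT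
    (hsF.sub hT hmF) (hsS.sub hT hmS) (he.sub hT hAF) (osc hsF) (osc hsS) (fun z hz => by
      rw [mode_sub 0 hT he hAF hz]
      simp only
      rw [he0 z hz, mode_zero_antiTheta le_rfl hT hF.tame_r hz, sub_zero])
  have hAFi := NormalIndep.antiTheta hT hF.tame_r hF.indep
  have hASi := NormalIndep.antiTheta hT hS.tame_r hS.indep
  have hASn := hAS.const_mul hT (-1)
  have hqd : Dec T σ (fun z => -1 * antiTheta rS z + q z) (fun z => -1 * antiTheta rS z) q :=
    ⟨hASn, hASi.const_mul _, ⟨δ, hδ, hq⟩, fun _ _ => rfl⟩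
  have hwd : Dec T σ (fun z => antiTheta rF z + w z) (antiTheta rF) w :=
    ⟨hAF, hAFi, ⟨δ, hδ, hw⟩, fun _ _ => rfl⟩
  refine ⟨_, _, _, _, _, _, hqd, hwd, fun z hz => ?_, fun z hz => ?_, fun z hz hY => ?_,
    fun z hz => ?_, fun z hz => ?_⟩
  · rw [pd_add hT hASn.smooth hq.smooth 4 hz, pd_add hT hAF.smooth hw.smooth 5 hz]
    simp only
    rw [(hASi.const_mul (-1)).pd_normal hT hASn.smooth hz,
      pd_theta_antiTheta le_rfl hT hF.tame_r hz, hF.eq z hz, (hF.mode hT 0).eq z hz]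
    linear_combination h1 z hz
  · rw [pd_add hT hASn.smooth hq.smooth 5 hz, pd_add hT hAF.smooth hw.smooth 4 hz]
    simp only
    rw [hAFi.pd_normal hT hAF.smooth hz, pd_const_mul hT hAS.smooth _ 5 hz]
    simp only
    rw [pd_theta_antiTheta le_rfl hT hS.tame_r hz, hS.eq z hz, (hS.mode hT 0).eq z hz]
    linear_combination h2 z hz
  · rw [h3 z hz hY]
    ring
  · rw [mode_add 0 hASn (hq.mono hδ.le) hz]
    simp only
    rw [mode_const_mul, mode_zero_antiTheta le_rfl hT hS.tame_r hz, hq0 z hz]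
    simp
  · rw [mode_add 0 hAF (hw.mono hδ.le) hz]
    simp only
    rw [mode_zero_antiTheta le_rfl hT hF.tame_r hz, hw0 z hz, add_zero]

/-! ### Construction of a particular solution -/

/-- The compatibility conditions on one side of the sheet. -/
structure SideCompatible (T : ℝ) (σ : Side) (P : Params) (F : Fin 7 → Pt → ℂ) (F₈ gu gH : Pt → ℂ) :
    Prop where
  mean_u₁ : ∀ z ∈ fastDom T σ, mode 0 (F 0) z = P.u σ 0 * mode 0 (F 6) z - P.H σ 0 * mode 0 F₈ z
  mean_u₂ : ∀ z ∈ fastDom T σ, mode 0 (F 1) z = P.u σ 1 * mode 0 (F 6) z - P.H σ 1 * mode 0 F₈ z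
  mean_H₁ : ∀ z ∈ fastDom T σ, mode 0 (F 3) z = P.H σ 0 * mode 0 (F 6) z - P.u σ 0 * mode 0 F₈ z
  mean_H₂ : ∀ z ∈ fastDom T σ, mode 0 (F 4) z = P.H σ 1 * mode 0 (F 6) z - P.u σ 1 * mode 0 F₈ z
  mean_H₃ : ∀ z ∈ fastDom T σ, mode 0 (F 5) z = 0
  div : ∀ z ∈ fastDom T σ, pd T σ 4 (F 5) z + P.ξ 0 * pd T σ 5 (F 3) z
    + P.ξ 1 * pd T σ 5 (F 4) z - P.τ * pd T σ 5 F₈ z = 0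
  bdry : ∀ p ∈ baseDom T, ∀ θ : ℝ, F 5 (p, 0, 0, θ)
    = -P.b σ * pd T σ 5 gu (p, 0, 0, θ) + P.c σ * pd T σ 5 gH (p, 0, 0, θ)

/-- The construction solves the Cauchy–Riemann system for q, w = c u₃ - b H₃, takes
θ-antiderivatives for Z = c H₃ - b u₃ and the tangential sources, and inverts the 2×2 matrix with
entries c, -b. Normal means are then added; `gq` fixes only the mean of q, whose oscillation is
determined by the equations. -/
theorem SideCompatible.exists_solution (hT : 0 < T) (h₂ : P.RationalDirection)
    (hμ : (P.c σ : ℂ) ^ 2 - (P.b σ : ℂ) ^ 2 ≠ 0) {F rF sF : Fin 7 → Pt → ℂ}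
    {F₈ r₈ s₈ gu gH gq : Pt → ℂ} (hF : ∀ j, Dec T σ (F j) (rF j) (sF j)) (hF₈ : Dec T σ F₈ r₈ s₈)
    (hm : ∀ z ∈ fastDom T σ, mode 0 (F 2) z = mode 0 (sF 2) z ∧ mode 0 (F 6) z = mode 0 (sF 6) z ∧
      mode 0 F₈ z = mode 0 s₈ z)
    (hgu : Tame T σ 0 gu) (hgH : Tame T σ 0 gH) (hgq : Tame T σ 0 gq)
    (h : SideCompatible T σ P F F₈ gu gH) :
    ∃ U rU sU : Fin 7 → Pt → ℂ, (∀ j, Dec T σ (U j) (rU j) (sU j)) ∧ Evol T σ P U F F₈ ∧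
      (∀ z ∈ fastDom T σ, mode 0 (U 0) z = 0 ∧ mode 0 (U 1) z = 0 ∧ mode 0 (U 3) z = 0 ∧
        mode 0 (U 4) z = 0) ∧
      (∀ j, ∀ z ∈ fastDom T σ, z.2.1 = σ.sg → mode 0 (rU j) z = 0) ∧
      ∀ p ∈ baseDom T, (∀ θ : ℝ, U 2 (p, 0, 0, θ) = gu (p, 0, 0, θ) ∧
        U 5 (p, 0, 0, θ) = gH (p, 0, 0, θ)) ∧ mode 0 (U 6) (p, 0, 0, 0) = mode 0 gq (p, 0, 0, 0) := by
  obtain ⟨κ, hκ⟩ : ∃ κ : ℂ, κ * ((P.c σ : ℂ) ^ 2 - (P.b σ : ℂ) ^ 2) = 1 :=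
    ⟨_, inv_mul_cancel₀ hμ⟩
  have hξ : (P.ξ 0 : ℂ) ^ 2 + (P.ξ 1 : ℂ) ^ 2 = 1 := by exact_mod_cast norm_xi h₂
  have hb : (P.b σ : ℂ) = P.ξ 0 * P.H σ 0 + P.ξ 1 * P.H σ 1 := by simp [Params.b]
  have hc : (P.c σ : ℂ) = P.τ + (P.ξ 0 * P.u σ 0 + P.ξ 1 * P.u σ 1) := by
    simp [Params.c, Params.a]
  have tF := fun j => (hF j).tame hT
  have tF₈ := hF₈.tame hT
  -- the right-hand sides of the equations for the tangential components
  have df : ∀ (j : Fin 7) (l : Fin 2), ∃ r s, Dec T σ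
      (fun z => 1 * F j z + -P.u σ l * F 6 z + P.H σ l * F₈ z) r s := fun j l =>
    ⟨_, _, (hF j).lin hT (hF 6) hF₈ 1 _ _⟩
  have dg : ∀ (j : Fin 7) (l : Fin 2), ∃ r s, Dec T σ
      (fun z => 1 * F j z + -P.H σ l * F 6 z + P.u σ l * F₈ z) r s := fun j l =>
    ⟨_, _, (hF j).lin hT (hF 6) hF₈ 1 _ _⟩
  obtain ⟨_, _, df0⟩ := df 0 0
  obtain ⟨_, _, df1⟩ := df 1 1
  obtain ⟨_, _, dg0⟩ := dg 3 0
  obtain ⟨_, _, dg1⟩ := dg 4 1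
  set f0 : Pt → ℂ := fun z => 1 * F 0 z + -P.u σ 0 * F 6 z + P.H σ 0 * F₈ z with hf0
  set f1 : Pt → ℂ := fun z => 1 * F 1 z + -P.u σ 1 * F 6 z + P.H σ 1 * F₈ z with hf1
  set g0 : Pt → ℂ := fun z => 1 * F 3 z + -P.H σ 0 * F 6 z + P.u σ 0 * F₈ z with hg0
  set g1 : Pt → ℂ := fun z => 1 * F 4 z + -P.H σ 1 * F 6 z + P.u σ 1 * F₈ z with hg1
  have mf0 : ∀ z ∈ fastDom T σ, mode 0 f0 z = 0 := fun z hz => by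
    rw [hf0, mode_lin hT (tF 0) (tF 6) tF₈ _ _ _ 0 hz, h.mean_u₁ z hz]; ring
  have mf1 : ∀ z ∈ fastDom T σ, mode 0 f1 z = 0 := fun z hz => by
    rw [hf1, mode_lin hT (tF 1) (tF 6) tF₈ _ _ _ 0 hz, h.mean_u₂ z hz]; ring
  have mg0 : ∀ z ∈ fastDom T σ, mode 0 g0 z = 0 := fun z hz => by
    rw [hg0, mode_lin hT (tF 3) (tF 6) tF₈ _ _ _ 0 hz, h.mean_H₁ z hz]; ring
  have mg1 : ∀ z ∈ fastDom T σ, mode 0 g1 z = 0 := fun z hz => by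
    rw [hg1, mode_lin hT (tF 4) (tF 6) tF₈ _ _ _ 0 hz, h.mean_H₂ z hz]; ring
  have dff := df0.lin hT df1 Dec.zero (P.ξ 0) (P.ξ 1) 0
  have dS := (hF 6).lin hT hF₈ dff (P.c σ) (-P.b σ) (-1)
  -- the boundary values
  have tB := hgu.lin hT hgH Tame.zero (-P.b σ) (P.c σ) 0
  have tE := hgu.lin hT hgH Tame.zero (P.c σ) (-P.b σ) 0
  set B : Pt → ℂ := fun z => -P.b σ * gu z + P.c σ * gH z + 0 * 0 with hB
  set E : Pt → ℂ := fun z => P.c σ * gu z + -P.b σ * gH z + 0 * 0 with hE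
  have mE : ∀ z ∈ fastDom T σ, mode 0 (fun z => E z - mode 0 E z) z = 0 := fun z hz => by
    rw [mode_sub 0 hT tE (tE.mode le_rfl hT 0) hz]
    simp only
    rw [mode_zero_mode_zero tE.per hz, sub_self]
  obtain ⟨q, w, rq, sq, rw_, sw, dq, dw, hq1, hw1, hwb, mq, mw⟩ := exists_wave hT (hF 2) dS
    (tE.sub hT (tE.mode le_rfl hT 0)) mE
  have dZ := (hF 5).antiTheta hT
  have dA0 := df0.antiTheta hT
  have dA1 := df1.antiTheta hT
  have dB0 := dg0.antiTheta hT
  have dB1 := dg1.antiTheta hT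
  have tq := dq.tame hT
  have tw := dw.tame hT
  have tZ := dZ.tame hT
  have tA0 := dA0.tame hT
  have tA1 := dA1.tame hT
  have tB0 := dB0.tame hT
  have tB1 := dB1.tame hT
  obtain ⟨δ2, hδ2, ts2⟩ := (hF 2).tame_s
  obtain ⟨δ6, hδ6, ts6⟩ := (hF 6).tame_s
  obtain ⟨δ8, hδ8, ts8⟩ := hF₈.tame_s
  obtain ⟨m2, r2, t2, dm2, m2Y, m2θ, m2m, m2b, m2r⟩ := exists_mean hT hδ6 ts6 hgu
  obtain ⟨m5, r5, t5, dm5, m5Y, m5θ, m5m, m5b, m5r⟩ := exists_mean hT hδ8 ts8 hgH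
  obtain ⟨m6, r6, t6, dm6, m6Y, m6θ, m6m, m6b, m6r⟩ := exists_mean hT hδ2 ts2 hgq
  have tm2 := dm2.tame hT
  have tm5 := dm5.tame hT
  have tm6 := dm6.tame hT
  set a0 := antiTheta f0 with ha0
  set a1 := antiTheta f1 with ha1
  set b0 := antiTheta g0 with hb0
  set b1 := antiTheta g1 with hb1
  set Z := antiTheta (F 5) with hZ
  -- With κ = 1/(c² - b²), the tangential entries solve c u_l - b H_l = a_l - ξ_l q and -b u_l + c
  -- H_l = b_l, where a_l, b_l are the antiderivatives. The normal entries solve the same system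
  -- with right-hand sides w, Z and then receive the means m2, m5. The coefficient 0 in the last
  -- entry fills the third slot of `Tame.lin`.
  set U : Fin 7 → Pt → ℂ := ![
    fun z => P.c σ * κ * a0 z + P.b σ * κ * b0 z + -(P.c σ * κ * P.ξ 0) * q z,
    fun z => P.c σ * κ * a1 z + P.b σ * κ * b1 z + -(P.c σ * κ * P.ξ 1) * q z,
    fun z => P.c σ * κ * w z + P.b σ * κ * Z z + 1 * m2 z,
    fun z => P.b σ * κ * a0 z + P.c σ * κ * b0 z + -(P.b σ * κ * P.ξ 0) * q z,
    fun z => P.b σ * κ * a1 z + P.c σ * κ * b1 z + -(P.b σ * κ * P.ξ 1) * q z,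
    fun z => P.b σ * κ * w z + P.c σ * κ * Z z + 1 * m5 z,
    fun z => 1 * q z + 1 * m6 z + 0 * m6 z] with hU
  have za : ∀ {v : Pt → ℂ}, Tame T σ 0 v → ∀ z ∈ fastDom T σ, mode 0 (antiTheta v) z = 0 :=
    fun hv z hz => mode_zero_antiTheta le_rfl hT hv hz
  have mU0 : ∀ z ∈ fastDom T σ, mode 0 (U 0) z = 0 := fun z hz => by
    refine (mode_lin hT tA0 tB0 tq _ _ _ 0 hz).trans ?_
    rw [ha0, hb0, za (df0.tame hT) z hz, za (dg0.tame hT) z hz, mq z hz]; ring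
  have mU1 : ∀ z ∈ fastDom T σ, mode 0 (U 1) z = 0 := fun z hz => by
    refine (mode_lin hT tA1 tB1 tq _ _ _ 0 hz).trans ?_
    rw [ha1, hb1, za (df1.tame hT) z hz, za (dg1.tame hT) z hz, mq z hz]; ring
  have mU3 : ∀ z ∈ fastDom T σ, mode 0 (U 3) z = 0 := fun z hz => by
    refine (mode_lin hT tA0 tB0 tq _ _ _ 0 hz).trans ?_
    rw [ha0, hb0, za (df0.tame hT) z hz, za (dg0.tame hT) z hz, mq z hz]; ring
  have mU4 : ∀ z ∈ fastDom T σ, mode 0 (U 4) z = 0 := fun z hz => by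
    refine (mode_lin hT tA1 tB1 tq _ _ _ 0 hz).trans ?_
    rw [ha1, hb1, za (df1.tame hT) z hz, za (dg1.tame hT) z hz, mq z hz]; ring
  have mU2 : ∀ z ∈ fastDom T σ, mode 0 (U 2) z = m2 z := fun z hz => by
    refine (mode_lin hT tw tZ tm2 _ _ _ 0 hz).trans ?_
    rw [hZ, mw z hz, za (tF 5) z hz, m2m z hz]; ring
  have mU5 : ∀ z ∈ fastDom T σ, mode 0 (U 5) z = m5 z := fun z hz => by
    refine (mode_lin hT tw tZ tm5 _ _ _ 0 hz).trans ?_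
    rw [hZ, mw z hz, za (tF 5) z hz, m5m z hz]; ring
  have mU6 : ∀ z ∈ fastDom T σ, mode 0 (U 6) z = m6 z := fun z hz => by
    refine (mode_lin hT tq tm6 tm6 _ _ _ 0 hz).trans ?_
    rw [mq z hz, m6m z hz]; ring
  -- The mean of `V` is the function `m`, so by uniqueness of decompositions the mean of the slow
  -- part of `V` is the slow part of `m`, which is known to vanish at y₃ = ±1.
  have hres : ∀ {V r s m rm sm : Pt → ℂ}, Dec T σ V r s → Dec T σ m rm sm →
      (∀ z ∈ fastDom T σ, mode 0 V z = m z) →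
      (∀ z ∈ fastDom T σ, z.2.1 = σ.sg → rm z = 0) →
      ∃ r s, Dec T σ V r s ∧ ∀ z ∈ fastDom T σ, z.2.1 = σ.sg → mode 0 r z = 0 := by
    intro V r s m rm sm hV hm hVm hr
    refine ⟨r, s, hV, fun z hz h3 => ?_⟩
    have := ((hV.mode hT 0).congr (fun z hz => (hVm z hz).symm) (fun _ _ => rfl)
      (fun _ _ => rfl)).unique hT hm
    rw [this.1 hz, hr z hz h3]
  have hUd : ∀ j, ∃ r s, Dec T σ (U j) r s ∧
      ∀ z ∈ fastDom T σ, z.2.1 = σ.sg → mode 0 r z = 0 := by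
    intro j
    fin_cases j
    · exact hres (dA0.lin hT dB0 dq _ _ _) Dec.zero mU0 fun _ _ _ => rfl
    · exact hres (dA1.lin hT dB1 dq _ _ _) Dec.zero mU1 fun _ _ _ => rfl
    · exact hres (dw.lin hT dZ dm2 _ _ _) dm2 mU2 m2r
    · exact hres (dA0.lin hT dB0 dq _ _ _) Dec.zero mU3 fun _ _ _ => rfl
    · exact hres (dA1.lin hT dB1 dq _ _ _) Dec.zero mU4 fun _ _ _ => rfl
    · exact hres (dw.lin hT dZ dm5 _ _ _) dm5 mU5 m5r
    · exact hres (dq.lin hT dm6 dm6 _ _ _) dm6 mU6 m6r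
  choose rU sU hUd hUr using hUd
  refine ⟨U, rU, sU, hUd, fun z hz => ?_,
    fun z hz => ⟨mU0 z hz, mU1 z hz, mU3 z hz, mU4 z hz⟩, hUr, fun p hp => ⟨fun θ => ?_, ?_⟩⟩
  · have p0 := fun i => pd_lin hT tA0 tB0 tq (P.c σ * κ) (P.b σ * κ) (-(P.c σ * κ * P.ξ 0)) i hz
    have p1 := fun i => pd_lin hT tA1 tB1 tq (P.c σ * κ) (P.b σ * κ) (-(P.c σ * κ * P.ξ 1)) i hz
    have p2 := fun i => pd_lin hT tw tZ tm2 (P.c σ * κ) (P.b σ * κ) 1 i hz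
    have p3 := fun i => pd_lin hT tA0 tB0 tq (P.b σ * κ) (P.c σ * κ) (-(P.b σ * κ * P.ξ 0)) i hz
    have p4 := fun i => pd_lin hT tA1 tB1 tq (P.b σ * κ) (P.c σ * κ) (-(P.b σ * κ * P.ξ 1)) i hz
    have p5 := fun i => pd_lin hT tw tZ tm5 (P.b σ * κ) (P.c σ * κ) 1 i hz
    have p6 := fun i => pd_lin hT tq tm6 tm6 1 1 0 i hz
    have ea0 : pd T σ 5 a0 z = f0 z := by
      rw [ha0, pd_theta_antiTheta le_rfl hT (df0.tame hT) hz, mf0 z hz, sub_zero]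
    have ea1 : pd T σ 5 a1 z = f1 z := by
      rw [ha1, pd_theta_antiTheta le_rfl hT (df1.tame hT) hz, mf1 z hz, sub_zero]
    have eb0 : pd T σ 5 b0 z = g0 z := by
      rw [hb0, pd_theta_antiTheta le_rfl hT (dg0.tame hT) hz, mg0 z hz, sub_zero]
    have eb1 : pd T σ 5 b1 z = g1 z := by
      rw [hb1, pd_theta_antiTheta le_rfl hT (dg1.tame hT) hz, mg1 z hz, sub_zero]
    have eZ5 : pd T σ 5 Z z = F 5 z := by
      rw [hZ, pd_theta_antiTheta le_rfl hT (tF 5) hz, h.mean_H₃ z hz, sub_zero]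
    -- Condition (d) makes ∂_Y F₆ the θ-derivative of τ F₈ - ξ_j F_{3+j}; hence ∂_Y Z is the
    -- oscillating part of that function. It is rewritten through `g0`, `g1` using b = ξ·H⁰ and c =
    -- τ + ξ·u⁰.
    have eZ4 : pd T σ 4 Z z = -P.ξ 0 * g0 z - P.ξ 1 * g1 z - P.b σ * (F 6 z - mode 0 (F 6) z)
        + P.c σ * (F₈ z - mode 0 F₈ z) := by
      have tK := (tF 3).lin hT (tF 4) tF₈ (-P.ξ 0) (-P.ξ 1) P.τ
      rw [hZ, pd_antiTheta le_rfl hT (tF 5) 4 hz,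
        antiTheta_line_congr (g := pd T σ 5 fun z => -P.ξ 0 * F 3 z + -P.ξ 1 * F 4 z + P.τ * F₈ z)
          fun a => ?_, antiTheta_pd_theta le_rfl hT tK hz,
        mode_lin hT (tF 3) (tF 4) tF₈ _ _ _ 0 hz, h.mean_H₁ z hz, h.mean_H₂ z hz]
      · simp only [hg0, hg1]
        linear_combination (mode 0 (F 6) z - F 6 z) * hb * (-1) + (mode 0 F₈ z - F₈ z) * hc
      · have ha := add_theta_mem a hz
        rw [pd_lin hT (tF 3) (tF 4) tF₈ _ _ _ 5 ha]
        linear_combination h.div _ ha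
    have eq1 := hq1 z hz
    have ew1 := hw1 z hz
    rw [mode_lin hT (tF 6) tF₈ (dff.tame hT) _ _ _ 0 hz,
      mode_lin hT (df0.tame hT) (df1.tame hT) Tame.zero _ _ _ 0 hz, mf0 z hz, mf1 z hz] at ew1
    have h2Y := m2Y z hz
    have h5Y := m5Y z hz
    have h6Y := m6Y z hz
    rw [← (hm z hz).2.1] at h2Y
    rw [← (hm z hz).2.2] at h5Y
    rw [← (hm z hz).1] at h6Y
    have ef0 : f0 z = F 0 z - P.u σ 0 * F 6 z + P.H σ 0 * F₈ z := by simp only [hf0]; ring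
    have ef1 : f1 z = F 1 z - P.u σ 1 * F 6 z + P.H σ 1 * F₈ z := by simp only [hf1]; ring
    have eg0 : g0 z = F 3 z - P.H σ 0 * F 6 z + P.u σ 0 * F₈ z := by simp only [hg0]; ring
    have eg1 : g1 z = F 4 z - P.H σ 1 * F 6 z + P.u σ 1 * F₈ z := by simp only [hg1]; ring
    refine ⟨?_, ?_, ?_, ?_, ?_, ?_, ?_, ?_⟩
    · refine (congrArg₂ (· + ·) (congrArg₂ (· + ·) (p2 4) (congrArg _ (p0 5)))
        (congrArg _ (p1 5))).trans ?_
      rw [ea0, ea1, eb0, eb1, eZ4, h2Y]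
      linear_combination P.c σ * κ * ew1 - P.c σ * κ * pd T σ 5 q z * hξ
        + (F 6 z - mode 0 (F 6) z) * hκ
    · refine (congrArg₂ (· + ·) (congrArg₂ (· + ·) (p5 4) (congrArg _ (p3 5)))
        (congrArg _ (p4 5))).trans ?_
      rw [ea0, ea1, eb0, eb1, eZ4, h5Y]
      linear_combination P.b σ * κ * ew1 - P.b σ * κ * pd T σ 5 q z * hξ
        + (F₈ z - mode 0 F₈ z) * hκ
    · refine (congrArg₂ (· + ·) (congrArg₂ (· - ·) (congrArg _ (p0 5)) (congrArg _ (p3 5)))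
        (congrArg _ (p6 5))).trans ?_
      rw [ea0, eb0, m6θ z hz, ← ef0]
      linear_combination (f0 z - P.ξ 0 * pd T σ 5 q z) * hκ
    · refine (congrArg₂ (· + ·) (congrArg₂ (· - ·) (congrArg _ (p1 5)) (congrArg _ (p4 5)))
        (congrArg _ (p6 5))).trans ?_
      rw [ea1, eb1, m6θ z hz, ← ef1]
      linear_combination (f1 z - P.ξ 1 * pd T σ 5 q z) * hκ
    · refine (congrArg₂ (· + ·) (congrArg _ (p0 5)) (congrArg _ (p3 5))).trans ?_
      rw [ea0, eb0, ← eg0]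
      linear_combination g0 z * hκ
    · refine (congrArg₂ (· + ·) (congrArg _ (p1 5)) (congrArg _ (p4 5))).trans ?_
      rw [ea1, eb1, ← eg1]
      linear_combination g1 z * hκ
    · refine (congrArg₂ (· - ·) (congrArg₂ (· + ·) (p6 4) (congrArg _ (p2 5)))
        (congrArg _ (p5 5))).trans ?_
      rw [m2θ z hz, m5θ z hz, h6Y]
      linear_combination eq1 + pd T σ 5 w z * hκ
    · refine (congrArg₂ (· + ·) (congrArg _ (p2 5)) (congrArg _ (p5 5))).trans ?_
      rw [m2θ z hz, m5θ z hz, eZ5]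
      linear_combination F 5 z * hκ
  · have hz := bdry_mem hp σ θ
    -- Condition (a) says that F₆ is ∂_θ B on the sheet, so the trace of Z is the oscillating part
    -- of B = -b gu + c gH. With w = c gu - b gH up to its mean, the 2×2 inversion returns the
    -- oscillating parts of gu and gH.
    have eZ : Z (p, 0, 0, θ) = B (p, 0, 0, θ) - mode 0 B (p, 0, 0, θ) := by
      rw [hZ, antiTheta_line_congr (g := pd T σ 5 B) fun a => ?_, antiTheta_pd_theta le_rfl hT tB hz]
      rw [add_smul_bas_five]
      simp only
      rw [h.bdry p hp, hB, pd_lin hT hgu hgH Tame.zero _ _ _ 5 (bdry_mem hp σ (θ + a))]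
      ring
    have ew := hwb _ hz rfl
    have hm2 := m2b _ hz rfl rfl
    have hm5 := m5b _ hz rfl rfl
    rw [hB, mode_lin hT hgu hgH Tame.zero _ _ _ 0 hz] at eZ
    rw [hE, mode_lin hT hgu hgH Tame.zero _ _ _ 0 hz] at ew
    simp only at eZ ew
    constructor
    · show P.c σ * κ * w _ + P.b σ * κ * Z _ + 1 * m2 _ = _
      rw [eZ, ew, hm2]
      linear_combination (gu (p, 0, 0, θ) - mode 0 gu (p, 0, 0, θ)) * hκ
    · show P.b σ * κ * w _ + P.c σ * κ * Z _ + 1 * m5 _ = _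
      rw [eZ, ew, hm5]
      linear_combination (gH (p, 0, 0, θ) - mode 0 gH (p, 0, 0, θ)) * hκ
  · rw [mU6 _ (bdry_mem hp σ 0)]
    exact m6b _ (bdry_mem hp σ 0) rfl rfl

/-! ### From the two sides to the full problem -/

theorem Tame.eq_zero_of_pd_normal_eq_zero (hδ : 0 < δ) (hf : Tame T σ δ f)
    (h : ∀ z ∈ fastDom T σ, FastProblem.pd T σ 4 f z = 0) {z : Pt} (hz : z ∈ fastDom T σ) : f z = 0 := by
  have h1 : ∀ b : ℝ, 0 ≤ b → f (z + b • (σ.sg • bas 4)) = f z := fun b hb => by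
    have := eq_exp_mul_of_pd_normal hf (c := 0) (fun w hw => by rw [h w hw]; simp) hz hb
    simpa using this
  refine tendsto_nhds_unique (tendsto_const_nhds.congr' ?_) (hf.tendsto_zero hδ hz)
  filter_upwards [eventually_ge_atTop 0] with b hb
  exact (h1 b hb).symm

theorem mode_zero_eq (hp : ∀ v ∈ periods, ∀ z ∈ fastDom T σ, f (z + v) = f z) {p : Base}
    {y₃ Y θ : ℝ} (hz : (p, y₃, Y, θ) ∈ fastDom T σ) :
    mode 0 f (p, y₃, Y, θ) = mode 0 f (p, y₃, Y, 0) := by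
  have hz0 : ((p, y₃, Y, 0) : Pt) ∈ fastDom T σ := mem_fastDom.2 (mem_fastDom.1 hz)
  have := mode_zero_theta hp hz0 θ
  rw [add_smul_bas_five] at this
  simpa using this

/-- Since the slow means vanish, the conditions on fast means hold for the full means. Condition (d)
extends to the closed domain by continuity. -/
theorem Compatible.side (hT : 0 < T) {F : Side → Fin 7 → FastFun} {F₈ : Side → FastFun}
    {G : Fin 5 → BdryFun} (hF : ∀ σ i, IsProfile T σ (F σ i)) (hF₈ : ∀ σ, IsProfile T σ (F₈ σ))
    (hG : ∀ i, IsHInfty T (G i)) (h : Compatible T P F F₈ G) (σ : Side) :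
    SideCompatible T σ P (fun j => lft (F σ j)) (lft (F₈ σ)) (lft (ofBdry (G σ.iu)))
      (lft (ofBdry (G σ.iH))) ∧
    (∀ j, ∀ z ∈ fastDom T σ, mode 0 (lft (F σ j)) z = mode 0 (lft (surf σ (F σ j))) z) ∧
    ∀ z ∈ fastDom T σ, mode 0 (lft (F₈ σ)) z = mode 0 (lft (surf σ (F₈ σ))) z := by
  have dF := fun j => (hF σ j).dec hT
  have dF₈ := (hF₈ σ).dec hT
  have tF := fun j => (hF σ j).tame hT
  have tF₈ := (hF₈ σ).tame hT
  have hr : ∀ j, ∀ z ∈ fastDom T σ, mode 0 (lft (ofSlow (resid σ (F σ j)))) z = 0 := by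
    rintro j ⟨p, y₃, Y, θ⟩ hz
    obtain ⟨hp, hy, hY⟩ := mem_fastDom.1 hz
    rw [mode_zero_eq (dF j).tame_r.per hz, ← fcoef_lft]
    exact h.slow_mean σ p hp y₃ hy j
  have hr₈ : ∀ z ∈ fastDom T σ, mode 0 (lft (ofSlow (resid σ (F₈ σ)))) z = 0 := by
    rintro ⟨p, y₃, Y, θ⟩ hz
    obtain ⟨hp, hy, hY⟩ := mem_fastDom.1 hz
    rw [mode_zero_eq dF₈.tame_r.per hz, ← fcoef_lft]
    exact h.slow_mean₈ σ p hp y₃ hy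
  have hs : ∀ j, ∀ z ∈ fastDom T σ, mode 0 (lft (F σ j)) z = mode 0 (lft (surf σ (F σ j))) z :=
    fun j z hz => by rw [((dF j).mode hT 0).eq z hz, hr j z hz, zero_add]
  have hs₈ : ∀ z ∈ fastDom T σ, mode 0 (lft (F₈ σ)) z = mode 0 (lft (surf σ (F₈ σ))) z :=
    fun z hz => by rw [(dF₈.mode hT 0).eq z hz, hr₈ z hz, zero_add]
  have hu : ∀ (j : Fin 2) (i : Fin 7), i.val = j.val → ∀ z ∈ fastDom T σ, mode 0 (lft (F σ i)) z
      = P.u σ j * mode 0 (lft (F σ 6)) z - P.H σ j * mode 0 (lft (F₈ σ)) z := by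
    rintro j i hij ⟨p, y₃, Y, θ⟩ hz
    obtain ⟨hp, hy, hY⟩ := mem_fastDom.1 hz
    have := h.fast_mean_u σ p hp y₃ hy Y hY j i hij
    simp only [fcoef_lft] at this
    have hz0 : ((p, y₃, Y, 0) : Pt) ∈ fastDom T σ := mem_fastDom.2 (mem_fastDom.1 hz)
    rw [mode_zero_eq (tF i).per hz, mode_zero_eq (tF 6).per hz, mode_zero_eq tF₈.per hz,
      hs _ _ hz0, hs _ _ hz0, hs₈ _ hz0, this]
  have hH : ∀ (j : Fin 2) (i : Fin 7), i.val = 3 + j.val → ∀ z ∈ fastDom T σ,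
      mode 0 (lft (F σ i)) z
      = P.H σ j * mode 0 (lft (F σ 6)) z - P.u σ j * mode 0 (lft (F₈ σ)) z := by
    rintro j i hij ⟨p, y₃, Y, θ⟩ hz
    obtain ⟨hp, hy, hY⟩ := mem_fastDom.1 hz
    have := h.fast_mean_H σ p hp y₃ hy Y hY j i hij
    simp only [fcoef_lft] at this
    have hz0 : ((p, y₃, Y, 0) : Pt) ∈ fastDom T σ := mem_fastDom.2 (mem_fastDom.1 hz)
    rw [mode_zero_eq (tF i).per hz, mode_zero_eq (tF 6).per hz, mode_zero_eq tF₈.per hz,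
      hs _ _ hz0, hs _ _ hz0, hs₈ _ hz0, this]
  have hdiv : EqOn (pd T σ 4 (lft (F σ 5))) (fun z => -P.ξ 0 * pd T σ 5 (lft (F σ 3)) z
      + -P.ξ 1 * pd T σ 5 (lft (F σ 4)) z + P.τ * pd T σ 5 (lft (F₈ σ)) z) (fastDom T σ) := by
    refine eqOn_of_eqOn_interior ((tF 5).pd hT 4).continuousOn
      (((tF 3).pd hT 5).lin hT ((tF 4).pd hT 5) (tF₈.pd hT 5) _ _ _).continuousOn ?_
    rintro ⟨p, y₃, Y, θ⟩ ⟨hp, hy, hY, -⟩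
    have hy' := slowOpen_subset hy
    have hY' : Y ∈ σ.fastClosed := Side.mem_fastClosed.2 (Side.mem_fastOpen.1 hY).le
    have := congrArg Complex.ofReal (h.divergence σ p hp y₃ hy Y hY θ)
    push_cast at this
    rw [deriv_normal (tF 5) hp hy' hY, deriv_theta (tF 3) hp hy' hY',
      deriv_theta (tF 4) hp hy' hY', deriv_theta tF₈ hp hy' hY'] at this
    simp only
    linear_combination this
  -- This is not among the conditions (a)–(e): by (d) the mean of F₆ does not vary with Y₃, and it
  -- equals its decaying part, so it is 0.
  have hm5 : ∀ z ∈ fastDom T σ, mode 0 (lft (F σ 5)) z = 0 := by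
    intro z hz
    obtain ⟨δ, hδ, ts⟩ := (dF 5).tame_s
    have hc : EqOn (mode 0 (lft (surf σ (F σ 5)))) (mode 0 (lft (F σ 5))) (fastDom T σ) :=
      fun w hw => (hs 5 w hw).symm
    rw [hs 5 z hz]
    refine (ts.mode hδ.le hT 0).eq_zero_of_pd_normal_eq_zero hδ (fun w hw => ?_) hz
    rw [pd_congr 4 hc hw, pd_mode le_rfl hT (tF 5) 0 4 hw, mode_congr 0 hdiv hw,
      mode_lin hT ((tF 3).pd hT 5) ((tF 4).pd hT 5) (tF₈.pd hT 5) _ _ _ 0 hw,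
      mode_pd_theta le_rfl hT (tF 3) 0 hw, mode_pd_theta le_rfl hT (tF 4) 0 hw,
      mode_pd_theta le_rfl hT tF₈ 0 hw]
    simp
  refine ⟨⟨hu 0 0 rfl, hu 1 1 rfl, hH 0 3 rfl, hH 1 4 rfl, hm5, fun z hz => ?_,
    fun p hp θ => ?_⟩, hs, hs₈⟩
  · rw [hdiv hz]
    ring
  · rw [← deriv_theta_bdry hT (hG _) σ hp, ← deriv_theta_bdry hT (hG _) σ hp]
    cases σ
    · have := congrArg Complex.ofReal (h.boundary_plus p hp θ)
      push_cast at this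
      exact this
    · have := congrArg Complex.ofReal (h.boundary_minus p hp θ)
      push_cast at this
      exact this

/-- The coefficients and sources are real, so the real part of a complex solution is again a
solution. -/
theorem Evol.re (hT : 0 < T) {U : Fin 7 → Pt → ℂ} {F : Fin 7 → FastFun} {F₈ : FastFun}
    (hU : ∀ j, Tame T σ 0 (U j)) (h : Evol T σ P U (fun j => lft (F j)) (lft F₈)) :
    Evol T σ P (fun j => lft (reFun (U j))) (fun j => lft (F j)) (lft F₈) := by
  intro z hz
  have hp : ∀ i j, pd T σ i (lft (reFun (U j))) z = ((pd T σ i (U j) z).re : ℂ) := by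
    intro i j
    have := pd_re hT (hU j) 1 i hz
    simp only [one_mul] at this
    exact this
  have h1 := h z hz
  simp only [hp]
  have e1 := congrArg Complex.re h1.div_u
  have e2 := congrArg Complex.re h1.div_H
  have e3 := congrArg Complex.re h1.u₁
  have e4 := congrArg Complex.re h1.u₂
  have e5 := congrArg Complex.re h1.H₁
  have e6 := congrArg Complex.re h1.H₂
  have e7 := congrArg Complex.re h1.u₃
  have e8 := congrArg Complex.re h1.H₃
  simp only [lft, Complex.add_re, Complex.sub_re, Complex.re_ofReal_mul, Complex.ofReal_re,
    ← Complex.ofReal_neg] at e1 e2 e3 e4 e5 e6 e7 e8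
  refine ⟨?_, ?_, ?_, ?_, ?_, ?_, ?_, ?_⟩ <;> simp only [lft] <;> assumption_mod_cast

theorem mode_zero_fun (k : ℤ) (z : Pt) : mode k (fun _ => 0) z = 0 := by
  simp [mode, trOp]

/-- The one-sided solutions satisfy the first four jump conditions with ψ = 0 by construction. The
jump of q follows for k ≠ 0 from orthogonality and for k = 0 from the choice of the means. -/
theorem exists_particular (hT : 0 < T) (h₂ : P.RationalDirection) (h₃ : P.NonDegenerate)
    (h₄ : P.LopatinskiiRoot) (hτ : P.τ ≠ 0) {F : Side → Fin 7 → FastFun} {F₈ : Side → FastFun}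
    {G : Fin 5 → BdryFun} (hF : ∀ σ i, IsProfile T σ (F σ i)) (hF₈ : ∀ σ, IsProfile T σ (F₈ σ))
    (hG : ∀ i, IsHInfty T (G i)) (h : Compatible T P F F₈ G) :
    ∃ UU : Side → Fin 7 → FastFun, (∀ σ i, IsProfile T σ (UU σ i)) ∧
      SolvesFast T P F F₈ G UU (fun _ _ => 0) ∧
      (∀ σ : Side, ∀ p ∈ baseDom T, ∀ y₃ ∈ σ.slowClosed, ∀ Y ∈ σ.fastClosed,
        Matrix.mulVec projTan (fcoefVec (UU σ) p y₃ Y 0) = 0) ∧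
      ∀ σ : Side, ∀ p ∈ baseDom T, ∀ i, fcoef (fun θ => resid σ (UU σ i) p σ.sg θ) 0 = 0 := by
  have hex : ∀ σ : Side, ∃ U rU sU : Fin 7 → Pt → ℂ, (∀ j, Dec T σ (U j) (rU j) (sU j)) ∧
      Evol T σ P U (fun j => lft (F σ j)) (lft (F₈ σ)) ∧
      (∀ z ∈ fastDom T σ, mode 0 (U 0) z = 0 ∧ mode 0 (U 1) z = 0 ∧ mode 0 (U 3) z = 0 ∧
        mode 0 (U 4) z = 0) ∧
      (∀ j, ∀ z ∈ fastDom T σ, z.2.1 = σ.sg → mode 0 (rU j) z = 0) ∧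
      ∀ p ∈ baseDom T, (∀ θ : ℝ, U 2 (p, 0, 0, θ) = lft (ofBdry (G σ.iu)) (p, 0, 0, θ) ∧
        U 5 (p, 0, 0, θ) = lft (ofBdry (G σ.iH)) (p, 0, 0, θ)) ∧
        mode 0 (U 6) (p, 0, 0, 0)
          = if σ.sg = 1 then mode 0 (lft (ofBdry (G 4))) (p, 0, 0, 0) else 0 := by
    intro σ
    obtain ⟨hs, hm, hm₈⟩ := h.side hT hF hF₈ hG σ
    obtain ⟨U, rU, sU, h1, h2, h3, h4, h5⟩ := hs.exists_solution hT h₂ (mu_ne_zero h₃ h₄ σ)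
      (fun j => (hF σ j).dec hT) ((hF₈ σ).dec hT) (fun z hz => ⟨hm 2 z hz, hm 6 z hz, hm₈ z hz⟩)
      ((hG _).tame hT σ) ((hG _).tame hT σ)
      -- The whole mean of G₅ is assigned to the plus side and 0 to the minus side; only the
      -- difference matters.
      (gq := fun z => (if σ.sg = 1 then 1 else 0) * lft (ofBdry (G 4)) z)
      (((hG 4).tame hT σ).const_mul hT _)
    refine ⟨U, rU, sU, h1, h2, h3, h4, fun p hp => ⟨(h5 p hp).1, ?_⟩⟩
    rw [(h5 p hp).2, mode_const_mul]
    split_ifs <;> simp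
  choose U rU sU hdec hE hmean hres hbd using hex
  have tU := fun σ j => (hdec σ j).tame hT
  have tF := fun σ j => (hF σ j).tame hT
  have hpro : ∀ σ i, IsProfile T σ (reFun (U σ i)) := fun σ i => (hdec σ i).isProfile hT
  refine ⟨fun σ i => reFun (U σ i), hpro, ?_, ?_, ?_⟩
  · refine (solvesFast_iff hT hF hF₈ hpro).2 ⟨fun σ => (hE σ).re hT (tU σ), fun p hp θ => ?_⟩
    have hq : ∀ k, mode k (U .plus 6) (p, 0, 0, 0)
        = mode k (fun z => U .minus 6 z + lft (ofBdry (G 4)) z) (p, 0, 0, 0) := by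
      intro k
      rw [mode_add k (tU .minus 6) ((hG 4).tame hT .minus) (bdry_mem hp .minus 0)]
      rcases eq_or_ne k 0 with rfl | hk
      · simp only
        rw [(hbd .plus p hp).2, (hbd .minus p hp).2]
        norm_num [Side.sg]
      -- Duality for both constructed solutions turns (e) into i τ sgn k times the desired jump
      -- relation, and τ ≠ 0 permits the division.
      · have ho := (orthogonality_iff hT tF hk hp).1 (h.orthogonality p hp k hk)
        rw [duality hT h₂ (hE .plus) (tU .plus) (tF .plus) hk (bdry_mem hp .plus 0),
          duality hT h₂ (hE .minus) (tU .minus) (tF .minus) hk (bdry_mem hp .minus 0)] at ho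
        have hj := bform_jump (G := fun i => lft (ofBdry (G i))) (U := U) (ψ := fun _ => 0)
          (p := p) (k := k) h₄ (fun σ => by
            rw [mode_zero_fun, mul_zero, mul_zero, add_zero]
            exact mode_line_congr k fun a => by rw [bdry_add, ((hbd σ p hp).1 a).1])
          (fun σ => by
            rw [mode_zero_fun, mul_zero, mul_zero, add_zero]
            exact mode_line_congr k fun a => by rw [bdry_add, ((hbd σ p hp).1 a).2])
        simp only [Side.sg] at ho hj ⊢
        push_cast at ho
        have hε : (Int.sign k : ℂ) ≠ 0 := by
          have : Int.sign k ≠ 0 := fun h0 => hk (Int.sign_eq_zero_iff_zero.1 h0)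
          exact_mod_cast this
        have hne : Complex.I * P.τ * (Int.sign k : ℂ) ≠ 0 :=
          mul_ne_zero (mul_ne_zero Complex.I_ne_zero (by exact_mod_cast hτ)) hε
        refine mul_left_cancel₀ hne ?_
        linear_combination ho + hj
    have hq' := line_eq_of_mode_eq hT (tU .plus 6)
      ((tU .minus 6).add hT ((hG 4).tame hT .minus)) (bdry_mem hp .plus 0) (bdry_mem hp .minus 0)
      hq θ
    rw [bdry_add] at hq'
    have hre : ∀ σ j, reFun (U σ j) p 0 0 θ = (U σ j (p, 0, 0, θ)).re := fun _ _ => rfl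
    refine ⟨?_, ?_, ?_, ?_, ?_⟩ <;> simp only [hre, deriv_const, mul_zero, add_zero]
    · rw [((hbd .plus p hp).1 θ).1]
      rfl
    · rw [((hbd .plus p hp).1 θ).2]
      rfl
    · rw [((hbd .minus p hp).1 θ).1]
      rfl
    · rw [((hbd .minus p hp).1 θ).2]
      rfl
    · rw [hq', Complex.add_re, add_sub_cancel_left]
      rfl
  · intro σ p hp y₃ hy Y hY
    have hz : ((p, y₃, Y, 0) : Pt) ∈ fastDom T σ := mem_fastDom.2 ⟨hp, hy, hY⟩
    have hm : ∀ i, mode 0 (U σ i) (p, y₃, Y, 0) = 0 →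
        fcoefVec (fun i => reFun (U σ i)) p y₃ Y 0 i = 0 := by
      intro i hi
      rw [fcoefVec, fcoef_lft]
      refine (mode_re hT (tU σ i) 0 hz).trans ?_
      rw [neg_zero, hi]
      simp
    obtain ⟨h0, h1, h3, h4⟩ := hmean σ _ hz
    funext i
    rw [projTan, mulVec_diagonal]
    fin_cases i
    · simp [hm 0 h0]
    · simp [hm 1 h1]
    · simp
    · simp [hm 3 h3]
    · simp [hm 4 h4]
    · simp
    · simp
  · intro σ p hp i
    have hsg : σ.sg ∈ σ.slowClosed := by cases σ <;> simp [Side.sg, Side.slowClosed]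
    have hz : ((p, σ.sg, 0, 0) : Pt) ∈ fastDom T σ :=
      mem_fastDom.2 ⟨hp, hsg, σ.zero_mem_fastClosed⟩
    have hu := (((hpro σ i).dec hT).unique hT ((hdec σ i).re hT)).1
    refine (fcoef_lft (ofSlow (resid σ (reFun (U σ i)))) p σ.sg 0 0).trans ?_
    rw [mode_congr 0 hu hz]
    refine (mode_re hT (hdec σ i).tame_r 0 hz).trans ?_
    rw [neg_zero, hres σ i _ hz rfl]
    simp

/-! ### The homogeneous problem -/

theorem abs_eq_mul_sign (k : ℤ) : ((|(k : ℝ)| : ℝ) : ℂ) = k * (Int.sign k : ℂ) := by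
  have h : ((|k| : ℤ) : ℂ) = ((k * Int.sign k : ℤ) : ℂ) := by rw [Int.mul_sign_self, Int.abs_eq_natAbs]
  rw [← Int.cast_abs, Complex.ofReal_intCast, h]
  push_cast
  rfl

theorem sign_sq {k : ℤ} (hk : k ≠ 0) : (Int.sign k : ℂ) ^ 2 = 1 := by
  rcases hk.lt_or_gt with h | h
  · rw [Int.sign_eq_neg_one_of_neg h]
    norm_num
  · rw [Int.sign_eq_one_of_pos h]
    norm_num

theorem sg_sq (σ : Side) : (σ.sg : ℂ) ^ 2 = 1 := by
  cases σ <;> simp [Side.sg]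

/-- Only the normal entries of 𝐑 are imaginary, so conjugation amounts to a factor sgn k there. Both
signs of k can then be treated together. -/
theorem calR_eq (P : Params) (σ : Side) {k : ℤ} (hk : k ≠ 0) : P.calR σ k =
    (![P.ξ 0 * P.c σ, P.ξ 1 * P.c σ, σ.sg * (Int.sign k : ℂ) * Complex.I * P.c σ,
      P.ξ 0 * P.b σ, P.ξ 1 * P.b σ, σ.sg * (Int.sign k : ℂ) * Complex.I * P.b σ,
      (P.b σ : ℂ) ^ 2 - (P.c σ : ℂ) ^ 2] : Fin 7 → ℂ) := by
  rcases hk.lt_or_gt with h | h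
  · rw [Params.calR, if_neg h.not_gt, Int.sign_eq_neg_one_of_neg h]
    funext i
    fin_cases i <;> simp [Params.boldR]
  · rw [Params.calR, if_pos h, Int.sign_eq_one_of_pos h]
    funext i
    fin_cases i <;> simp [Params.boldR]

/-- On e^{∓|k|Y₃ + ikθ} ℛ(k) the normal derivative is multiplication by ∓|k| and the angular one by
i k. The divergences cancel because |ξ'| = 1 and |k| = k sgn k. -/
theorem reduced_calR (h₂ : P.RationalDirection) {k : ℤ} (hk : k ≠ 0) (a : ℂ) :
    Reduced P σ (fun j => -(σ.sg * |(k : ℝ)|) * (a * P.calR σ k j))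
      (fun j => Complex.I * k * (a * P.calR σ k j)) (fun _ => 0) 0 := by
  have hx : (P.ξ 0 : ℂ) ^ 2 + (P.ξ 1 : ℂ) ^ 2 = 1 := by exact_mod_cast norm_xi h₂
  have hs := sg_sq σ
  have he := sign_sq hk
  have hI := Complex.I_sq
  rw [calR_eq P σ hk, abs_eq_mul_sign]
  have hd : ∀ m : ℂ, -(σ.sg * (k * (Int.sign k : ℂ)))
      * (a * (σ.sg * (Int.sign k : ℂ) * Complex.I * m))
      + P.ξ 0 * (Complex.I * k * (a * (P.ξ 0 * m)))
      + P.ξ 1 * (Complex.I * k * (a * (P.ξ 1 * m))) = 0 := by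
    intro m
    linear_combination a * m * Complex.I * k * hx
      - a * m * Complex.I * k * ((Int.sign k : ℂ) ^ 2 * hs + he)
  refine ⟨hd _, hd _, ?_, ?_, ?_, ?_, ?_, ?_⟩
  · simp
    ring
  · simp
    ring
  · simp
    ring
  · simp
    ring
  · simp
    linear_combination σ.sg * k * (Int.sign k : ℂ) * a * ((P.c σ : ℂ) ^ 2 - (P.b σ : ℂ) ^ 2) * hI
  · simp
    ring

theorem pd_normal_of_exp (hf : Tame T σ δ f) {c : ℝ} {z : Pt} (hz : z ∈ fastDom T σ)
    (h : ∀ b : ℝ, 0 ≤ b → f (z + b • (σ.sg • bas 4)) = Complex.exp (-(c * b : ℝ)) * f z) :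
    FastProblem.pd T σ 4 f z = -(σ.sg * c) * f z := by
  have h1 := hf.hasGrad.hasDerivWithinAt_normal hz le_rfl
  have h2 : HasDerivWithinAt (fun b : ℝ => f (z + b • (σ.sg • bas 4))) (-c * f z) (Ici 0) 0 := by
    have h3 : HasDerivAt (fun b : ℝ => Complex.exp (-(c * b : ℝ)) * f z) (-c * f z) 0 := by
      have h4 : HasDerivAt (fun b : ℝ => -((c * b : ℝ) : ℂ)) (-c) 0 := by
        have := ((hasDerivAt_id (0 : ℝ)).const_mul c).ofReal_comp.neg
        simpa [Function.comp_def, Pi.neg_def] using this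
      simpa using h4.cexp.mul_const (f z)
    exact h3.hasDerivWithinAt.congr (fun b hb => h b hb) (h 0 le_rfl)
  have h5 := (uniqueDiffOn_Ici (0 : ℝ) 0 self_mem_Ici).eq_deriv _ h1 h2
  rw [zero_smul, add_zero] at h5
  have hs := sg_sq σ
  linear_combination σ.sg * h5 - FastProblem.pd T σ 4 f z * hs

theorem eq_of_pd_theta_eq_zero (hf : Tame T σ δ f)
    (h : ∀ z ∈ fastDom T σ, FastProblem.pd T σ 5 f z = 0) {z : Pt} (hz : z ∈ fastDom T σ) (a : ℝ) :
    f (z + a • bas 5) = f z := by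
  have h1 : ∀ b : ℝ, HasDerivAt (fun b : ℝ => f (z + b • bas 5)) 0 b := fun b => by
    have := hf.hasGrad.hasDerivAt_theta hz b
    rwa [h _ (add_theta_mem b hz)] at this
  have := is_const_of_deriv_eq_zero (fun b => (h1 b).differentiableAt) (fun b => (h1 b).deriv) a 0
  simpa using this

/-- A solution of the symbol equations with a decaying wave mode is a multiple of `ℛ(k)`. -/
theorem Evol.eq_calR (hT : 0 < T) (h₂ : P.RationalDirection)
    (hμ : (P.c σ : ℂ) ^ 2 - (P.b σ : ℂ) ^ 2 ≠ 0) (hδ : 0 ≤ δ) {k : ℤ} (hk : k ≠ 0)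
    {M : Fin 7 → Pt → ℂ} (hM : ∀ j, Tame T σ δ (M j))
    (hθ : ∀ j, ∀ z ∈ fastDom T σ, FastProblem.pd T σ 5 (M j) z = Complex.I * k * M j z)
    (h : Evol T σ P M (fun _ _ => 0) (fun _ => 0)) {z : Pt} (hz : z ∈ fastDom T σ) :
    (∀ j, M j z = -(M 6 z / ((P.c σ : ℂ) ^ 2 - (P.b σ : ℂ) ^ 2)) * P.calR σ k j) ∧
    ∀ b : ℝ, 0 ≤ b → M 6 (z + b • (σ.sg • bas 4)) = Complex.exp (-(|(k : ℝ)| * b : ℝ)) * M 6 z := by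
  have hx : (P.ξ 0 : ℂ) ^ 2 + (P.ξ 1 : ℂ) ^ 2 = 1 := by exact_mod_cast norm_xi h₂
  have hs := sg_sq σ
  have he := sign_sq hk
  have hI := Complex.I_sq
  have hk' : Complex.I * k ≠ 0 := mul_ne_zero Complex.I_ne_zero (by exact_mod_cast hk)
  have habs := abs_eq_mul_sign k
  have hw : ∀ z ∈ fastDom T σ, (((P.c σ : ℂ) ^ 2 - (P.b σ : ℂ) ^ 2) * M 0 z = -(P.c σ * P.ξ 0 * M 6 z) ∧
      ((P.c σ : ℂ) ^ 2 - (P.b σ : ℂ) ^ 2) * M 1 z = -(P.c σ * P.ξ 1 * M 6 z) ∧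
      ((P.c σ : ℂ) ^ 2 - (P.b σ : ℂ) ^ 2) * M 3 z = -(P.b σ * P.ξ 0 * M 6 z) ∧
      ((P.c σ : ℂ) ^ 2 - (P.b σ : ℂ) ^ 2) * M 4 z = -(P.b σ * P.ξ 1 * M 6 z)) ∧
      (((P.c σ : ℂ) ^ 2 - (P.b σ : ℂ) ^ 2) * M 2 z = P.c σ * (P.c σ * M 2 z - P.b σ * M 5 z) ∧
      ((P.c σ : ℂ) ^ 2 - (P.b σ : ℂ) ^ 2) * M 5 z = P.b σ * (P.c σ * M 2 z - P.b σ * M 5 z)) ∧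
      FastProblem.pd T σ 4 (M 6) z = -(Complex.I * k) * (P.c σ * M 2 z - P.b σ * M 5 z) ∧
      P.c σ * FastProblem.pd T σ 4 (M 2) z - P.b σ * FastProblem.pd T σ 4 (M 5) z
        = Complex.I * k * M 6 z := by
    intro z hz
    obtain ⟨e1, e2, e3, e4, e5, e6, e7, e8⟩ := h z hz
    simp only [hθ _ z hz, mul_zero, sub_zero, add_zero] at e1 e2 e3 e4 e5 e6 e7 e8
    have f3 : P.c σ * M 0 z - P.b σ * M 3 z + P.ξ 0 * M 6 z = 0 :=
      mul_left_cancel₀ hk' (by linear_combination e3)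
    have f4 : P.c σ * M 1 z - P.b σ * M 4 z + P.ξ 1 * M 6 z = 0 :=
      mul_left_cancel₀ hk' (by linear_combination e4)
    have f5 : -P.b σ * M 0 z + P.c σ * M 3 z = 0 :=
      mul_left_cancel₀ hk' (by linear_combination e5)
    have f6 : -P.b σ * M 1 z + P.c σ * M 4 z = 0 :=
      mul_left_cancel₀ hk' (by linear_combination e6)
    have f8 : -P.b σ * M 2 z + P.c σ * M 5 z = 0 :=
      mul_left_cancel₀ hk' (by linear_combination e8)
    refine ⟨⟨?_, ?_, ?_, ?_⟩, ⟨?_, ?_⟩, ?_, ?_⟩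
    · linear_combination P.c σ * f3 + P.b σ * f5
    · linear_combination P.c σ * f4 + P.b σ * f6
    · linear_combination P.b σ * f3 + P.c σ * f5
    · linear_combination P.b σ * f4 + P.c σ * f6
    · linear_combination P.b σ * f8
    · linear_combination P.c σ * f8
    · linear_combination e7
    · linear_combination P.c σ * e1 - P.b σ * e2 - Complex.I * k * (P.ξ 0 * f3 + P.ξ 1 * f4)
        + Complex.I * k * M 6 z * hx
  -- The pair q, w = c u₃ - b H₃ obeys q' = -i k w and w' = i k q. This combination is its growing
  -- eigenvector, with rate |k| away from the sheet, so boundedness kills it; the rest decays with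
  -- rate |k|.
  have hg : ∀ z ∈ fastDom T σ, M 6 z - Complex.I * (Int.sign k : ℂ) * σ.sg
      * (P.c σ * M 2 z - P.b σ * M 5 z) = 0 := by
    intro z hz
    have ht : Tame T σ δ (fun z => 1 * M 6 z + -(Complex.I * (Int.sign k : ℂ) * σ.sg * P.c σ) * M 2 z
        + Complex.I * (Int.sign k : ℂ) * σ.sg * P.b σ * M 5 z) :=
      Tame.lin hT (hM 6) (hM 2) (hM 5) _ _ _
    have := eq_zero_of_pd_normal hδ ht (c := |(k : ℝ)|) (abs_pos.2 (by exact_mod_cast hk))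
      (fun z hz => by
        rw [pd_lin hT (hM 6) (hM 2) (hM 5) _ _ _ 4 hz, habs]
        obtain ⟨-, -, h1, h2⟩ := hw z hz
        linear_combination h1 - Complex.I * (Int.sign k : ℂ) * σ.sg * h2
          + Complex.I * k * (P.c σ * M 2 z - P.b σ * M 5 z) * ((Int.sign k : ℂ) ^ 2 * hs + he)
          - (Int.sign k : ℂ) * σ.sg * k * M 6 z * hI) hz
    linear_combination this
  have hw6 : ∀ z ∈ fastDom T σ, P.c σ * M 2 z - P.b σ * M 5 z
      = -(Complex.I * (Int.sign k : ℂ) * σ.sg * M 6 z) := by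
    intro z hz
    linear_combination Complex.I * (Int.sign k : ℂ) * σ.sg * hg z hz
      + (P.c σ * M 2 z - P.b σ * M 5 z) * ((Int.sign k : ℂ) ^ 2 * σ.sg ^ 2 * hI
        - (Int.sign k : ℂ) ^ 2 * hs - he)
  refine ⟨fun j => mul_left_cancel₀ hμ ?_, fun b hb => ?_⟩
  · obtain ⟨⟨h0, h1, h3, h4⟩, ⟨h2, h5⟩, -, -⟩ := hw z hz
    rw [hw6 z hz] at h2 h5
    rw [calR_eq P σ hk, ← mul_assoc, mul_neg, mul_div_cancel₀ _ hμ]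
    fin_cases j <;> simp
    · linear_combination h0
    · linear_combination h1
    · linear_combination h2
    · linear_combination h3
    · linear_combination h4
    · linear_combination h5
    · ring
  · have := eq_exp_mul_of_pd_normal (hM 6) (c := -|(k : ℝ)|) (fun z hz => by
      obtain ⟨-, -, h1, -⟩ := hw z hz
      rw [h1, hw6 z hz, Complex.ofReal_neg, habs]
      linear_combination (Int.sign k : ℂ) * σ.sg * k * M 6 z * hI) hz hb
    rw [this]
    congr 2
    push_cast
    ring

/-! ### Solutions on one side -/

/-- The sum of a slow mean, a fast mean and surface waves of amplitudes `γ`. -/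
structure WaveForm (T : ℝ) (σ : Side) (P : Params) (V : Fin 7 → FastFun)
    (Uh : Fin 7 → Base → ℝ → ℝ) (v : Fin 4 → Base → ℝ → ℝ → ℝ) (γ : Base → ℝ → ℤ → ℂ)
    (W : Fin 7 → FastFun) : Prop where
  slow : ∀ i, IsResidual T σ (fun p y₃ _ => Uh i p y₃)
  fast : ∀ j, IsSurface T σ (fun p y₃ Y _ => v j p y₃ Y)
  wave : ∀ i, IsSurface T σ (W i)
  hasSum : ∀ p ∈ baseDom T, ∀ y₃ ∈ σ.slowClosed, ∀ Y ∈ σ.fastClosed, ∀ θ : ℝ, ∀ i,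
    HasSum (fun k : {k : ℤ // k ≠ 0} => γ p y₃ k
        * Complex.exp (-(σ.sg * |(k : ℝ)| * Y : ℝ) + Complex.I * (k : ℤ) * θ) * P.calR σ k i)
      (W i p y₃ Y θ : ℂ)
  eq : ∀ p ∈ baseDom T, ∀ y₃ ∈ σ.slowClosed, ∀ Y ∈ σ.fastClosed, ∀ θ : ℝ, ∀ i,
    V i p y₃ Y θ = Uh i p y₃
      + (![v 0 p y₃ Y, v 1 p y₃ Y, 0, v 2 p y₃ Y, v 3 p y₃ Y, 0, 0] : Fin 7 → ℝ) i
      + W i p y₃ Y θ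
  star : ∀ p ∈ baseDom T, ∀ y₃ ∈ σ.slowClosed, ∀ k : ℤ, k ≠ 0 →
    γ p y₃ (-k) = star (γ p y₃ k)

section WaveForm

variable {V W : Fin 7 → FastFun} {Uh : Fin 7 → Base → ℝ → ℝ} {v : Fin 4 → Base → ℝ → ℝ → ℝ}
  {γ : Base → ℝ → ℤ → ℂ}

/-- The means and the wave series together form one absolutely convergent trigonometric series in θ,
whose coefficients are its modes. -/
theorem WaveForm.mode_eq (h : WaveForm T σ P V Uh v γ W) {p : Base} {y₃ Y : ℝ}
    (hp : p ∈ baseDom T) (hy : y₃ ∈ σ.slowClosed) (hY : Y ∈ σ.fastClosed) (θ : ℝ) (i : Fin 7)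
    (k : ℤ) : mode k (lft (V i)) (p, y₃, Y, θ) = if k = 0 then ((Uh i p y₃
        + (![v 0 p y₃ Y, v 1 p y₃ Y, 0, v 2 p y₃ Y, v 3 p y₃ Y, 0, 0] : Fin 7 → ℝ) i : ℝ) : ℂ)
      else γ p y₃ k * Complex.exp (-(σ.sg * |(k : ℝ)| * Y : ℝ) + Complex.I * k * θ)
        * P.calR σ k i := by
  refine mode_of_hasSum (a := fun k : ℤ => if k = 0 then ((Uh i p y₃
      + (![v 0 p y₃ Y, v 1 p y₃ Y, 0, v 2 p y₃ Y, v 3 p y₃ Y, 0, 0] : Fin 7 → ℝ) i : ℝ) : ℂ)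
    else γ p y₃ k * Complex.exp (-(σ.sg * |(k : ℝ)| * Y : ℝ) + Complex.I * k * θ)
        * P.calR σ k i) (fun a => ?_) k
  rw [add_smul_bas_five]
  have h1 := (hasSum_subtype_iff_indicator (s := {k : ℤ | k ≠ 0}) (f := fun k : ℤ => γ p y₃ k
        * Complex.exp (-(σ.sg * |(k : ℝ)| * Y : ℝ) + Complex.I * k * (θ + a : ℝ))
          * P.calR σ k i)).1 (h.hasSum p hp y₃ hy Y hY (θ + a) i)
  have h2 := (hasSum_ite_eq (0 : ℤ) ((Uh i p y₃
        + (![v 0 p y₃ Y, v 1 p y₃ Y, 0, v 2 p y₃ Y, v 3 p y₃ Y, 0, 0] : Fin 7 → ℝ) i : ℝ) : ℂ)).add h1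
  convert h2 using 1
  · funext m
    rcases eq_or_ne m 0 with rfl | hm
    · simp
    · simp only [if_neg hm, Set.indicator_of_mem (show m ∈ {k : ℤ | k ≠ 0} from hm), zero_add]
      rw [mul_right_comm, mul_assoc (γ p y₃ m), ← Complex.exp_add]
      congr 3
      push_cast
      ring
  · rw [← Complex.ofReal_add, ← h.eq p hp y₃ hy Y hY (θ + a) i]
    rfl

theorem Evol.of_mode (hT : 0 < T) {U : Fin 7 → Pt → ℂ} (hU : ∀ j, Tame T σ 0 (U j))
    (h : ∀ k, Evol T σ P (fun j => FastProblem.mode k (U j)) (fun _ _ => 0) (fun _ => 0)) :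
    Evol T σ P U (fun _ _ => 0) (fun _ => 0) := by
  have hk := fun k => evol_iff_lcomb.1 (h k)
  refine evol_iff_lcomb.2 ⟨fun i z hz => ?_, fun z hz => ?_⟩
  · refine eq_zero_of_mode_eq_zero le_rfl hT (tame_lcomb hT hU) hz fun k => ?_
    rw [mode_lcomb le_rfl hT hU k hz]
    exact (hk k).1 i z hz
  · refine eq_zero_of_mode_eq_zero le_rfl hT (tame_lcomb hT hU) hz fun k => ?_
    rw [mode_lcomb le_rfl hT hU k hz]
    exact (hk k).2 z hz

theorem WaveForm.evol (hT : 0 < T) (h₂ : P.RationalDirection) (hV : ∀ j, Tame T σ 0 (lft (V j)))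
    (h : WaveForm T σ P V Uh v γ W) :
    Evol T σ P (fun j => lft (V j)) (fun _ _ => 0) (fun _ => 0) := by
  refine Evol.of_mode hT hV fun k z hz => ?_
  have hz' := mem_fastDom.1 hz
  have hm := h.mode_eq hz'.1 hz'.2.1 hz'.2.2 z.2.2.2
  have hadd : ∀ b : ℝ, 0 ≤ b → σ.sg * (z.2.2.1 + b * σ.sg) = σ.sg * z.2.2.1 + b := fun b _ => by
    linear_combination b * σ.sg_mul_sg
  have hmem : ∀ b : ℝ, 0 ≤ b → z.2.2.1 + b * σ.sg ∈ σ.fastClosed := fun b hb => by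
    rw [Side.mem_fastClosed, hadd b hb]
    exact add_nonneg (Side.mem_fastClosed.1 hz'.2.2) hb
  have hz4 : ∀ b : ℝ, z + b • (σ.sg • bas 4) = (z.1, z.2.1, z.2.2.1 + b * σ.sg, z.2.2.2) :=
    fun b => by rw [smul_smul, add_smul_bas_four]
  have h5 : ∀ j, pd T σ 5 (mode k (lft (V j))) z = Complex.I * k * mode k (lft (V j)) z :=
    fun j => pd_theta_mode le_rfl hT (hV j) k hz
  -- For k = 0 only the normal derivatives of u₃, H₃, q enter the equations, and the means of these
  -- three have no fast part. For k ≠ 0 each mode is an exponential multiple of ℛ(k).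
  rcases eq_or_ne k 0 with rfl | hk
  · have h4 : ∀ j : Fin 7, (j = 2 ∨ j = 5 ∨ j = 6) → pd T σ 4 (mode 0 (lft (V j))) z = 0 := by
      intro j hj
      rw [pd_normal_of_exp ((hV j).mode le_rfl hT 0) (c := 0) hz, Complex.ofReal_zero, mul_zero,
        neg_zero, zero_mul]
      intro b hb
      rw [hz4, h.mode_eq hz'.1 hz'.2.1 (hmem b hb) z.2.2.2 j 0, hm j 0]
      rcases hj with rfl | rfl | rfl <;> simp
    constructor <;> simp [h5, h4]
  · have h4 : ∀ j : Fin 7, pd T σ 4 (mode k (lft (V j))) z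
        = -(σ.sg * |(k : ℝ)|) * mode k (lft (V j)) z := by
      intro j
      refine pd_normal_of_exp ((hV j).mode le_rfl hT k) hz fun b hb => ?_
      have he : Complex.exp (-(σ.sg * |(k : ℝ)| * (z.2.2.1 + b * σ.sg) : ℝ)
          + Complex.I * k * z.2.2.2) = Complex.exp (-(|(k : ℝ)| * b : ℝ))
          * Complex.exp (-(σ.sg * |(k : ℝ)| * z.2.2.1 : ℝ) + Complex.I * k * z.2.2.2) := by
        rw [mul_right_comm, hadd b hb, ← Complex.exp_add]
        congr 1
        push_cast
        ring
      rw [hz4, h.mode_eq hz'.1 hz'.2.1 (hmem b hb) z.2.2.2 j k, hm j k, if_neg hk, if_neg hk, he]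
      ring
    simp only [h4, h5, hm _ k, if_neg hk]
    exact reduced_calR h₂ hk _

theorem mode_neg_lft (f : FastFun) (k : ℤ) (z : Pt) :
    mode (-k) (lft f) z = starRingEnd ℂ (mode k (lft f) z) := by
  have h := mode_star (f := lft f) (-k) z
  rw [neg_neg] at h
  rw [← h]
  congr 1
  funext w
  exact (Complex.conj_ofReal _).symm

/-- The value at `(p, y₃, Y, θ)` of a mode which decays like `e^{-|k||Y|}`. -/
theorem wave_eq (hf : Tame T σ δ f) {k : ℤ} (h : ∀ z ∈ fastDom T σ, ∀ b : ℝ, 0 ≤ b →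
      mode k f (z + b • (σ.sg • bas 4)) = Complex.exp (-(|(k : ℝ)| * b : ℝ)) * mode k f z)
    {p : Base} {y₃ Y : ℝ} (hp : p ∈ baseDom T) (hy : y₃ ∈ σ.slowClosed) (hY : Y ∈ σ.fastClosed)
    (θ : ℝ) : mode k f (p, y₃, Y, θ)
      = Complex.exp (-(σ.sg * |(k : ℝ)| * Y : ℝ) + Complex.I * k * θ) * mode k f (p, y₃, 0, 0) := by
  have h0 : ((p, y₃, 0, 0) : Pt) ∈ fastDom T σ := mem_fastDom.2 ⟨hp, hy, σ.zero_mem_fastClosed⟩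
  have h1 : ((p, y₃, Y, 0) : Pt) ∈ fastDom T σ := mem_fastDom.2 ⟨hp, hy, hY⟩
  have e1 : ((p, y₃, Y, θ) : Pt) = (p, y₃, Y, 0) + θ • bas 5 := by
    rw [add_smul_bas_five]
    simp
  have e2 : ((p, y₃, Y, 0) : Pt) = (p, y₃, 0, 0) + (σ.sg * Y) • (σ.sg • bas 4) := by
    rw [smul_smul, add_smul_bas_four]
    have : σ.sg * Y * σ.sg = Y := by linear_combination Y * σ.sg_mul_sg
    simp [this]
  rw [e1, mode_add_theta hf.per k h1, e2, h _ h0 _ (Side.mem_fastClosed.1 hY), ← mul_assoc,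
    ← Complex.exp_add]
  congr 2
  push_cast
  ring

/-- Without normal derivatives the system is algebraic in the θ-derivatives. The tangential momentum
equations contracted with ξ' give ∂_θ q = 0, and c² - b² ≠ 0 gives the rest. -/
theorem Evol.pd_theta_eq_zero (h₂ : P.RationalDirection)
    (hμ : (P.c σ : ℂ) ^ 2 - (P.b σ : ℂ) ^ 2 ≠ 0) (hT : 0 < T) {U : Fin 7 → Pt → ℂ}
    (hU : ∀ j, Tame T σ δ (U j)) (hi : ∀ j, NormalIndep T σ (U j))
    (h : Evol T σ P U (fun _ _ => 0) (fun _ => 0)) (j : Fin 7) {z : Pt} (hz : z ∈ fastDom T σ) :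
    pd T σ 5 (U j) z = 0 := by
  have hx : (P.ξ 0 : ℂ) ^ 2 + (P.ξ 1 : ℂ) ^ 2 = 1 := by exact_mod_cast norm_xi h₂
  have hn := fun j => (hi j).pd_normal hT (hU j).smooth hz
  obtain ⟨e1, e2, e3, e4, e5, e6, e7, e8⟩ := h z hz
  simp only [hn, mul_zero, sub_zero, add_zero, zero_add] at e1 e2 e3 e4 e5 e6 e7 e8
  have hq : pd T σ 5 (U 6) z = 0 := by
    linear_combination P.ξ 0 * e3 + P.ξ 1 * e4 - P.c σ * e1 + P.b σ * e2
      - pd T σ 5 (U 6) z * hx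
  rw [hq] at e3 e4
  have hc : ∀ m : Fin 7, ((P.c σ : ℂ) ^ 2 - (P.b σ : ℂ) ^ 2) * pd T σ 5 (U m) z = 0 →
      pd T σ 5 (U m) z = 0 := fun m hm => (mul_eq_zero.1 hm).resolve_left hμ
  fin_cases j
  · exact hc 0 (by linear_combination P.c σ * e3 + P.b σ * e5)
  · exact hc 1 (by linear_combination P.c σ * e4 + P.b σ * e6)
  · exact hc 2 (by linear_combination P.c σ * e7 + P.b σ * e8)
  · exact hc 3 (by linear_combination P.b σ * e3 + P.c σ * e5)
  · exact hc 4 (by linear_combination P.b σ * e4 + P.c σ * e6)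
  · exact hc 5 (by linear_combination P.b σ * e7 + P.c σ * e8)
  · exact hq

/-- On means the equations reduce to the vanishing of the normal derivatives of u₃, H₃, q, and a
decaying function constant in Y₃ is 0. The tangential means are unconstrained. -/
theorem Evol.mode_zero_eq_zero (hT : 0 < T) (hδ : 0 < δ) {U : Fin 7 → Pt → ℂ}
    (hU : ∀ j, Tame T σ δ (U j)) (h : Evol T σ P U (fun _ _ => 0) (fun _ => 0)) {z : Pt}
    (hz : z ∈ fastDom T σ) :
    FastProblem.mode 0 (U 2) z = 0 ∧ FastProblem.mode 0 (U 5) z = 0 ∧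
      FastProblem.mode 0 (U 6) z = 0 := by
  have h5 : ∀ j, ∀ z ∈ fastDom T σ, pd T σ 5 (FastProblem.mode 0 (U j)) z = 0 := fun j z hz => by
    rw [pd_theta_mode hδ.le hT (hU j) 0 hz]
    simp
  have hm := h.mode hδ.le hT hU 0
  have key : ∀ j, (∀ z ∈ fastDom T σ, pd T σ 4 (FastProblem.mode 0 (U j)) z = 0) →
      FastProblem.mode 0 (U j) z = 0 := fun j hj =>
    ((hU j).mode hδ.le hT 0).eq_zero_of_pd_normal_eq_zero hδ hj hz
  refine ⟨key 2 fun w hw => ?_, key 5 fun w hw => ?_, key 6 fun w hw => ?_⟩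
  · have := (hm w hw).div_u
    simpa [h5 _ w hw, mode_zero_fun] using this
  · have := (hm w hw).div_H
    simpa [h5 _ w hw, mode_zero_fun] using this
  · have := (hm w hw).u₃
    simpa [h5 _ w hw, mode_zero_fun] using this

/-- The homogeneous equations split into slow and decaying parts. The former has no θ-dependence;
the latter consists of its mean, tangential only, and modes proportional to ℛ(k). -/
theorem exists_waveForm (hT : 0 < T) (h₂ : P.RationalDirection)
    (hμ : (P.c σ : ℂ) ^ 2 - (P.b σ : ℂ) ^ 2 ≠ 0) (hV : ∀ j, IsProfile T σ (V j))
    (h : Evol T σ P (fun j => lft (V j)) (fun _ _ => 0) (fun _ => 0)) :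
    ∃ Uh v γ W, WaveForm T σ P V Uh v γ W := by
  have hdec := fun j => (hV j).dec hT
  obtain ⟨Er, Es⟩ := h.dec hT hdec (fun _ => Dec.zero) Dec.zero
  obtain ⟨δ, hδ, -, hs⟩ := exists_common_rate fun j => (hdec j).tame_s
  have tr := fun j => (hdec j).tame_r
  have hr0 : ∀ j, ∀ z ∈ fastDom T σ, mode 0 (lft (ofSlow (resid σ (V j)))) z
      = lft (ofSlow (resid σ (V j))) z := fun j z hz =>
    mode_zero_of_const (eq_of_pd_theta_eq_zero (tr j)
      (fun w hw => Er.pd_theta_eq_zero h₂ hμ hT tr (fun j => (hdec j).indep) j hw) hz)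
  have hconst : ∀ f : FastFun, ∀ δ ≥ 0, Tame T σ δ (lft f) →
      Tame T σ δ (fun z => mode 0 (lft f) (z.1, z.2.1, z.2.2.1, 0)) := fun f δ hδ hf =>
    (hf.mode hδ hT 0).congr fun z hz => (mode_zero_eq hf.per hz).symm
  have hE := fun k => Es.mode hδ.le hT hs k
  have hzero : ∀ k : ℤ, Evol T σ P (fun j => mode k (lft (surf σ (V j)))) (fun _ _ => 0)
      (fun _ => 0) := fun k z hz => by
    have := hE k z hz
    simpa only [mode_zero_fun] using this
  have hwave := fun (k : ℤ) (hk : k ≠ 0) => fun z (hz : z ∈ fastDom T σ) =>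
    (hzero k).eq_calR hT h₂ hμ hδ.le hk (fun j => (hs j).mode hδ.le hT k)
      (fun j z hz => pd_theta_mode hδ.le hT (hs j) k hz) hz
  have hlW : ∀ j, ∀ z, lft (reFun fun z => lft (surf σ (V j)) z - mode 0 (lft (surf σ (V j))) z) z
      = lft (surf σ (V j)) z - mode 0 (lft (surf σ (V j))) z := fun j z => by
    rw [mode_ofReal]
    simp [lft, reFun]
  refine ⟨fun j p y₃ => (mode 0 (lft (ofSlow (resid σ (V j)))) (p, y₃, 0, 0)).re,
    -- The four tangential components among the seven are those of index 0, 1, 3, 4. The amplitude γ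
    -- on the next lines is read off from q, whose entry in ℛ(k) is b² - c² ≠ 0 for both signs of k.
    fun j p y₃ Y => (mode 0 (lft (surf σ (V (![0, 1, 3, 4] j)))) (p, y₃, Y, 0)).re,
    fun p y₃ k => -(mode k (lft (surf σ (V 6))) (p, y₃, 0, 0)
      / ((P.c σ : ℂ) ^ 2 - (P.b σ : ℂ) ^ 2)),
    fun j => reFun fun z => lft (surf σ (V j)) z - mode 0 (lft (surf σ (V j))) z, ?_⟩
  refine ⟨fun j => (hconst _ 0 le_rfl (tr j)).isResidual,
    fun j => (hconst _ δ hδ.le (hs _)).isSurface hT hδ,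
    fun j => ((hs j).sub hT ((hs j).mode hδ.le hT 0)).isSurface hT hδ, ?_, ?_, ?_⟩
  · intro p hp y₃ hy Y hY θ i
    have hz : ((p, y₃, Y, θ) : Pt) ∈ fastDom T σ := mem_fastDom.2 ⟨hp, hy, hY⟩
    have hsum := hasSum_ite_sub_hasSum (hasSum_mode hδ.le hT (hs i) hz) 0
    rw [← hlW] at hsum
    have hsub := (Function.Injective.hasSum_iff (Subtype.val_injective (p := fun k : ℤ => k ≠ 0))
      (fun k hk => if_pos (by simpa using hk))).2 hsum
    refine (congrArg (fun u => HasSum u _) (funext fun ⟨k, hk⟩ => ?_)).mpr hsub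
    simp only [Function.comp_apply, if_neg hk]
    rw [(hwave k hk _ hz).1 i, wave_eq (hs 6) (fun z hz b hb => (hwave k hk z hz).2 b hb) hp hy hY θ]
    ring
  · intro p hp y₃ hy Y hY θ i
    have hz : ((p, y₃, Y, θ) : Pt) ∈ fastDom T σ := mem_fastDom.2 ⟨hp, hy, hY⟩
    have hz0 : ((p, y₃, Y, 0) : Pt) ∈ fastDom T σ := mem_fastDom.2 ⟨hp, hy, hY⟩
    have er : ((mode 0 (lft (ofSlow (resid σ (V i)))) (p, y₃, 0, 0)).re : ℂ)
        = lft (ofSlow (resid σ (V i))) (p, y₃, Y, θ) := by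
      rw [← mode_ofReal, ← hr0 i _ hz, mode_zero_eq (tr i).per hz]
      exact mode_line_congr 0 fun a => by simp only [add_smul_bas_five]; rfl
    have ev : (((![(mode 0 (lft (surf σ (V (![0, 1, 3, 4] 0)))) (p, y₃, Y, 0)).re,
        (mode 0 (lft (surf σ (V (![0, 1, 3, 4] 1)))) (p, y₃, Y, 0)).re, 0,
        (mode 0 (lft (surf σ (V (![0, 1, 3, 4] 2)))) (p, y₃, Y, 0)).re,
        (mode 0 (lft (surf σ (V (![0, 1, 3, 4] 3)))) (p, y₃, Y, 0)).re, 0, 0] : Fin 7 → ℝ) i : ℝ) : ℂ)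
        = mode 0 (lft (surf σ (V i))) (p, y₃, Y, θ) := by
      obtain ⟨h2, h5, h6⟩ := Es.mode_zero_eq_zero hT hδ hs hz0
      rw [mode_zero_eq (hs i).per hz]
      fin_cases i
      · exact (mode_ofReal _ _).symm
      · exact (mode_ofReal _ _).symm
      · exact h2.symm
      · exact (mode_ofReal _ _).symm
      · exact (mode_ofReal _ _).symm
      · exact h5.symm
      · exact h6.symm
    have eW := hlW i (p, y₃, Y, θ)
    refine Complex.ofReal_injective ?_
    rw [Complex.ofReal_add, Complex.ofReal_add, er, ev]
    refine ((hdec i).eq _ hz).trans ?_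
    rw [add_assoc, add_left_cancel_iff]
    refine Eq.trans ?_ (congrArg _ eW.symm)
    ring
  · intro p hp y₃ hy k hk
    rw [mode_neg_lft]
    simp

end WaveForm

/-! ### The jump conditions -/

/-- The kinematic conditions read c(...) = 0 and b(...) = 0 with the same bracket comparing γ and
±|k| ψ̂. Either of c, b may vanish, so they are combined into (c² - b²)(...) = 0. The jump of q is
then proportional to the sum of c² - b² over the two sides, zero by (H4). -/
theorem modeJump_iff (hμ : ∀ σ : Side, (P.c σ : ℂ) ^ 2 - (P.b σ : ℂ) ^ 2 ≠ 0)
    (h₄ : P.LopatinskiiRoot) {V W : Side → Fin 7 → FastFun} {Uh : Side → Fin 7 → Base → ℝ → ℝ}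
    {v : Side → Fin 4 → Base → ℝ → ℝ → ℝ} {γ : Side → Base → ℝ → ℤ → ℂ} {ψ : BdryFun}
    (h : ∀ σ, WaveForm T σ P (V σ) (Uh σ) (v σ) (γ σ) (W σ)) {p : Base} (hp : p ∈ baseDom T) :
    (∀ k, ModeJump P (fun _ => lft (ofBdry fun _ _ => 0)) (fun σ j => lft (V σ j))
      (lft (ofBdry ψ)) p k) ↔
    (∀ σ : Side, ∀ k : ℤ, k ≠ 0 → γ σ p 0 k = σ.sg * |(k : ℝ)| * fcoef (fun θ => ψ p θ) k) ∧
    (∀ σ, Uh σ 2 p 0 = 0 ∧ Uh σ 5 p 0 = 0) ∧ Uh .plus 6 p 0 = Uh .minus 6 p 0 := by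
  have hG : ∀ k : ℤ, ∀ z, mode k (lft (ofBdry fun _ _ => 0)) z = 0 := fun k z => by
    have : lft (ofBdry fun _ _ => 0) = fun _ => 0 := by
      funext w
      simp [lft, ofBdry]
    rw [this, mode_zero_fun]
  have hψ : ∀ k, fcoef (fun θ => ψ p θ) k = mode k (lft (ofBdry ψ)) (p, 0, 0, 0) :=
    fun k => fcoef_lft (ofBdry ψ) p 0 0 k
  have hm := fun σ i k => (h σ).mode_eq hp σ.zero_mem_slowClosed σ.zero_mem_fastClosed 0 i k
  have hexp : ∀ (σ : Side) (k : ℤ), Complex.exp (-((σ.sg * |(k : ℝ)| * 0 : ℝ) : ℂ)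
      + Complex.I * k * (0 : ℝ)) = 1 := fun σ k => by simp
  have hmk : ∀ (σ : Side) (i : Fin 7) (k : ℤ), k ≠ 0 →
      mode k (lft (V σ i)) (p, 0, 0, 0) = γ σ p 0 k * P.calR σ k i := fun σ i k hk => by
    rw [hm σ i k, if_neg hk, hexp, mul_one]
  have h0 : ∀ (σ : Side) (i : Fin 7), (i = 2 ∨ i = 5 ∨ i = 6) →
      mode 0 (lft (V σ i)) (p, 0, 0, 0) = (Uh σ i p 0 : ℂ) := fun σ i hi => by
    rw [hm σ i 0, if_pos rfl]
    rcases hi with rfl | rfl | rfl <;> simp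
  have hI := Complex.I_sq
  constructor
  · intro hj
    refine ⟨fun σ k hk => ?_, fun σ => ⟨?_, ?_⟩, ?_⟩
    · have hs := sg_sq σ
      have he := sign_sq hk
      have hu := (hj k).u σ
      have hH := (hj k).H σ
      rw [hmk σ _ k hk, calR_eq P σ hk, hG] at hu hH
      simp at hu hH
      refine mul_left_cancel₀ (hμ σ) ?_
      rw [hψ, abs_eq_mul_sign]
      linear_combination (-(Complex.I * σ.sg * (Int.sign k : ℂ))) * (P.c σ * hu - P.b σ * hH)
        + ((P.c σ : ℂ) ^ 2 - (P.b σ : ℂ) ^ 2) * (γ σ p 0 k * ((σ.sg : ℂ) ^ 2 * (Int.sign k : ℂ) ^ 2 * hI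
          - (Int.sign k : ℂ) ^ 2 * hs - he)
          - σ.sg * (Int.sign k : ℂ) * k * mode k (lft (ofBdry ψ)) (p, 0, 0, 0) * hI)
    · have := (hj 0).u σ
      rw [hG, h0 σ 2 (by simp)] at this
      simpa using this
    · have := (hj 0).H σ
      rw [hG, h0 σ 5 (by simp)] at this
      simpa using this
    · have := (hj 0).q
      rw [hG, h0 _ 6 (by simp), h0 _ 6 (by simp), sub_eq_zero] at this
      exact_mod_cast this
  · rintro ⟨hγ, hU, hq⟩ k
    rcases eq_or_ne k 0 with rfl | hk
    · refine ⟨fun σ => ?_, fun σ => ?_, ?_⟩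
      · rw [hG, h0 σ 2 (by simp), (hU σ).1]
        simp
      · rw [hG, h0 σ 5 (by simp), (hU σ).2]
        simp
      · rw [hG, h0 _ 6 (by simp), h0 _ 6 (by simp), hq, sub_self]
    · have he := sign_sq hk
      refine ⟨fun σ => ?_, fun σ => ?_, ?_⟩
      · have hs := sg_sq σ
        rw [hG, hmk σ _ k hk, calR_eq P σ hk, hγ σ k hk, hψ, abs_eq_mul_sign]
        simp
        linear_combination Complex.I * k * P.c σ * mode k (lft (ofBdry ψ)) (p, 0, 0, 0)
          * ((Int.sign k : ℂ) ^ 2 * hs + he)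
      · have hs := sg_sq σ
        rw [hG, hmk σ _ k hk, calR_eq P σ hk, hγ σ k hk, hψ, abs_eq_mul_sign]
        simp
        linear_combination Complex.I * k * P.b σ * mode k (lft (ofBdry ψ)) (p, 0, 0, 0)
          * ((Int.sign k : ℂ) ^ 2 * hs + he)
      · rw [hG, hmk _ _ k hk, hmk _ _ k hk, calR_eq P _ hk, calR_eq P _ hk, hγ _ k hk, hγ _ k hk,
          hψ, abs_eq_mul_sign]
        simp [Side.sg]
        linear_combination -(k * (Int.sign k : ℂ) * mode k (lft (ofBdry ψ)) (p, 0, 0, 0))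
          * mu_add h₄

/-! ### Reduction to the homogeneous problem and conclusion -/

theorem evol_sub_iff (hT : 0 < T) {U V F : Fin 7 → Pt → ℂ} {F₈ : Pt → ℂ}
    (hU : ∀ j, Tame T σ 0 (U j)) (hV : ∀ j, Tame T σ 0 (V j)) (h : Evol T σ P V F F₈) :
    Evol T σ P U F F₈ ↔
      Evol T σ P (fun j z => U j z - V j z) (fun _ _ => 0) (fun _ => 0) := by
  refine forall₂_congr fun z hz => ?_
  have hs := fun i j => pd_sub hT (hU j).smooth (hV j).smooth i hz
  simp only [hs]
  obtain ⟨e1, e2, e3, e4, e5, e6, e7, e8⟩ := h z hz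
  constructor <;> rintro ⟨f1, f2, f3, f4, f5, f6, f7, f8⟩
  · exact ⟨by linear_combination f1 - e1, by linear_combination f2 - e2,
      by linear_combination f3 - e3, by linear_combination f4 - e4,
      by linear_combination f5 - e5, by linear_combination f6 - e6,
      by linear_combination f7 - e7, by linear_combination f8 - e8⟩
  · exact ⟨by linear_combination f1 + e1, by linear_combination f2 + e2,
      by linear_combination f3 + e3, by linear_combination f4 + e4,
      by linear_combination f5 + e5, by linear_combination f6 + e6,
      by linear_combination f7 + e7, by linear_combination f8 + e8⟩

theorem jump_sub_iff {G : Fin 5 → ℝ} {U V U' V' : Fin 7 → ℝ} {d : ℝ} (h : Jump P G U' V' 0) :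
    Jump P G U V d ↔ Jump P (fun _ => 0) (fun j => U j - U' j) (fun j => V j - V' j) d := by
  obtain ⟨e1, e2, e3, e4, e5⟩ := h
  constructor <;> rintro ⟨f1, f2, f3, f4, f5⟩
  · exact ⟨by linear_combination f1 - e1, by linear_combination f2 - e2,
      by linear_combination f3 - e3, by linear_combination f4 - e4, by linear_combination f5 - e5⟩
  · exact ⟨by linear_combination f1 + e1, by linear_combination f2 + e2,
      by linear_combination f3 + e3, by linear_combination f4 + e4, by linear_combination f5 + e5⟩

theorem isHInfty_zero : IsHInfty T (fun _ _ => 0) :=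
  ⟨contDiffOn_const, fun _ _ _ _ _ => rfl, fun _ _ _ _ _ => rfl, fun _ _ _ => rfl⟩

/-- By linearity, `U` solves the problem with front ψ exactly when U - UU solves the homogeneous
equations with the same front, because UU has front 0. Wave forms with matching amplitudes are
precisely those homogeneous solutions. -/
theorem solvesFast_iff_hasGeneralForm (hT : 0 < T) (h₂ : P.RationalDirection)
    (h₃ : P.NonDegenerate) (h₄ : P.LopatinskiiRoot) {F : Side → Fin 7 → FastFun}
    {F₈ : Side → FastFun} {G : Fin 5 → BdryFun} (hF : ∀ σ i, IsProfile T σ (F σ i))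
    (hF₈ : ∀ σ, IsProfile T σ (F₈ σ)) {UU U : Side → Fin 7 → FastFun} {ψ : BdryFun}
    (hUU : ∀ σ i, IsProfile T σ (UU σ i)) (hS : SolvesFast T P F F₈ G UU (fun _ _ => 0))
    (hU : ∀ σ i, IsProfile T σ (U σ i)) (hψ : IsHInfty T ψ) :
    SolvesFast T P F F₈ G U ψ ↔ HasGeneralForm T P UU U ψ := by
  have hμ := mu_ne_zero h₃ h₄
  obtain ⟨hE, hJ⟩ := (solvesFast_iff hT hF hF₈ hUU).1 hS
  simp only [deriv_const] at hJ
  set V : Side → Fin 7 → FastFun := fun σ i p y₃ Y θ => U σ i p y₃ Y θ - UU σ i p y₃ Y θ with hVdef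
  have hlV : ∀ σ i, lft (V σ i) = fun z => lft (U σ i) z - lft (UU σ i) z := fun σ i => by
    funext z
    simp [lft, V]
  have hV : ∀ σ i, IsProfile T σ (V σ i) := fun σ i => by
    have := (((hU σ i).dec hT).sub hT ((hUU σ i).dec hT)).isProfile hT
    rwa [← hlV] at this
  have tV := fun σ i => (hV σ i).tame hT
  have hev : ∀ σ, Evol T σ P (fun j => lft (U σ j)) (fun j => lft (F σ j)) (lft (F₈ σ)) ↔
      Evol T σ P (fun j => lft (V σ j)) (fun _ _ => 0) (fun _ => 0) := fun σ => by
    rw [evol_sub_iff hT (fun j => (hU σ j).tame hT) (fun j => (hUU σ j).tame hT) (hE σ)]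
    simp only [hlV]
  have hju : ∀ p ∈ baseDom T, (∀ θ : ℝ, Jump P (fun i => G i p θ) (fun j => U .plus j p 0 0 θ)
      (fun j => U .minus j p 0 0 θ) (deriv (fun θ' => ψ p θ') θ)) ↔
      ∀ k, ModeJump P (fun _ => lft (ofBdry fun _ _ => 0)) (fun σ j => lft (V σ j))
        (lft (ofBdry ψ)) p k := fun p hp => by
    rw [← jump_iff_mode (G := fun _ _ _ => 0) hT (fun _ => isHInfty_zero) tV hψ hp]
    exact forall_congr' fun θ => jump_sub_iff (hJ p hp θ)
  rw [solvesFast_iff hT hF hF₈ hU, forall_congr' hev, forall₂_congr hju]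
  constructor
  · rintro ⟨h1, h2⟩
    choose Uh v γ W hw using fun σ => exists_waveForm hT h₂ (hμ σ) (hV σ) (h1 σ)
    have hj := fun p hp => (modeJump_iff hμ h₄ hw hp).1 (h2 p hp)
    refine ⟨Uh, v, γ, W, fun σ => (hw σ).slow, fun σ => (hw σ).fast, fun σ => (hw σ).wave,
      fun σ => (hw σ).hasSum, fun σ p hp y₃ hy Y hY θ i => ?_, fun σ p hp => (hj p hp).1 σ,
      fun σ => (hw σ).star, fun σ p hp => (hj p hp).2.1 σ, fun p hp => (hj p hp).2.2⟩
    have := (hw σ).eq p hp y₃ hy Y hY θ i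
    simp only [V] at this
    linarith
  · rintro ⟨Uh, v, γ, W, a1, a2, a3, a4, a5, a6, a7, a8, a9⟩
    have hw : ∀ σ, WaveForm T σ P (V σ) (Uh σ) (v σ) (γ σ) (W σ) := fun σ =>
      ⟨a1 σ, a2 σ, a3 σ, a4 σ, fun p hp y₃ hy Y hY θ i => by
        have := a5 σ p hp y₃ hy Y hY θ i
        simp only [V]
        linarith, a7 σ⟩
    exact ⟨fun σ => (hw σ).evol hT h₂ (tV σ), fun p hp =>
      (modeJump_iff hμ h₄ hw hp).2 ⟨fun σ => a6 σ p hp, fun σ => a8 σ p hp, a9 p hp⟩⟩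

end FastProblem

theorem mainTheorem2 (T : ℝ) (hT : 0 < T) (P : Params)
    (h₁ : P.Stable) (h₂ : P.RationalDirection) (h₃ : P.NonDegenerate)
    (h₄ : P.LopatinskiiRoot) (hτ : P.τ ≠ 0)
    (F : Side → Fin 7 → FastFun) (F₈ : Side → FastFun) (G : Fin 5 → BdryFun)
    (hF : ∀ σ i, IsProfile T σ (F σ i)) (hF₈ : ∀ σ, IsProfile T σ (F₈ σ))
    (hG : ∀ i, IsHInfty T (G i)) :
    ((∃ (U : Side → Fin 7 → FastFun) (ψ : BdryFun),
        (∀ σ i, IsProfile T σ (U σ i)) ∧ IsHInfty T ψ ∧ SolvesFast T P F F₈ G U ψ) ↔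
      Compatible T P F F₈ G) ∧
    (Compatible T P F F₈ G →
      ∃ UU : Side → Fin 7 → FastFun,
        (∀ σ i, IsProfile T σ (UU σ i)) ∧
        SolvesFast T P F F₈ G UU (fun _ _ => 0) ∧
        (∀ σ : Side, ∀ p ∈ baseDom T, ∀ y₃ ∈ σ.slowClosed, ∀ Y ∈ σ.fastClosed,
          Matrix.mulVec projTan (fcoefVec (UU σ) p y₃ Y 0) = 0) ∧
        (∀ σ : Side, ∀ p ∈ baseDom T, ∀ i,
          fcoef (fun θ => resid σ (UU σ i) p σ.sg θ) 0 = 0) ∧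
        ∀ (U : Side → Fin 7 → FastFun) (ψ : BdryFun),
          (∀ σ i, IsProfile T σ (U σ i)) → IsHInfty T ψ →
          (SolvesFast T P F F₈ G U ψ ↔ HasGeneralForm T P UU U ψ)) := by
  refine ⟨⟨?_, fun h => ?_⟩, fun h => ?_⟩
  · rintro ⟨U, ψ, hU, hψ, h⟩
    exact compatible_of_solvesFast hT h₂ h₄ hF hF₈ hG hU hψ h
  · obtain ⟨UU, hUU, hS, -⟩ := exists_particular hT h₂ h₃ h₄ hτ hF hF₈ hG h
    exact ⟨UU, fun _ _ => 0, hUU, isHInfty_zero, hS⟩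
  · obtain ⟨UU, hUU, hS, h1, h2⟩ := exists_particular hT h₂ h₃ h₄ hτ hF hF₈ hG h
    exact ⟨UU, hUU, hS, h1, h2, fun U ψ hU hψ =>
      solvesFast_iff_hasGeneralForm hT h₂ h₃ h₄ hF hF₈ hUU hS hU hψ⟩
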